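/- Let $\lambda>0$, $\Theta_0=\lambda^2\begin{pmatrix}0&-\mathbb 1_2\\ \mathbb 1_2&0\end{pmatrix}$, let $k^2=k_0^2-k_1^2-k_2^2-k_3^2$ on $\mathbb R^4$ and $(k\Theta_0)^\nu=k_\mu\Theta_0^{\mu\nu}$, so that $-(k\Theta_0)^2=\lambda^4(k_0^2+k_1^2+k_3^2-k_2^2)$. Let $N=\{k\in\mathbb R^4: k_1=k_3=0\}$, and for $\mathbf k=(k_1,k_2,k_3)\in\mathbb R^3$ put $|k_\perp|^2=k_1^2+k_3^2$, $L=\{\mathbf k\in\mathbb R^3:k_\perp=0\}$, $\dot N=L\setminus\{0\}$. On $\mathbb R^4\setminus\{0\}$ let $D_0=\theta(k_0)\delta(k^2)$, i.e. $D_0(f)=\int\frac{d^3\mathbf k}{2|\mathbf k|}f(|\mathbf k|,\mathbf k)$, and $D_1=\theta(k_0)\delta'(k^2)=-\frac{d}{ds}\big|_{s=0}\theta(k_0)\delta(k^2-s)$. Let $K$ be one of the functions $\ln x$, $x^{-n}$ ($n\ge1$). The scaling degree of a distribution $T$ is the infimum of all real $a$ with $\mu^aT_\mu\to0$ as $\mu\to0^+$,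 where $T_\mu(\mathbf k)=T(\mu k_\perp,k_2)$ (tested on functions supported in $\{k_2\ne0\}$) for the scaling degree $\mathrm{sd}_{\dot N}$ at $\dot N$, and $T_\mu(\mathbf k)=T(\mu\mathbf k)$ for the scaling degree $\mathrm{sd}_0$ at the origin. "Extension" below always means an extension that does not increase the respective scaling degree, unless it is called arbitrary. 1. For both signs, the limit $K(-(k\Theta_0)^2\pm i0)$ exists as a distribution on $\mathbb R^4\setminus\{0\}$ and equals the function $K(-(k\Theta_0)^2)$ where $-(k\Theta_0)^2>0$. For every distribution $v$ on $\mathbb R^4\setminus\{0\}$ that is given by the function $K(-(k\Theta_0)^2)$ where $-(k\Theta_0)^2>0$, and for $D\in\{D_0,D_1\}$, the set of points $k$ for which there is $p$ with $(k,p)\in WF(D)$ and $(k,-p)\in WF(v)$ is exactly $N\cap\{k^2=0,k_0>0\}$. Hence the product of $D$ and $v$ is not defined in Hörmander's sense. 2. On test functions vanishing near $N$, the product $P=D_0\cdot K(-(k\Theta_0)^2)$ is well defined and equals $f\mapsto T_K(\tilde f)$, $\tilde f(\mathbf k)=\frac{f(|\mathbf k|,\mathbf k)}{2|\mathbf k|}$,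 where $T_K$ is the locally integrable function $K(2\lambda^4|k_\perp|^2)$ on $\mathbb R^3\setminus L$. For each arbitrary extension $T$ of $T_K$ to $\mathbb R^3\setminus\{0\}$, $f\mapsto T(\tilde f)$ is a distribution on $\mathbb R^4\setminus\{0\}$ extending $P$, and different $T$ give different distributions. 3. On test functions vanishing near $N$, the product $D_1\cdot(k\Theta_0)^{-4}$ is well defined and equals $f\mapsto 2\lambda^4T_{x^{-3}}(\tilde f_0)+T_{x^{-2}}(\tilde f_1)$, where $\tilde f_0=\tilde f$ and $\tilde f_1(\mathbf k)=-\frac{d}{ds}\big|_{s=0}\frac{f(\omega_s,\mathbf k)}{2\omega_s}$, $\omega_s=\sqrt{|\mathbf k|^2+s}$. Any pair $(A,B)$ of arbitrary extensions of $T_{x^{-3}}$, $T_{x^{-2}}$ to $\mathbb R^3\setminus\{0\}$ gives a distribution $f\mapsto2\lambda^4A(\tilde f_0)+B(\tilde f_1)$ on $\mathbb R^4\setminus\{0\}$ extending this product, and different pairs give different distributions. 4. $\mathrm{sd}_{\dot N}(T_{\ln})=0$, and $T_{\ln}$ has exactly one extension $T$ to $\mathbb R^3\setminus\{0\}$. One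 has $\mathrm{sd}_0(T)=0$ and $\mathrm{sd}_0(T/(2|\mathbf k|))=1$, and each of $T$ and $T/(2|\mathbf k|)$ has exactly one extension to $\mathbb R^3$. 5. For $n\ge1$, $\mathrm{sd}_{\dot N}(T_{x^{-n}})=2n$ (that is, $2$ for $K=1/x$; $6$ and $4$ for the two distributions in 3). There is an extension $T_0$ of $T_{x^{-n}}$ to $\mathbb R^3\setminus\{0\}$, and the extensions of $T_{x^{-n}}$ to $\mathbb R^3\setminus\{0\}$ are exactly the distributions $$T_0+\sum_{a+b\le 2n-2}c_{ab}(k_2)\otimes\partial_{k_1}^a\partial_{k_3}^b\delta^2(k_\perp)$$ with arbitrary $c_{ab}\in\mathcal D'(\mathbb R\setminus\{0\})$, which are uniquely determined by the extension. In particular the extension is not unique (for $K=1/x$: one arbitrary distribution $c(k_2)\otimes\delta^2(k_\perp)$). The ambiguity is nonlocal: the difference of two distinct extensions is never given by a continuous function on $\mathbb R^3\setminus\{0\}$, in particular never by a polynomial in $(|\mathbf k|,\mathbf k)$. 6. For $K=1/x$ the extension to the origin is not unique either. There is an extension $T$ of $T_{1/x}$ to $\mathbb R^3\setminus\{0\}$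 such that $T/(2|\mathbf k|)$ has scaling degree $3$ at the origin and has an extension to $\mathbb R^3$. For every extension $T$ of $T_{1/x}$ to $\mathbb R^3\setminus\{0\}$, every extension $S$ of $T/(2|\mathbf k|)$ to $\mathbb R^3$ and every $b\in\mathbb C$, $S+b\,\delta_0$ is again such an extension. Moreover there is a distribution $S$ on $\mathbb R^3$ such that, for each $b\in\mathbb C$, $S+b\int ds\,\delta_{(0,s,0)}$ extends some extension of $T_{1/x}$ to $\mathbb R^3\setminus\{0\}$ without increasing the scaling degree at the origin. -/

import Mathlib

open MeasureTheory Filter Topology TopologicalSpace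
open scoped Distributions ContDiff LineDeriv

namespace NCQED

noncomputable section

/-! ### Spaces, distributions -/

/-- Momentum space `ℝ⁴`, with coordinates `k 0, k 1, k 2, k 3`. -/
abbrev R4 := EuclideanSpace ℝ (Fin 4)

/-- Spatial momentum space `ℝ³`. The components `k₁, k₂, k₃` of the text are `k 0, k 1, k 2`. -/
abbrev R3 := EuclideanSpace ℝ (Fin 3)

/-- Complex distributions on the open set `Ω`: continuous linear forms on the LF-space of complex
test functions on `Ω`. -/
abbrev Dist {E : Type*} [NormedAddCommGroup E] [NormedSpace ℝ E] (Ω : Opens E) :=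
  𝓓(Ω, ℂ) →L[ℂ] ℂ

section General

variable {E : Type*} [NormedAddCommGroup E] [NormedSpace ℝ E]
variable {E' : Type*} [NormedAddCommGroup E'] [NormedSpace ℝ E']

/-- Restriction of a distribution from `Ω'` to the smaller open set `Ω`
(always used with `Ω ≤ Ω'`). -/
def restrict {Ω Ω' : Opens E} (T : Dist Ω') : Dist Ω :=
  T ∘L (TestFunction.monoCLM ℂ : 𝓓(Ω, ℂ) →L[ℂ] 𝓓(Ω', ℂ))

/-- The pullback `f ∘ g` of a test function `f` along a smooth closed embedding `g`. -/
def pull {Ω : Opens E} {Ω' : Opens E'} (g : E' → E) (hg : ContDiff ℝ ∞ g)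
    (hc : IsClosedEmbedding g) (hΩ : ∀ x, g x ∈ Ω → x ∈ Ω') (f : 𝓓(Ω, ℂ)) : 𝓓(Ω', ℂ) where
  toFun := f ∘ g
  contDiff' := f.contDiff.comp hg
  hasCompactSupport' := f.hasCompactSupport.comp_isClosedEmbedding hc
  tsupport_subset' := fun x hx =>
    hΩ x (f.tsupport_subset (tsupport_comp_subset_preimage f hg.continuous hx))

/-- The distribution `f ↦ ∫ f g` given by a locally integrable function `g` on `Ω`. -/
def regular [MeasureSpace E] [BorelSpace E] (Ω : Opens E) (g : E → ℂ) :
    Dist Ω :=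
  TestFunction.integralAgainstBilinCLM (ContinuousLinearMap.mul ℂ ℂ) volume g

/-- The scaling degree of `T`, for scaling in `d` directions: `scale μ f` is the test function
`f` with its arguments in these directions divided by `μ`, so that
`μ⁻ᵈ T (scale μ f)` is the scaled distribution `T_μ`, formally `T_μ(k) = T(μ k)`. The scaling degree
is the infimum of all real `a` with `μ^a T_μ → 0` as `μ → 0+`, tested on functions supported
in `V`. -/
def scalingDegree {Ω : Opens E} (d : ℕ) (scale : Set.Ioi (0 : ℝ) → 𝓓(Ω, ℂ) → 𝓓(Ω, ℂ))
    (V : Set E) (T : Dist Ω) : EReal :=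
  sInf ((fun a : ℝ => (a : EReal)) '' {a : ℝ | ∀ f : 𝓓(Ω, ℂ), tsupport f ⊆ V →
    Tendsto (fun μ : Set.Ioi (0 : ℝ) =>
        ((((μ : ℝ) ^ a / (μ : ℝ) ^ d : ℝ) : ℂ) * T (scale μ f)))
      (comap Subtype.val (𝓝 (0 : ℝ))) (𝓝 0)})

end General

section Wavefront

variable {E : Type*} [NormedAddCommGroup E] [InnerProductSpace ℝ E]

/-- The test function `x ↦ e^{-i⟨η, x⟩} φ(x)`. -/
def modulate {Ω : Opens E} (η : E) (φ : 𝓓(Ω, ℂ)) : 𝓓(Ω, ℂ) where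
  toFun := fun x => Complex.exp (-Complex.I * ((inner ℝ η x : ℝ) : ℂ)) * φ x
  contDiff' := by
    refine ContDiff.mul ?_ φ.contDiff
    refine Complex.contDiff_exp.comp (contDiff_const.mul ?_)
    exact Complex.ofRealCLM.contDiff.comp (contDiff_const.inner ℝ contDiff_id)
  hasCompactSupport' := φ.hasCompactSupport.mul_left
  tsupport_subset' := (tsupport_mul_subset_right).trans φ.tsupport_subset

/-- The wave front set: `(x, ξ)`, `ξ ≠ 0`, is not in it iff there are a test function `φ` with
`φ x ≠ 0` and an open cone `Γ ∋ ξ` on which the Fourier transform of `φ u` is rapidly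
decreasing. -/
def waveFrontSet {Ω : Opens E} (u : Dist Ω) : Set (E × E) :=
  {p | p.1 ∈ Ω ∧ p.2 ≠ 0 ∧ ¬ ∃ φ : 𝓓(Ω, ℂ), φ p.1 ≠ 0 ∧
    ∃ Γ : Set E, IsOpen Γ ∧ p.2 ∈ Γ ∧ (∀ t : ℝ, 0 < t → ∀ η ∈ Γ, t • η ∈ Γ) ∧
      ∀ m : ℕ, ∃ C : ℝ, ∀ η ∈ Γ, (1 + ‖η‖) ^ m * ‖u (modulate η φ)‖ ≤ C}

/-- The points over which covectors of the two wave front sets add up to zero. -/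
def waveFrontOverlap {Ω : Opens E} (u v : Dist Ω) : Set E :=
  {x | ∃ ξ, (x, ξ) ∈ waveFrontSet u ∧ (x, -ξ) ∈ waveFrontSet v}

/-- Hörmander's criterion for the existence of the product `u v`. -/
def HormanderMultipliable {Ω : Opens E} (u v : Dist Ω) : Prop :=
  waveFrontOverlap u v = ∅

end Wavefront

/-! ### Open sets -/

/-- `ℝ⁴ ∖ {0}`: its test functions are those vanishing near the origin. -/
def punctured4 : Opens R4 := ⟨{0}ᶜ, isOpen_compl_singleton⟩

/-- The plane `N = {k₁ = k₃ = 0}` of `ℝ⁴`. -/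
def planeN : Set R4 := {k | k 1 = 0 ∧ k 3 = 0}

/-- `ℝ⁴ ∖ N`. -/
def offN : Opens R4 := ⟨planeNᶜ, by
  refine IsClosed.isOpen_compl (self := ?_)
  exact (isClosed_eq (by fun_prop) continuous_const).inter
    (isClosed_eq (by fun_prop) continuous_const)⟩

/-- `|k_⊥|² = k₁² + k₃²` on `ℝ³`. -/
def perpSq (k : R3) : ℝ := k 0 ^ 2 + k 2 ^ 2

/-- `ℝ³` without the line `k_⊥ = 0`. -/
def offAxis : Opens R3 := ⟨{k | perpSq k ≠ 0}, by
  refine isOpen_ne_fun ?_ continuous_const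
  unfold perpSq; fun_prop⟩

/-- `ℝ³ ∖ {0}`, i.e. `offAxis` together with `Ṅ = {k_⊥ = 0, |k₂| > 0}`. -/
def punctured3 : Opens R3 := ⟨{0}ᶜ, isOpen_compl_singleton⟩

/-- `ℝ ∖ {0}`, the coordinate domain of `Ṅ`. -/
def punctured1 : Opens ℝ := ⟨{0}ᶜ, isOpen_compl_singleton⟩

/-! ### The factors of the product -/

/-- The Minkowski metric of signature `(+,-,-,-)`. -/
def eta : Matrix (Fin 4) (Fin 4) ℝ := Matrix.diagonal ![1, -1, -1, -1]

/-- `v² = v_μ v^μ`. -/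
def minkowskiSq (v : Fin 4 → ℝ) : ℝ := v 0 ^ 2 - v 1 ^ 2 - v 2 ^ 2 - v 3 ^ 2

/-- The matrix `Θ₀ = λ² ((0, -1₂), (1₂, 0))`. -/
def Theta0 (lam : ℝ) : Matrix (Fin 4) (Fin 4) ℝ :=
  lam ^ 2 • !![0, 0, -1, 0; 0, 0, 0, -1; 1, 0, 0, 0; 0, 1, 0, 0]

/-- `(kΘ₀)^ν = k_μ Θ₀^{μν}`, the index of `k` being lowered with the metric. -/
def kTheta (lam : ℝ) (k : R4) : Fin 4 → ℝ :=
  Matrix.vecMul (eta.mulVec (fun i => k i)) (Theta0 lam)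

/-- `-(kΘ₀)²`. -/
def negKThetaSq (lam : ℝ) (k : R4) : ℝ := -minkowskiSq (kTheta lam k)

/-- The forward light cone `k² = 0`, `k₀ > 0`. -/
def forwardCone : Set R4 := {k | minkowskiSq (fun i => k i) = 0 ∧ 0 < k 0}

/-- The kernel `K(x) = ln x`. -/
def logKernel : ℂ → ℂ := Complex.log

/-- The kernel `K(x) = x⁻ⁿ`. -/
def powKernel (n : ℕ) : ℂ → ℂ := fun z => (z ^ n)⁻¹

/-- The kernels under consideration: `ln x` and `x⁻ⁿ`, `n ≥ 1`. -/
def IsKernel (K : ℂ → ℂ) : Prop := K = logKernel ∨ ∃ n : ℕ, 1 ≤ n ∧ K = powKernel n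

/-- `v` is the distribution `K(-(kΘ₀)² + σ iε)`, `ε → 0+`. -/
def IsBoundaryValue (lam : ℝ) (K : ℂ → ℂ) (σ : ℝ) (v : Dist punctured4) : Prop :=
  ∀ f : 𝓓(punctured4, ℂ), Tendsto
    (fun ε : ℝ => ∫ k, K ((negKThetaSq lam k : ℂ) + ((σ * ε : ℝ) : ℂ) * Complex.I) * f k)
    (𝓝[>] 0) (𝓝 (v f))

/-- `v` is a distribution on `ℝ⁴ ∖ {0}` realizing the function `K(-(kΘ₀)²)`: it is given by this
function where the argument of `K` is positive. What `v` is elsewhere, in particular the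
prescription at `(kΘ₀)² = 0`, is left open. -/
def Realizes (lam : ℝ) (K : ℂ → ℂ) (v : Dist punctured4) : Prop :=
  ∀ f : 𝓓(punctured4, ℂ), tsupport f ⊆ {k | 0 < negKThetaSq lam k} →
    v f = ∫ k, K (negKThetaSq lam k : ℂ) * f k

/-- The energy `ω = √(|k|² + s)` on the mass shell `k² = s`. -/
def energy (s : ℝ) (k : R3) : ℝ := √(‖k‖ ^ 2 + s)

/-- `f(ω, k) / (2ω)` on the mass shell `k² = s`. For `s = 0` this is `f(|k|, k) / (2|k|)`. -/
def onShell (f : R4 → ℂ) (s : ℝ) (k : R3) : ℂ :=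
  f !₂[energy s k, k 0, k 1, k 2] / ((2 * energy s k : ℝ) : ℂ)

/-- `D = θ(k₀) δ(k²)`. -/
def IsShellDelta (D : Dist punctured4) : Prop :=
  ∀ f : 𝓓(punctured4, ℂ), D f = ∫ k, onShell f 0 k

/-- `D = θ(k₀) δ'(k²)`, that is, minus the derivative of `θ(k₀) δ(k² - s)` with respect to `s` at
`s = 0`. -/
def IsShellDeltaPrime (D : Dist punctured4) : Prop :=
  ∀ f : 𝓓(punctured4, ℂ), HasDerivAt (fun s : ℝ => ∫ k, onShell f s k) (-(D f)) 0

/-- `P` is the product of `D` (supported on the forward cone) with `K(-(kΘ₀)²)`, on test functions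
vanishing near `N`: there `K(-(kΘ₀)²)` is smooth near the support of `D`, and `P f = D g` for
any test function `g` that agrees with `K(-(kΘ₀)²) f` near the forward cone. -/
def IsProductOffN (lam : ℝ) (D : Dist punctured4) (K : ℂ → ℂ) (P : Dist offN) : Prop :=
  ∀ f : 𝓓(offN, ℂ),
    (∃ g : 𝓓(punctured4, ℂ), ∃ U : Set R4, IsOpen U ∧ forwardCone ⊆ U ∧
      ∀ k ∈ U, g k = K (negKThetaSq lam k : ℂ) * f k) ∧
    ∀ g : 𝓓(punctured4, ℂ), (∃ U : Set R4, IsOpen U ∧ forwardCone ⊆ U ∧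
      ∀ k ∈ U, g k = K (negKThetaSq lam k : ℂ) * f k) → P f = D g

/-! ### Reduction to `ℝ³` -/

/-- The distribution `K(2λ⁴|k_⊥|²)` on `ℝ³` without the line `k_⊥ = 0`. -/
def kernelDist (lam : ℝ) (K : ℂ → ℂ) : Dist offAxis :=
  regular offAxis (fun k => K ((2 * lam ^ 4 * perpSq k : ℝ) : ℂ))

/-- `P f = T f̃` with `f̃(k) = f(|k|, k) / (2|k|)`. -/
def ReducesTo {Ω₄ : Opens R4} {Ω₃ : Opens R3} (P : Dist Ω₄) (T : Dist Ω₃) : Prop :=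
  ∀ f : 𝓓(Ω₄, ℂ), ∃ f₀ : 𝓓(Ω₃, ℂ), (∀ k, f₀ k = onShell f 0 k) ∧ P f = T f₀

/-- `P f = A f̃₀ + B f̃₁`, where `f̃₀ = f̃` and `f̃₁` is minus the derivative of
`f(ω, k) / (2ω)` with respect to `s = k²` at `s = 0`. -/
def ReducesTo₂ {Ω₄ : Opens R4} {Ω₃ : Opens R3} (P : Dist Ω₄) (A B : Dist Ω₃) : Prop :=
  ∀ f : 𝓓(Ω₄, ℂ), ∃ f₀ f₁ : 𝓓(Ω₃, ℂ), (∀ k, f₀ k = onShell f 0 k) ∧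
    (∀ k, f₁ k = -deriv (fun s : ℝ => onShell f s k) 0) ∧ P f = A f₀ + B f₁

/-- `W = T / (2|k|)`. -/
def IsWeighted (T W : Dist punctured3) : Prop :=
  ∀ f : 𝓓(punctured3, ℂ), ∃ g : 𝓓(punctured3, ℂ),
    (∀ k, g k = f k / ((2 * ‖k‖ : ℝ) : ℂ)) ∧ W f = T g

/-! ### Scaling degrees and extensions -/

/-- `(k_⊥, k₂) ↦ (μ k_⊥, k₂)`. -/
def perpDil (μ : ℝ) (k : R3) : R3 := !₂[μ * k 0, k 1, μ * k 2]

theorem perpDil_contDiff (μ : ℝ) : ContDiff ℝ ∞ (perpDil μ) := by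
  unfold perpDil
  refine (PiLp.contDiff_toLp (𝕜 := ℝ) (p := 2) (n := ∞) (E := fun _ : Fin 3 => ℝ)).comp ?_
  rw [contDiff_pi]
  intro i
  fin_cases i <;> simp <;> fun_prop

theorem perpDil_perpDil (μ ν : ℝ) (k : R3) :
    perpDil μ (perpDil ν k) = perpDil (μ * ν) k := by
  ext i; fin_cases i <;> simp [perpDil, mul_assoc]

theorem perpDil_one (k : R3) : perpDil 1 k = k := by
  ext i; fin_cases i <;> simp [perpDil]

theorem perpDil_isClosedEmbedding {μ : ℝ} (hμ : μ ≠ 0) : IsClosedEmbedding (perpDil μ) :=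
  Function.LeftInverse.isClosedEmbedding (f := perpDil μ⁻¹)
    (fun k => by rw [perpDil_perpDil, inv_mul_cancel₀ hμ, perpDil_one])
    (perpDil_contDiff _).continuous (perpDil_contDiff _).continuous

/-- Open sets of `ℝ³` that are invariant under the transversal and the isotropic dilations. -/
class Scalable (Ω : Opens R3) : Prop where
  perp : ∀ μ : ℝ, 0 < μ → ∀ k, perpDil μ k ∈ Ω → k ∈ Ω
  iso : ∀ μ : ℝ, 0 < μ → ∀ k : R3, μ • k ∈ Ω → k ∈ Ω

instance : Scalable offAxis where
  perp μ hμ k h := by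
    change perpSq k ≠ 0
    intro h0
    apply h
    simp only [perpSq, perpDil] at *
    simp
    linear_combination μ ^ 2 * h0
  iso μ hμ k h := by
    change perpSq k ≠ 0
    intro h0
    apply h
    simp only [perpSq] at *
    simp
    linear_combination μ ^ 2 * h0

instance : Scalable punctured3 where
  perp μ hμ k h := by
    change k ≠ 0
    rintro rfl
    apply h
    ext i; fin_cases i <;> simp [perpDil]
  iso μ hμ k h := by
    change k ≠ 0
    rintro rfl
    exact h (smul_zero μ)

instance : Scalable (⊤ : Opens R3) where
  perp _ _ _ _ := trivial
  iso _ _ _ _ := trivial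

/-- `f(k_⊥ / μ, k₂)`. -/
def perpScale {Ω : Opens R3} [Scalable Ω] (μ : Set.Ioi (0 : ℝ)) (f : 𝓓(Ω, ℂ)) : 𝓓(Ω, ℂ) :=
  pull (perpDil (μ : ℝ)⁻¹) (perpDil_contDiff _)
    (perpDil_isClosedEmbedding (inv_ne_zero (ne_of_gt μ.2)))
    (Scalable.perp _ (inv_pos.2 μ.2)) f

/-- `f(k / μ)`. -/
def isoScale {Ω : Opens R3} [Scalable Ω] (μ : Set.Ioi (0 : ℝ)) (f : 𝓓(Ω, ℂ)) : 𝓓(Ω, ℂ) :=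
  pull (fun k => (μ : ℝ)⁻¹ • k) (contDiff_const_smul _)
    (Homeomorph.smulOfNeZero (α := R3) (μ : ℝ)⁻¹ (inv_ne_zero (ne_of_gt μ.2))).isClosedEmbedding
    (Scalable.iso _ (inv_pos.2 μ.2)) f

/-- The scaling degree at `Ṅ` (codimension 2): scaling of `k_⊥`, tested on the neighbourhood
`{k₂ ≠ 0}` of `Ṅ`. -/
def sdAxis {Ω : Opens R3} [Scalable Ω] (T : Dist Ω) : EReal :=
  scalingDegree 2 perpScale {k | k 1 ≠ 0} T

/-- The scaling degree at the origin of `ℝ³` (codimension 3). -/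
def sdOrigin {Ω : Opens R3} [Scalable Ω] (T : Dist Ω) : EReal :=
  scalingDegree 3 isoScale Set.univ T

/-- The extensions of `T` across `Ṅ` that do not increase the scaling degree at `Ṅ`. -/
def axisExtensions (T : Dist offAxis) : Set (Dist punctured3) :=
  {T' | restrict T' = T ∧ sdAxis T' ≤ sdAxis T}

/-- The extensions of `T` to the origin that do not increase the scaling degree there. -/
def originExtensions (T : Dist punctured3) : Set (Dist (⊤ : Opens R3)) :=
  {S | restrict S = T ∧ sdOrigin S ≤ sdOrigin T}

/-! ### Counterterms supported on `Ṅ` -/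

/-- The point `(0, s, 0)` of the line `k_⊥ = 0`. -/
def axisPoint (s : ℝ) : R3 := EuclideanSpace.single 1 s

theorem axisPoint_contDiff : ContDiff ℝ ∞ axisPoint := by
  have h : axisPoint = fun s : ℝ => s • (EuclideanSpace.single 1 1 : R3) := by
    funext s; ext i; fin_cases i <;> simp [axisPoint]
  rw [h]
  exact contDiff_id.smul contDiff_const

/-- The restriction `s ↦ f(0, s, 0)` of a test function to `Ṅ`. -/
def axisRestrict (f : 𝓓(punctured3, ℂ)) : 𝓓(punctured1, ℂ) :=
  pull axisPoint
    axisPoint_contDiff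
    (Function.LeftInverse.isClosedEmbedding (f := fun k : R3 => k 1)
      (fun s => by simp [axisPoint]) (by fun_prop)
      axisPoint_contDiff.continuous)
    (fun s hs => by
      change s ≠ 0
      rintro rfl
      apply hs
      simp [axisPoint])
    f

/-- Pairs `(a, b)` of natural numbers with `a + b < m`, written as `⟨a + b, a⟩`. -/
abbrev PerpIndex (m : ℕ) := Σ j : Fin m, Fin (j + 1)

/-- The value at `f` of the distribution `∑ c_{ab}(k₂) ⊗ ∂₁ᵃ ∂₃ᵇ δ²(k_⊥)`, the sum being over
`a + b < m`, with coefficients `c_{ab}` that are distributions on `ℝ ∖ {0}`. -/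
def counterterm {m : ℕ} (c : PerpIndex m → Dist punctured1) (f : 𝓓(punctured3, ℂ)) : ℂ :=
  ∑ α : PerpIndex m, (-1) ^ (α.1 : ℕ) *
    c α (axisRestrict
      ((fun g : 𝓓(punctured3, ℂ) => ∂_{(EuclideanSpace.single 0 1 : R3)} g)^[(α.2 : ℕ)]
        ((fun g : 𝓓(punctured3, ℂ) => ∂_{(EuclideanSpace.single 2 1 : R3)} g)^[(α.1 : ℕ) - α.2]
          f)))

end

end NCQED

namespace NCQED
noncomputable section

/-! ### Test functions and continuity -/

section TestFunctions

variable {E : Type*} [NormedAddCommGroup E] [NormedSpace ℝ E]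
variable {E' : Type*} [NormedAddCommGroup E'] [NormedSpace ℝ E']

/-! Reduction. On the forward cone `-(kΘ₀)²` equals `2λ⁴|k_⊥|²`, and the mass shell distributions
are integrals over ℝ³ of the restriction of `f` to the shell, or of its derivative in the squared
mass `s`. Off `N` the product with the kernel is therefore a distribution on ℝ³ evaluated at `f̃`;
for `δ'` the product rule in `s` also differentiates the kernel, which gives the second term.
Arbitrary `f̃₀` can be realised, and arbitrary `f̃₁` together with `f̃₀ = 0`
(`exists_shell_preimage`), so nothing is lost in passing to ℝ³.

Extension across the axis. `ln|k_⊥|²` is locally integrable and extends itself. Off the axis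
`|k_⊥|⁻²ⁿ` is a constant times `Δ_⊥ⁿ ln²|k_⊥|²`; the squared logarithm is locally integrable, so the
same formula is an extension (`powExt`), and scaling costs only logarithms. Two extensions differ by
a distribution supported on the axis. By finite order and Taylor expansion (`VanishesOff.eq_zero`)
it is determined by its values on `k₁ᵃ k₃ᵇ g(k₂)`, which scale exactly as `μ^{-(a+b)}`; the scaling
degree allows precisely `a + b ≤ 2n - 2`, and none for the logarithm (`existsUnique_counterterm`,
`add_counterterm_mem`).

Extension to the origin. Below scaling degree `3` the same argument with the origin in place of the
axis gives uniqueness. The function `1/(|k_⊥|²|k|)` is homogeneous of degree `-3` and is an explicit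
divergence of a locally integrable field (`sum_potentialDeriv`); moving the divergence to the test
function extends it with degree `3`, which leaves room for `δ₀`. For the family on the axis,
`powExt` is already defined on all of ℝ³, and integration over the axis does not exceed its scaling
degrees.

Boundary values. With `q = -(kΘ₀)²` the gradient of `q` vanishes only at the origin. Integrating by
parts along `∇q/|∇q|²` replaces `log w`, `w⁻¹`, … in `w = ε - iσq` by `w log w - w`, which is
continuous up to `ε = 0` (`integral_logTower`, `tendsto_logTower`).

Wave front sets. Off the cone `D` vanishes locally, and on the cone off `N` one has `q > 0`, where
`v` is smooth; so the overlap lies in `N` and the cone. Conversely take a point of `N` on the cone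
and the conormal `ξ = (1, 0, -σ, 0)`. If neither `ξ` nor `-ξ` were in the wave front set of `u`, the
Fourier transform would decay along the whole line `ℝξ`, and `u` would give only `O(δ^{M+1})` on
`h^{(M)}(⟨ξ, x⟩/δ) θ` (`exists_ray_bound`). Explicit integrals in the parabolic scaling `k_⊥ ~ √δ`
are larger: order `δ` for `D₀` with `M = 1`, order `1` for `D₁` with `M = 0`, and at least order
`δ²` for `v` with `M = 2`. Since `D₀` and `D₁` are real, both signs occur for them, so whichever
sign occurs for `v` there is an opposite one. -/

theorem natCast_le_infty (m : ℕ) : (m : WithTop ℕ∞) ≤ ∞ := by exact_mod_cast le_top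

/-- A smooth function vanishing outside a compact subset of `Ω`, as a test function. -/
def mkTest {Ω : Opens E} (f : E → ℂ) (hf : ContDiff ℝ ∞ f) (K : Set E) (hK : IsCompact K)
    (hKΩ : K ⊆ Ω) (h0 : ∀ x, x ∉ K → f x = 0) : 𝓓(Ω, ℂ) where
  toFun := f
  contDiff' := hf
  hasCompactSupport' := HasCompactSupport.intro hK h0
  tsupport_subset' := (closure_minimal (fun x hx => by
    by_contra h; exact hx (h0 x h)) hK.isClosed).trans hKΩ

theorem contDiff_of_vanish {s : Set E} (hs : IsOpen s) {K : Set E} (hK : IsClosed K) (hKs : K ⊆ s)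
    {f : E → ℂ} (hf : ContDiffOn ℝ ∞ f s) (h0 : ∀ x, x ∉ K → f x = 0) : ContDiff ℝ ∞ f := by
  rw [contDiff_iff_contDiffAt]
  intro x
  by_cases hx : x ∈ K
  · exact hf.contDiffAt (hs.mem_nhds (hKs hx))
  · refine (contDiffAt_const (c := (0 : ℂ))).congr_of_eventuallyEq ?_
    filter_upwards [hK.isOpen_compl.mem_nhds hx] with y hy using h0 y hy

theorem testFunction_eq_zero {Ω : Opens E} (f : 𝓓(Ω, ℂ)) {x : E} (hx : x ∉ tsupport f) :
    f x = 0 := image_eq_zero_of_notMem_tsupport hx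

theorem exists_bound_iteratedFDerivWithin {F : Type*} [NormedAddCommGroup F] [NormedSpace ℝ F]
    {s : Set E} (hs : IsOpen s) {K : Set E} (hK : IsCompact K) (hKs : K ⊆ s) {g : E → F}
    (hg : ContDiffOn ℝ ∞ g s) (n : ℕ) :
    ∃ C, 1 ≤ C ∧ ∀ i ≤ n, ∀ x ∈ K, ‖iteratedFDerivWithin ℝ i g s x‖ ≤ C := by
  have h1 : ∀ i : ℕ, ∃ C, ∀ x ∈ K, ‖iteratedFDerivWithin ℝ i g s x‖ ≤ C := fun i =>
    hK.exists_bound_of_continuousOn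
      ((hg.continuousOn_iteratedFDerivWithin (by exact_mod_cast le_top) hs.uniqueDiffOn).mono hKs)
  choose C hC using h1
  refine ⟨1 + ∑ i ∈ Finset.range (n + 1), |C i|, ?_, fun i hi x hx => ?_⟩
  · have : 0 ≤ ∑ i ∈ Finset.range (n + 1), |C i| := Finset.sum_nonneg fun _ _ => abs_nonneg _
    linarith
  · have h2 : |C i| ≤ ∑ i ∈ Finset.range (n + 1), |C i| :=
      Finset.single_le_sum (f := fun i => |C i|) (fun _ _ => abs_nonneg _)
        (Finset.mem_range.2 (by omega))
    linarith [hC i x hx, le_abs_self (C i)]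

/-- Leibniz rule and Faà di Bruno formula. The constant depends only on `a`, `γ`, `K` and `n`, not
on `f`; this uniformity is what makes `f ↦ a · (f ∘ γ)` continuous. -/
theorem exists_bound_comp {s : Set E'} (hs : IsOpen s) {K : Set E'} (hK : IsCompact K)
    (hKs : K ⊆ s) {a : E' → ℂ} {γ : E' → E} (ha : ContDiffOn ℝ ∞ a s) (hγ : ContDiffOn ℝ ∞ γ s)
    (n : ℕ) : ∃ C, 0 ≤ C ∧ ∀ (f : E → ℂ), ContDiff ℝ ∞ f → ∀ M : ℝ, 0 ≤ M →
      ∀ x ∈ K, (∀ i ≤ n, ‖iteratedFDeriv ℝ i f (γ x)‖ ≤ M) →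
        ‖iteratedFDeriv ℝ n (fun x => a x * f (γ x)) x‖ ≤ C * M := by
  obtain ⟨A, hA1, hA⟩ := exists_bound_iteratedFDerivWithin hs hK hKs ha n
  obtain ⟨D, hD1, hD⟩ := exists_bound_iteratedFDerivWithin hs hK hKs hγ n
  refine ⟨∑ i ∈ Finset.range (n + 1), (n.choose i : ℝ) * A * ((n - i).factorial * D ^ (n - i)),
    by positivity, fun f hf M hM x hx hfx => ?_⟩
  have hxs := hKs hx
  rw [← iteratedFDerivWithin_of_isOpen _ hs hxs]
  have hfγ : ContDiffOn ℝ ∞ (f ∘ γ) s := hf.comp_contDiffOn hγ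
  refine (norm_iteratedFDerivWithin_mul_le (N := ∞) ha hfγ hs.uniqueDiffOn hxs
    (by exact_mod_cast le_top)).trans ?_
  rw [Finset.sum_mul]
  refine Finset.sum_le_sum fun i hi => ?_
  have hi' : i ≤ n := by simpa [Nat.lt_succ_iff] using hi
  have h1 : ‖iteratedFDerivWithin ℝ (n - i) (f ∘ γ) s x‖ ≤ (n - i).factorial * M * D ^ (n - i) := by
    refine norm_iteratedFDerivWithin_comp_le (N := ∞) (t := Set.univ) hf.contDiffOn hγ
      (natCast_le_infty _) uniqueDiffOn_univ hs.uniqueDiffOn (fun _ _ => Set.mem_univ _) hxs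
      (fun j hj => ?_) (fun j hj1 hj => ?_)
    · rw [iteratedFDerivWithin_univ]; exact hfx j (by omega)
    -- The composition estimate asks for `D ^ j`; the bound `D` does because it was chosen to be at
    -- least one.
    · exact (hD j (by omega) x hx).trans (le_self_pow₀ hD1 (by omega))
  calc _ ≤ (n.choose i : ℝ) * A * ((n - i).factorial * M * D ^ (n - i)) := by
        gcongr
        exact hA i hi' x hx
    _ = _ := by ring

theorem continuous_of_bound {K : Compacts E} {K' : Compacts E'}
    (Φ : 𝓓_{K}(E, ℂ) →ₗ[ℂ] 𝓓_{K'}(E', ℂ))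
    (h : ∀ n : ℕ, ∃ C : ℝ, 0 ≤ C ∧ ∀ f : 𝓓_{K}(E, ℂ), ∀ M : ℝ, 0 ≤ M →
      (∀ i ≤ n, ∀ x, ‖iteratedFDeriv ℝ i f x‖ ≤ M) →
      ∀ x ∈ K', ‖iteratedFDeriv ℝ n (Φ f) x‖ ≤ C * M) : Continuous Φ := by
  refine WithSeminorms.continuous_of_isBounded (ContDiffMapSupportedIn.withSeminorms ℂ E ℂ ⊤ K)
    (ContDiffMapSupportedIn.withSeminorms ℂ E' ℂ ⊤ K') _ (.of_real fun n => ?_)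
  obtain ⟨C, hC, hf⟩ := h n
  refine ⟨Finset.Iic n, C, fun f => ?_⟩
  refine ((Φ f).seminorm_top_le_iff ℂ (mul_nonneg hC (apply_nonneg _ _)) n).2 fun x hx => ?_
  refine hf f _ (apply_nonneg _ _) (fun i hi y => ?_) x hx
  exact (ContDiffMapSupportedIn.norm_iteratedFDeriv_apply_le_seminorm_top ℂ).trans
    (Seminorm.le_finset_sup_apply (Finset.mem_Iic.2 hi))

/-- The properness condition under which `f ↦ a · (f ∘ γ)` maps test functions on `Ω` to test
functions on `Ω'`. -/
def ProperPull (Ω : Opens E) (Ω' : Opens E') (a : E' → ℂ) (γ : E' → E) : Prop :=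
  ∀ K : Set E, IsCompact K → K ⊆ Ω →
    ∃ K' : Set E', IsCompact K' ∧ K' ⊆ Ω' ∧ ∀ x, x ∉ K' → a x = 0 ∨ γ x ∉ K

section Pull

variable {Ω : Opens E} {Ω' : Opens E'} {a : E' → ℂ} {γ : E' → E}

/-- A single compact `K'` serves all `f` supported in `K`. Continuity on the LF-space is checked on
each space of functions with fixed support, so this uniformity is needed. -/
theorem pull_aux (ha : ContDiffOn ℝ ∞ a Ω') (hγ : ContDiffOn ℝ ∞ γ Ω')
    (hp : ProperPull Ω Ω' a γ) (K : Set E) (hK : IsCompact K) (hKΩ : K ⊆ Ω) :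
    ∃ K' : Compacts E', (K' : Set E') ⊆ Ω' ∧ ∀ f : E → ℂ, ContDiff ℝ ∞ f →
      (∀ x, x ∉ K → f x = 0) → ContDiff ℝ ∞ (fun x => a x * f (γ x)) ∧
        ∀ x, x ∉ K' → a x * f (γ x) = 0 := by
  obtain ⟨K', hK', hK'Ω, h0⟩ := hp K hK hKΩ
  refine ⟨⟨K', hK'⟩, hK'Ω, fun f hf hf0 => ?_⟩
  have h1 : ∀ x, x ∉ K' → a x * f (γ x) = 0 := fun x hx => by
    rcases h0 x hx with h | h
    · simp [h]
    · simp [hf0 _ h]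
  exact ⟨contDiff_of_vanish Ω'.isOpen hK'.isClosed hK'Ω (ha.mul (hf.comp_contDiffOn hγ)) h1, h1⟩

theorem pull_exists (ha : ContDiffOn ℝ ∞ a Ω') (hγ : ContDiffOn ℝ ∞ γ Ω')
    (hp : ProperPull Ω Ω' a γ) (f : 𝓓(Ω, ℂ)) : ∃ g : 𝓓(Ω', ℂ), ∀ x, g x = a x * f (γ x) := by
  obtain ⟨K', hK', h⟩ := pull_aux ha hγ hp (tsupport f) f.hasCompactSupport f.tsupport_subset
  obtain ⟨h1, h2⟩ := h f f.contDiff fun x hx => testFunction_eq_zero f hx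
  exact ⟨mkTest _ h1 K' K'.isCompact hK' h2, fun x => rfl⟩

/-- The continuous map `f ↦ a · (f ∘ γ)` between spaces of test functions. -/
def weightedPull (ha : ContDiffOn ℝ ∞ a Ω') (hγ : ContDiffOn ℝ ∞ γ Ω')
    (hp : ProperPull Ω Ω' a γ) : 𝓓(Ω, ℂ) →L[ℂ] 𝓓(Ω', ℂ) :=
  TestFunction.mkCLM ℂ (fun f => (pull_exists ha hγ hp f).choose)
    (fun f g => by
      ext x
      rw [add_apply, (pull_exists ha hγ hp (f + g)).choose_spec x,
        (pull_exists ha hγ hp f).choose_spec x, (pull_exists ha hγ hp g).choose_spec x, add_apply]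
      ring)
    (fun c f => by
      ext x
      rw [smul_apply, (pull_exists ha hγ hp (c • f)).choose_spec x,
        (pull_exists ha hγ hp f).choose_spec x, smul_apply, smul_eq_mul, smul_eq_mul]
      ring)
    (fun K hK => by
      obtain ⟨K', hK', h⟩ := pull_aux ha hγ hp K K.isCompact hK
      let Φ : 𝓓_{K}(E, ℂ) →ₗ[ℂ] 𝓓_{K'}(E', ℂ) :=
        { toFun := fun f => ⟨fun x => a x * f (γ x),
            (h f f.contDiff fun x hx => f.zero_on_compl hx).1,
            fun x hx => (h f f.contDiff fun x hx => f.zero_on_compl hx).2 x hx⟩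
          map_add' := fun f g => by
            ext x
            change a x * (f + g) (γ x) = a x * f (γ x) + a x * g (γ x)
            rw [add_apply]; ring
          map_smul' := fun c f => by
            ext x
            change a x * (c • f) (γ x) = c * (a x * f (γ x))
            rw [smul_apply, smul_eq_mul]; ring }
      have hΦ : Continuous Φ := continuous_of_bound Φ fun n => by
        obtain ⟨C, hC, hb⟩ := exists_bound_comp Ω'.isOpen K'.isCompact hK' ha hγ n
        exact ⟨C, hC, fun f M hM hf x hx => hb f f.contDiff M hM x hx fun i hi => hf i hi _⟩
      have := (TestFunction.continuous_ofSupportedIn hK').comp hΦ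
      refine this.congr fun f => ?_
      ext x
      simp only [Function.comp_apply, (pull_exists ha hγ hp _).choose_spec]
      rfl)

@[simp] theorem weightedPull_apply (ha : ContDiffOn ℝ ∞ a Ω') (hγ : ContDiffOn ℝ ∞ γ Ω')
    (hp : ProperPull Ω Ω' a γ) (f : 𝓓(Ω, ℂ)) (x : E') :
    weightedPull ha hγ hp f x = a x * f (γ x) :=
  (pull_exists ha hγ hp f).choose_spec x

end Pull

theorem properPull_id {Ω : Opens E} (a : E → ℂ) : ProperPull Ω Ω a id :=
  fun K hK hKΩ => ⟨K, hK, hKΩ, fun _ hx => Or.inr hx⟩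

/-- Multiplication of test functions by a function that is smooth on `Ω`. -/
def mulCLM {Ω : Opens E} {a : E → ℂ} (ha : ContDiffOn ℝ ∞ a Ω) : 𝓓(Ω, ℂ) →L[ℂ] 𝓓(Ω, ℂ) :=
  weightedPull ha contDiffOn_id (properPull_id a)

@[simp] theorem mulCLM_apply {Ω : Opens E} {a : E → ℂ} (ha : ContDiffOn ℝ ∞ a Ω) (f : 𝓓(Ω, ℂ))
    (x : E) : mulCLM ha f x = a x * f x := by simp [mulCLM]

theorem restrict_apply {Ω Ω' : Opens E} (h : Ω ≤ Ω') (T : Dist Ω') (f : 𝓓(Ω, ℂ))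
    (g : 𝓓(Ω', ℂ)) (hg : ∀ x, g x = f x) : restrict (Ω := Ω) T f = T g := by
  change T (TestFunction.monoCLM ℂ f) = T g
  congr 1
  ext x
  rw [TestFunction.monoCLM_apply]
  simp [h, hg]

/-- Inclusion of test functions on `Ω` into those on `Ω' ⊇ Ω`. -/
def incl {Ω Ω' : Opens E} (h : Ω ≤ Ω') (f : 𝓓(Ω, ℂ)) : 𝓓(Ω', ℂ) :=
  ⟨f, f.contDiff, f.hasCompactSupport, f.tsupport_subset.trans h⟩

@[simp] theorem incl_apply {Ω Ω' : Opens E} (h : Ω ≤ Ω') (f : 𝓓(Ω, ℂ)) (x : E) :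
    incl h f x = f x := rfl

theorem restrict_apply' {Ω Ω' : Opens E} (h : Ω ≤ Ω') (T : Dist Ω') (f : 𝓓(Ω, ℂ)) :
    restrict (Ω := Ω) T f = T (incl h f) := restrict_apply h T f _ fun _ => rfl

/-- A test function on `Ω` with support in `Ω'`, as a test function on `Ω'`. -/
def recast {Ω : Opens E} (Ω' : Opens E) (f : 𝓓(Ω, ℂ)) (h : tsupport f ⊆ Ω') : 𝓓(Ω', ℂ) :=
  ⟨f, f.contDiff, f.hasCompactSupport, h⟩

theorem lineDeriv_test {Ω : Opens E} (f : 𝓓(Ω, ℂ)) (v x : E) :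
    (∂_{v} f : 𝓓(Ω, ℂ)) x = fderiv ℝ f x v := by
  rw [TestFunction.lineDerivOp_eq_lineDerivCLM ℝ, TestFunction.lineDerivCLM_eq_fderivCLM]
  simp

/-- Every distribution has finite order on test functions supported in a given compact set. -/
theorem exists_order_bound {Ω : Opens E} (T : Dist Ω) (K : Set E) (hK : IsCompact K)
    (hKΩ : K ⊆ Ω) : ∃ (N : ℕ) (C : ℝ), 0 ≤ C ∧ ∀ f : 𝓓(Ω, ℂ), (∀ x, x ∉ K → f x = 0) →
      ∀ M : ℝ, 0 ≤ M → (∀ i ≤ N, ∀ x ∈ K, ‖iteratedFDeriv ℝ i f x‖ ≤ M) → ‖T f‖ ≤ C * M := by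
  let K' : Compacts E := ⟨K, hK⟩
  have hK' : (K' : Set E) ⊆ Ω := hKΩ
  let S : 𝓓_{K'}(E, ℂ) →L[ℂ] ℂ := T ∘L TestFunction.ofSupportedInCLM ℂ hK'
  -- A continuous linear form on the space of functions supported in `K` is bounded by finitely many
  -- of the defining seminorms; the largest index that occurs is the order.
  obtain ⟨s, C, -, hC⟩ := Seminorm.bound_of_continuous
    (ContDiffMapSupportedIn.withSeminorms ℂ E ℂ ⊤ K') ((normSeminorm ℂ ℂ).comp S.toLinearMap)
    (by exact continuous_norm.comp S.continuous)
  refine ⟨s.sup id, C, C.2, fun f hf M hM hb => ?_⟩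
  let g : 𝓓_{K'}(E, ℂ) := ⟨f, f.contDiff, fun x hx => hf x hx⟩
  have h1 : T f = S g := by
    change T f = T (TestFunction.ofSupportedIn hK' g)
    congr 1
  rw [h1]
  refine (hC g).trans ?_
  change (C : ℝ) * (s.sup (ContDiffMapSupportedIn.seminorm ℂ E ℂ ⊤ K')) g ≤ C * M
  refine mul_le_mul_of_nonneg_left ?_ C.2
  refine Seminorm.finset_sup_apply_le hM fun i hi => ?_
  exact (g.seminorm_top_le_iff ℂ hM i).2 fun x hx => hb i (Finset.le_sup (f := id) hi) x hx

theorem regular_apply [MeasureSpace E] [BorelSpace E] {Ω : Opens E} {g : E → ℂ}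
    (hg : LocallyIntegrableOn g Ω) (f : 𝓓(Ω, ℂ)) : regular Ω g f = ∫ x, g x * f x := by
  rw [regular, TestFunction.integralAgainstBilinCLM_eq_integral hg]
  simp [mul_comm]

theorem integrable_mul_test [MeasureSpace E] [BorelSpace E] {Ω : Opens E} {g : E → ℂ}
    (hg : LocallyIntegrableOn g Ω) (f : 𝓓(Ω, ℂ)) : Integrable fun x => g x * f x := by
  simpa [mul_comm] using f.integrable_bilin (ContinuousLinearMap.mul ℂ ℂ) hg

/-- A smooth cutoff equal to one near the compact set `K`. -/
theorem exists_cutoff [FiniteDimensional ℝ E] {K s : Set E} (hK : IsCompact K) (hs : IsOpen s)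
    (hKs : K ⊆ s) : ∃ χ : E → ℝ, ContDiff ℝ ∞ χ ∧ HasCompactSupport χ ∧ tsupport χ ⊆ s ∧
      (∀ x, χ x ∈ Set.Icc (0 : ℝ) 1) ∧ ∃ U, IsOpen U ∧ K ⊆ U ∧ ∀ x ∈ U, χ x = 1 := by
  -- Two nested compact neighbourhoods: the cutoff is one on the inner one and zero outside the
  -- interior of the outer one.
  obtain ⟨V, hV, hKV, hVs⟩ := exists_compact_between hK hs hKs
  obtain ⟨W, hW, hVW, hWs⟩ := exists_compact_between hV hs hVs
  obtain ⟨χ, h1, h2, h3⟩ := exists_contMDiff_zero_iff_one_iff_of_isClosed (n := (⊤ : ℕ∞))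
    (modelWithCornersSelf ℝ E)
    (isOpen_interior (s := W)).isClosed_compl hV.isClosed
    (Set.disjoint_left.2 fun x hx hx' => hx (hVW hx'))
  have h0 : ∀ x, x ∉ W → χ x = 0 := fun x hx =>
    ((h3.1 x).1 (fun h => hx (interior_subset h)))
  refine ⟨χ, h1.contDiff, HasCompactSupport.intro hW h0,
    (closure_minimal (fun x hx => ?_) hW.isClosed).trans hWs, fun x => h2 ⟨x, rfl⟩,
    interior V, isOpen_interior, hKV, fun x hx => (h3.2 x).1 (interior_subset hx)⟩
  by_contra h; exact hx (h0 x h)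

end TestFunctions

/-! ### Restriction to the mass shell -/

/-- The point of the mass shell `k² = s` over `k`. -/
def shellPt (s : ℝ) (k : R3) : R4 := !₂[energy s k, k 0, k 1, k 2]

theorem energy_zero (k : R3) : energy 0 k = ‖k‖ := by simp [energy]

theorem onShell_eq (f : R4 → ℂ) (s : ℝ) (k : R3) :
    onShell f s k = f (shellPt s k) / ((2 * energy s k : ℝ) : ℂ) := rfl

theorem norm_sq_R3 (k : R3) : ‖k‖ ^ 2 = k 0 ^ 2 + k 1 ^ 2 + k 2 ^ 2 := by
  simp [EuclideanSpace.norm_sq_eq, Fin.sum_univ_three]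

theorem norm_sq_R4 (k : R4) : ‖k‖ ^ 2 = k 0 ^ 2 + k 1 ^ 2 + k 2 ^ 2 + k 3 ^ 2 := by
  simp [EuclideanSpace.norm_sq_eq, Fin.sum_univ_four]

theorem norm_shellPt (s : ℝ) (k : R3) : ‖shellPt s k‖ ^ 2 = energy s k ^ 2 + ‖k‖ ^ 2 := by
  rw [norm_sq_R4, norm_sq_R3]; simp [shellPt]; ring

theorem continuous_shellPt (s : ℝ) : Continuous (shellPt s) := by
  unfold shellPt energy
  refine (PiLp.continuous_toLp 2 _).comp (continuous_pi fun i => ?_)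
  fin_cases i <;> simp <;> fun_prop

theorem mem_punctured3 {k : R3} : k ∈ punctured3 ↔ k ≠ 0 := Iff.rfl
theorem mem_punctured4 {k : R4} : k ∈ punctured4 ↔ k ≠ 0 := Iff.rfl

theorem offAxis_le : offAxis ≤ punctured3 := by
  rintro k hk rfl
  exact hk (by simp [perpSq])

theorem offN_le : offN ≤ punctured4 := by
  rintro k hk rfl
  exact hk (by simp [planeN])

theorem contDiffOn_shellPt : ContDiffOn ℝ ∞ (shellPt 0) punctured3 := by
  rw [contDiffOn_euclidean]
  intro i
  have h0 : ContDiffOn ℝ ∞ (fun k : R3 => ‖k‖) punctured3 := fun k hk =>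
    ((contDiffAt_norm ℝ hk).contDiffWithinAt)
  fin_cases i
  · simpa [shellPt, energy_zero] using h0
  all_goals
    simp only [shellPt]
    simp
    fun_prop

theorem contDiffOn_weight (n : ℕ) (c : ℂ) :
    ContDiffOn ℝ ∞ (fun k : R3 => c * (((‖k‖ : ℝ) : ℂ) ^ n)⁻¹) punctured3 := fun k hk => by
  have h0 : ContDiffAt ℝ ∞ (fun k : R3 => ((‖k‖ : ℝ) : ℂ)) k :=
    Complex.ofRealCLM.contDiff.contDiffAt.comp k (contDiffAt_norm ℝ hk)
  refine ContDiffAt.contDiffWithinAt ?_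
  refine contDiffAt_const.mul ((h0.pow n).inv ?_)
  have : ‖k‖ ≠ 0 := norm_ne_zero_iff.2 hk
  exact pow_ne_zero _ (by exact_mod_cast this)

/-- Pairs of open sets such that test functions on `Ω₄` restrict to test functions on `Ω₃`. -/
structure ShellPair (Ω₄ : Opens R4) (Ω₃ : Opens R3) : Prop where
  mem : ∀ k, shellPt 0 k ∈ Ω₄ → k ∈ Ω₃
  le₃ : Ω₃ ≤ punctured3
  le₄ : Ω₄ ≤ punctured4

theorem shellPair_punctured : ShellPair punctured4 punctured3 where
  mem k hk h := hk (by
    have h : k = 0 := h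
    subst h
    ext i; fin_cases i <;> simp [shellPt, energy])
  le₃ := le_rfl
  le₄ := le_rfl

theorem shellPair_off : ShellPair offN offAxis where
  mem k hk h := hk (by
    have h : k 0 ^ 2 + k 2 ^ 2 = 0 := h
    have h0 : k 0 = 0 := by nlinarith [sq_nonneg (k 0), sq_nonneg (k 2)]
    have h2 : k 2 = 0 := by nlinarith [sq_nonneg (k 0), sq_nonneg (k 2)]
    simp [planeN, shellPt, h0, h2])
  le₃ := offAxis_le
  le₄ := offN_le

/-- The shell map is proper because it does not decrease norms: `‖k‖ ≤ ‖shellPt 0 k‖`. -/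
theorem ShellPair.proper {Ω₄ : Opens R4} {Ω₃ : Opens R3} (h : ShellPair Ω₄ Ω₃) (a : R3 → ℂ) :
    ProperPull Ω₄ Ω₃ a (shellPt 0) := fun K hK hKΩ => by
  refine ⟨shellPt 0 ⁻¹' K, ?_, fun k hk => h.mem k (hKΩ hk), fun k hk => Or.inr hk⟩
  obtain ⟨R, hR⟩ := hK.isBounded.exists_norm_le
  refine Metric.isCompact_of_isClosed_isBounded (hK.isClosed.preimage (continuous_shellPt 0))
    (isBounded_iff_forall_norm_le.2 ⟨R, fun k hk => (?_ : ‖k‖ ≤ _).trans (hR _ hk)⟩)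
  have := norm_shellPt 0 k
  exact abs_le_of_sq_le_sq' (by nlinarith [sq_nonneg (energy 0 k)]) (norm_nonneg _) |>.2

/-- The restriction `f̃(k) = f(|k|, k) / (2|k|)`. -/
def shell₀ {Ω₄ : Opens R4} {Ω₃ : Opens R3} (h : ShellPair Ω₄ Ω₃) : 𝓓(Ω₄, ℂ) →L[ℂ] 𝓓(Ω₃, ℂ) :=
  weightedPull ((contDiffOn_weight 1 2⁻¹).mono h.le₃) (contDiffOn_shellPt.mono h.le₃) (h.proper _)

theorem shell₀_apply {Ω₄ : Opens R4} {Ω₃ : Opens R3} (h : ShellPair Ω₄ Ω₃) (f : 𝓓(Ω₄, ℂ))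
    (k : R3) : shell₀ h f k = onShell f 0 k := by
  rw [shell₀, weightedPull_apply, onShell_eq, energy_zero]
  push_cast
  rw [div_eq_mul_inv, mul_inv, pow_one]; ring

/-- The time direction. -/
def timeDir : R4 := EuclideanSpace.single 0 1

/-- Minus the derivative of `f(ω, k) / (2ω)` with respect to the squared mass, at mass zero. -/
def shell₁ {Ω₄ : Opens R4} {Ω₃ : Opens R3} (h : ShellPair Ω₄ Ω₃) : 𝓓(Ω₄, ℂ) →L[ℂ] 𝓓(Ω₃, ℂ) :=
  -- From `dω/ds = 1/(2ω)`, the derivative of `f(ω, k)/(2ω)` is `∂₀f/(4ω²) - f/(4ω³)`, here with the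
  -- opposite sign and at `ω = ‖k‖`.
  weightedPull ((contDiffOn_weight 2 (-4⁻¹)).mono h.le₃) (contDiffOn_shellPt.mono h.le₃)
    (h.proper _) ∘L TestFunction.lineDerivCLM ℂ timeDir +
  weightedPull ((contDiffOn_weight 3 4⁻¹).mono h.le₃) (contDiffOn_shellPt.mono h.le₃) (h.proper _)

theorem shell₁_apply' {Ω₄ : Opens R4} {Ω₃ : Opens R3} (h : ShellPair Ω₄ Ω₃) (f : 𝓓(Ω₄, ℂ))
    (k : R3) : shell₁ h f k = -4⁻¹ * (((‖k‖ : ℝ) : ℂ) ^ 2)⁻¹ * fderiv ℝ f (shellPt 0 k) timeDir +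
      4⁻¹ * (((‖k‖ : ℝ) : ℂ) ^ 3)⁻¹ * f (shellPt 0 k) := by
  rw [shell₁, _root_.add_apply, add_apply, ContinuousLinearMap.comp_apply, weightedPull_apply,
    weightedPull_apply, ← lineDeriv_test, TestFunction.lineDerivOp_eq_lineDerivCLM ℂ]

/-- The derivative of `f(ω, k) / (2ω)` with respect to the squared mass. -/
def onShellDeriv (f : R4 → ℂ) (s : ℝ) (k : R3) : ℂ :=
  4⁻¹ * (((energy s k : ℝ) : ℂ) ^ 2)⁻¹ * fderiv ℝ f (shellPt s k) timeDir -
    4⁻¹ * (((energy s k : ℝ) : ℂ) ^ 3)⁻¹ * f (shellPt s k)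

theorem hasDerivAt_energy {s : ℝ} {k : R3} (h : 0 < ‖k‖ ^ 2 + s) :
    HasDerivAt (fun s => energy s k) (2 * energy s k)⁻¹ s := by
  have := ((hasDerivAt_id s).const_add (‖k‖ ^ 2)).sqrt h.ne'
  simpa [energy, one_div] using this

theorem energy_pos {s : ℝ} {k : R3} (h : 0 < ‖k‖ ^ 2 + s) : 0 < energy s k := Real.sqrt_pos.2 h

theorem hasDerivAt_shellPt {s : ℝ} {k : R3} (h : 0 < ‖k‖ ^ 2 + s) :
    HasDerivAt (fun s => shellPt s k) ((2 * energy s k)⁻¹ • timeDir) s := by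
  have e : (fun s => shellPt s k) = fun s => energy s k • timeDir + shellPt 0 k -
      ‖k‖ • timeDir := by
    funext s
    ext i; fin_cases i <;> simp [shellPt, timeDir, energy_zero]
  rw [e]
  exact (((hasDerivAt_energy h).smul_const timeDir).add_const _).sub_const _

theorem hasDerivAt_onShell {f : R4 → ℂ} {s : ℝ} {k : R3} (h : 0 < ‖k‖ ^ 2 + s)
    (hf : DifferentiableAt ℝ f (shellPt s k)) :
    HasDerivAt (fun s => onShell f s k) (onShellDeriv f s k) s := by
  have he := energy_pos h
  have h1 : HasDerivAt (fun s => f (shellPt s k))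
      (fderiv ℝ f (shellPt s k) ((2 * energy s k)⁻¹ • timeDir)) s :=
    hf.hasFDerivAt.comp_hasDerivAt s (hasDerivAt_shellPt h)
  have h2 : HasDerivAt (fun s => ((2 * energy s k : ℝ) : ℂ)) ((2 * (2 * energy s k)⁻¹ : ℝ) : ℂ) s :=
    ((hasDerivAt_energy h).const_mul 2).ofReal_comp
  have hc : ((energy s k : ℝ) : ℂ) ≠ 0 := by exact_mod_cast he.ne'
  have h3 := h1.div h2 (by push_cast; simpa using hc)
  refine h3.congr_deriv ?_
  rw [map_smul, onShellDeriv]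
  push_cast
  rw [Complex.real_smul]
  push_cast
  field_simp
  ring

theorem exists_ball_vanish {Ω₄ : Opens R4} (h : Ω₄ ≤ punctured4) (f : 𝓓(Ω₄, ℂ)) :
    ∃ r > 0, ∀ k, ‖k‖ < r → f k = 0 := by
  have h0 : (0 : R4) ∉ tsupport f := fun h' => h (f.tsupport_subset h') rfl
  obtain ⟨r, hr, hb⟩ := Metric.isOpen_iff.1 (isClosed_tsupport f).isOpen_compl 0 h0
  exact ⟨r, hr, fun k hk => testFunction_eq_zero f (hb (by simpa using hk))⟩

theorem norm_shellPt_lt {r : ℝ} (hr : 0 < r) {s : ℝ} {k : R3}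
    (hk : ‖k‖ ^ 2 < r ^ 2 / 4) (hs : s < r ^ 2 / 4) :
    ‖shellPt s k‖ < r := by
  have h1 := norm_shellPt s k
  have h2 : energy s k ^ 2 ≤ max (‖k‖ ^ 2 + s) 0 := by
    unfold energy
    rcases le_total 0 (‖k‖ ^ 2 + s) with h | h
    · rw [Real.sq_sqrt h]; exact le_max_left _ _
    · rw [Real.sqrt_eq_zero_of_nonpos h]; simp
  have h3 : max (‖k‖ ^ 2 + s) 0 < r ^ 2 / 2 := max_lt (by linarith) (by positivity)
  refine abs_lt_of_sq_lt_sq' (by nlinarith) hr.le |>.2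

/-- The energy is singular where `‖k‖² + s = 0`, but test functions on the punctured space vanish
near the origin. Hence one interval of `s` serves all `k`: either `ω²` is bounded below or the
integrand vanishes. The dichotomy is kept in the statement because the dominating function for
differentiation under the integral uses it. -/
theorem hasDerivAt_onShell_test {Ω₄ : Opens R4} (h : Ω₄ ≤ punctured4) (f : 𝓓(Ω₄, ℂ)) :
    ∃ ε > 0, ∀ s : ℝ, |s| < ε → ∀ k, (0 < ‖k‖ ^ 2 + s ∧ ε ≤ ‖k‖ ^ 2 + s ∨
      (f (shellPt s k) = 0 ∧ fderiv ℝ f (shellPt s k) = 0)) ∧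
      HasDerivAt (fun s => onShell f s k) (onShellDeriv f s k) s := by
  obtain ⟨r, hr, hf⟩ := exists_ball_vanish h f
  -- If `‖k‖²` and `s` are below `r²/4`, the shell point lies in the ball where `f` vanishes;
  -- otherwise `‖k‖² + s ≥ r²/4 - r²/8`.
  refine ⟨r ^ 2 / 8, by positivity, fun s hs k => ?_⟩
  rw [abs_lt] at hs
  have hd : Differentiable ℝ f := f.contDiff.differentiable (by simp)
  by_cases hk : ‖k‖ ^ 2 < r ^ 2 / 4
  · have h0 : shellPt s k ∈ Metric.ball (0 : R4) r := by
      simpa using norm_shellPt_lt hr hk (by linarith : s < r ^ 2 / 4)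
    have hfd : fderiv ℝ f (shellPt s k) = 0 := by
      have : (f : R4 → ℂ) =ᶠ[𝓝 (shellPt s k)] fun _ => 0 := by
        filter_upwards [Metric.isOpen_ball.mem_nhds h0] with x hx using hf x (by simpa using hx)
      rw [this.fderiv_eq]; simp
    have hf0 : f (shellPt s k) = 0 := hf _ (by simpa using h0)
    refine ⟨Or.inr ⟨hf0, hfd⟩, ?_⟩
    rw [onShellDeriv, hf0, hfd]
    simp only [_root_.zero_apply, mul_zero, sub_zero]
    refine (hasDerivAt_const s (0 : ℂ)).congr_of_eventuallyEq ?_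
    filter_upwards [Iio_mem_nhds (by linarith : s < r ^ 2 / 4)] with s' hs'
    rw [onShell_eq, hf _ (norm_shellPt_lt hr hk hs'), zero_div]
  · push Not at hk
    have h1 : 0 < ‖k‖ ^ 2 + s := by nlinarith
    exact ⟨Or.inl ⟨h1, by linarith⟩, hasDerivAt_onShell h1 hd.differentiableAt⟩

theorem shell₁_apply {Ω₄ : Opens R4} {Ω₃ : Opens R3} (h : ShellPair Ω₄ Ω₃) (f : 𝓓(Ω₄, ℂ))
    (k : R3) : shell₁ h f k = -onShellDeriv f 0 k := by
  rw [shell₁_apply', onShellDeriv, energy_zero]; ring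

theorem deriv_onShell {Ω₄ : Opens R4} (h : Ω₄ ≤ punctured4) (f : 𝓓(Ω₄, ℂ)) (k : R3) :
    HasDerivAt (fun s => onShell f s k) (onShellDeriv f 0 k) 0 := by
  obtain ⟨ε, hε, h1⟩ := hasDerivAt_onShell_test h f
  exact (h1 0 (by simpa using hε) k).2

theorem locallyIntegrableOn_one (Ω : Opens R3) : LocallyIntegrableOn (fun _ : R3 => (1 : ℂ)) Ω :=
  (locallyIntegrable_const 1).locallyIntegrableOn _

/-- `θ(k₀) δ(k²)`. -/
def shellDelta : Dist punctured4 := regular punctured3 (fun _ => 1) ∘L shell₀ shellPair_punctured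

/-- `θ(k₀) δ'(k²)`. -/
def shellDeltaPrime : Dist punctured4 :=
  regular punctured3 (fun _ => 1) ∘L shell₁ shellPair_punctured

theorem shellDelta_apply (f : 𝓓(punctured4, ℂ)) : shellDelta f = ∫ k, onShell f 0 k := by
  rw [shellDelta, ContinuousLinearMap.comp_apply, regular_apply (locallyIntegrableOn_one _)]
  simp [shell₀_apply]

theorem shellDeltaPrime_apply (f : 𝓓(punctured4, ℂ)) :
    shellDeltaPrime f = ∫ k, -onShellDeriv f 0 k := by
  rw [shellDeltaPrime, ContinuousLinearMap.comp_apply, regular_apply (locallyIntegrableOn_one _)]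
  simp [shell₁_apply]

theorem isShellDelta_shellDelta : IsShellDelta shellDelta := shellDelta_apply

theorem isShellDeltaPrime_shellDeltaPrime : IsShellDeltaPrime shellDeltaPrime := fun f => by
  obtain ⟨ε, hε, h1⟩ := hasDerivAt_onShell_test le_rfl f
  obtain ⟨R, hR⟩ := f.hasCompactSupport.isBounded.exists_norm_le
  obtain ⟨M, hM⟩ := f.hasCompactSupport.exists_bound_of_continuous f.continuous
  have hfd : Continuous (fderiv ℝ f) := f.contDiff.continuous_fderiv (by simp)
  obtain ⟨M', hM'⟩ := (f.hasCompactSupport.fderiv ℝ).exists_bound_of_continuous hfd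
  have hM0 : 0 ≤ M := (norm_nonneg _).trans (hM 0)
  have hM0' : 0 ≤ M' := (norm_nonneg _).trans (hM' 0)
  have hsupp : ∀ s k, R < ‖k‖ → f (shellPt s k) = 0 ∧ fderiv ℝ f (shellPt s k) = 0 := by
    intro s k hk
    have h2 : shellPt s k ∉ tsupport f := fun h => by
      have h3 := hR _ h
      have h4 := norm_shellPt s k
      have h5 : ‖k‖ ≤ ‖shellPt s k‖ :=
        abs_le_of_sq_le_sq' (by nlinarith [sq_nonneg (energy s k)]) (norm_nonneg _) |>.2
      linarith
    exact ⟨testFunction_eq_zero f h2,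
      image_eq_zero_of_notMem_tsupport fun h => h2 (tsupport_fderiv_subset ℝ h)⟩
  have hme : ∀ s, Measurable (energy s) := fun s => by unfold energy; fun_prop
  have hmeas : ∀ s, AEStronglyMeasurable (fun k => onShell f s k) (volume : Measure R3) :=
    fun s => by
    refine Measurable.aestronglyMeasurable ?_
    have : Measurable fun k => f (shellPt s k) :=
      (f.continuous.comp (continuous_shellPt s)).measurable
    exact this.div (Complex.measurable_ofReal.comp ((hme s).const_mul 2))
  have hmeas' : AEStronglyMeasurable (fun k => onShellDeriv f 0 k) (volume : Measure R3) := by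
    refine Measurable.aestronglyMeasurable ?_
    have h3 : Measurable fun k => f (shellPt 0 k) :=
      (f.continuous.comp (continuous_shellPt 0)).measurable
    have h4 : Measurable fun k => fderiv ℝ f (shellPt 0 k) timeDir :=
      ((hfd.comp (continuous_shellPt 0)).clm_apply continuous_const).measurable
    have h5 : Measurable fun k => ((energy 0 k : ℝ) : ℂ) := Complex.measurable_ofReal.comp (hme 0)
    exact (((h5.pow_const 2).inv.const_mul _).mul h4).sub
      (((h5.pow_const 3).inv.const_mul _).mul h3)
  have hint : Integrable (fun k => onShell f 0 k) (volume : Measure R3) := by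
    refine (integrable_mul_test (locallyIntegrableOn_one _) (shell₀ shellPair_punctured f)).congr ?_
    filter_upwards with k
    simp [shell₀_apply]
  -- The dominating constant uses `ω² ≥ ε`, so that `ω⁻³ ≤ ε⁻¹ (√ε)⁻¹`, together with sup bounds `M`
  -- of `f` and `M'` of its derivative. It is cut off to the ball of radius `R`, outside which no
  -- shell point meets the support.
  have key := hasDerivAt_integral_of_dominated_loc_of_deriv_le (μ := (volume : Measure R3))
    (F := fun s k => onShell f s k) (F' := fun s k => onShellDeriv f s k) (x₀ := 0)
    (s := Metric.ball 0 ε)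
    (bound := (Metric.closedBall (0 : R3) R).indicator fun _ =>
      4⁻¹ * ε⁻¹ * (M' * ‖timeDir‖) + 4⁻¹ * (ε⁻¹ * (√ε)⁻¹) * M) (Metric.ball_mem_nhds 0 hε)
    (Eventually.of_forall hmeas) hint hmeas' ?_ ?_ ?_
  · have e := key.2
    rw [shellDeltaPrime_apply, integral_neg, neg_neg]
    exact e
  · refine Eventually.of_forall fun k s hs => ?_
    have hs : |s| < ε := by simpa using hs
    by_cases hk : k ∈ Metric.closedBall (0 : R3) R
    · rw [Set.indicator_of_mem hk]
      rcases (h1 s hs k).1 with ⟨h2, h3⟩ | ⟨h2, h3⟩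
      · have he := energy_pos h2
        have he2 : ε ≤ energy s k ^ 2 := by rw [energy, Real.sq_sqrt h2.le]; exact h3
        have he1 : √ε ≤ energy s k := Real.sqrt_le_sqrt h3
        have hse : 0 < √ε := Real.sqrt_pos.2 hε
        rw [onShellDeriv]
        refine (norm_sub_le _ _).trans ?_
        simp only [norm_mul, norm_inv, norm_pow, Complex.norm_real, Real.norm_of_nonneg he.le]
        have h4 : (energy s k ^ 3)⁻¹ ≤ ε⁻¹ * (√ε)⁻¹ := by
          rw [← mul_inv]
          refine inv_anti₀ (by positivity) ?_
          rw [pow_succ]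
          exact mul_le_mul he2 he1 hse.le (by positivity)
        have h5 : ‖fderiv ℝ f (shellPt s k) timeDir‖ ≤ M' * ‖timeDir‖ :=
          (ContinuousLinearMap.le_opNorm _ _).trans (by gcongr; exact hM' _)
        have h6 : ‖(4 : ℂ)‖ = 4 := by simp
        rw [h6]
        gcongr
        exact hM _
      · rw [onShellDeriv, h2, h3]
        simp
        positivity
    · rw [Set.indicator_of_notMem hk]
      obtain ⟨h2, h3⟩ := hsupp s k (by simpa using hk)
      rw [onShellDeriv, h2, h3]
      simp
  · rw [integrable_indicator_iff measurableSet_closedBall]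
    exact integrableOn_const (isCompact_closedBall _ _).measure_lt_top.ne
  · exact Eventually.of_forall fun k s hs => (h1 s (by simpa using hs) k).2

/-! ### The products off `N` and their extensions -/

theorem negKThetaSq_eq (lam : ℝ) (k : R4) :
    negKThetaSq lam k = lam ^ 4 * (k 0 ^ 2 + k 1 ^ 2 + k 3 ^ 2 - k 2 ^ 2) := by
  simp [negKThetaSq, minkowskiSq, kTheta, Theta0, eta, Matrix.mulVec_diagonal, Matrix.vecMul, dotProduct,
    Fin.sum_univ_four]
  ring

theorem contDiff_negKThetaSq (lam : ℝ) : ContDiff ℝ ∞ (negKThetaSq lam) := by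
  have : negKThetaSq lam = fun k : R4 => lam ^ 4 * (k 0 ^ 2 + k 1 ^ 2 + k 3 ^ 2 - k 2 ^ 2) :=
    funext (negKThetaSq_eq lam)
  rw [this]; fun_prop

theorem negKThetaSq_shellPt (lam : ℝ) {s : ℝ} {k : R3} (h : 0 ≤ ‖k‖ ^ 2 + s) :
    negKThetaSq lam (shellPt s k) = lam ^ 4 * (2 * perpSq k + s) := by
  have h1 : energy s k ^ 2 = ‖k‖ ^ 2 + s := Real.sq_sqrt h
  rw [negKThetaSq_eq]
  simp [shellPt, perpSq]
  rw [h1, norm_sq_R3]; left; ring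

theorem negKThetaSq_shellPt_zero (lam : ℝ) (k : R3) :
    negKThetaSq lam (shellPt 0 k) = 2 * lam ^ 4 * perpSq k := by
  rw [negKThetaSq_shellPt lam (by positivity)]; ring

theorem shellPt_mem_forwardCone {k : R3} (hk : k ≠ 0) : shellPt 0 k ∈ forwardCone := by
  have h := norm_sq_R3 k
  have h0 : 0 < ‖k‖ := norm_pos_iff.2 hk
  constructor
  · simp [minkowskiSq, shellPt, energy_zero]; linarith
  · simpa [shellPt, energy_zero] using hk

theorem eq_shellPt_of_mem_forwardCone {k : R4} (hk : k ∈ forwardCone) :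
    k = shellPt 0 !₂[k 1, k 2, k 3] := by
  obtain ⟨h1, h2⟩ := hk
  have h3 : ‖(!₂[k 1, k 2, k 3] : R3)‖ = k 0 := by
    have h4 := norm_sq_R3 (!₂[k 1, k 2, k 3] : R3)
    simp [minkowskiSq] at h1 h4
    exact (pow_left_inj₀ (norm_nonneg _) h2.le two_ne_zero).1 (by rw [h4]; linarith)
  ext i; fin_cases i <;> simp [shellPt, energy_zero, h3]

theorem perpSq_nonneg (k : R3) : 0 ≤ perpSq k := by unfold perpSq; positivity

theorem contDiff_perpSq : ContDiff ℝ ∞ perpSq := by unfold perpSq; fun_prop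

/-- The properties of the kernels used for the products. -/
theorem IsKernel.contDiffAt {K : ℂ → ℂ} (hK : IsKernel K) {z : ℂ} (hz : z ∈ Complex.slitPlane) :
    ContDiffAt ℝ ∞ K z := by
  rcases hK with rfl | ⟨n, -, rfl⟩
  · exact (Complex.contDiffAt_log hz).restrict_scalars ℝ
  · exact (contDiffAt_id.pow n).inv (pow_ne_zero _ (Complex.slitPlane_ne_zero hz))

theorem IsKernel.contDiffAt_real {K : ℂ → ℂ} (hK : IsKernel K) {x : ℝ} (hx : 0 < x) :
    ContDiffAt ℝ ∞ (fun x : ℝ => K (x : ℂ)) x :=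
  (hK.contDiffAt (Complex.ofReal_mem_slitPlane.2 hx)).comp x
    Complex.ofRealCLM.contDiff.contDiffAt

theorem kernel_contDiffOn {K : ℂ → ℂ} (hK : IsKernel K) {lam : ℝ} (hlam : 0 < lam) :
    ContDiffOn ℝ ∞ (fun k : R3 => K ((2 * lam ^ 4 * perpSq k : ℝ) : ℂ)) offAxis := fun k hk => by
  have h : 0 < 2 * lam ^ 4 * perpSq k := by
    have : 0 < perpSq k := lt_of_le_of_ne (perpSq_nonneg k) (Ne.symm hk)
    positivity
  have h2 : ContDiff ℝ ∞ fun k => 2 * lam ^ 4 * perpSq k := contDiff_const.mul contDiff_perpSq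
  exact ((hK.contDiffAt_real h).comp k h2.contDiffAt).contDiffWithinAt

theorem kernel_locallyIntegrableOn {K : ℂ → ℂ} (hK : IsKernel K) {lam : ℝ} (hlam : 0 < lam) :
    LocallyIntegrableOn (fun k : R3 => K ((2 * lam ^ 4 * perpSq k : ℝ) : ℂ)) offAxis :=
  (kernel_contDiffOn hK hlam).continuousOn.locallyIntegrableOn offAxis.isOpen.measurableSet

theorem kernelDist_apply {K : ℂ → ℂ} (hK : IsKernel K) {lam : ℝ} (hlam : 0 < lam)
    (f : 𝓓(offAxis, ℂ)) :
    kernelDist lam K f = ∫ k, K ((2 * lam ^ 4 * perpSq k : ℝ) : ℂ) * f k :=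
  regular_apply (kernel_locallyIntegrableOn hK hlam) f

/-- A smooth function on the line vanishing near `(-∞, 0]` that agrees with the kernel on a
half-line. -/
theorem exists_smooth_kernel {K : ℂ → ℂ} (hK : IsKernel K) {c : ℝ} (hc : 0 < c) :
    ∃ κ : ℝ → ℂ, ContDiff ℝ ∞ κ ∧ ∀ x, c ≤ x → κ x = K x := by
  refine ⟨fun x => (Real.smoothTransition (2 * x / c - 1) : ℂ) * K x, ?_, fun x hx => ?_⟩
  · rw [contDiff_iff_contDiffAt]
    intro x
    rcases lt_or_ge x (c / 2) with hx | hx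
    · refine (contDiffAt_const (c := (0 : ℂ))).congr_of_eventuallyEq ?_
      filter_upwards [Iio_mem_nhds hx] with y hy
      rw [Real.smoothTransition.zero_of_nonpos]
      · simp
      · have hy : y < c / 2 := hy
        have : 2 * y / c ≤ 1 := by rw [div_le_one hc]; linarith
        linarith
    · refine ContDiffAt.mul ?_ (hK.contDiffAt_real (by linarith))
      refine Complex.ofRealCLM.contDiff.contDiffAt.comp x ?_
      exact Real.smoothTransition.contDiff.contDiffAt.comp x (by fun_prop)
  · change ((2 * x / c - 1).smoothTransition : ℂ) * K x = K x
    rw [Real.smoothTransition.one_of_one_le]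
    · simp
    · have : 2 ≤ 2 * x / c := by rw [le_div_iff₀ hc]; linarith
      linarith

/-- On the support of `f` one has `k₁² + k₃² ≥ c > 0`, so at its points on the cone `-(kΘ₀)² ≥
2λ⁴c`. Composing `-(kΘ₀)²` with a smooth function that agrees with `K` only above `λ⁴c` removes the
singularities elsewhere and does not change the product near the cone. -/
theorem exists_product_rep {K : ℂ → ℂ} (hK : IsKernel K) {lam : ℝ} (hlam : 0 < lam)
    (f : 𝓓(offN, ℂ)) : ∃ g : 𝓓(punctured4, ℂ), ∃ U : Set R4, IsOpen U ∧ forwardCone ⊆ U ∧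
      ∀ k ∈ U, g k = K (negKThetaSq lam k : ℂ) * f k := by
  obtain ⟨c, hc, hcb⟩ : ∃ c > 0, ∀ k ∈ tsupport f, c ≤ k 1 ^ 2 + k 3 ^ 2 := by
    rcases (tsupport f).eq_empty_or_nonempty with h | h
    · exact ⟨1, one_pos, by simp [h]⟩
    · obtain ⟨k₀, hk₀, hmin⟩ := f.hasCompactSupport.isCompact.exists_isMinOn h
        (f := fun k : R4 => k 1 ^ 2 + k 3 ^ 2) (by fun_prop)
      refine ⟨k₀ 1 ^ 2 + k₀ 3 ^ 2, ?_, fun k hk => hmin hk⟩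
      have h1 : ¬ (k₀ 1 = 0 ∧ k₀ 3 = 0) := f.tsupport_subset hk₀
      rcases not_and_or.1 h1 with h2 | h2 <;> positivity
  obtain ⟨κ, hκ, hκe⟩ := exists_smooth_kernel hK (c := lam ^ 4 * c) (by positivity)
  let g : 𝓓(offN, ℂ) := mulCLM (hκ.comp (contDiff_negKThetaSq lam)).contDiffOn f
  refine ⟨incl offN_le g, {k | lam ^ 4 * c < negKThetaSq lam k} ∪ (tsupport f)ᶜ,
    (isOpen_lt continuous_const (contDiff_negKThetaSq lam).continuous).union
      (isClosed_tsupport f).isOpen_compl, fun k hk => ?_, fun k hk => ?_⟩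
  · by_cases h : k ∈ tsupport f
    · left
      rw [eq_shellPt_of_mem_forwardCone hk, Set.mem_ofPred_eq, negKThetaSq_shellPt_zero]
      have := hcb k h
      simp only [perpSq]
      have h4 : 0 < lam ^ 4 := by positivity
      simp
      nlinarith
    · right; exact h
  · simp only [incl_apply, g, mulCLM_apply, Function.comp_apply]
    rcases hk with hk | hk
    · rw [hκe _ (le_of_lt hk)]
    · rw [testFunction_eq_zero f hk]; simp

/-- The product of the mass shell distribution with the kernel off `N`. -/
theorem isProductOffN_shellDelta {K : ℂ → ℂ} (hK : IsKernel K) {lam : ℝ} (hlam : 0 < lam) :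
    IsProductOffN lam shellDelta K (kernelDist lam K ∘L shell₀ shellPair_off) := fun f => by
  refine ⟨exists_product_rep hK hlam f, fun g ⟨U, hU, hcU, hg⟩ => ?_⟩
  rw [shellDelta_apply, ContinuousLinearMap.comp_apply, kernelDist_apply hK hlam]
  congr 1
  ext k
  rw [shell₀_apply]
  by_cases hk : k = 0
  -- The shell point over `k = 0` is not on the forward cone; there both sides vanish, since
  -- division by the zero energy gives zero.
  · subst hk; simp [onShell_eq, energy]
  · rw [onShell_eq, onShell_eq, hg _ (hcU (shellPt_mem_forwardCone hk)), negKThetaSq_shellPt_zero]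
    ring

theorem restrict_comp_shell {L : 𝓓(punctured4, ℂ) → 𝓓(punctured3, ℂ)}
    {L' : 𝓓(offN, ℂ) → 𝓓(offAxis, ℂ)} (hL : ∀ f k, L' f k = L (incl offN_le f) k)
    (T : Dist punctured3) (f : 𝓓(offN, ℂ)) :
    T (L (incl offN_le f)) = restrict (Ω := offAxis) T (L' f) :=
  (restrict_apply offAxis_le T _ _ fun k => (hL f k).symm).symm

/-- The product of a function of `k₀` with a test function of the spatial momentum. -/
def liftTest (b : ℝ → ℂ) (hb : ContDiff ℝ ∞ b) (hbc : HasCompactSupport b) (h : 𝓓(punctured3, ℂ)) :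
    𝓓(punctured4, ℂ) :=
  mkTest (fun k => b (k 0) * h !₂[k 1, k 2, k 3])
    (by
      refine ContDiff.mul (hb.comp (by fun_prop)) (h.contDiff.comp ?_)
      rw [contDiff_euclidean]
      intro i; fin_cases i <;> simp <;> fun_prop)
    ((fun p : ℝ × R3 => (!₂[p.1, p.2 0, p.2 1, p.2 2] : R4)) '' (tsupport b ×ˢ tsupport h))
    ((hbc.isCompact.prod h.hasCompactSupport.isCompact).image (by
      refine (PiLp.continuous_toLp 2 _).comp (continuous_pi fun i => ?_)
      fin_cases i <;> simp <;> fun_prop))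
    (by
      rintro _ ⟨⟨t, k⟩, ⟨-, hk⟩, rfl⟩ h0
      refine h.tsupport_subset hk ?_
      have h0 : (!₂[t, k 0, k 1, k 2] : R4) = 0 := h0
      have h1 := congrArg (fun v : R4 => v 1) h0
      have h2 := congrArg (fun v : R4 => v 2) h0
      have h3 := congrArg (fun v : R4 => v 3) h0
      simp at h1 h2 h3
      change k = 0
      ext i; fin_cases i <;> simp [h1, h2, h3])
    (fun k hk => by
      by_contra hne
      refine hk ⟨(k 0, !₂[k 1, k 2, k 3]), ⟨subset_tsupport _ fun h' => hne ?_,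
        subset_tsupport _ fun h' => hne ?_⟩, ?_⟩
      · simp [show b (k 0) = 0 from h']
      · simp [show h !₂[k 1, k 2, k 3] = 0 from h']
      · ext i; fin_cases i <;> simp)

@[simp] theorem liftTest_apply (b : ℝ → ℂ) (hb : ContDiff ℝ ∞ b) (hbc : HasCompactSupport b)
    (h : 𝓓(punctured3, ℂ)) (k : R4) :
    liftTest b hb hbc h k = b (k 0) * h !₂[k 1, k 2, k 3] := rfl

/-- Every test function is, on the mass shell, `(k₀ - |k|) h`, for a given `h`. -/
theorem exists_shell_preimage (h₀ h₁ : 𝓓(punctured3, ℂ)) : ∃ f : 𝓓(punctured4, ℂ),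
    shell₀ shellPair_punctured f = h₀ ∧ ∃ g, shell₁ shellPair_punctured f = g ∧
      ∃ f', shell₀ shellPair_punctured f' = 0 ∧ shell₁ shellPair_punctured f' = h₁ := by
  have hn : ∀ h : 𝓓(punctured3, ℂ), ∃ b : ℝ → ℂ, ContDiff ℝ ∞ b ∧ HasCompactSupport b ∧
      ∀ k ∈ tsupport h, ∀ᶠ x in 𝓝 ‖k‖, b x = 1 := fun h => by
    obtain ⟨χ, h1, h2, -, -, U, hU, hKU, hχ⟩ := exists_cutoff
      (h.hasCompactSupport.isCompact.image continuous_norm) isOpen_univ (Set.subset_univ _)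
    refine ⟨fun x => (χ x : ℂ), Complex.ofRealCLM.contDiff.comp h1,
      h2.comp_left (g := fun x : ℝ => (x : ℂ)) (by simp), fun k hk => ?_⟩
    filter_upwards [hU.mem_nhds (hKU ⟨k, hk, rfl⟩)] with x hx
    simp [hχ x hx]
  have hw : ∀ n : ℕ, ContDiffOn ℝ ∞ (fun k : R3 => ((‖k‖ : ℝ) : ℂ) ^ n) punctured3 := fun n k hk =>
    ((Complex.ofRealCLM.contDiff.contDiffAt.comp k
      (contDiffAt_norm ℝ hk)).pow n).contDiffWithinAt
  have hvec : ∀ k : R3, (!₂[k 0, k 1, k 2] : R3) = k := fun k => by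
    ext i; fin_cases i <;> simp
  obtain ⟨b, hb, hbc, hb1⟩ := hn h₀
  obtain ⟨b', hb', hbc', hb1'⟩ := hn h₁
  have hid : ContDiff ℝ ∞ fun x : ℝ => (x : ℂ) := Complex.ofRealCLM.contDiff
  -- The first function is `b(k₀) · 2|k| h₀`, which restricts to `h₀`. The second is `b'(k₀) (k₀ -
  -- |k|) (-4|k|² h₁)`, written as a difference of two products: it vanishes on the shell, and only
  -- its `k₀`-derivative contributes to `shell₁`, with value `h₁`.
  refine ⟨liftTest b hb hbc ((2 : ℂ) • mulCLM (hw 1) h₀), ?_, _, rfl,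
    liftTest (fun x => b' x * x) (hb'.mul hid) hbc'.mul_right ((-4 : ℂ) • mulCLM (hw 2) h₁) -
    liftTest b' hb' hbc' ((-4 : ℂ) • mulCLM (hw 3) h₁), ?_, ?_⟩
  · ext k
    rw [shell₀_apply, onShell_eq, energy_zero, liftTest_apply]
    simp only [shellPt, energy_zero]
    simp [hvec]
    by_cases hk : k ∈ tsupport h₀
    · have h0 : ((‖k‖ : ℝ) : ℂ) ≠ 0 := by
        have : k ≠ 0 := h₀.tsupport_subset hk
        exact_mod_cast norm_ne_zero_iff.2 this
      rw [(hb1 k hk).self_of_nhds]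
      field_simp
    · rw [testFunction_eq_zero h₀ hk]; simp
  · ext k
    rw [shell₀_apply, onShell_eq, energy_zero]
    simp only [sub_apply, liftTest_apply]
    simp [shellPt, energy_zero, hvec]
    left; ring
  · ext k
    rw [shell₁_apply']
    by_cases hk : k ∈ tsupport h₁
    · have h0 : ((‖k‖ : ℝ) : ℂ) ≠ 0 := by
        have : k ≠ 0 := h₁.tsupport_subset hk
        exact_mod_cast norm_ne_zero_iff.2 this
      set F := liftTest (fun x => b' x * x) (hb'.mul hid) hbc'.mul_right
        ((-4 : ℂ) • mulCLM (hw 2) h₁) - liftTest b' hb' hbc' ((-4 : ℂ) • mulCLM (hw 3) h₁) with hF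
      have hline : ∀ t : ℝ, F (shellPt 0 k + t • timeDir) =
          b' (‖k‖ + t) * t * (-4 * ((‖k‖ : ℝ) : ℂ) ^ 2 * h₁ k) := fun t => by
        rw [hF]
        simp only [sub_apply, liftTest_apply]
        simp [shellPt, energy_zero, timeDir, hvec]
        ring
      have h1 : HasDerivAt (fun t : ℝ => F (shellPt 0 k + t • timeDir))
          (fderiv ℝ F (shellPt 0 k) timeDir) 0 := by
        have hd : DifferentiableAt ℝ F (shellPt 0 k + (0 : ℝ) • timeDir) :=
          (F.contDiff.differentiable (by simp)).differentiableAt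
        have := hd.hasFDerivAt.comp_hasDerivAt (0 : ℝ)
          (((hasDerivAt_id (0 : ℝ)).smul_const timeDir).const_add (shellPt 0 k))
        simpa [Function.comp_def] using this
      have h2 : HasDerivAt (fun t : ℝ => F (shellPt 0 k + t • timeDir))
          (1 * (-4 * ((‖k‖ : ℝ) : ℂ) ^ 2 * h₁ k)) 0 := by
        have h3 : HasDerivAt (fun t : ℝ => (t : ℂ)) 1 0 := by
          simpa using (hasDerivAt_id (0 : ℝ)).ofReal_comp
        refine (h3.mul_const (-4 * ((‖k‖ : ℝ) : ℂ) ^ 2 * h₁ k)).congr_of_eventuallyEq ?_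
        have h4 : Tendsto (fun t : ℝ => ‖k‖ + t) (𝓝 0) (𝓝 ‖k‖) := by
          have : Continuous fun t : ℝ => ‖k‖ + t := by fun_prop
          simpa using this.tendsto 0
        filter_upwards [h4.eventually (hb1' k hk)] with t ht
        rw [hline, ht, one_mul]
      rw [h1.unique h2]
      have h5 : F (shellPt 0 k) = 0 := by simpa using hline 0
      rw [h5]
      field_simp
      ring
    · have hz : ∀ᶠ x in 𝓝 (shellPt 0 k), (liftTest (fun x => b' x * x) (hb'.mul hid)
          hbc'.mul_right ((-4 : ℂ) • mulCLM (hw 2) h₁) - liftTest b' hb' hbc'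
            ((-4 : ℂ) • mulCLM (hw 3) h₁)) x = 0 := by
        have hc : Continuous fun x : R4 => (!₂[x 1, x 2, x 3] : R3) := by
          refine (PiLp.continuous_toLp 2 _).comp (continuous_pi fun i => ?_)
          fin_cases i <;> simp <;> fun_prop
        have : (fun x : R4 => (!₂[x 1, x 2, x 3] : R3)) ⁻¹' (tsupport h₁)ᶜ ∈ 𝓝 (shellPt 0 k) := by
          refine ((isClosed_tsupport h₁).isOpen_compl.preimage hc).mem_nhds ?_
          simpa [shellPt, hvec] using hk
        filter_upwards [this] with x hx
        simp only [sub_apply, liftTest_apply]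
        simp [testFunction_eq_zero h₁ hx]
      have hz' := EventuallyEq.fderiv_eq (𝕜 := ℝ) (f := fun _ => (0 : ℂ)) hz
      rw [hz', hz.self_of_nhds, testFunction_eq_zero h₁ hk]
      simp

/-! ### Reduction to ℝ³ and extension of the products -/

theorem reducesTo_comp {Ω₄ : Opens R4} {Ω₃ : Opens R3} (h : ShellPair Ω₄ Ω₃) (T : Dist Ω₃) :
    ReducesTo (T ∘L shell₀ h) T := fun f => ⟨shell₀ h f, shell₀_apply h f, rfl⟩

theorem ReducesTo.apply {Ω₄ : Opens R4} {Ω₃ : Opens R3} (h : ShellPair Ω₄ Ω₃) {P : Dist Ω₄}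
    {T : Dist Ω₃} (hP : ReducesTo P T) (f : 𝓓(Ω₄, ℂ)) : P f = T (shell₀ h f) := by
  obtain ⟨f₀, h1, h2⟩ := hP f
  rw [h2]; congr 1; ext k; rw [h1, shell₀_apply]

theorem reducesTo₂_comp {Ω₄ : Opens R4} {Ω₃ : Opens R3} (h : ShellPair Ω₄ Ω₃) (A B : Dist Ω₃) :
    ReducesTo₂ (A ∘L shell₀ h + B ∘L shell₁ h) A B := fun f =>
  ⟨shell₀ h f, shell₁ h f, shell₀_apply h f, fun k => by
    rw [shell₁_apply, (deriv_onShell h.le₄ f k).deriv], rfl⟩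

theorem ReducesTo₂.apply {Ω₄ : Opens R4} {Ω₃ : Opens R3} (h : ShellPair Ω₄ Ω₃) {P : Dist Ω₄}
    {A B : Dist Ω₃} (hP : ReducesTo₂ P A B) (f : 𝓓(Ω₄, ℂ)) :
    P f = A (shell₀ h f) + B (shell₁ h f) := by
  obtain ⟨f₀, f₁, h1, h1', h2⟩ := hP f
  rw [h2]
  congr 2
  · ext k; rw [h1, shell₀_apply]
  · ext k; rw [h1', shell₁_apply, (deriv_onShell h.le₄ f k).deriv]

theorem ReducesTo.unique {T T' : Dist punctured3} {P : Dist punctured4} (h : ReducesTo P T)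
    (h' : ReducesTo P T') : T = T' := by
  ext g
  obtain ⟨f, hf, -⟩ := exists_shell_preimage g 0
  rw [← hf, ← h.apply shellPair_punctured, ← h'.apply shellPair_punctured]

/-- Test functions that vanish on the shell but have arbitrary `f̃₁` determine `B`; once `B` is
known, surjectivity of `f ↦ f̃₀` determines `A`. -/
theorem ReducesTo₂.unique {A B A' B' : Dist punctured3} {P : Dist punctured4}
    (h : ReducesTo₂ P A B) (h' : ReducesTo₂ P A' B') : A = A' ∧ B = B' := by
  have e : ∀ f, A (shell₀ shellPair_punctured f) + B (shell₁ shellPair_punctured f) =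
      A' (shell₀ shellPair_punctured f) + B' (shell₁ shellPair_punctured f) := fun f => by
    rw [← h.apply shellPair_punctured, ← h'.apply shellPair_punctured]
  have hB : B = B' := by
    ext g
    obtain ⟨-, -, -, -, f, hf, hf'⟩ := exists_shell_preimage 0 g
    simpa [hf, hf'] using e f
  subst hB
  refine ⟨?_, rfl⟩
  ext g
  obtain ⟨f, hf, -⟩ := exists_shell_preimage g 0
  simpa [hf] using e f

theorem exists_extension_product {lam : ℝ} {K : ℂ → ℂ} (T : Dist punctured3)
    (hT : restrict T = kernelDist lam K) :
    ∃ P' : Dist punctured4, restrict P' = kernelDist lam K ∘L shell₀ shellPair_off ∧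
      ReducesTo P' T := by
  refine ⟨T ∘L shell₀ shellPair_punctured, ?_, reducesTo_comp _ T⟩
  ext f
  rw [restrict_apply' offN_le, ContinuousLinearMap.comp_apply, ContinuousLinearMap.comp_apply,
    ← hT]
  exact restrict_comp_shell (fun f k => by rw [shell₀_apply, shell₀_apply]; rfl) T f

theorem exists_extension_product₂ {A B : Dist punctured3} {A₀ B₀ : Dist offAxis}
    (hA : restrict A = A₀) (hB : restrict B = B₀) :
    ∃ P' : Dist punctured4, restrict P' = A₀ ∘L shell₀ shellPair_off + B₀ ∘L shell₁ shellPair_off ∧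
      ReducesTo₂ P' A B := by
  refine ⟨A ∘L shell₀ shellPair_punctured + B ∘L shell₁ shellPair_punctured, ?_,
    reducesTo₂_comp _ A B⟩
  ext f
  rw [restrict_apply' offN_le, add_apply, add_apply, ContinuousLinearMap.comp_apply,
    ContinuousLinearMap.comp_apply, ContinuousLinearMap.comp_apply, ContinuousLinearMap.comp_apply,
    ← hA, ← hB]
  congr 1
  · exact restrict_comp_shell (fun f k => by rw [shell₀_apply, shell₀_apply]; rfl) A f
  · exact restrict_comp_shell (fun f k => by rw [shell₁_apply, shell₁_apply]; rfl) B f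

theorem isKernel_pow {n : ℕ} (hn : 1 ≤ n) : IsKernel (powKernel n) := Or.inr ⟨n, hn, rfl⟩

/-- The product of the derivative of the mass shell distribution with `x⁻²` off `N`. -/
theorem isProductOffN_shellDeltaPrime {lam : ℝ} (hlam : 0 < lam) :
    IsProductOffN lam shellDeltaPrime (powKernel 2)
      (((2 * lam ^ 4 : ℂ) • kernelDist lam (powKernel 3)) ∘L shell₀ shellPair_off +
        kernelDist lam (powKernel 2) ∘L shell₁ shellPair_off) := fun f => by
  have hK2 : IsKernel (powKernel 2) := isKernel_pow (by norm_num)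
  have hK3 : IsKernel (powKernel 3) := isKernel_pow (by norm_num)
  refine ⟨exists_product_rep hK2 hlam f, fun g ⟨U, hU, hcU, hg⟩ => ?_⟩
  rw [shellDeltaPrime_apply, add_apply, ContinuousLinearMap.comp_apply,
    ContinuousLinearMap.comp_apply, smul_apply, kernelDist_apply hK3 hlam,
    kernelDist_apply hK2 hlam, smul_eq_mul, ← integral_const_mul, ← integral_add]
  rotate_left
  · exact (integrable_mul_test (kernel_locallyIntegrableOn hK3 hlam) _).const_mul _
  · exact integrable_mul_test (kernel_locallyIntegrableOn hK2 hlam) _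
  congr 1
  ext k
  rw [shell₀_apply, shell₁_apply]
  have hdg := deriv_onShell le_rfl g k
  have hdf := deriv_onShell offN_le f k
  by_cases hk0 : k = 0
  · subst hk0
    simp [onShellDeriv, energy, onShell_eq]
  have hkn : 0 < ‖k‖ ^ 2 := by have := norm_pos_iff.2 hk0; positivity
  -- On the shell `k² = s` the argument of the kernel is `λ⁴(2|k_⊥|² + s)`. Its inverse square has
  -- `s`-derivative `-2λ⁴` times the inverse cube; with the sign in the definition of `δ'` this is
  -- the term `2λ⁴ x⁻³`.
  have hgs : ∀ᶠ s in 𝓝 (0 : ℝ), onShell g s k =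
      powKernel 2 ((lam ^ 4 * (2 * perpSq k + s) : ℝ) : ℂ) * onShell f s k := by
    have hc : ContinuousAt (fun s => shellPt s k) 0 :=
      (hasDerivAt_shellPt (by simpa using hkn)).continuousAt
    filter_upwards [hc.preimage_mem_nhds (hU.mem_nhds (hcU (shellPt_mem_forwardCone hk0))),
      Ioi_mem_nhds (by linarith : -‖k‖ ^ 2 < 0)] with s hs hs'
    rw [onShell_eq, onShell_eq, hg _ hs, negKThetaSq_shellPt lam (by
      have : -‖k‖ ^ 2 < s := hs'
      linarith)]
    ring
  -- Over the axis every shell point lies in `N`, where `f` vanishes; this case is separate because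
  -- the kernel cannot be differentiated there.
  by_cases hk : perpSq k = 0
  · have hf0 : ∀ s, onShell f s k = 0 := fun s => by
      have : shellPt s k ∉ tsupport f := fun h => f.tsupport_subset h (by
        have h : k 0 ^ 2 + k 2 ^ 2 = 0 := hk
        have h0 : k 0 = 0 := by nlinarith [sq_nonneg (k 0), sq_nonneg (k 2)]
        have h2 : k 2 = 0 := by nlinarith [sq_nonneg (k 0), sq_nonneg (k 2)]
        simp [planeN, shellPt, h0, h2])
      rw [onShell_eq, testFunction_eq_zero f this, zero_div]
    have h1 : onShellDeriv g 0 k = 0 := hdg.unique ((hasDerivAt_const 0 (0 : ℂ)).congr_of_eventuallyEq (by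
      filter_upwards [hgs] with s hs
      rw [hs, hf0, mul_zero]))
    have h2 : onShellDeriv f 0 k = 0 := hdf.unique ((hasDerivAt_const 0 (0 : ℂ)).congr_of_eventuallyEq
      (Eventually.of_forall hf0))
    rw [h1, h2, hf0]; simp
  · have hx : ((2 * lam ^ 4 * perpSq k : ℝ) : ℂ) ≠ 0 := by
      exact_mod_cast (by positivity : 2 * lam ^ 4 * perpSq k ≠ 0)
    have h1 : HasDerivAt (fun s : ℝ => ((lam ^ 4 * (2 * perpSq k + s) : ℝ) : ℂ))
        ((lam ^ 4 : ℝ) : ℂ) 0 := by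
      refine HasDerivAt.ofReal_comp ?_
      simpa using ((hasDerivAt_id (0 : ℝ)).const_add (2 * perpSq k)).const_mul (lam ^ 4)
    have hx' : ((lam ^ 4 * (2 * perpSq k + 0) : ℝ) : ℂ) ≠ 0 := by
      rw [show lam ^ 4 * (2 * perpSq k + 0) = 2 * lam ^ 4 * perpSq k by ring]; exact hx
    have h2 := ((h1.pow 2).inv (pow_ne_zero 2 hx')).mul hdf
    have h3 := hdg.unique (h2.congr_of_eventuallyEq hgs)
    rw [h3]
    simp only [powKernel, Pi.pow_apply, Pi.inv_apply]
    rw [show lam ^ 4 * (2 * perpSq k + 0) = 2 * lam ^ 4 * perpSq k by ring]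
    have hl : (lam : ℂ) ≠ 0 := by exact_mod_cast hlam.ne'
    have hp : (perpSq k : ℂ) ≠ 0 := by exact_mod_cast hk
    push_cast
    field_simp
    ring

/-! ### Distributions supported on coordinate subspaces -/

/-- Induction on the order by differentiating under the integral. The target space is quantified
inside the induction because the derivative takes values in `E →L[ℝ] F`. -/
theorem contDiff_parametric_intervalIntegral_aux {E : Type} [NormedAddCommGroup E]
    [NormedSpace ℝ E] [FiniteDimensional ℝ E] (n : ℕ) :
    ∀ {F : Type} [NormedAddCommGroup F] [NormedSpace ℝ F] [CompleteSpace F] (g : E → ℝ → F),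
      ContDiff ℝ ∞ (fun p : E × ℝ => g p.1 p.2) →
        ContDiff ℝ n fun x => ∫ t in (0 : ℝ)..1, g x t := by
  induction n with
  | zero =>
    intro F _ _ _ g hg
    exact contDiff_zero.2
      (intervalIntegral.continuous_parametric_intervalIntegral_of_continuous' hg.continuous 0 1)
  | succ n ih =>
    intro F _ _ _ g hg
    let g' : E → ℝ → (E →L[ℝ] F) := fun x t =>
      (fderiv ℝ (fun p : E × ℝ => g p.1 p.2) (x, t)).comp (ContinuousLinearMap.inl ℝ E ℝ)
    have hg' : ContDiff ℝ ∞ (fun p : E × ℝ => g' p.1 p.2) :=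
      (hg.fderiv_right (m := ∞) (by simp)).clm_comp contDiff_const
    have hd : ∀ x t, HasFDerivAt (fun x => g x t) (g' x t) x := fun x t => by
      have h1 : HasFDerivAt (fun p : E × ℝ => g p.1 p.2) _ (x, t) :=
        (hg.differentiable (by simp)).differentiableAt.hasFDerivAt
      exact HasFDerivAt.comp x (f := fun e : E => (e, t)) h1 (hasFDerivAt_prodMk_left x t)
    have key : ∀ x, HasFDerivAt (fun x => ∫ t in (0 : ℝ)..1, g x t)
        (∫ t in (0 : ℝ)..1, g' x t) x := fun x => by
      obtain ⟨C, hC⟩ := ((isCompact_closedBall x 1).prod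
        (isCompact_Icc (a := (0 : ℝ)) (b := 1))).exists_bound_of_continuousOn
        hg'.continuous.continuousOn
      have hcont : ∀ y, Continuous (g y) := fun y =>
        hg.continuous.comp (by fun_prop : Continuous fun t : ℝ => (y, t))
      have hcont' : Continuous (g' x) := 
        hg'.continuous.comp (by fun_prop : Continuous fun t : ℝ => (x, t))
      refine (intervalIntegral.hasFDerivAt_integral_of_dominated_of_fderiv_le
        (s := Metric.ball x 1) (bound := fun _ => C) (F' := g')
        (Metric.ball_mem_nhds x one_pos)
        (Eventually.of_forall fun y => (hcont y).aestronglyMeasurable)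
        ((hcont x).intervalIntegrable _ _) hcont'.aestronglyMeasurable ?_ (by simp) ?_)
      · refine Eventually.of_forall fun t ht y hy => hC (y, t) ⟨Metric.ball_subset_closedBall hy, ?_⟩
        rw [Set.uIoc_of_le zero_le_one] at ht
        exact ⟨ht.1.le, ht.2⟩
      · exact Eventually.of_forall fun t _ y _ => hd y t
    have hfd : fderiv ℝ (fun x => ∫ t in (0 : ℝ)..1, g x t) = fun x => ∫ t in (0 : ℝ)..1, g' x t :=
      funext fun x => (key x).fderiv
    push_cast
    rw [contDiff_succ_iff_fderiv]
    refine ⟨fun x => (key x).differentiableAt, by simp, ?_⟩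
    rw [hfd]
    exact ih g' hg'

theorem contDiff_parametric_intervalIntegral {E : Type} [NormedAddCommGroup E]
    [NormedSpace ℝ E] [FiniteDimensional ℝ E] {F : Type} [NormedAddCommGroup F] [NormedSpace ℝ F]
    [CompleteSpace F] (g : E → ℝ → F) (hg : ContDiff ℝ ∞ (fun p : E × ℝ => g p.1 p.2)) :
    ContDiff ℝ ∞ fun x => ∫ t in (0 : ℝ)..1, g x t :=
  contDiff_infty.2 fun n => contDiff_parametric_intervalIntegral_aux n g hg

/-- The projection onto the coordinates in `I`. -/
def coordProj (I : Finset (Fin 3)) : R3 →L[ℝ] R3 :=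
  ∑ i ∈ I, (EuclideanSpace.proj i : R3 →L[ℝ] ℝ).smulRight (EuclideanSpace.single i (1 : ℝ))

theorem coordProj_eq (I : Finset (Fin 3)) (k : R3) :
    coordProj I k = ∑ i ∈ I, k i • (EuclideanSpace.single i 1 : R3) := by
  simp [coordProj]

theorem coordProj_apply (I : Finset (Fin 3)) (k : R3) (j : Fin 3) :
    coordProj I k j = if j ∈ I then k j else 0 := by
  rw [coordProj_eq]
  simp [Finset.sum_apply, Pi.single_apply]

/-- Fundamental theorem of calculus along the segment from `k - coordProj I k` to `k`. It is used
with `I = {0, 2}` for the axis and with all coordinates for the origin. -/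
theorem hadamard (I : Finset (Fin 3)) (h : R3 → ℂ) (hh : ContDiff ℝ ∞ h) :
    ∃ h' : Fin 3 → R3 → ℂ, (∀ i, ContDiff ℝ ∞ (h' i)) ∧
      ∀ k, h k = h (k - coordProj I k) + ∑ i ∈ I, (k i : ℂ) * h' i k := by
  have hfd : ContDiff ℝ ∞ (fderiv ℝ h) := hh.fderiv_right (by simp)
  have hG : ∀ i : Fin 3, ContDiff ℝ ∞ (fun p : R3 × ℝ =>
      fderiv ℝ h (p.1 - coordProj I p.1 + p.2 • coordProj I p.1) (EuclideanSpace.single i 1)) :=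
    fun i => by
    have : ContDiff ℝ ∞ fun p : R3 × ℝ => p.1 - coordProj I p.1 + p.2 • coordProj I p.1 := by
      fun_prop
    exact (hfd.comp this).clm_apply contDiff_const
  refine ⟨fun i k => ∫ t in (0 : ℝ)..1,
    fderiv ℝ h (k - coordProj I k + t • coordProj I k) (EuclideanSpace.single i 1),
    fun i => contDiff_parametric_intervalIntegral _ (hG i), fun k => ?_⟩
  have h1 : ∀ t ∈ Set.uIcc (0 : ℝ) 1, HasDerivAt
      (fun t : ℝ => h (k - coordProj I k + t • coordProj I k))
      (∑ i ∈ I, (k i : ℂ) * fderiv ℝ h (k - coordProj I k + t • coordProj I k)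
        (EuclideanSpace.single i 1)) t := fun t _ => by
    have h2 : HasDerivAt (fun t : ℝ => k - coordProj I k + t • coordProj I k) (coordProj I k) t := by
      simpa using ((hasDerivAt_id t).smul_const (coordProj I k)).const_add (k - coordProj I k)
    have h3 := ((hh.differentiable (by simp)).differentiableAt
      (x := k - coordProj I k + t • coordProj I k)).hasFDerivAt.comp_hasDerivAt t h2
    refine h3.congr_deriv ?_
    conv_lhs => rw [coordProj_eq I k]
    rw [map_sum]
    refine Finset.sum_congr rfl fun i _ => ?_
    rw [map_smul, Complex.real_smul, coordProj_eq]
  have hc : ∀ i, Continuous fun t : ℝ => (k i : ℂ) *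
      fderiv ℝ h (k - coordProj I k + t • coordProj I k) (EuclideanSpace.single i 1) := fun i =>
    continuous_const.mul ((hG i).continuous.comp (by fun_prop : Continuous fun t : ℝ => (k, t)))
  have h4 := intervalIntegral.integral_eq_sub_of_hasDerivAt h1
    ((continuous_finsetSum _ fun i _ => hc i).intervalIntegrable 0 1)
  rw [intervalIntegral.integral_finsetSum fun i _ => (hc i).intervalIntegrable 0 1] at h4
  simp only [intervalIntegral.integral_const_mul, one_smul, sub_add_cancel, zero_smul,
    add_zero] at h4
  rw [h4]; ring

/-- The monomial `k ^ α`. -/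
def mono (α : Fin 3 → ℕ) (k : R3) : ℂ := ∏ i, (k i : ℂ) ^ α i

theorem contDiff_mono (α : Fin 3 → ℕ) : ContDiff ℝ ∞ (mono α) := by
  unfold mono
  refine contDiff_prod fun i _ => ContDiff.pow ?_ _
  exact Complex.ofRealCLM.contDiff.comp (by fun_prop)

theorem mono_add_single (α : Fin 3 → ℕ) (i : Fin 3) (k : R3) :
    mono (α + Pi.single i 1) k = (k i : ℂ) * mono α k := by
  simp only [mono, Pi.add_apply, pow_add, Finset.prod_mul_distrib]
  rw [mul_comm]
  congr 1
  rw [Finset.prod_eq_single i]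
  · simp
  · intro j _ hj; simp [hj]
  · simp

theorem mono_smul_proj {I : Finset (Fin 3)} {α : Fin 3 → ℕ} (hα : ∀ i, i ∉ I → α i = 0) {ε : ℝ}
    (hε : ε ≠ 0) (k : R3) :
    mono α k = (ε : ℂ) ^ (∑ i, α i) * mono α (ε⁻¹ • coordProj I k) := by
  have hc : (ε : ℂ) ≠ 0 := by exact_mod_cast hε
  rw [mono, mono, ← Finset.prod_pow_eq_pow_sum, ← Finset.prod_mul_distrib]
  refine Finset.prod_congr rfl fun i _ => ?_
  by_cases hi : i ∈ I
  · rw [PiLp.smul_apply, coordProj_apply, if_pos hi, ← mul_pow]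
    congr 1
    simp [hc]
  · simp [hα i hi]

/-- A distribution that vanishes on test functions vanishing near `{coordProj I k = 0}`. -/
def VanishesOff {Ω : Opens R3} (I : Finset (Fin 3)) (D : Dist Ω) : Prop :=
  ∀ f : 𝓓(Ω, ℂ), (∃ U : Set R3, IsOpen U ∧ (∀ k, coordProj I k = 0 → k ∈ U) ∧ ∀ k ∈ U, f k = 0) →
    D f = 0

/-- Near the subspace `k^α` may be replaced by `χ(Pk/ε) k^α`, with `P` the projection. The
derivatives of the latter up to the order `N` of `D` on the support of `ψ` are `O(ε^{|α| - N})`, and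
`|α| > N`; let `ε → 0`. -/
theorem VanishesOff.high_order {Ω : Opens R3} {I : Finset (Fin 3)} {D : Dist Ω}
    (hD : VanishesOff I D) (ψ : 𝓓(Ω, ℂ)) : ∃ N : ℕ, ∀ α : Fin 3 → ℕ, (∀ i, i ∉ I → α i = 0) →
      N < ∑ i, α i → ∀ (h : R3 → ℂ) (hh : ContDiff ℝ ∞ h),
        D (mulCLM ((contDiff_mono α).mul hh).contDiffOn ψ) = 0 := by
  obtain ⟨N, C, hC, hb⟩ := exists_order_bound D (tsupport ψ) ψ.hasCompactSupport ψ.tsupport_subset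
  refine ⟨N, fun α hα hαN h hh => ?_⟩
  let χ : ContDiffBump (0 : R3) := ⟨1, 2, one_pos, one_lt_two⟩
  let η : R3 → ℂ := fun k => (χ k : ℂ) * mono α k
  have hχ : ContDiff ℝ ∞ fun k => (χ k : ℂ) := Complex.ofRealCLM.contDiff.comp χ.contDiff
  have hη : ContDiff ℝ ∞ η := hχ.mul (contDiff_mono α)
  have hηc : HasCompactSupport η :=
    (χ.hasCompactSupport.comp_left (g := fun x : ℝ => (x : ℂ)) (by simp)).mul_right
  let w : 𝓓(Ω, ℂ) := mulCLM hh.contDiffOn ψ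
  have hwb : ∀ i, ∃ B, ∀ x, ‖iteratedFDeriv ℝ i w x‖ ≤ B := fun i =>
    (w.hasCompactSupport.iteratedFDeriv i).exists_bound_of_continuous
      (w.contDiff.continuous_iteratedFDeriv (natCast_le_infty i))
  have hηb : ∀ i, ∃ B, ∀ x, ‖iteratedFDeriv ℝ i η x‖ ≤ B := fun i =>
    (hηc.iteratedFDeriv i).exists_bound_of_continuous
      (hη.continuous_iteratedFDeriv (natCast_le_infty i))
  choose A hA using hwb
  choose B hB using hηb
  have hA0 : ∀ i, 0 ≤ A i := fun i => (norm_nonneg _).trans (hA i 0)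
  have hB0 : ∀ i, 0 ≤ B i := fun i => (norm_nonneg _).trans (hB i 0)
  set P := ‖coordProj I‖ with hP
  let M : ℝ := ∑ n ∈ Finset.range (N + 1), ∑ i ∈ Finset.range (n + 1),
    (n.choose i : ℝ) * A i * (B (n - i) * P ^ (n - i))
  have hM0 : 0 ≤ M := Finset.sum_nonneg fun n _ => Finset.sum_nonneg fun i _ => by
    have := hA0 i; have := hB0 (n - i); positivity
  have key : ∀ ε : ℝ, 0 < ε → ε ≤ 1 →
      ‖D (mulCLM ((contDiff_mono α).mul hh).contDiffOn ψ)‖ ≤ C * (ε * M) := by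
    intro ε hε hε1
    have hLs : ContDiff ℝ ∞ (η ∘ (ε⁻¹ • coordProj I)) := hη.comp (ContinuousLinearMap.contDiff _)
    let f : 𝓓(Ω, ℂ) := ((ε : ℂ) ^ (∑ i, α i)) • mulCLM hLs.contDiffOn w
    have h1 : D (mulCLM ((contDiff_mono α).mul hh).contDiffOn ψ) = D f := by
      rw [← sub_eq_zero, ← map_sub]
      -- On this neighbourhood of the subspace the cutoff is one, so the two functions agree there.
      refine hD _ ⟨{k | ‖ε⁻¹ • coordProj I k‖ < 1}, isOpen_lt (by fun_prop) continuous_const,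
        fun k hk => ?_, fun k hk => ?_⟩
      · change ‖ε⁻¹ • coordProj I k‖ < 1
        rw [hk]; simp
      · have h2 : χ (ε⁻¹ • coordProj I k) = 1 := χ.one_of_mem_closedBall (by
          have hk : ‖ε⁻¹ • coordProj I k‖ < 1 := hk
          simpa using hk.le)
        have h3 : η (ε⁻¹ • coordProj I k) = mono α (ε⁻¹ • coordProj I k) := by
          simp only [η, h2]; simp
        have e1 : f k = (ε : ℂ) ^ (∑ i, α i) * (η (ε⁻¹ • coordProj I k) * (h k * ψ k)) := by
          simp only [f, w, smul_apply, mulCLM_apply, smul_eq_mul]; rfl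
        have e2 : mulCLM ((contDiff_mono α).mul hh).contDiffOn ψ k = mono α k * h k * ψ k := by
          simp
        rw [sub_apply, e2, e1, h3, mono_smul_proj hα hε.ne' k]
        ring
    rw [h1]
    refine hb f (fun x hx => ?_) (ε * M) (by positivity) fun n hn x _ => ?_
    · simp [f, w, testFunction_eq_zero ψ hx]
    have h4 : (f : R3 → ℂ) = fun x => w x * (((ε : ℂ) ^ (∑ i, α i)) •
        (η ∘ (ε⁻¹ • coordProj I))) x := by
      funext x
      simp only [f, smul_apply, mulCLM_apply, smul_eq_mul, Pi.smul_apply]; ring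
    rw [h4]
    refine (norm_iteratedFDeriv_mul_le w.contDiff (contDiff_const.smul hLs : ContDiff ℝ ∞ _) x
      (natCast_le_infty n)).trans ?_
    have h5 : ∀ i ∈ Finset.range (n + 1), (n.choose i : ℝ) * ‖iteratedFDeriv ℝ i w x‖ *
        ‖iteratedFDeriv ℝ (n - i) (((ε : ℂ) ^ (∑ i, α i)) • (η ∘ (ε⁻¹ • coordProj I))) x‖ ≤
        ε * ((n.choose i : ℝ) * A i * (B (n - i) * P ^ (n - i))) := fun i hi => by
      rw [iteratedFDeriv_const_smul_apply (hLs.contDiffAt.of_le (natCast_le_infty _)),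
        ContinuousLinearMap.iteratedFDeriv_comp_right _ hη _ (natCast_le_infty _), norm_smul]
      have h6 := ContinuousMultilinearMap.norm_compContinuousLinearMap_le
        (iteratedFDeriv ℝ (n - i) η ((ε⁻¹ • coordProj I) x))
        (fun _ : Fin (n - i) => ε⁻¹ • coordProj I)
      rw [Finset.prod_const, Finset.card_univ, Fintype.card_fin, norm_smul, norm_inv,
        Real.norm_of_nonneg hε.le, ← hP] at h6
      have h7 : ‖(ε : ℂ) ^ (∑ i, α i)‖ = ε ^ (∑ i, α i) := by
        rw [norm_pow, Complex.norm_real, Real.norm_of_nonneg hε.le]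
      rw [h7]
      -- Each of the at most `N` derivatives costs one factor `ε⁻¹`; the monomial supplies at least
      -- `N + 1` factors `ε`, so one is left over.
      have h8 : ε ^ (∑ i, α i) * (ε⁻¹ * P) ^ (n - i) ≤ ε * P ^ (n - i) := by
        rw [mul_pow, ← mul_assoc]
        gcongr
        have h9 : ∑ i, α i = (∑ i, α i - (n - i)) + (n - i) := by omega
        rw [h9, pow_add, mul_assoc, ← mul_pow, mul_inv_cancel₀ hε.ne', one_pow, mul_one]
        exact pow_le_of_le_one hε.le hε1 (by omega)
      calc _ ≤ (n.choose i : ℝ) * A i * (ε ^ (∑ i, α i) * (B (n - i) * (ε⁻¹ * P) ^ (n - i))) := by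
            have := hA0 i
            gcongr
            · exact hA i x
            · exact h6.trans (by gcongr; exact hB _ _)
        _ = (n.choose i : ℝ) * A i * B (n - i) * (ε ^ (∑ i, α i) * (ε⁻¹ * P) ^ (n - i)) := by ring
        _ ≤ (n.choose i : ℝ) * A i * B (n - i) * (ε * P ^ (n - i)) := by
            have := hA0 i; have := hB0 (n - i)
            gcongr
        _ = _ := by ring
    refine (Finset.sum_le_sum h5).trans ?_
    rw [← Finset.mul_sum]
    refine mul_le_mul_of_nonneg_left ?_ hε.le
    exact Finset.single_le_sum (f := fun n => ∑ i ∈ Finset.range (n + 1),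
      (n.choose i : ℝ) * A i * (B (n - i) * P ^ (n - i)))
      (fun n _ => Finset.sum_nonneg fun i _ => by
        have := hA0 i; have := hB0 (n - i); positivity) (Finset.mem_range.2 (by omega))
  have hlim : Tendsto (fun ε : ℝ => C * (ε * M)) (𝓝[>] 0) (𝓝 0) := by
    have : Tendsto (fun ε : ℝ => C * (ε * M)) (𝓝 0) (𝓝 (C * (0 * M))) := by
      exact (continuous_const.mul (continuous_id.mul continuous_const)).tendsto 0
    rw [zero_mul, mul_zero] at this
    exact this.mono_left nhdsWithin_le_nhds
  have h0 := ge_of_tendsto hlim (b := ‖D (mulCLM ((contDiff_mono α).mul hh).contDiffOn ψ)‖) (by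
    filter_upwards [Ioc_mem_nhdsGT one_pos] with ε hε using key ε hε.1 hε.2)
  exact norm_le_zero_iff.1 h0

/-- A distribution supported on a coordinate subspace vanishes on multiples of `ψ` if it does so
on products of monomials in the transversal and functions of the remaining coordinates. -/
theorem VanishesOff.eq_zero {Ω : Opens R3} {I : Finset (Fin 3)} {D : Dist Ω}
    (hD : VanishesOff I D) (ψ : 𝓓(Ω, ℂ))
    (hprod : ∀ α : Fin 3 → ℕ, (∀ i, i ∉ I → α i = 0) → ∀ h : R3 → ℂ, ContDiff ℝ ∞ h →
      ∀ f : 𝓓(Ω, ℂ), (∀ k, f k = mono α k * h (k - coordProj I k) * ψ k) → D f = 0)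
    (h : R3 → ℂ) (hh : ContDiff ℝ ∞ h) : D (mulCLM hh.contDiffOn ψ) = 0 := by
  obtain ⟨N, hN⟩ := hD.high_order ψ
  -- Induction on the number `m` of degrees missing to exceed `N`. Hadamard's formula splits off the
  -- value on the subspace, handled by `hprod`, and the remainder has a monomial of one degree more.
  have key : ∀ m l : ℕ, N + 1 ≤ l + m → ∀ α : Fin 3 → ℕ, (∀ i, i ∉ I → α i = 0) → ∑ i, α i = l →
      ∀ (h : R3 → ℂ) (hh : ContDiff ℝ ∞ h),
        D (mulCLM ((contDiff_mono α).mul hh).contDiffOn ψ) = 0 := by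
    intro m
    induction m with
    | zero => exact fun l hl α hα hαl h hh => hN α hα (by omega) h hh
    | succ m ih =>
      intro l hl α hα hαl h hh
      obtain ⟨h', hh', he⟩ := hadamard I h hh
      have hh0 : ContDiff ℝ ∞ fun k => h (k - coordProj I k) := hh.comp (by fun_prop)
      have e : mulCLM ((contDiff_mono α).mul hh).contDiffOn ψ =
          mulCLM ((contDiff_mono α).mul hh0).contDiffOn ψ +
          ∑ i ∈ I, mulCLM ((contDiff_mono (α + Pi.single i 1)).mul (hh' i)).contDiffOn ψ := by
        ext k
        rw [add_apply, sum_apply]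
        simp only [mulCLM_apply, mono_add_single]
        rw [he k, mul_add, add_mul, Finset.mul_sum, Finset.sum_mul]
        congr 1
        exact Finset.sum_congr rfl fun i _ => by ring
      rw [e, map_add, map_sum, hprod α hα h hh _ (fun k => by simp), zero_add]
      refine Finset.sum_eq_zero fun i hi => ih (l + 1) (by omega) _ (fun j hj => ?_) ?_ _ (hh' i)
      · have : j ≠ i := fun h => hj (h ▸ hi)
        simp [hα j hj, this]
      · simp [Finset.sum_add_distrib, hαl]
  have h0 := key (N + 1) 0 (by omega) 0 (fun _ _ => rfl) (by simp) h hh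
  rw [← h0]
  congr 1
  ext k
  simp [mono]

/-! ### Scaling degrees -/

section ScalingDegree

variable {E : Type*} [NormedAddCommGroup E] [NormedSpace ℝ E] {Ω : Opens E}

/-- The exponents `a` with `μ ^ a T_μ → 0`. -/
def decaySet (d : ℕ) (scale : Set.Ioi (0 : ℝ) → 𝓓(Ω, ℂ) → 𝓓(Ω, ℂ)) (V : Set E) (T : Dist Ω) :
    Set ℝ :=
  {a : ℝ | ∀ f : 𝓓(Ω, ℂ), tsupport f ⊆ V →
    Tendsto (fun μ : Set.Ioi (0 : ℝ) => ((((μ : ℝ) ^ a / (μ : ℝ) ^ d : ℝ) : ℂ) * T (scale μ f)))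
      (comap Subtype.val (𝓝 (0 : ℝ))) (𝓝 0)}

variable {d : ℕ} {scale : Set.Ioi (0 : ℝ) → 𝓓(Ω, ℂ) → 𝓓(Ω, ℂ)} {V : Set E} {T : Dist Ω}

theorem scalingDegree_eq :
    scalingDegree d scale V T = sInf ((fun a : ℝ => (a : EReal)) '' decaySet d scale V T) := rfl

theorem scalingDegree_le_of_forall {x : ℝ} (h : ∀ a, x < a → a ∈ decaySet d scale V T) :
    scalingDegree d scale V T ≤ x := by
  rw [scalingDegree_eq]
  refine EReal.le_of_forall_lt_iff_le.1 fun a ha => sInf_le ⟨a, h a (by exact_mod_cast ha), rfl⟩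

theorem le_scalingDegree_of_forall {x : ℝ} (h : ∀ a ∈ decaySet d scale V T, x ≤ a) :
    (x : EReal) ≤ scalingDegree d scale V T := by
  rw [scalingDegree_eq]
  refine le_sInf ?_
  rintro _ ⟨a, ha, rfl⟩
  exact EReal.coe_le_coe_iff.2 (h a ha)

theorem exists_mem_decaySet {x y : ℝ} (h : scalingDegree d scale V T ≤ x) (hxy : x < y) :
    ∃ a ∈ decaySet d scale V T, a < y := by
  rw [scalingDegree_eq] at h
  obtain ⟨_, ⟨a, ha, rfl⟩, hay⟩ := sInf_lt_iff.1 (h.trans_lt (by exact_mod_cast hxy : (x : EReal) < y))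
  exact ⟨a, ha, EReal.coe_lt_coe_iff.1 hay⟩

theorem neBot_comap_Ioi : (comap (Subtype.val : Set.Ioi (0 : ℝ) → ℝ) (𝓝 (0 : ℝ))).NeBot := by
  refine comap_neBot fun t ht => ?_
  obtain ⟨ε, hε, hb⟩ := Metric.mem_nhds_iff.1 ht
  exact ⟨⟨ε / 2, by simpa using hε⟩, hb (by simp [abs_of_pos hε, hε])⟩

theorem tendsto_comap_Ioi {X : Type*} {G : ℝ → X} {l : Filter X} (h : Tendsto G (𝓝[>] 0) l) :
    Tendsto (fun μ : Set.Ioi (0 : ℝ) => G μ) (comap Subtype.val (𝓝 (0 : ℝ))) l := by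
  refine h.comp ?_
  rw [tendsto_nhdsWithin_iff]
  exact ⟨tendsto_comap, Eventually.of_forall fun μ => μ.2⟩

theorem decaySet_mono {a b : ℝ} (hab : a ≤ b) (ha : a ∈ decaySet d scale V T) :
    b ∈ decaySet d scale V T := fun f hf => by
  have h0 := (ha f hf).norm
  rw [norm_zero] at h0
  refine squeeze_zero_norm' ?_ h0
  have : ∀ᶠ μ : Set.Ioi (0 : ℝ) in comap Subtype.val (𝓝 (0 : ℝ)), (μ : ℝ) < 1 :=
    tendsto_comap.eventually (Iio_mem_nhds one_pos)
  filter_upwards [this] with μ hμ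
  have hμ0 : 0 < (μ : ℝ) := μ.2
  simp only [norm_mul, Complex.norm_real]
  gcongr
  rw [Real.norm_of_nonneg (by positivity), Real.norm_of_nonneg (by positivity)]
  gcongr ?_ / _
  exact Real.rpow_le_rpow_of_exponent_ge hμ0 hμ.le hab

/-- An exponent in the decay set exceeds the one of a homogeneous test value. -/
theorem lt_of_mem_decaySet {a p : ℝ} (ha : a ∈ decaySet d scale V T) {f : 𝓓(Ω, ℂ)}
    (hf : tsupport f ⊆ V) {c : ℂ} (hc : c ≠ 0) {G : ℝ → ℂ}
    (hT : ∀ μ : Set.Ioi (0 : ℝ), T (scale μ f) = (((μ : ℝ) ^ p : ℝ) : ℂ) * G μ)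
    (hG : ∀ᶠ x in 𝓝[>] 0, ‖c‖ ≤ ‖G x‖) : d < a + p := by
  by_contra hcon
  push Not at hcon
  have h1 := (ha f hf).norm
  have h2 : ∀ᶠ μ : Set.Ioi (0 : ℝ) in comap Subtype.val (𝓝 (0 : ℝ)),
      ‖c‖ ≤ ‖((((μ : ℝ) ^ a / (μ : ℝ) ^ d : ℝ) : ℂ) * T (scale μ f))‖ := by
    have : ∀ᶠ μ : Set.Ioi (0 : ℝ) in comap Subtype.val (𝓝 (0 : ℝ)), (μ : ℝ) < 1 :=
      tendsto_comap.eventually (Iio_mem_nhds one_pos)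
    filter_upwards [this, tendsto_comap_Ioi (G := id) tendsto_id |>.eventually hG] with μ hμ hGμ
    have hμ0 : 0 < (μ : ℝ) := μ.2
    rw [hT, ← mul_assoc, ← Complex.ofReal_mul, norm_mul, Complex.norm_real]
    have h3 : (μ : ℝ) ^ a / (μ : ℝ) ^ d * (μ : ℝ) ^ p = (μ : ℝ) ^ (a + p - d) := by
      rw [Real.rpow_sub hμ0, Real.rpow_add hμ0, Real.rpow_natCast]; ring
    rw [h3, Real.norm_of_nonneg (by positivity)]
    have h4 : (1 : ℝ) ≤ (μ : ℝ) ^ (a + p - d) :=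
      Real.one_le_rpow_of_pos_of_le_one_of_nonpos hμ0 hμ.le (by linarith)
    nlinarith [norm_nonneg (G μ), show ‖c‖ ≤ ‖G μ‖ from hGμ]
  have := neBot_comap_Ioi
  have h5 := ge_of_tendsto h1 h2
  rw [norm_zero] at h5
  exact hc (norm_le_zero_iff.1 h5)

theorem tendsto_rpow_mul_log_sq {s : ℝ} (hs : 0 < s) :
    Tendsto (fun x : ℝ => x ^ s * (1 + |Real.log x|) ^ 2) (𝓝[>] 0) (𝓝 0) := by
  have h1 : Tendsto (fun x : ℝ => x ^ (s / 2)) (𝓝[>] 0) (𝓝 0) := by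
    have := (Real.continuousAt_rpow_const 0 (s / 2) (Or.inr (by positivity))).tendsto
    rw [Real.zero_rpow (by positivity)] at this
    exact this.mono_left nhdsWithin_le_nhds
  have h2 : Tendsto (fun x : ℝ => |Real.log x * x ^ (s / 2)|) (𝓝[>] 0) (𝓝 0) := by
    have := (tendsto_log_mul_rpow_nhdsGT_zero (r := s / 2) (by positivity)).abs
    simpa using this
  have h3 := (h1.add h2).pow 2
  simp only [add_zero, ne_eq, OfNat.ofNat_ne_zero, not_false_eq_true, zero_pow] at h3
  refine h3.congr' ?_
  filter_upwards [self_mem_nhdsWithin] with x hx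
  have hx : 0 < x := hx
  have h4 : 0 < x ^ (s / 2) := by positivity
  rw [abs_mul, abs_of_pos h4]
  have h5 : x ^ s = x ^ (s / 2) * x ^ (s / 2) := by rw [← Real.rpow_add hx]; ring_nf
  rw [h5]; ring

/-- Logarithmic factors do not affect the scaling degree. Allowing the square of a logarithm in the
bound covers the homogeneous, the logarithmic and the squared-logarithmic cases at once. -/
theorem mem_decaySet_of_bound {a p : ℝ} (hap : d < a + p)
    (h : ∀ f : 𝓓(Ω, ℂ), tsupport f ⊆ V → ∃ C : ℝ, ∀ μ : Set.Ioi (0 : ℝ), (μ : ℝ) < 1 →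
      ‖T (scale μ f)‖ ≤ (μ : ℝ) ^ p * (C * (1 + |Real.log μ|) ^ 2)) :
    a ∈ decaySet d scale V T := fun f hf => by
  obtain ⟨C, hC⟩ := h f hf
  have h1 := (tendsto_rpow_mul_log_sq (s := a + p - d) (by linarith)).const_mul C
  rw [mul_zero] at h1
  refine squeeze_zero_norm' ?_ (tendsto_comap_Ioi h1)
  have : ∀ᶠ μ : Set.Ioi (0 : ℝ) in comap Subtype.val (𝓝 (0 : ℝ)), (μ : ℝ) < 1 :=
    tendsto_comap.eventually (Iio_mem_nhds one_pos)
  filter_upwards [this] with μ hμ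
  have hμ0 : 0 < (μ : ℝ) := μ.2
  rw [norm_mul, Complex.norm_real, Real.norm_of_nonneg (by positivity)]
  have h3 : (μ : ℝ) ^ (a + p - d) = (μ : ℝ) ^ a / (μ : ℝ) ^ d * (μ : ℝ) ^ p := by
    rw [Real.rpow_sub hμ0, Real.rpow_add hμ0, Real.rpow_natCast]; ring
  rw [h3]
  calc _ ≤ (μ : ℝ) ^ a / (μ : ℝ) ^ d * ((μ : ℝ) ^ p * (C * (1 + |Real.log μ|) ^ 2)) := by
        gcongr; exact hC μ hμ
    _ = _ := by ring

end ScalingDegree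

theorem mem_decaySet_add {E : Type*} [NormedAddCommGroup E] [NormedSpace ℝ E] {Ω : Opens E}
    {d : ℕ} {scale : Set.Ioi (0 : ℝ) → 𝓓(Ω, ℂ) → 𝓓(Ω, ℂ)} {V : Set E} {T T' : Dist Ω} {a : ℝ}
    (h : a ∈ decaySet d scale V T) (h' : a ∈ decaySet d scale V T') :
    a ∈ decaySet d scale V (T + T') := fun f hf => by
  simpa [mul_add] using (h f hf).add (h' f hf)

theorem mem_decaySet_neg {E : Type*} [NormedAddCommGroup E] [NormedSpace ℝ E] {Ω : Opens E}
    {d : ℕ} {scale : Set.Ioi (0 : ℝ) → 𝓓(Ω, ℂ) → 𝓓(Ω, ℂ)} {V : Set E} {T : Dist Ω} {a : ℝ}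
    (h : a ∈ decaySet d scale V T) : a ∈ decaySet d scale V (-T) := fun f hf => by
  simpa using (h f hf).neg

@[simp] theorem perpScale_apply {Ω : Opens R3} [Scalable Ω] (μ : Set.Ioi (0 : ℝ)) (f : 𝓓(Ω, ℂ))
    (k : R3) : perpScale μ f k = f (perpDil (μ : ℝ)⁻¹ k) := rfl

@[simp] theorem isoScale_apply {Ω : Opens R3} [Scalable Ω] (μ : Set.Ioi (0 : ℝ)) (f : 𝓓(Ω, ℂ))
    (k : R3) : isoScale μ f k = f ((μ : ℝ)⁻¹ • k) := rfl

/-! ### Counterterms -/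

/-- A bump function on the line that equals one on `[-1, 1]`. -/
def cut : ContDiffBump (0 : ℝ) := ⟨1, 2, one_pos, one_lt_two⟩

/-- `χ(x) xᵃ` with the cutoff `χ`. -/
def cutPow (a : ℕ) (x : ℝ) : ℂ := (cut x : ℂ) * (x : ℂ) ^ a

theorem contDiff_cutPow (a : ℕ) : ContDiff ℝ ∞ (cutPow a) :=
  (Complex.ofRealCLM.contDiff.comp cut.contDiff).mul (Complex.ofRealCLM.contDiff.pow a)

theorem cutPow_eq_zero {a : ℕ} {x : ℝ} (hx : 2 ≤ |x|) : cutPow a x = 0 := by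
  have : cut x = 0 := cut.zero_of_le_dist (by simpa [cut] using hx)
  simp [cutPow, this]

theorem cutPow_of_le {a : ℕ} {x : ℝ} (hx : |x| ≤ 1) : cutPow a x = (x : ℂ) ^ a := by
  have : cut x = 1 := cut.one_of_mem_closedBall (by simpa [cut] using hx)
  simp [cutPow, this]

theorem isCompact_box {K : Set ℝ} (hK : IsCompact K) (r : ℝ) :
    IsCompact {k : R3 | k 1 ∈ K ∧ |k 0| ≤ r ∧ |k 2| ≤ r} := by
  have hp : IsCompact (Metric.closedBall (0 : ℝ) r ×ˢ K ×ˢ Metric.closedBall (0 : ℝ) r) :=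
    (isCompact_closedBall _ _).prod (hK.prod (isCompact_closedBall _ _))
  have hc : Continuous fun p : ℝ × ℝ × ℝ => (!₂[p.1, p.2.1, p.2.2] : R3) := by
    refine (PiLp.continuous_toLp 2 _).comp (continuous_pi fun i => ?_)
    fin_cases i <;> simp <;> fun_prop
  convert hp.image hc using 1
  ext k
  constructor
  · rintro ⟨h1, h0, h2⟩
    exact ⟨(k 0, k 1, k 2), ⟨by simpa using h0, h1, by simpa using h2⟩, by
      ext i; fin_cases i <;> simp⟩
  · rintro ⟨p, ⟨h0, h1, h2⟩, rfl⟩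
    exact ⟨by simpa using h1, by simpa using h0, by simpa using h2⟩

theorem properPull_tens (a b : ℕ) : ProperPull punctured1 punctured3
    (fun k : R3 => cutPow a (k 0) * cutPow b (k 2)) (fun k => k 1) := fun K hK hK0 => by
  refine ⟨_, isCompact_box hK 2, fun k hk h0 => ?_, fun k hk => ?_⟩
  · have h0 : k = 0 := h0
    exact hK0 hk.1 (by simp [h0])
  · by_cases h1 : k 1 ∈ K
    · left
      by_cases h0 : |k 0| ≤ 2
      · have h2 : 2 ≤ |k 2| := le_of_lt (not_le.1 fun h => hk ⟨h1, h0, h⟩)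
        change cutPow a (k 0) * cutPow b (k 2) = 0
        rw [cutPow_eq_zero h2, mul_zero]
      · change cutPow a (k 0) * cutPow b (k 2) = 0
        rw [cutPow_eq_zero (not_le.1 h0).le, zero_mul]
    · exact Or.inr h1

/-- The test function `χ(k₁) k₁ᵃ χ(k₃) k₃ᵇ g(k₂)`. -/
def tens (a b : ℕ) : 𝓓(punctured1, ℂ) →L[ℂ] 𝓓(punctured3, ℂ) :=
  weightedPull (by
    refine ContDiff.contDiffOn (ContDiff.mul ?_ ?_)
    · exact (contDiff_cutPow a).comp (by fun_prop)
    · exact (contDiff_cutPow b).comp (by fun_prop)) (by fun_prop) (properPull_tens a b)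

@[simp] theorem tens_apply (a b : ℕ) (g : 𝓓(punctured1, ℂ)) (k : R3) :
    tens a b g k = cutPow a (k 0) * cutPow b (k 2) * g (k 1) := by simp [tens]

theorem properPull_axis : ProperPull punctured3 punctured1 (fun _ => (1 : ℂ)) axisPoint :=
  fun K hK hK0 => by
  have hce : IsClosedEmbedding axisPoint :=
    Function.LeftInverse.isClosedEmbedding (f := fun k : R3 => k 1)
      (fun s => by simp [axisPoint]) (by fun_prop) axisPoint_contDiff.continuous
  refine ⟨axisPoint ⁻¹' K, hce.isCompact_preimage hK, fun s hs h0 => ?_, fun s hs => Or.inr hs⟩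
  have h0 : s = 0 := h0
  exact hK0 hs (by subst h0; simp [axisPoint])

/-- Restriction of test functions to the axis. -/
def axisCLM : 𝓓(punctured3, ℂ) →L[ℂ] 𝓓(punctured1, ℂ) :=
  weightedPull contDiffOn_const axisPoint_contDiff.contDiffOn properPull_axis

theorem axisCLM_apply (f : 𝓓(punctured3, ℂ)) : axisCLM f = axisRestrict f := by
  ext s
  rw [axisCLM, weightedPull_apply, one_mul]; rfl

theorem axisRestrict_apply (f : 𝓓(punctured3, ℂ)) (s : ℝ) :
    axisRestrict f s = f (axisPoint s) := rfl

/-- The mixed derivative `∂₁ᵃ ∂₃ᵇ`. -/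
def perpDeriv (a b : ℕ) : 𝓓(punctured3, ℂ) →L[ℂ] 𝓓(punctured3, ℂ) :=
  (TestFunction.lineDerivCLM ℂ (EuclideanSpace.single 0 1 : R3)) ^ a *
    (TestFunction.lineDerivCLM ℂ (EuclideanSpace.single 2 1 : R3)) ^ b

theorem perpDeriv_apply (a b : ℕ) (f : 𝓓(punctured3, ℂ)) : perpDeriv a b f =
    (fun g : 𝓓(punctured3, ℂ) => ∂_{(EuclideanSpace.single 0 1 : R3)} g)^[a]
      ((fun g : 𝓓(punctured3, ℂ) => ∂_{(EuclideanSpace.single 2 1 : R3)} g)^[b] f) := by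
  rw [perpDeriv, mul_apply_eq_comp, FunLike.coe_pow_eq_iterate,
    FunLike.coe_pow_eq_iterate]
  rfl

/-- The counterterm as a distribution. -/
def counterDist {m : ℕ} (c : PerpIndex m → Dist punctured1) : Dist punctured3 :=
  ∑ α : PerpIndex m, ((-1 : ℂ) ^ (α.1 : ℕ)) •
    (c α ∘L axisCLM ∘L perpDeriv (α.2 : ℕ) ((α.1 : ℕ) - α.2))

theorem counterDist_apply {m : ℕ} (c : PerpIndex m → Dist punctured1) (f : 𝓓(punctured3, ℂ)) :
    counterDist c f = counterterm c f := by
  rw [counterDist, counterterm, sum_apply]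
  refine Finset.sum_congr rfl fun α _ => ?_
  rw [smul_apply, smul_eq_mul, ContinuousLinearMap.comp_apply, ContinuousLinearMap.comp_apply,
    axisCLM_apply, perpDeriv_apply]

theorem counterterm_eq {m : ℕ} (c : PerpIndex m → Dist punctured1) (f : 𝓓(punctured3, ℂ)) :
    counterterm c f = ∑ α : PerpIndex m, (-1) ^ (α.1 : ℕ) *
      c α (axisRestrict (perpDeriv (α.2 : ℕ) ((α.1 : ℕ) - α.2) f)) := by
  simp only [counterterm, perpDeriv_apply]

theorem lineDeriv_test' {Ω : Opens R3} (f : 𝓓(Ω, ℂ)) (v x : R3) :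
    (∂_{v} f : 𝓓(Ω, ℂ)) x = deriv (fun t : ℝ => f (x + t • v)) 0 := by
  rw [TestFunction.lineDerivOp_eq_lineDerivCLM ℂ, TestFunction.lineDerivCLM_apply_of_le (by simp)]
  rfl

theorem iterate_deriv_zero {Ω : Opens R3} {p r : ℝ → ℂ} {g : ℝ → ℂ} (n : ℕ) (f : 𝓓(Ω, ℂ))
    (hf : ∀ k, f k = p (k 0) * r (k 2) * g (k 1)) (k : R3) :
    ((fun g : 𝓓(Ω, ℂ) => ∂_{(EuclideanSpace.single 0 1 : R3)} g)^[n] f) k =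
      iteratedDeriv n p (k 0) * r (k 2) * g (k 1) := by
  induction n generalizing k with
  | zero => simp [hf]
  | succ n ih =>
    rw [Function.iterate_succ_apply', lineDeriv_test']
    simp only [ih]
    simp only [PiLp.add_apply, PiLp.smul_apply, smul_eq_mul]
    simp only [PiLp.single_apply, mul_assoc]
    simp only [if_true, mul_one, Fin.reduceEq, if_false, mul_zero, add_zero]
    rw [deriv_mul_const_field, deriv_comp_const_add, add_zero, iteratedDeriv_succ]

theorem iterate_deriv_two {Ω : Opens R3} {p r : ℝ → ℂ} {g : ℝ → ℂ} (n : ℕ) (f : 𝓓(Ω, ℂ))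
    (hf : ∀ k, f k = p (k 0) * r (k 2) * g (k 1)) (k : R3) :
    ((fun g : 𝓓(Ω, ℂ) => ∂_{(EuclideanSpace.single 2 1 : R3)} g)^[n] f) k =
      p (k 0) * iteratedDeriv n r (k 2) * g (k 1) := by
  induction n generalizing k with
  | zero => simp [hf]
  | succ n ih =>
    rw [Function.iterate_succ_apply', lineDeriv_test']
    simp only [ih]
    simp only [PiLp.add_apply, PiLp.smul_apply, smul_eq_mul]
    simp only [PiLp.single_apply, mul_assoc]
    simp only [if_true, mul_one, Fin.reduceEq, if_false, mul_zero, add_zero]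
    rw [deriv_const_mul_field, deriv_mul_const_field, deriv_comp_const_add, add_zero,
      iteratedDeriv_succ]

theorem perpDeriv_prod {p r : ℝ → ℂ} {g : ℝ → ℂ} (a b : ℕ) (f : 𝓓(punctured3, ℂ))
    (hf : ∀ k, f k = p (k 0) * r (k 2) * g (k 1)) (k : R3) :
    perpDeriv a b f k = iteratedDeriv a p (k 0) * iteratedDeriv b r (k 2) * g (k 1) := by
  rw [perpDeriv_apply]
  exact iterate_deriv_zero a _ (iterate_deriv_two b f hf) k

theorem iteratedDeriv_ofReal_pow (a n : ℕ) :
    iteratedDeriv n (fun x : ℝ => (x : ℂ) ^ a) =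
      fun x : ℝ => (a.descFactorial n : ℂ) * (x : ℂ) ^ (a - n) := by
  induction n with
  | zero => simp
  | succ n ih =>
    rw [iteratedDeriv_succ, ih]
    funext x
    have h1 : HasDerivAt (fun x : ℝ => (x : ℂ)) 1 x := by
      simpa using (hasDerivAt_id x).ofReal_comp
    have h2 : HasDerivAt (fun x : ℝ => (a.descFactorial n : ℂ) * (x : ℂ) ^ (a - n))
        ((a.descFactorial n : ℂ) * (((a - n : ℕ) : ℂ) * (x : ℂ) ^ (a - n - 1) * 1)) x :=
      (h1.pow (a - n)).const_mul _
    rw [h2.deriv, Nat.descFactorial_succ, Nat.sub_sub]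
    push_cast; ring

theorem iteratedDeriv_cutPow (a n : ℕ) :
    iteratedDeriv n (cutPow a) 0 = if n = a then (a.factorial : ℂ) else 0 := by
  have h : cutPow a =ᶠ[𝓝 0] fun x : ℝ => (x : ℂ) ^ a := by
    filter_upwards [Metric.closedBall_mem_nhds (0 : ℝ) one_pos] with x hx
    exact cutPow_of_le (by simpa using hx)
  rw [h.iteratedDeriv_eq, iteratedDeriv_ofReal_pow]
  split_ifs with hn
  · subst hn; simp [Nat.descFactorial_self]
  · rcases lt_or_gt_of_ne hn with h1 | h1
    · have : a - n ≠ 0 := by omega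
      simp [this]
    · simp [Nat.descFactorial_of_lt h1]

/-- Up to factorials the transversal derivatives on the axis are dual to the functions `k₁ᵃ k₃ᵇ
g(k₂)`; this is how the coefficients of a counterterm are read off. -/
theorem axisRestrict_perpDeriv_tens (a b a' b' : ℕ) (g : 𝓓(punctured1, ℂ)) :
    axisRestrict (perpDeriv a b (tens a' b' g)) =
      (if a = a' ∧ b = b' then ((a'.factorial * b'.factorial : ℕ) : ℂ) else 0) • g := by
  ext s
  rw [axisRestrict_apply, perpDeriv_prod a b _ (tens_apply a' b' g), smul_apply, smul_eq_mul]
  simp only [axisPoint, PiLp.single_apply, Fin.reduceEq, if_false, if_true,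
    iteratedDeriv_cutPow]
  split_ifs <;> simp_all

/-- The counterterm evaluated on `tens`. -/
theorem counterterm_tens {m : ℕ} (c : PerpIndex m → Dist punctured1) (a b : ℕ)
    (g : 𝓓(punctured1, ℂ)) : counterterm c (tens a b g) =
      if h : a + b < m then (-1) ^ (a + b) * ((a.factorial * b.factorial : ℕ) : ℂ) *
        c ⟨⟨a + b, h⟩, ⟨a, by simp⟩⟩ g else 0 := by
  rw [counterterm_eq]
  simp only [axisRestrict_perpDeriv_tens, map_smul, smul_eq_mul]
  split_ifs with h
  · rw [Finset.sum_eq_single (⟨⟨a + b, h⟩, ⟨a, by simp⟩⟩ : PerpIndex m)]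
    · simp; ring
    · rintro ⟨⟨j, hj⟩, ⟨i, hi⟩⟩ - hne
      rw [if_neg]
      · simp
      · rintro ⟨h1, h2⟩
        change i = a at h1
        change j - i = b at h2
        have hi : i < j + 1 := hi
        have h3 : j = a + b := by omega
        subst h1; subst h3
        exact hne rfl
    · simp
  · refine Finset.sum_eq_zero ?_
    rintro ⟨⟨j, hj⟩, ⟨i, hi⟩⟩ -
    rw [if_neg]
    · simp
    · rintro ⟨h1, h2⟩
      change i = a at h1
      change j - i = b at h2
      have hi : i < j + 1 := hi
      omega

theorem coordProj_perp_eq_zero {k : R3} : coordProj {0, 2} k = 0 ↔ perpSq k = 0 := by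
  constructor
  · intro h
    have h0 := congrArg (fun v : R3 => v 0) h
    have h2 := congrArg (fun v : R3 => v 2) h
    simp [coordProj_apply] at h0 h2
    simp [perpSq, h0, h2]
  · intro h
    have h : k 0 ^ 2 + k 2 ^ 2 = 0 := h
    have h0 : k 0 = 0 := by nlinarith [sq_nonneg (k 0), sq_nonneg (k 2)]
    have h2 : k 2 = 0 := by nlinarith [sq_nonneg (k 0), sq_nonneg (k 2)]
    ext i
    rw [coordProj_apply]
    fin_cases i <;> simp [h0, h2]

theorem tsupport_subset_of_vanish {E : Type*} [TopologicalSpace E] {f : E → ℂ} {U : Set E}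
    (hU : IsOpen U) (h : ∀ k ∈ U, f k = 0) : tsupport f ⊆ Uᶜ :=
  closure_minimal (fun k hk hkU => hk (h k hkU)) hU.isClosed_compl

theorem vanishesOff_of_restrict {D : Dist punctured3} (h : restrict (Ω := offAxis) D = 0) :
    VanishesOff {0, 2} D := fun f ⟨U, hU, hZ, hf⟩ => by
  have h1 : tsupport f ⊆ offAxis := (tsupport_subset_of_vanish hU hf).trans fun k hk h0 =>
    hk (hZ k (coordProj_perp_eq_zero.2 h0))
  rw [← restrict_apply offAxis_le D (recast offAxis f h1) f fun x => rfl, h]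
  simp

/-- A distribution supported on the axis that vanishes on all `tens a b g` is zero. -/
theorem VanishesOff.eq_zero_of_tens {D : Dist punctured3} (hD : VanishesOff {0, 2} D)
    (h : ∀ a b g, D (tens a b g) = 0) : D = 0 := by
  ext f
  have hce : IsClosedEmbedding axisPoint :=
    Function.LeftInverse.isClosedEmbedding (f := fun k : R3 => k 1)
      (fun s => by simp [axisPoint]) (by fun_prop) axisPoint_contDiff.continuous
  -- The cutoff in `k₂` is one near the part of the axis that meets the support of `f`, so `f` and
  -- `f` times `tens 0 0 c'` agree near the axis.
  obtain ⟨c, h1, h2, h3, -, W, hW, hKW, hcW⟩ := exists_cutoff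
    (hce.isCompact_preimage f.hasCompactSupport.isCompact) punctured1.isOpen
    (fun s hs h0 => f.tsupport_subset hs (by
      have h0 : s = 0 := h0
      subst h0; simp [axisPoint]))
  let c' : 𝓓(punctured1, ℂ) := mkTest (fun s => (c s : ℂ)) (Complex.ofRealCLM.contDiff.comp h1)
    (tsupport c) h2 h3 (fun s hs => by simp [image_eq_zero_of_notMem_tsupport hs])
  have e1 : D (mulCLM f.contDiff.contDiffOn (tens 0 0 c')) = 0 := by
    refine hD.eq_zero _ (fun α hα g hg F hF => ?_) f f.contDiff
    have hg' : ContDiff ℝ ∞ fun s => g (axisPoint s) := hg.comp axisPoint_contDiff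
    -- A transversal monomial times a function of `k₂` times `tens 0 0 c'` is again of the form
    -- `tens`, so the hypothesis applies to it.
    have : F = tens (α 0) (α 2) (mulCLM hg'.contDiffOn c') := by
      ext k
      rw [hF, tens_apply, tens_apply, mulCLM_apply]
      have h5 : k - coordProj {0, 2} k = axisPoint (k 1) := by
        ext i
        rw [PiLp.sub_apply, coordProj_apply]
        fin_cases i <;> simp [axisPoint]
      rw [h5, mono, Fin.prod_univ_three, hα 1 (by simp)]
      simp only [cutPow]; ring
    rw [this]; exact h _ _ _
  have e2 : D (f - mulCLM f.contDiff.contDiffOn (tens 0 0 c')) = 0 := by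
    refine hD _ ⟨{k | |k 0| < 1 ∧ |k 2| < 1 ∧ k 1 ∈ W} ∪ (tsupport f)ᶜ, ?_, fun k hk => ?_,
      fun k hk => ?_⟩
    · refine IsOpen.union ?_ (isClosed_tsupport f).isOpen_compl
      exact (isOpen_lt (f := fun k : R3 => |k 0|) (by fun_prop) continuous_const).inter
        ((isOpen_lt (f := fun k : R3 => |k 2|) (by fun_prop) continuous_const).inter
          (hW.preimage (f := fun k : R3 => k 1) (by fun_prop)))
    · by_cases hkf : k ∈ tsupport f
      · left
        have hk : k 0 ^ 2 + k 2 ^ 2 = 0 := coordProj_perp_eq_zero.1 hk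
        have h0 : k 0 = 0 := by nlinarith [sq_nonneg (k 0), sq_nonneg (k 2)]
        have h2 : k 2 = 0 := by nlinarith [sq_nonneg (k 0), sq_nonneg (k 2)]
        refine ⟨by simp [h0], by simp [h2], hKW ?_⟩
        have : axisPoint (k 1) = k := by ext i; fin_cases i <;> simp [axisPoint, h0, h2]
        simpa [this] using hkf
      · exact Or.inr hkf
    · rw [sub_apply, mulCLM_apply, tens_apply]
      rcases hk with ⟨h0, h2, h1⟩ | hk
      · rw [cutPow_of_le h0.le, cutPow_of_le h2.le]
        have h4 : c' (k 1) = 1 := by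
          change ((c (k 1) : ℝ) : ℂ) = 1
          simp [hcW _ h1]
        simp [h4]
      · simp [testFunction_eq_zero f hk]
  rw [map_sub, e1, sub_zero] at e2
  simpa using e2

/-- Where `|k₁|` and `|k₃|` are below `min 1 μ`, the cutoffs of both functions are one and `tens a b
g` is homogeneous of degree `a + b` in `k_⊥`. Since `D` sees only a neighbourhood of the axis, the
scaling is exact. -/
theorem VanishesOff.perpScale_tens {D : Dist punctured3} (hD : VanishesOff {0, 2} D) (a b : ℕ)
    (g : 𝓓(punctured1, ℂ)) (μ : Set.Ioi (0 : ℝ)) :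
    D (perpScale μ (tens a b g)) = ((((μ : ℝ) ^ (-((a + b : ℕ) : ℝ)) : ℝ)) : ℂ) * D (tens a b g) := by
  have hμ : 0 < (μ : ℝ) := μ.2
  have hμc : ((μ : ℝ) : ℂ) ≠ 0 := by exact_mod_cast hμ.ne'
  rw [← smul_eq_mul, ← map_smul, ← sub_eq_zero, ← map_sub]
  refine hD _ ⟨{k | |k 0| < min (1 : ℝ) (μ : ℝ) ∧ |k 2| < min (1 : ℝ) (μ : ℝ)}, ?_, fun k hk => ?_, fun k hk => ?_⟩
  · exact (isOpen_lt (f := fun k : R3 => |k 0|) (by fun_prop) continuous_const).inter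
      (isOpen_lt (f := fun k : R3 => |k 2|) (by fun_prop) continuous_const)
  · have hk : k 0 ^ 2 + k 2 ^ 2 = 0 := coordProj_perp_eq_zero.1 hk
    have h0 : k 0 = 0 := by nlinarith [sq_nonneg (k 0), sq_nonneg (k 2)]
    have h2 : k 2 = 0 := by nlinarith [sq_nonneg (k 0), sq_nonneg (k 2)]
    constructor <;> simp [h0, h2, hμ]
  · obtain ⟨h0, h2⟩ := hk
    rw [lt_min_iff] at h0 h2
    rw [sub_apply, smul_apply, perpScale_apply, tens_apply, tens_apply, smul_eq_mul]
    have h3 : ∀ x : ℝ, |x| < μ → |(μ : ℝ)⁻¹ * x| ≤ 1 := fun x hx => by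
      rw [abs_mul, abs_inv, abs_of_pos hμ, inv_mul_le_iff₀ hμ]; linarith
    simp only [perpDil]
    simp only [Matrix.cons_val_zero, Matrix.cons_val_one, Matrix.cons_val]
    rw [cutPow_of_le (h3 _ h0.2), cutPow_of_le (h3 _ h2.2), cutPow_of_le h0.1.le,
      cutPow_of_le h2.1.le, Real.rpow_neg hμ.le, Real.rpow_natCast]
    push_cast
    rw [mul_pow, mul_pow, pow_add, inv_pow, inv_pow, mul_inv]
    ring

/-! ### Extensions across the axis -/

theorem perpDeriv_eq_zero {f : 𝓓(punctured3, ℂ)} {U : Set R3} (hU : IsOpen U)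
    (hf : ∀ k ∈ U, f k = 0) (a b : ℕ) {k : R3} (hk : k ∈ U) : perpDeriv a b f k = 0 := by
  have step : ∀ (v : R3) (n : ℕ) (g : 𝓓(punctured3, ℂ)), (∀ k ∈ U, g k = 0) → ∀ k ∈ U,
      ((fun g : 𝓓(punctured3, ℂ) => ∂_{v} g)^[n] g) k = 0 := by
    intro v n
    induction n with
    | zero => exact fun g hg => hg
    | succ n ih =>
      intro g hg
      rw [Function.iterate_succ_apply]
      refine ih _ fun k hk => ?_
      rw [lineDeriv_test]
      have : (g : R3 → ℂ) =ᶠ[𝓝 k] fun _ => 0 := by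
        filter_upwards [hU.mem_nhds hk] with x hx using hg x hx
      rw [this.fderiv_eq]; simp
  rw [perpDeriv_apply]
  exact step _ _ _ (step _ _ _ hf) k hk

theorem restrict_counterDist {m : ℕ} (c : PerpIndex m → Dist punctured1) :
    restrict (Ω := offAxis) (counterDist c) = 0 := by
  ext f
  rw [restrict_apply' offAxis_le, counterDist_apply, counterterm_eq]
  refine Finset.sum_eq_zero fun α _ => ?_
  have : axisRestrict (perpDeriv (α.2 : ℕ) ((α.1 : ℕ) - α.2) (incl offAxis_le f)) = 0 := by
    ext s
    rw [axisRestrict_apply]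
    refine perpDeriv_eq_zero (U := (tsupport f)ᶜ) (isClosed_tsupport f).isOpen_compl
      (fun k hk => testFunction_eq_zero f hk) _ _ fun hs => ?_
    have : perpSq (axisPoint s) ≠ 0 := f.tsupport_subset hs
    exact this (by simp [perpSq, axisPoint])
  rw [this]; simp

theorem lineDeriv_perpScale {Ω : Opens R3} [Scalable Ω] (μ : Set.Ioi (0 : ℝ)) (f : 𝓓(Ω, ℂ)) {i : Fin 3}
    (hi : i ≠ 1) : (∂_{(EuclideanSpace.single i 1 : R3)} (perpScale μ f) : 𝓓(Ω, ℂ)) =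
      (((μ : ℝ)⁻¹ : ℝ) : ℂ) • perpScale μ (∂_{(EuclideanSpace.single i 1 : R3)} f) := by
  ext k
  rw [lineDeriv_test', smul_apply, perpScale_apply, lineDeriv_test', smul_eq_mul]
  have h : ∀ t : ℝ, perpScale μ f (k + t • (EuclideanSpace.single i 1 : R3)) =
      f (perpDil (μ : ℝ)⁻¹ k + ((μ : ℝ)⁻¹ * t) • (EuclideanSpace.single i 1 : R3)) := fun t => by
    rw [perpScale_apply]
    congr 1
    ext j
    fin_cases i <;> fin_cases j <;> simp [perpDil, mul_add] at hi ⊢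
  simp only [h]
  have := deriv_comp_mul_left (μ : ℝ)⁻¹ (fun t : ℝ =>
    f (perpDil (μ : ℝ)⁻¹ k + t • (EuclideanSpace.single i 1 : R3))) 0
  rw [this, mul_zero, Complex.real_smul]

theorem perpDeriv_perpScale (μ : Set.Ioi (0 : ℝ)) (f : 𝓓(punctured3, ℂ)) (a b : ℕ) :
    perpDeriv a b (perpScale μ f) =
      ((((μ : ℝ)⁻¹ ^ (a + b) : ℝ)) : ℂ) • perpScale μ (perpDeriv a b f) := by
  have step : ∀ i : Fin 3, i ≠ 1 → ∀ (n : ℕ) (g : 𝓓(punctured3, ℂ)),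
      (fun g : 𝓓(punctured3, ℂ) => ∂_{(EuclideanSpace.single i 1 : R3)} g)^[n] (perpScale μ g) =
      ((((μ : ℝ)⁻¹ ^ n : ℝ)) : ℂ) • perpScale μ
        ((fun g : 𝓓(punctured3, ℂ) => ∂_{(EuclideanSpace.single i 1 : R3)} g)^[n] g) := by
    intro i hi n g
    induction n with
    | zero => simp
    | succ n ih =>
      rw [Function.iterate_succ_apply', Function.iterate_succ_apply', ih,
        TestFunction.lineDerivOp_eq_lineDerivCLM ℂ, map_smul,
        ← TestFunction.lineDerivOp_eq_lineDerivCLM ℂ, lineDeriv_perpScale μ _ hi, smul_smul,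
        ← Complex.ofReal_mul, pow_succ]
  have hsm : ∀ (c : ℂ) (n : ℕ) (g : 𝓓(punctured3, ℂ)),
      (fun g : 𝓓(punctured3, ℂ) => ∂_{(EuclideanSpace.single 0 1 : R3)} g)^[n] (c • g) =
      c • (fun g : 𝓓(punctured3, ℂ) => ∂_{(EuclideanSpace.single 0 1 : R3)} g)^[n] g := by
    intro c n g
    have := map_smul (perpDeriv n 0) c g
    rwa [perpDeriv_apply, perpDeriv_apply] at this
  rw [perpDeriv_apply, perpDeriv_apply, step 2 (by decide), hsm, step 0 (by decide), smul_smul,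
    ← Complex.ofReal_mul, pow_add, mul_comm]

theorem counterterm_perpScale {m : ℕ} (c : PerpIndex m → Dist punctured1) (μ : Set.Ioi (0 : ℝ))
    (f : 𝓓(punctured3, ℂ)) : counterterm c (perpScale μ f) =
      ∑ α : PerpIndex m, ((((μ : ℝ)⁻¹ ^ (α.1 : ℕ) : ℝ)) : ℂ) * ((-1) ^ (α.1 : ℕ) *
        c α (axisRestrict (perpDeriv (α.2 : ℕ) ((α.1 : ℕ) - α.2) f))) := by
  rw [counterterm_eq]
  refine Finset.sum_congr rfl fun α _ => ?_
  have h : axisRestrict (perpDeriv (α.2 : ℕ) ((α.1 : ℕ) - α.2) (perpScale μ f)) =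
      ((((μ : ℝ)⁻¹ ^ (α.1 : ℕ) : ℝ)) : ℂ) •
        axisRestrict (perpDeriv (α.2 : ℕ) ((α.1 : ℕ) - α.2) f) := by
    rw [perpDeriv_perpScale, Nat.add_sub_cancel' (Nat.lt_succ_iff.1 α.2.2)]
    ext s
    rw [axisRestrict_apply, smul_apply, smul_apply, perpScale_apply, axisRestrict_apply]
    congr 2
    ext j; fin_cases j <;> simp [perpDil, axisPoint]
  rw [h, map_smul, smul_eq_mul]; ring

theorem tsupport_tens_subset (a b : ℕ) (g : 𝓓(punctured1, ℂ)) :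
    tsupport (tens a b g) ⊆ {k | k 1 ≠ 0} := by
  have : tsupport (tens a b g) ⊆ (fun k : R3 => k 1) ⁻¹' tsupport g := by
    refine closure_minimal (fun k hk => ?_)
      ((isClosed_tsupport g).preimage (f := fun k : R3 => k 1) (by fun_prop))
    by_contra h
    exact hk (by rw [tens_apply, testFunction_eq_zero g h, mul_zero])
  exact fun k hk => g.tsupport_subset (this hk)

theorem mem_decaySet_of_sdAxis_le {Ω : Opens R3} [Scalable Ω] {T : Dist Ω} {s a : ℝ}
    (h : sdAxis T ≤ s) (ha : s < a) : a ∈ decaySet 2 perpScale {k | k 1 ≠ 0} T := by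
  obtain ⟨b, hb, hba⟩ := exists_mem_decaySet h ha
  exact decaySet_mono hba.le hb

/-- Two extensions across the axis differ by a unique counterterm. -/
theorem existsUnique_counterterm {K₀ : Dist offAxis} {s : ℝ} (hs : sdAxis K₀ = s) {m : ℕ}
    (hm : s < m + 2) {T₀ T : Dist punctured3} (hT₀ : T₀ ∈ axisExtensions K₀)
    (hT : T ∈ axisExtensions K₀) :
    ∃! c : PerpIndex m → Dist punctured1, ∀ f, T f = T₀ f + counterterm c f := by
  have hD : VanishesOff {0, 2} (T + -T₀) := vanishesOff_of_restrict (by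
    ext f
    have h1 := congrArg (fun D => D f) (hT.1.trans hT₀.1.symm)
    simp only [restrict_apply' offAxis_le] at h1 ⊢
    simp [h1])
  obtain ⟨a, hsa, ham⟩ := exists_between hm
  have ha : a ∈ decaySet 2 perpScale {k | k 1 ≠ 0} (T + -T₀) := mem_decaySet_add
    (mem_decaySet_of_sdAxis_le (hT.2.trans hs.le) hsa)
    (mem_decaySet_neg (mem_decaySet_of_sdAxis_le (hT₀.2.trans hs.le) hsa))
  -- A nonzero value would scale as `μ^{-(i+j)}`, so that `2 < a - (i + j)`; but `a < m + 2`.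
  have hbig : ∀ i j g, m ≤ i + j → (T + -T₀) (tens i j g) = 0 := by
    intro i j g hij
    by_contra hne
    have := lt_of_mem_decaySet ha (tsupport_tens_subset i j g) hne
      (G := fun _ => (T + -T₀) (tens i j g)) (fun μ => hD.perpScale_tens i j g μ)
      (Eventually.of_forall fun _ => le_rfl)
    have h2 : (m : ℝ) ≤ ((i + j : ℕ) : ℝ) := by exact_mod_cast hij
    push_cast at this h2
    linarith
  have hf0 : ∀ i j : ℕ, ((i.factorial * j.factorial : ℕ) : ℂ) ≠ 0 := fun i j => by
    exact_mod_cast (Nat.mul_pos i.factorial_pos j.factorial_pos).ne'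
  have hneg : ∀ j : ℕ, ((-1 : ℂ) ^ j) * (-1) ^ j = 1 := fun j => by
    rw [← mul_pow]; simp
  -- The inverse of the factor in `counterterm_tens`; the sign `(-1)^(a+b)` is its own inverse.
  let c : PerpIndex m → Dist punctured1 := fun α =>
    (((α.2 : ℕ).factorial * ((α.1 : ℕ) - α.2).factorial : ℕ) : ℂ)⁻¹ • ((-1 : ℂ) ^ (α.1 : ℕ)) •
      ((T + -T₀) ∘L tens (α.2 : ℕ) ((α.1 : ℕ) - α.2))
  refine ⟨c, fun f => ?_, fun c' hc' => ?_⟩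
  · have hv : VanishesOff {0, 2} (T + -T₀ + -counterDist c) := fun F hF => by
      rw [_root_.add_apply, hD F hF, _root_.neg_apply,
        vanishesOff_of_restrict (restrict_counterDist c) F hF]; simp
    have hz := hv.eq_zero_of_tens fun i j g => by
      rw [_root_.add_apply, _root_.neg_apply, counterDist_apply, counterterm_tens]
      split_ifs with h
      · simp only [c, smul_apply, smul_eq_mul, ContinuousLinearMap.comp_apply]
        have e1 : i + j - i = j := by omega
        rw [e1]
        have := hf0 i j
        have := hneg (i + j)
        field_simp
        linear_combination (-(T + -T₀) (tens i j g)) * this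
      · rw [hbig i j g (not_lt.1 h)]; simp
    have := congrArg (fun D => D f) hz
    simp only [_root_.add_apply, _root_.neg_apply, counterDist_apply, _root_.zero_apply] at this
    linear_combination this
  · funext α
    obtain ⟨⟨j, hj⟩, ⟨i, hi⟩⟩ := α
    obtain ⟨l, rfl⟩ : ∃ l, j = i + l := ⟨j - i, by simp at hi; omega⟩
    ext g
    have e := counterterm_tens c' i l g
    rw [dif_pos hj] at e
    have e2 := hc' (tens i l g)
    simp only [c, smul_apply, smul_eq_mul, ContinuousLinearMap.comp_apply, _root_.add_apply,
      _root_.neg_apply]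
    have e1 : i + l - i = l := by omega
    rw [e1, e2, e]
    have := hf0 i l
    have := hneg (i + l)
    field_simp
    linear_combination (-(c' ⟨⟨i + l, hj⟩, ⟨i, hi⟩⟩) g) *
      ((i.factorial * l.factorial : ℕ) : ℂ) * this

/-- A transversal derivative of order `j` of the delta distribution scales as `μ^{-j}` on test
functions, that is, with degree `j + 2`; all `j < m` stay within `s`. -/
theorem add_counterterm_mem {K₀ : Dist offAxis} {s : ℝ} (hs : sdAxis K₀ = s) {m : ℕ}
    (hm : ∀ j < m, (j : ℝ) + 2 ≤ s) {T₀ : Dist punctured3} (hT₀ : T₀ ∈ axisExtensions K₀)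
    (c : PerpIndex m → Dist punctured1) :
    ∃ T ∈ axisExtensions K₀, ∀ f, T f = T₀ f + counterterm c f := by
  refine ⟨T₀ + counterDist c, ⟨?_, ?_⟩, fun f => by rw [_root_.add_apply, counterDist_apply]⟩
  · ext f
    have h1 := congrArg (fun D => D f) hT₀.1
    have h2 := congrArg (fun D => D f) (restrict_counterDist c)
    simp only [restrict_apply' offAxis_le] at h1 h2 ⊢
    simp [h1, h2]
  · rw [hs]
    refine scalingDegree_le_of_forall fun a ha => mem_decaySet_add
      (mem_decaySet_of_sdAxis_le (hT₀.2.trans hs.le) ha) ?_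
    refine mem_decaySet_of_bound (p := 2 - s) (by push_cast; linarith) fun f _ =>
      ⟨∑ α : PerpIndex m, ‖(-1) ^ (α.1 : ℕ) *
        c α (axisRestrict (perpDeriv (α.2 : ℕ) ((α.1 : ℕ) - α.2) f))‖, fun μ hμ => ?_⟩
    have hμ0 : 0 < (μ : ℝ) := μ.2
    rw [counterDist_apply, counterterm_perpScale]
    have h1 : ∀ α : PerpIndex m, (μ : ℝ)⁻¹ ^ (α.1 : ℕ) ≤ (μ : ℝ) ^ (2 - s) := fun α => by
      rw [inv_pow, ← Real.rpow_natCast, ← Real.rpow_neg hμ0.le]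
      refine Real.rpow_le_rpow_of_exponent_ge hμ0 hμ.le ?_
      linarith [hm α.1 α.1.2]
    calc _ ≤ ∑ α : PerpIndex m, (μ : ℝ) ^ (2 - s) * ‖(-1) ^ (α.1 : ℕ) *
        c α (axisRestrict (perpDeriv (α.2 : ℕ) ((α.1 : ℕ) - α.2) f))‖ := by
          refine norm_sum_le_of_le _ fun α _ => ?_
          rw [norm_mul, Complex.norm_real, Real.norm_of_nonneg (by positivity)]
          gcongr
          exact h1 α
      _ = (μ : ℝ) ^ (2 - s) * ((∑ α : PerpIndex m, ‖(-1) ^ (α.1 : ℕ) *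
        c α (axisRestrict (perpDeriv (α.2 : ℕ) ((α.1 : ℕ) - α.2) f))‖) * 1) := by
          rw [← Finset.mul_sum, mul_one]
      _ ≤ _ := by
          gcongr
          exact one_le_pow₀ (by linarith [abs_nonneg (Real.log μ)])

/-! ### Negligibility of the axis and nonlocality of the ambiguity -/

theorem volume_hyperplane {n : ℕ} (i : Fin n) :
    volume {k : EuclideanSpace ℝ (Fin n) | k i = 0} = 0 := by
  have h := Measure.addHaar_submodule (volume : Measure (EuclideanSpace ℝ (Fin n)))
    (LinearMap.ker (EuclideanSpace.proj i : EuclideanSpace ℝ (Fin n) →L[ℝ] ℝ).toLinearMap) (by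
      intro h
      have : (EuclideanSpace.single i 1 : EuclideanSpace ℝ (Fin n)) ∈
        LinearMap.ker (EuclideanSpace.proj i : EuclideanSpace ℝ (Fin n) →L[ℝ] ℝ).toLinearMap := by
          rw [h]; trivial
      simp at this)
  convert h using 2
  ext k; simp

theorem ae_coord_ne_zero {n : ℕ} (i : Fin n) :
    ∀ᵐ k : EuclideanSpace ℝ (Fin n), k i ≠ 0 := by
  rw [ae_iff]; simpa using volume_hyperplane i

theorem perpSq_pos {k : R3} (h : k 0 ≠ 0) : 0 < perpSq k := by
  unfold perpSq; positivity

/-- The difference of distinct extensions across the axis is not a continuous function. -/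
theorem eq_of_sub_eq_integral {T T' : Dist punctured3}
    (h : restrict (Ω := offAxis) T = restrict (Ω := offAxis) T') {g : R3 → ℂ}
    (hg : ContinuousOn g punctured3) (hT : ∀ f, T f - T' f = ∫ k, g k * f k) : T = T' := by
  -- Both extensions agree off the axis, so there `g` is zero almost everywhere by the fundamental
  -- lemma of the calculus of variations. The axis itself is a null set, hence `g` contributes
  -- nothing at all.
  have hz : ∀ᵐ k : R3, k ∈ (offAxis : Set R3) → g k = 0 := by
    refine offAxis.isOpen.ae_eq_zero_of_integral_contDiff_smul_eq_zero
      ((hg.mono offAxis_le).locallyIntegrableOn offAxis.isOpen.measurableSet) fun φ h1 h2 h3 => ?_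
    let F : 𝓓(offAxis, ℂ) := mkTest (fun k => (φ k : ℂ)) (Complex.ofRealCLM.contDiff.comp h1)
      (tsupport φ) h2 h3 (fun s hs => by simp [image_eq_zero_of_notMem_tsupport hs])
    have e := hT (incl offAxis_le F)
    have e2 := congrArg (fun D => D F) h
    simp only [restrict_apply' offAxis_le] at e2
    rw [e2, sub_self] at e
    rw [e]
    refine integral_congr_ae (Eventually.of_forall fun k => ?_)
    change φ k • g k = g k * (φ k : ℂ)
    rw [Complex.real_smul, mul_comm]
  ext f
  rw [← sub_eq_zero, hT]
  refine integral_eq_zero_of_ae ?_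
  filter_upwards [hz, ae_coord_ne_zero (0 : Fin 3)] with k hk hk0
  rw [hk (perpSq_pos hk0).ne']; simp

/-! ### Integration by parts -/

/-- Integration by parts of a smooth function on `Ω` against a test function. -/
theorem integral_mul_lineDeriv {E : Type*} [NormedAddCommGroup E] [NormedSpace ℝ E]
    [FiniteDimensional ℝ E] [MeasureSpace E] [BorelSpace E]
    [(volume : Measure E).IsAddHaarMeasure] {Ω : Opens E} {g g' : E → ℂ}
    (hg : ContDiffOn ℝ ∞ g Ω) (v : E) (hg' : ∀ x ∈ Ω, HasLineDerivAt ℝ g (g' x) x v)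
    (f : 𝓓(Ω, ℂ)) : ∫ x, g x * (∂_{v} f : 𝓓(Ω, ℂ)) x = -∫ x, g' x * f x := by
  have hd : ∀ x ∈ Ω, DifferentiableAt ℝ g x := fun x hx =>
    (hg.differentiableOn (by simp) x hx).differentiableAt (Ω.isOpen.mem_nhds hx)
  have he : ∀ x ∈ Ω, fderiv ℝ g x v = g' x := fun x hx =>
    ((hd x hx).hasFDerivAt.hasLineDerivAt v).unique (hg' x hx)
  have hc : ContinuousOn (fun x => fderiv ℝ g x v) Ω :=
    (hg.continuousOn_fderiv_of_isOpen Ω.isOpen (by simp)).clm_apply continuousOn_const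
  have h1 := integral_mul_fderiv_eq_neg_fderiv_mul_of_integrable (μ := volume) (f := g) (g := f)
    (v := v) (integrable_mul_test (hc.locallyIntegrableOn Ω.isOpen.measurableSet) f)
    (by
      have := integrable_mul_test (hg.continuousOn.locallyIntegrableOn Ω.isOpen.measurableSet)
        (∂_{v} f : 𝓓(Ω, ℂ))
      simpa only [lineDeriv_test] using this)
    (integrable_mul_test (hg.continuousOn.locallyIntegrableOn Ω.isOpen.measurableSet) f)
    (fun x hx => hd x (f.tsupport_subset hx))
    (fun x _ => (f.contDiff.differentiable (by simp)).differentiableAt)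
  simp only [lineDeriv_test]
  rw [h1]
  congr 1
  refine integral_congr_ae (Eventually.of_forall fun x => ?_)
  by_cases hx : x ∈ tsupport f
  · simp only [he x (f.tsupport_subset hx)]
  · simp [testFunction_eq_zero f hx]

/-! ### Changes of variables -/

theorem integral_perpDil (F : R3 → ℂ) {μ : ℝ} (hμ : 0 < μ) :
    ∫ k, F (perpDil μ k) = ((μ ^ 2 : ℝ) : ℂ)⁻¹ * ∫ k, F k := by
  let A : R3 →ₗ[ℝ] R3 := Matrix.toLpLin 2 2 (Matrix.diagonal ![μ, 1, μ])
  have hA : ∀ k, A k = perpDil μ k := fun k => by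
    ext i; fin_cases i <;> simp [A, perpDil, Matrix.mulVec_diagonal]
  have hdet : LinearMap.det A = μ ^ 2 := by
    simp only [A]
    rw [Matrix.toLpLin_eq_toLin, LinearMap.det_toLin, Matrix.det_diagonal, Fin.prod_univ_three]
    simp; ring
  have hm := Measure.map_linearMap_addHaar_eq_smul_addHaar (volume : Measure R3) (f := A)
    (by rw [hdet]; positivity)
  have hA' : (⇑A : R3 → R3) = perpDil μ := funext hA
  rw [hdet, hA'] at hm
  have h1 := (perpDil_isClosedEmbedding hμ.ne').measurableEmbedding.integral_map
    (μ := volume) F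
  rw [← h1, hm, integral_smul_measure, abs_of_pos (by positivity),
    ENNReal.toReal_ofReal (by positivity), Complex.real_smul, Complex.ofReal_inv]

theorem integral_mul_perpScale {Ω : Opens R3} [Scalable Ω] (G : R3 → ℂ) (μ : Set.Ioi (0 : ℝ))
    (f : 𝓓(Ω, ℂ)) : ∫ k, G k * perpScale μ f k =
      (((μ : ℝ) ^ 2 : ℝ) : ℂ) * ∫ k, G (perpDil μ k) * f k := by
  have hμ : 0 < (μ : ℝ) := μ.2
  have h := integral_perpDil (fun k => G k * perpScale μ f k) hμ
  simp only [perpScale_apply, perpDil_perpDil, inv_mul_cancel₀ hμ.ne', perpDil_one] at h ⊢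
  rw [h, mul_inv_cancel_left₀]
  exact_mod_cast (by positivity : (μ : ℝ) ^ 2 ≠ 0)

theorem integral_mul_isoScale {Ω : Opens R3} [Scalable Ω] (G : R3 → ℂ) (μ : Set.Ioi (0 : ℝ))
    (f : 𝓓(Ω, ℂ)) : ∫ k, G k * isoScale μ f k =
      (((μ : ℝ) ^ 3 : ℝ) : ℂ) * ∫ k, G ((μ : ℝ) • k) * f k := by
  have hμ : 0 < (μ : ℝ) := μ.2
  have h := Measure.integral_comp_smul (volume : Measure R3)
    (fun k => G k * isoScale μ f k) (μ : ℝ)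
  simp only [isoScale_apply, smul_smul, inv_mul_cancel₀ hμ.ne', one_smul, finrank_euclideanSpace,
    Fintype.card_fin] at h ⊢
  rw [h, abs_of_pos (by positivity), Complex.real_smul, Complex.ofReal_inv, mul_inv_cancel_left₀]
  exact_mod_cast (by positivity : (μ : ℝ) ^ 3 ≠ 0)

/-! ### Locally integrable singularities -/

theorem locallyIntegrable_abs_rpow {p : ℝ} (hp : p < 1) :
    LocallyIntegrable fun x : ℝ => |x| ^ (-p) := by
  have h1 : ∀ R : ℝ, 0 ≤ R → IntegrableOn (fun x : ℝ => |x| ^ (-p)) (Set.Icc (-R) R) := by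
    intro R hR
    have e1 : IntegrableOn (fun x : ℝ => |x| ^ (-p)) (Set.Ioc 0 R) := by
      have := (intervalIntegral.intervalIntegrable_rpow' (a := 0) (b := R) (r := -p)
        (by linarith)).1
      refine this.congr_fun (fun x hx => ?_) measurableSet_Ioc
      rw [abs_of_pos hx.1]
    have e2 : IntegrableOn (fun x : ℝ => |x| ^ (-p)) (Set.Ico (-R) 0) := by
      have := ((Measure.measurePreserving_neg (volume : Measure ℝ)).integrableOn_comp_preimage
        (MeasurableEquiv.neg ℝ).measurableEmbedding (f := fun x : ℝ => |x| ^ (-p))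
        (s := Set.Ioc 0 R)).2 e1
      simpa [Function.comp_def] using this
    rw [← integrableOn_Icc_iff_integrableOn_Ioc] at e1
    exact (e2.union e1).mono_set fun x hx => (lt_or_ge x 0).imp (fun h => ⟨hx.1, h⟩)
      fun h => ⟨h, hx.2⟩
  refine locallyIntegrable_iff.2 fun K hK => ?_
  obtain ⟨R, hR, hKR⟩ := hK.isBounded.subset_closedBall_lt 0 0
  exact (h1 R hR.le).mono_set (by simpa [Real.closedBall_eq_Icc] using hKR)

theorem locallyIntegrable_prod_rpow {n : ℕ} {p : Fin n → ℝ} (hp : ∀ i, p i < 1) :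
    LocallyIntegrable fun k : EuclideanSpace ℝ (Fin n) => ∏ i, |k i| ^ (-p i) := by
  refine locallyIntegrable_iff.2 fun K hK => ?_
  obtain ⟨R, hR, hKR⟩ := hK.isBounded.subset_closedBall_lt 0 0
  have h1 : Integrable (fun x : Fin n → ℝ => ∏ i,
      (Set.Icc (-R) R).indicator (fun t => |t| ^ (-p i)) (x i)) := by
    refine Integrable.fintype_prod (f := fun i => (Set.Icc (-R) R).indicator fun t => |t| ^ (-p i))
      fun i => ?_
    exact (integrable_indicator_iff measurableSet_Icc).2
      ((locallyIntegrable_abs_rpow (hp i)).integrableOn_isCompact isCompact_Icc)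
  have h2 := ((EuclideanSpace.volume_preserving_symm_measurableEquiv_toLp (Fin n)).integrable_comp_emb
    (MeasurableEquiv.measurableEmbedding _)).2 h1
  refine (h2.integrableOn (s := K)).congr_fun (fun k hk => ?_) hK.measurableSet
  refine Finset.prod_congr rfl fun i _ => ?_
  have : k i ∈ Set.Icc (-R) R := by
    have h3 := (PiLp.norm_apply_le k i).trans (by simpa using hKR hk : ‖k‖ ≤ R)
    exact abs_le.1 h3
  exact Set.indicator_of_mem this _

/-- The majorant of all singular functions below. -/
def majorant (k : R3) : ℝ := (1 + ‖k‖ ^ 2) ^ 3 * (1 + |k 0| ^ (-(1 / 4) : ℝ)) *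
  (|k 0| ^ (-(1 / 2) : ℝ) * |k 1| ^ (-(3 / 4) : ℝ) * |k 2| ^ (-(3 / 4) : ℝ))

theorem locallyIntegrable_majorant : LocallyIntegrable majorant := by
  have h1 := locallyIntegrable_prod_rpow (n := 3) (p := ![1 / 2, 3 / 4, 3 / 4])
    (by intro i; fin_cases i <;> norm_num)
  have h2 := locallyIntegrable_prod_rpow (n := 3) (p := ![3 / 4, 3 / 4, 3 / 4])
    (by intro i; fin_cases i <;> norm_num)
  have h3 : Continuous fun k : R3 => (1 + ‖k‖ ^ 2) ^ 3 := by fun_prop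
  refine ((h1.add h2).mul_continuous h3).congr ?_
  filter_upwards [ae_coord_ne_zero (0 : Fin 3)] with k hk
  have h4 : |k 0| ^ (-(1 / 4) : ℝ) * |k 0| ^ (-(1 / 2) : ℝ) = |k 0| ^ (-(3 / 4) : ℝ) := by
    rw [← Real.rpow_add (abs_pos.2 hk)]; norm_num
  simp only [Pi.add_apply, Fin.prod_univ_three, majorant, Matrix.cons_val_zero,
    Matrix.cons_val_one, Matrix.cons_val]
  rw [← h4]; ring

theorem locallyIntegrable_of_le_majorant {g : R3 → ℂ} (hg : AEStronglyMeasurable g) {C : ℝ}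
    (h : ∀ k : R3, k 0 ≠ 0 → k 1 ≠ 0 → k 2 ≠ 0 → ‖g k‖ ≤ C * majorant k) :
    LocallyIntegrable g := by
  have h1 : LocallyIntegrable fun k => C * majorant k := locallyIntegrable_majorant.smul C
  refine h1.mono hg ?_
  filter_upwards [ae_coord_ne_zero (0 : Fin 3), ae_coord_ne_zero (1 : Fin 3),
    ae_coord_ne_zero (2 : Fin 3)] with k h0 h1 h2
  exact (h k h0 h1 h2).trans (le_abs_self _)

/-- `(1 + |log y|)²`. -/
def logSq (y : ℝ) : ℝ := (1 + |Real.log y|) ^ 2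

theorem one_le_logSq (y : ℝ) : 1 ≤ logSq y := one_le_pow₀ (by linarith [abs_nonneg (Real.log y)])

theorem abs_log_le_logSq (y : ℝ) : |Real.log y| ≤ logSq y := by
  unfold logSq; nlinarith [abs_nonneg (Real.log y)]

theorem sq_log_le_logSq (y : ℝ) : Real.log y ^ 2 ≤ logSq y := by
  unfold logSq; rw [← sq_abs]; nlinarith [abs_nonneg (Real.log y)]

theorem logSq_mul_le {x y : ℝ} (hx : x ≠ 0) (hy : y ≠ 0) : logSq (x * y) ≤ logSq x * logSq y := by
  unfold logSq
  rw [Real.log_mul hx hy, ← mul_pow]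
  have := abs_add_le (Real.log x) (Real.log y)
  gcongr
  nlinarith [abs_nonneg (Real.log x), abs_nonneg (Real.log y)]

theorem logSq_sq_le (x : ℝ) : logSq (x ^ 2) ≤ 4 * (1 + |Real.log x|) ^ 2 := by
  unfold logSq
  rw [Real.log_pow, abs_mul]
  have := abs_nonneg (Real.log x)
  norm_num
  nlinarith

theorem abs_log_le {y : ℝ} (hy : 0 < y) : |Real.log y| ≤ y + 16 * y ^ (-(1 / 16) : ℝ) := by
  have h1 := Real.log_le_sub_one_of_pos hy
  have h2 := Real.log_le_rpow_div (inv_nonneg.2 hy.le) (show (0 : ℝ) < 1 / 16 by norm_num)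
  rw [Real.log_inv, Real.inv_rpow hy.le, ← Real.rpow_neg hy.le] at h2
  have h3 : 0 < y ^ (-(1 / 16) : ℝ) := by positivity
  rw [abs_le]
  constructor <;> linarith

/-- The exponent `1/16` in `abs_log_le` becomes `1/8` after squaring, and `y ≥ k₁²` turns `y^{-1/8}`
into at most `|k₁|^{-1/4}`. The factor `512` is `2 · 16²`. -/
theorem logSq_le_of_mem {k : R3} (h0 : k 0 ≠ 0) {y : ℝ} (hy : k 0 ^ 2 ≤ y) (hy' : y ≤ ‖k‖ ^ 2) :
    logSq y ≤ 512 * ((1 + ‖k‖ ^ 2) ^ 2 * (1 + |k 0| ^ (-(1 / 4) : ℝ))) := by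
  have hk : 0 < k 0 ^ 2 := by positivity
  have hy0 : 0 < y := hk.trans_le hy
  have h1 := abs_log_le hy0
  set z := y ^ (-(1 / 16) : ℝ) with hz
  have hz0 : 0 < z := by positivity
  have h2 : z ^ 2 ≤ |k 0| ^ (-(1 / 4) : ℝ) := by
    have e1 : z ^ 2 = y ^ (-(1 / 8) : ℝ) := by
      rw [hz, ← Real.rpow_natCast, ← Real.rpow_mul hy0.le]; norm_num
    have e2 : |k 0| ^ (-(1 / 4) : ℝ) = (k 0 ^ 2) ^ (-(1 / 8) : ℝ) := by
      rw [← sq_abs, ← Real.rpow_natCast, ← Real.rpow_mul (abs_nonneg _)]; norm_num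
    rw [e1, e2]
    exact Real.rpow_le_rpow_of_nonpos hk hy (by norm_num)
  have h3 : logSq y ≤ 2 * (1 + ‖k‖ ^ 2) ^ 2 + 512 * z ^ 2 := by
    have : 1 + |Real.log y| ≤ (1 + ‖k‖ ^ 2) + 16 * z := by linarith
    unfold logSq
    calc _ ≤ ((1 + ‖k‖ ^ 2) + 16 * z) ^ 2 := by gcongr
      _ ≤ _ := by nlinarith [sq_nonneg ((1 + ‖k‖ ^ 2) - 16 * z)]
  have h4 : 1 ≤ (1 + ‖k‖ ^ 2) ^ 2 := one_le_pow₀ (by nlinarith [norm_nonneg k])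
  have h5 : 0 ≤ |k 0| ^ (-(1 / 4) : ℝ) := by positivity
  nlinarith

theorem perpSq_le_norm_sq (k : R3) : perpSq k ≤ ‖k‖ ^ 2 := by
  rw [norm_sq_R3]; unfold perpSq; nlinarith [sq_nonneg (k 1)]

/-- Weighted geometric means: `|k₁|^{1/4}|k₃|^{3/4} ≤ |k_⊥|` and `|k₁|^{1/4}|k₂|^{3/4} ≤ |k|`. All
exponents are below one, and the exponent of `|k₁|` stays so after the extra `1/4` that controls the
logarithms. -/
theorem inv_le_singular {k : R3} (h0 : k 0 ≠ 0) (h1 : k 1 ≠ 0) (h2 : k 2 ≠ 0) :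
    (√(perpSq k) * ‖k‖)⁻¹ ≤
      |k 0| ^ (-(1 / 2) : ℝ) * |k 1| ^ (-(3 / 4) : ℝ) * |k 2| ^ (-(3 / 4) : ℝ) := by
  have a0 := abs_pos.2 h0
  have a1 := abs_pos.2 h1
  have a2 := abs_pos.2 h2
  have hρ0 : |k 0| ≤ √(perpSq k) := Real.le_sqrt_of_sq_le (by
    rw [sq_abs]; unfold perpSq; nlinarith [sq_nonneg (k 2)])
  have hρ2 : |k 2| ≤ √(perpSq k) := Real.le_sqrt_of_sq_le (by
    rw [sq_abs]; unfold perpSq; nlinarith [sq_nonneg (k 0)])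
  have hr0 : |k 0| ≤ ‖k‖ := PiLp.norm_apply_le k 0
  have hr1 : |k 1| ≤ ‖k‖ := PiLp.norm_apply_le k 1
  rw [Real.rpow_neg a0.le, Real.rpow_neg a1.le, Real.rpow_neg a2.le, ← mul_inv, ← mul_inv]
  have hρ : 0 < √(perpSq k) := a0.trans_le hρ0
  have hr : 0 < ‖k‖ := a0.trans_le hr0
  refine inv_anti₀ (by positivity) ?_
  have e0 : |k 0| ^ (1 / 2 : ℝ) = |k 0| ^ (1 / 4 : ℝ) * |k 0| ^ (1 / 4 : ℝ) := by
    rw [← Real.rpow_add a0]; norm_num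
  have eρ : √(perpSq k) = √(perpSq k) ^ (1 / 4 : ℝ) * √(perpSq k) ^ (3 / 4 : ℝ) := by
    rw [← Real.rpow_add hρ]; norm_num
  have er : ‖k‖ = ‖k‖ ^ (1 / 4 : ℝ) * ‖k‖ ^ (3 / 4 : ℝ) := by
    rw [← Real.rpow_add hr]; norm_num
  calc |k 0| ^ (1 / 2 : ℝ) * |k 1| ^ (3 / 4 : ℝ) * |k 2| ^ (3 / 4 : ℝ)
      = (|k 0| ^ (1 / 4 : ℝ) * |k 2| ^ (3 / 4 : ℝ)) *
        (|k 0| ^ (1 / 4 : ℝ) * |k 1| ^ (3 / 4 : ℝ)) := by rw [e0]; ring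
    _ ≤ (√(perpSq k) ^ (1 / 4 : ℝ) * √(perpSq k) ^ (3 / 4 : ℝ)) *
        (‖k‖ ^ (1 / 4 : ℝ) * ‖k‖ ^ (3 / 4 : ℝ)) := by gcongr
    _ = _ := by rw [← eρ, ← er]

theorem logSq_div_le_majorant {k : R3} (h0 : k 0 ≠ 0) (h1 : k 1 ≠ 0) (h2 : k 2 ≠ 0) {y : ℝ}
    (hy : k 0 ^ 2 ≤ y) (hy' : y ≤ ‖k‖ ^ 2) :
    logSq y * (√(perpSq k) * ‖k‖)⁻¹ ≤ 512 * majorant k := by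
  have e1 := logSq_le_of_mem h0 hy hy'
  have e2 := inv_le_singular h0 h1 h2
  have e3 : (1 + ‖k‖ ^ 2) ^ 2 ≤ (1 + ‖k‖ ^ 2) ^ 3 :=
    pow_le_pow_right₀ (by nlinarith [norm_nonneg k]) (by norm_num)
  unfold majorant
  calc _ ≤ (512 * ((1 + ‖k‖ ^ 2) ^ 3 * (1 + |k 0| ^ (-(1 / 4) : ℝ)))) *
        (|k 0| ^ (-(1 / 2) : ℝ) * |k 1| ^ (-(3 / 4) : ℝ) * |k 2| ^ (-(3 / 4) : ℝ)) := by
        have : logSq y ≤ 512 * ((1 + ‖k‖ ^ 2) ^ 3 * (1 + |k 0| ^ (-(1 / 4) : ℝ))) :=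
          e1.trans (by gcongr)
        gcongr
    _ = _ := by ring

theorem logSq_mul_le_majorant {k : R3} (h0 : k 0 ≠ 0) (h1 : k 1 ≠ 0) (h2 : k 2 ≠ 0) {w : ℝ}
    (hw : w * (√(perpSq k) * ‖k‖) ≤ 1 + ‖k‖ ^ 2) :
    logSq (perpSq k) * w ≤ 512 * majorant k := by
  have e1 := logSq_le_of_mem h0 (y := perpSq k) (by unfold perpSq; nlinarith [sq_nonneg (k 2)])
    (perpSq_le_norm_sq k)
  have e2 := inv_le_singular h0 h1 h2
  have hρ : 0 < √(perpSq k) := Real.sqrt_pos.2 (perpSq_pos h0)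
  have hr : 0 < ‖k‖ := norm_pos_iff.2 fun h => h0 (by simp [h])
  have e3 : w ≤ (1 + ‖k‖ ^ 2) * (√(perpSq k) * ‖k‖)⁻¹ := by
    rw [← div_eq_mul_inv, le_div_iff₀ (by positivity)]; exact hw
  unfold majorant
  calc logSq (perpSq k) * w ≤ logSq (perpSq k) * ((1 + ‖k‖ ^ 2) * (√(perpSq k) * ‖k‖)⁻¹) :=
        mul_le_mul_of_nonneg_left e3 (zero_le_one.trans (one_le_logSq _))
    _ ≤ (512 * ((1 + ‖k‖ ^ 2) ^ 2 * (1 + |k 0| ^ (-(1 / 4) : ℝ)))) *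
        ((1 + ‖k‖ ^ 2) *
        (|k 0| ^ (-(1 / 2) : ℝ) * |k 1| ^ (-(3 / 4) : ℝ) * |k 2| ^ (-(3 / 4) : ℝ))) := by
        gcongr
    _ = _ := by ring

/-! ### Scaling degrees of distributions with logarithmic or homogeneous scaling -/

section ScalingDegree

variable {E : Type*} [NormedAddCommGroup E] [NormedSpace ℝ E] {Ω : Opens E}
variable {d : ℕ} {scale : Set.Ioi (0 : ℝ) → 𝓓(Ω, ℂ) → 𝓓(Ω, ℂ)} {V : Set E} {T : Dist Ω}

theorem mem_decaySet_of_lt {a : ℝ} (h : scalingDegree d scale V T < a) :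
    a ∈ decaySet d scale V T := by
  rw [scalingDegree_eq] at h
  obtain ⟨_, ⟨b, hb, rfl⟩, hba⟩ := sInf_lt_iff.1 h
  exact decaySet_mono (EReal.coe_lt_coe_iff.1 hba).le hb

theorem scalingDegree_le_of_bound {p : ℝ}
    (h : ∀ f : 𝓓(Ω, ℂ), tsupport f ⊆ V → ∃ C : ℝ, ∀ μ : Set.Ioi (0 : ℝ), (μ : ℝ) < 1 →
      ‖T (scale μ f)‖ ≤ (μ : ℝ) ^ p * (C * (1 + |Real.log μ|) ^ 2)) :
    scalingDegree d scale V T ≤ ((d - p : ℝ) : EReal) :=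
  scalingDegree_le_of_forall fun _ ha => mem_decaySet_of_bound (by linarith) h

theorem le_scalingDegree_of_homogeneous {p : ℝ} {f : 𝓓(Ω, ℂ)} (hf : tsupport f ⊆ V)
    (hT : ∀ μ : Set.Ioi (0 : ℝ), T (scale μ f) = (((μ : ℝ) ^ p : ℝ) : ℂ) * T f) (h0 : T f ≠ 0) :
    ((d - p : ℝ) : EReal) ≤ scalingDegree d scale V T :=
  le_scalingDegree_of_forall fun _ ha => by
    have := lt_of_mem_decaySet ha hf h0 (G := fun _ => T f) hT (Eventually.of_forall fun _ => le_rfl)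
    linarith

/-- As `A ≠ 0`, the logarithm dominates `B`, so the bracket is at least one in absolute value for
small `μ`. -/
theorem le_scalingDegree_of_log {p : ℝ} {f : 𝓓(Ω, ℂ)} (hf : tsupport f ⊆ V) {A B : ℂ}
    (hT : ∀ μ : Set.Ioi (0 : ℝ), T (scale μ f) =
      (((μ : ℝ) ^ p : ℝ) : ℂ) * ((Real.log μ : ℂ) * A + B)) (h0 : A ≠ 0) :
    ((d - p : ℝ) : EReal) ≤ scalingDegree d scale V T :=
  le_scalingDegree_of_forall fun _ ha => by
    have := lt_of_mem_decaySet ha hf one_ne_zero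
      (G := fun x => (Real.log x : ℂ) * A + B) hT (by
        have h1 : Tendsto (fun x : ℝ => |Real.log x|) (𝓝[>] 0) atTop :=
          tendsto_abs_atBot_atTop.comp Real.tendsto_log_nhdsGT_zero
        filter_upwards [h1.eventually_ge_atTop ((1 + ‖B‖) / ‖A‖)] with x hx
        have hA : 0 < ‖A‖ := norm_pos_iff.2 h0
        rw [div_le_iff₀ hA] at hx
        have h2 := norm_sub_norm_le ((Real.log x : ℂ) * A) (-B)
        rw [norm_neg, sub_neg_eq_add, norm_mul, Complex.norm_real, Real.norm_eq_abs] at h2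
        rw [norm_one]; linarith)
    linarith

end ScalingDegree

/-! ### The transversal Laplacian -/

/-- The unit vector in direction `i`. -/
abbrev dir (i : Fin 3) : R3 := EuclideanSpace.single i 1

/-- The derivative of test functions in the direction `v`. -/
def derivCLM {E : Type*} [NormedAddCommGroup E] [NormedSpace ℝ E] {Ω : Opens E} (v : E) :
    𝓓(Ω, ℂ) →L[ℂ] 𝓓(Ω, ℂ) := TestFunction.lineDerivCLM ℂ v

theorem derivCLM_apply {E : Type*} [NormedAddCommGroup E] [NormedSpace ℝ E] {Ω : Opens E} (v : E)
    (f : 𝓓(Ω, ℂ)) : derivCLM v f = ∂_{v} f := rfl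

/-- `∂₁² + ∂₃²`. -/
def perpLap {Ω : Opens R3} : 𝓓(Ω, ℂ) →L[ℂ] 𝓓(Ω, ℂ) :=
  derivCLM (dir 0) ∘L derivCLM (dir 0) + derivCLM (dir 2) ∘L derivCLM (dir 2)

theorem perpLap_apply {Ω : Opens R3} (f : 𝓓(Ω, ℂ)) :
    perpLap f = ∂_{dir 0} (∂_{dir 0} f) + ∂_{dir 2} (∂_{dir 2} f) := rfl

theorem lineDeriv_smul {Ω : Opens R3} (v : R3) (c : ℂ) (f : 𝓓(Ω, ℂ)) :
    (∂_{v} (c • f) : 𝓓(Ω, ℂ)) = c • (∂_{v} f : 𝓓(Ω, ℂ)) :=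
  map_smul (derivCLM v) c f

theorem perpLap_perpScale {Ω : Opens R3} [Scalable Ω] (μ : Set.Ioi (0 : ℝ)) (f : 𝓓(Ω, ℂ)) :
    perpLap (perpScale μ f) = ((((μ : ℝ)⁻¹ ^ 2 : ℝ)) : ℂ) • perpScale μ (perpLap f) := by
  have h : ∀ i : Fin 3, i ≠ 1 → (∂_{dir i} (∂_{dir i} (perpScale μ f)) : 𝓓(Ω, ℂ)) =
      ((((μ : ℝ)⁻¹ ^ 2 : ℝ)) : ℂ) • perpScale μ (∂_{dir i} (∂_{dir i} f)) := fun i hi => by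
    rw [lineDeriv_perpScale μ f hi, lineDeriv_smul, lineDeriv_perpScale μ _ hi, smul_smul,
      ← Complex.ofReal_mul, sq]
  rw [perpLap_apply, h 0 (by decide), h 2 (by decide), ← smul_add, perpLap_apply]
  congr 1

theorem perpLap_pow_perpScale {Ω : Opens R3} [Scalable Ω] (n : ℕ) (μ : Set.Ioi (0 : ℝ))
    (f : 𝓓(Ω, ℂ)) : (perpLap ^ n) (perpScale μ f) =
      ((((μ : ℝ)⁻¹ ^ (2 * n) : ℝ)) : ℂ) • perpScale μ ((perpLap ^ n) f) := by
  induction n with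
  | zero => simp
  | succ n ih =>
    rw [pow_succ', mul_apply_eq_comp, ih, map_smul, perpLap_perpScale, smul_smul,
      ← Complex.ofReal_mul, mul_apply_eq_comp, ← pow_add]
    rfl

theorem lineDeriv_isoScale {Ω : Opens R3} [Scalable Ω] (μ : Set.Ioi (0 : ℝ)) (f : 𝓓(Ω, ℂ))
    (v : R3) : (∂_{v} (isoScale μ f) : 𝓓(Ω, ℂ)) =
      (((μ : ℝ)⁻¹ : ℝ) : ℂ) • isoScale μ (∂_{v} f) := by
  ext k
  rw [lineDeriv_test', smul_apply, isoScale_apply, lineDeriv_test', smul_eq_mul]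
  simp only [isoScale_apply, smul_add]
  have := deriv_comp_mul_left (μ : ℝ)⁻¹ (fun t : ℝ => f ((μ : ℝ)⁻¹ • k + t • v)) 0
  simp only [mul_smul] at this
  rw [this, mul_zero, Complex.real_smul]

theorem perpLap_isoScale {Ω : Opens R3} [Scalable Ω] (μ : Set.Ioi (0 : ℝ)) (f : 𝓓(Ω, ℂ)) :
    perpLap (isoScale μ f) = ((((μ : ℝ)⁻¹ ^ 2 : ℝ)) : ℂ) • isoScale μ (perpLap f) := by
  have h : ∀ v : R3, (∂_{v} (∂_{v} (isoScale μ f)) : 𝓓(Ω, ℂ)) =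
      ((((μ : ℝ)⁻¹ ^ 2 : ℝ)) : ℂ) • isoScale μ (∂_{v} (∂_{v} f)) := fun v => by
    rw [lineDeriv_isoScale, lineDeriv_smul, lineDeriv_isoScale, smul_smul,
      ← Complex.ofReal_mul, sq]
  rw [perpLap_apply, h, h, ← smul_add, perpLap_apply]
  congr 1

theorem lineDeriv_incl {E : Type*} [NormedAddCommGroup E] [NormedSpace ℝ E] {Ω Ω' : Opens E}
    (h : Ω ≤ Ω') (v : E) (f : 𝓓(Ω, ℂ)) :
    (∂_{v} (incl h f) : 𝓓(Ω', ℂ)) = incl h (∂_{v} f) := by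
  ext x
  rw [lineDeriv_test, incl_apply, lineDeriv_test]; rfl

theorem perpLap_incl {Ω Ω' : Opens R3} (h : Ω ≤ Ω') (f : 𝓓(Ω, ℂ)) :
    perpLap (incl h f) = incl h (perpLap f) := by
  rw [perpLap_apply, lineDeriv_incl, lineDeriv_incl, lineDeriv_incl, lineDeriv_incl, perpLap_apply]
  rfl

theorem perpLap_pow_incl {Ω Ω' : Opens R3} (h : Ω ≤ Ω') (n : ℕ) (f : 𝓓(Ω, ℂ)) :
    (perpLap ^ n) (incl h f) = incl h ((perpLap ^ n) f) := by
  induction n with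
  | zero => simp
  | succ n ih => rw [pow_succ', mul_apply_eq_comp, ih, perpLap_incl, pow_succ', mul_apply_eq_comp]

theorem perpSq_add_smul (k : R3) (t : ℝ) {i : Fin 3} (hi : i ≠ 1) :
    perpSq (k + t • dir i) = perpSq k + 2 * k i * t + t ^ 2 := by
  fin_cases i <;> simp [perpSq] at hi ⊢ <;> ring

theorem hasDerivAt_perpSq (k : R3) {i : Fin 3} (hi : i ≠ 1) :
    HasDerivAt (fun t : ℝ => perpSq (k + t • dir i)) (2 * k i) 0 := by
  simp only [perpSq_add_smul k _ hi]
  have h1 := ((hasDerivAt_id (0 : ℝ)).const_mul (2 * k i)).const_add (perpSq k)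
  have h2 := h1.add (hasDerivAt_pow 2 (0 : ℝ))
  exact h2.congr_deriv (by simp)

theorem hasDerivAt_coord (k : R3) (i : Fin 3) :
    HasDerivAt (fun t : ℝ => (k + t • dir i) i) 1 0 := by
  have : (fun t : ℝ => (k + t • dir i) i) = fun t => k i + t := by
    funext t; simp
  rw [this]
  simpa using (hasDerivAt_id (0 : ℝ)).const_add (k i)

theorem perpSq_pos_of_mem {k : R3} (hk : k ∈ offAxis) : 0 < perpSq k :=
  lt_of_le_of_ne (perpSq_nonneg k) (Ne.symm hk)

/-- The transversal Laplacian of a radial function, in the sense of distributions off the axis. -/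
theorem integral_mul_perpLap {h h₁ h₂ : ℝ → ℝ} (hh : ContDiffOn ℝ ∞ h (Set.Ioi 0))
    (hh₁ : ContDiffOn ℝ ∞ h₁ (Set.Ioi 0)) (hd : ∀ t, 0 < t → HasDerivAt h (h₁ t) t)
    (hd₁ : ∀ t, 0 < t → HasDerivAt h₁ (h₂ t) t) (f : 𝓓(offAxis, ℂ)) :
    ∫ k, (h (perpSq k) : ℂ) * perpLap f k =
      ∫ k, ((4 * perpSq k * h₂ (perpSq k) + 4 * h₁ (perpSq k) : ℝ) : ℂ) * f k := by
  have hc : ∀ g : ℝ → ℝ, ContDiffOn ℝ ∞ g (Set.Ioi 0) →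
      ContDiffOn ℝ ∞ (fun k : R3 => (g (perpSq k) : ℂ)) offAxis := fun g hg =>
    Complex.ofRealCLM.contDiff.comp_contDiffOn
      (hg.comp contDiff_perpSq.contDiffOn fun k hk => perpSq_pos_of_mem hk)
  -- A second transversal derivative of `h(|k_⊥|²)` is `2h' + 4kᵢ²h''`; adding the two directions
  -- turns `kᵢ²` into `|k_⊥|²`.
  have key : ∀ i : Fin 3, i ≠ 1 →
      ∫ k, (h (perpSq k) : ℂ) * (∂_{dir i} (∂_{dir i} f) : 𝓓(offAxis, ℂ)) k =
        ∫ k, ((2 * h₁ (perpSq k) + 4 * k i ^ 2 * h₂ (perpSq k) : ℝ) : ℂ) * f k := by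
    intro i hi
    rw [integral_mul_lineDeriv (g' := fun k => ((2 * k i * h₁ (perpSq k) : ℝ) : ℂ)) (hc h hh),
      integral_mul_lineDeriv
        (g' := fun k => ((2 * h₁ (perpSq k) + 4 * k i ^ 2 * h₂ (perpSq k) : ℝ) : ℂ)), neg_neg]
    · have h1 : ContDiffOn ℝ ∞ (fun k : R3 => ((2 * k i : ℝ) : ℂ)) offAxis :=
        (Complex.ofRealCLM.contDiff.comp (g := Complex.ofRealCLM)
          (f := fun k : R3 => 2 * k i) (by fun_prop)).contDiffOn
      refine (h1.mul (hc h₁ hh₁)).congr fun k _ => ?_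
      push_cast; ring
    · intro k hk
      have e1 := (hd₁ _ (perpSq_pos_of_mem hk)).comp_of_eq 0 (hasDerivAt_perpSq k hi) (by simp)
      have e2 := ((hasDerivAt_coord k i).const_mul 2).mul e1
      refine HasDerivAt.congr_deriv e2.ofReal_comp ?_
      simp; ring
    · intro k hk
      have e1 := (hd _ (perpSq_pos_of_mem hk)).comp_of_eq 0 (hasDerivAt_perpSq k hi) (by simp)
      refine HasDerivAt.congr_deriv e1.ofReal_comp ?_
      simp; ring
  have hI : ∀ g : 𝓓(offAxis, ℂ), Integrable fun k => (h (perpSq k) : ℂ) * g k := fun g =>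
    integrable_mul_test ((hc h hh).continuousOn.locallyIntegrableOn
      offAxis.isOpen.measurableSet) g
  have h1 : (fun k => (h (perpSq k) : ℂ) * perpLap f k) = fun k =>
      (h (perpSq k) : ℂ) * (∂_{dir 0} (∂_{dir 0} f) : 𝓓(offAxis, ℂ)) k +
      (h (perpSq k) : ℂ) * (∂_{dir 2} (∂_{dir 2} f) : 𝓓(offAxis, ℂ)) k := by
    funext k; rw [perpLap_apply, _root_.add_apply, mul_add]
  have h₂c : ContinuousOn h₂ (Set.Ioi 0) :=
    ((hh₁.continuousOn_deriv_of_isOpen isOpen_Ioi (by simp)).congr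
      fun t ht => (hd₁ t ht).deriv.symm)
  have hI2 : ∀ i : Fin 3, Integrable fun k : R3 =>
      ((2 * h₁ (perpSq k) + 4 * k i ^ 2 * h₂ (perpSq k) : ℝ) : ℂ) * f k := fun i => by
    refine integrable_mul_test (ContinuousOn.locallyIntegrableOn ?_
      offAxis.isOpen.measurableSet) f
    refine Complex.continuous_ofReal.comp_continuousOn ?_
    have hp : ContinuousOn perpSq offAxis := contDiff_perpSq.continuous.continuousOn
    have e1 := hh₁.continuousOn.comp hp fun k hk => perpSq_pos_of_mem hk
    have e2 := h₂c.comp hp fun k hk => perpSq_pos_of_mem hk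
    have e3 : ContinuousOn (fun k : R3 => k i) offAxis :=
      Continuous.continuousOn (by fun_prop)
    exact (continuousOn_const.mul e1).add ((continuousOn_const.mul (e3.pow 2)).mul e2)
  rw [h1, integral_add (hI _) (hI _), key 0 (by decide), key 2 (by decide),
    ← integral_add (hI2 0) (hI2 2)]
  congr 1
  funext k
  rw [← add_mul]
  congr 1
  rw [← Complex.ofReal_add]
  congr 1
  unfold perpSq; ring

/-! ### Test functions off the axis -/

/-- The test function is a bump divided by `w`, placed at a point off the axis with `k₂ ≠ 0`; the
integral is then that of the bump. It supplies the nonzero values behind the lower bounds of scaling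
degrees. -/
theorem exists_test_integral_ne_zero {w : R3 → ℂ} (hw : ContDiffOn ℝ ∞ w offAxis)
    (h0 : ∀ k ∈ offAxis, w k ≠ 0) :
    ∃ f : 𝓓(offAxis, ℂ), tsupport f ⊆ {k | k 1 ≠ 0} ∧ ∫ k, w k * f k ≠ 0 := by
  let x : R3 := !₂[1, 1, 0]
  have hU : IsOpen ((offAxis : Set R3) ∩ {k | k 1 ≠ 0}) :=
    offAxis.isOpen.inter (isOpen_ne_fun (by fun_prop) continuous_const)
  have hx : x ∈ (offAxis : Set R3) ∩ {k | k 1 ≠ 0} := by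
    refine ⟨?_, by simp [x]⟩
    change perpSq x ≠ 0
    simp [x, perpSq]
  obtain ⟨ε, hε, hb⟩ := Metric.isOpen_iff.1 hU x hx
  let b : ContDiffBump x := ⟨ε / 4, ε / 2, by positivity, by linarith⟩
  have hbs : tsupport b ⊆ (offAxis : Set R3) ∩ {k | k 1 ≠ 0} := by
    rw [b.tsupport_eq]
    exact (Metric.closedBall_subset_ball (by change ε / 2 < ε; linarith)).trans hb
  let B : 𝓓(offAxis, ℂ) := mkTest (fun k => (b k : ℂ)) (Complex.ofRealCLM.contDiff.comp b.contDiff)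
    (tsupport b) b.hasCompactSupport (fun k hk => (hbs hk).1)
    (fun s hs => by simp [image_eq_zero_of_notMem_tsupport hs])
  have hB : ∀ k, B k = (b k : ℂ) := fun k => rfl
  have hw' : ContDiffOn ℝ ∞ (fun k => (w k)⁻¹) offAxis := hw.inv h0
  refine ⟨mulCLM hw' B, ?_, ?_⟩
  · refine Set.Subset.trans (closure_mono fun k hk => ?_) (hbs.trans fun k hk => hk.2)
    rw [Function.mem_support, mulCLM_apply, hB] at hk
    intro h
    exact hk (by rw [h]; simp)
  · have h1 : ∀ k, w k * mulCLM hw' B k = ((b k : ℝ) : ℂ) := fun k => by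
      rw [mulCLM_apply, hB]
      by_cases hk : k ∈ offAxis
      · rw [mul_inv_cancel_left₀ (h0 k hk)]
      · rw [image_eq_zero_of_notMem_tsupport fun h => hk (hbs h).1]; simp
    simp only [h1]
    rw [integral_complex_ofReal]
    exact_mod_cast (b.integral_pos (μ := volume)).ne'

theorem perpSq_perpDil (μ : ℝ) (k : R3) :
    perpSq (perpDil μ k) = μ ^ 2 * perpSq k := by
  simp [perpSq, perpDil]; ring

theorem perpSq_smul (μ : ℝ) (k : R3) : perpSq (μ • k) = μ ^ 2 * perpSq k := by
  simp [perpSq]; ring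

theorem aestronglyMeasurable_of_continuousOn {g : R3 → ℂ} (hg : ContinuousOn g offAxis) :
    AEStronglyMeasurable g := by
  have h := hg.aestronglyMeasurable offAxis.isOpen.measurableSet (μ := volume)
  rwa [Measure.restrict_eq_self_of_ae_mem] at h
  filter_upwards [ae_coord_ne_zero (0 : Fin 3)] with k hk using (perpSq_pos hk).ne'

/-! ### The logarithm -/

theorem contDiffOn_log_perpSq : ContDiffOn ℝ ∞ (fun k : R3 => (Real.log (perpSq k) : ℂ)) offAxis :=
  Complex.ofRealCLM.contDiff.comp_contDiffOn (contDiff_perpSq.contDiffOn.log fun _ hk => hk)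

/-- Sufficient condition for local integrability of a function of size `log²(|k_⊥|²) w`. -/
theorem locallyIntegrable_of_logSq {g : R3 → ℂ} (hg : ContinuousOn g offAxis) {C : ℝ} (hC : 0 ≤ C)
    {w : R3 → ℝ} (hw : ∀ k : R3, w k * (√(perpSq k) * ‖k‖) ≤ 1 + ‖k‖ ^ 2)
    (h : ∀ k ∈ offAxis, ‖g k‖ ≤ C * (logSq (perpSq k) * w k)) : LocallyIntegrable g := by
  refine locallyIntegrable_of_le_majorant (C := C * 512)
    (aestronglyMeasurable_of_continuousOn hg) fun k h0 h1 h2 => ?_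
  refine (h k (perpSq_pos h0).ne').trans ?_
  rw [mul_assoc]
  exact mul_le_mul_of_nonneg_left (logSq_mul_le_majorant h0 h1 h2 (hw k)) hC

theorem sqrt_perpSq_le_norm (k : R3) : √(perpSq k) ≤ ‖k‖ :=
  Real.sqrt_le_iff.2 ⟨norm_nonneg k, perpSq_le_norm_sq k⟩

theorem one_mul_le (k : R3) : 1 * (√(perpSq k) * ‖k‖) ≤ 1 + ‖k‖ ^ 2 := by
  nlinarith [sqrt_perpSq_le_norm k, norm_nonneg k]

theorem inv_norm_mul_le (k : R3) : ‖k‖⁻¹ * (√(perpSq k) * ‖k‖) ≤ 1 + ‖k‖ ^ 2 := by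
  rcases eq_or_ne k 0 with rfl | h
  · simp
  · have : 0 < ‖k‖ := norm_pos_iff.2 h
    rw [mul_comm, mul_assoc, mul_inv_cancel₀ this.ne', mul_one]
    nlinarith [sqrt_perpSq_le_norm k, sq_nonneg (‖k‖ - 1)]

/-- `ln(c |k_⊥|²)`. -/
def logFun (c : ℝ) (k : R3) : ℂ := (Real.log (c * perpSq k) : ℂ)

/-- `ln(c |k_⊥|²) / (2|k|)`. -/
def logFunW (c : ℝ) (k : R3) : ℂ := (1 / 2) * (((‖k‖ : ℝ) : ℂ) ^ 1)⁻¹ * logFun c k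

theorem logFun_eq {c : ℝ} (hc : 0 < c) {k : R3} (hk : k ∈ offAxis) :
    logFun c k = (Real.log c : ℂ) + (Real.log (perpSq k) : ℂ) := by
  rw [logFun, Real.log_mul hc.ne' hk, Complex.ofReal_add]

theorem contDiffOn_logFun {c : ℝ} (hc : 0 < c) : ContDiffOn ℝ ∞ (logFun c) offAxis :=
  (contDiffOn_const.add contDiffOn_log_perpSq).congr fun _ hk => logFun_eq hc hk

theorem norm_logFun_le {c : ℝ} (hc : 0 < c) {k : R3} (hk : k ∈ offAxis) :
    ‖logFun c k‖ ≤ logSq c * logSq (perpSq k) := by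
  rw [logFun, Complex.norm_real, Real.norm_eq_abs]
  exact (abs_log_le_logSq _).trans (logSq_mul_le hc.ne' hk)

theorem locallyIntegrable_logFun {c : ℝ} (hc : 0 < c) : LocallyIntegrable (logFun c) :=
  locallyIntegrable_of_logSq (contDiffOn_logFun hc).continuousOn
    (zero_le_one.trans (one_le_logSq c)) one_mul_le fun k hk => by
      rw [mul_one]; exact norm_logFun_le hc hk

theorem locallyIntegrable_logFunW {c : ℝ} (hc : 0 < c) : LocallyIntegrable (logFunW c) := by
  refine locallyIntegrable_of_logSq ?_ (zero_le_one.trans (one_le_logSq c)) inv_norm_mul_le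
    fun k hk => ?_
  · exact ((contDiffOn_weight 1 (1 / 2)).continuousOn.mono offAxis_le).mul
      (contDiffOn_logFun hc).continuousOn
  · rw [logFunW, norm_mul, norm_mul, norm_inv, pow_one, Complex.norm_real, norm_norm]
    have := norm_logFun_le hc hk
    have h1 : ‖(1 / 2 : ℂ)‖ ≤ 1 := by norm_num
    calc _ ≤ 1 * ‖k‖⁻¹ * (logSq c * logSq (perpSq k)) := by gcongr
      _ = _ := by ring

theorem locallyIntegrable_inv_norm :
    LocallyIntegrable fun k : R3 => (1 : ℂ) * (((‖k‖ : ℝ) : ℂ) ^ 1)⁻¹ := by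
  refine locallyIntegrable_of_logSq
    ((contDiffOn_weight 1 1).continuousOn.mono offAxis_le) zero_le_one inv_norm_mul_le
    fun k hk => ?_
  rw [one_mul, one_mul, pow_one, norm_inv, Complex.norm_real, norm_norm]
  nlinarith [one_le_logSq (perpSq k), inv_nonneg.2 (norm_nonneg k)]

/-- Scaling of a regular distribution whose density is homogeneous up to a logarithm. -/
theorem regular_scale_log {Ω : Opens R3} {g w : R3 → ℂ} (hg : LocallyIntegrable g)
    (hw : LocallyIntegrable w) {d : ℕ} {scale : Set.Ioi (0 : ℝ) → 𝓓(Ω, ℂ) → 𝓓(Ω, ℂ)}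
    {δ : ℝ → R3 → R3} (hscale : ∀ (G : R3 → ℂ) (μ : Set.Ioi (0 : ℝ)) (f : 𝓓(Ω, ℂ)),
      ∫ k, G k * scale μ f k = (((μ : ℝ) ^ d : ℝ) : ℂ) * ∫ k, G (δ μ k) * f k) {q : ℝ}
    (hgw : ∀ μ : ℝ, 0 < μ → ∀ k ∈ offAxis,
      g (δ μ k) = ((μ ^ (-q) : ℝ) : ℂ) * ((Real.log μ : ℂ) * w k + g k))
    (f : 𝓓(Ω, ℂ)) (μ : Set.Ioi (0 : ℝ)) : regular Ω g (scale μ f) =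
      (((μ : ℝ) ^ (d - q) : ℝ) : ℂ) *
        ((Real.log μ : ℂ) * (∫ k, w k * f k) + ∫ k, g k * f k) := by
  have hμ : 0 < (μ : ℝ) := μ.2
  rw [regular_apply (hg.locallyIntegrableOn _), hscale]
  have h1 : ∫ k, g (δ μ k) * f k = ∫ k, (((μ : ℝ) ^ (-q) : ℝ) : ℂ) *
      ((Real.log μ : ℂ) * (w k * f k) + g k * f k) := by
    refine integral_congr_ae ?_
    filter_upwards [ae_coord_ne_zero (0 : Fin 3)] with k hk
    rw [hgw μ hμ k (perpSq_pos hk).ne']; ring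
  rw [h1, integral_const_mul, integral_add
    ((integrable_mul_test (hw.locallyIntegrableOn _) f).const_mul _)
    (integrable_mul_test (hg.locallyIntegrableOn _) f), integral_const_mul, ← mul_assoc,
    ← Complex.ofReal_mul]
  congr 2
  rw [sub_eq_add_neg, Real.rpow_add hμ, Real.rpow_natCast]

section ScalingDegree

variable {E : Type*} [NormedAddCommGroup E] [NormedSpace ℝ E] {Ω : Opens E}
variable {d : ℕ} {scale : Set.Ioi (0 : ℝ) → 𝓓(Ω, ℂ) → 𝓓(Ω, ℂ)} {V : Set E} {T : Dist Ω}

theorem scalingDegree_le_of_log {p : ℝ} (h : ∀ f : 𝓓(Ω, ℂ), ∃ A B : ℂ, ∀ μ : Set.Ioi (0 : ℝ),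
      T (scale μ f) = (((μ : ℝ) ^ p : ℝ) : ℂ) * ((Real.log μ : ℂ) * A + B)) :
    scalingDegree d scale V T ≤ ((d - p : ℝ) : EReal) :=
  scalingDegree_le_of_bound fun f _ => by
    obtain ⟨A, B, hAB⟩ := h f
    refine ⟨‖A‖ + ‖B‖, fun μ _ => ?_⟩
    have hμ : 0 < (μ : ℝ) := μ.2
    rw [hAB, norm_mul, Complex.norm_real, Real.norm_of_nonneg (by positivity)]
    gcongr
    have h1 := abs_log_le_logSq μ
    have h2 := one_le_logSq μ
    unfold logSq at h1 h2
    calc _ ≤ ‖(Real.log μ : ℂ) * A‖ + ‖B‖ := norm_add_le _ _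
      _ = |Real.log μ| * ‖A‖ + 1 * ‖B‖ := by
        rw [norm_mul, Complex.norm_real, Real.norm_eq_abs, one_mul]
      _ ≤ (1 + |Real.log μ|) ^ 2 * ‖A‖ + (1 + |Real.log μ|) ^ 2 * ‖B‖ := by gcongr
      _ = _ := by ring

end ScalingDegree

theorem logFun_perpDil {c : ℝ} (hc : 0 < c) (μ : ℝ) (hμ : 0 < μ) (k : R3) (hk : k ∈ offAxis) :
    logFun c (perpDil μ k) =
      ((μ ^ (-(0 : ℝ)) : ℝ) : ℂ) * ((Real.log μ : ℂ) * 2 + logFun c k) := by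
  rw [logFun, logFun, perpSq_perpDil, mul_left_comm,
    Real.log_mul (by positivity) (mul_ne_zero hc.ne' hk), Real.log_pow]
  simp; ring

theorem logFun_smul {c : ℝ} (hc : 0 < c) (μ : ℝ) (hμ : 0 < μ) (k : R3) (hk : k ∈ offAxis) :
    logFun c (μ • k) =
      ((μ ^ (-(0 : ℝ)) : ℝ) : ℂ) * ((Real.log μ : ℂ) * 2 + logFun c k) := by
  rw [logFun, logFun, perpSq_smul, mul_left_comm,
    Real.log_mul (by positivity) (mul_ne_zero hc.ne' hk), Real.log_pow]
  simp; ring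

theorem logFunW_smul {c : ℝ} (hc : 0 < c) (μ : ℝ) (hμ : 0 < μ) (k : R3) (hk : k ∈ offAxis) :
    logFunW c (μ • k) = ((μ ^ (-(1 : ℝ)) : ℝ) : ℂ) *
      ((Real.log μ : ℂ) * (1 * (((‖k‖ : ℝ) : ℂ) ^ 1)⁻¹) + logFunW c k) := by
  rw [logFunW, logFunW, logFun_smul hc μ hμ k hk, norm_smul, Real.norm_of_nonneg hμ.le,
    Real.rpow_neg_one]
  simp only [neg_zero, Real.rpow_zero, pow_one, Complex.ofReal_mul, Complex.ofReal_one,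
    Complex.ofReal_inv, mul_inv]
  ring

theorem locallyIntegrable_two : LocallyIntegrable fun _ : R3 => (2 : ℂ) :=
  continuous_const.locallyIntegrable

theorem restrict_regular {Ω Ω' : Opens R3} (h : Ω ≤ Ω') {g : R3 → ℂ} (hg : LocallyIntegrable g) :
    restrict (Ω := Ω) (regular Ω' g) = regular Ω g := by
  ext f
  rw [restrict_apply' h, regular_apply (hg.locallyIntegrableOn _),
    regular_apply (hg.locallyIntegrableOn _)]
  rfl

theorem sdAxis_logFun_le {Ω : Opens R3} [Scalable Ω] {c : ℝ} (hc : 0 < c) :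
    sdAxis (regular Ω (logFun c)) ≤ 0 := by
  have h := scalingDegree_le_of_log (T := regular Ω (logFun c)) (d := 2) (scale := perpScale)
    (V := {k | k 1 ≠ 0}) fun f => ⟨_, _, fun μ => regular_scale_log (locallyIntegrable_logFun hc)
      locallyIntegrable_two integral_mul_perpScale (logFun_perpDil hc) f μ⟩
  simpa [sdAxis] using h

/-- Scaling adds `2 log μ` to the density. The lower bound comes from this term, whose coefficient
is the integral of `2f`. -/
theorem sdAxis_logFun {Ω : Opens R3} [Scalable Ω] (hΩ : offAxis ≤ Ω) {c : ℝ} (hc : 0 < c) :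
    sdAxis (regular Ω (logFun c)) = 0 := by
  refine le_antisymm (sdAxis_logFun_le hc) ?_
  obtain ⟨f, hf, h0⟩ := exists_test_integral_ne_zero (w := fun _ => 2) contDiffOn_const
    (fun _ _ => two_ne_zero)
  have h := le_scalingDegree_of_log (T := regular Ω (logFun c)) (d := 2) (scale := perpScale)
    (V := {k | k 1 ≠ 0}) (f := incl hΩ f) hf (regular_scale_log (locallyIntegrable_logFun hc)
      locallyIntegrable_two integral_mul_perpScale (logFun_perpDil hc) (incl hΩ f)) h0
  simpa [sdAxis] using h

theorem sdOrigin_logFun {Ω : Opens R3} [Scalable Ω] (hΩ : offAxis ≤ Ω) {c : ℝ} (hc : 0 < c) :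
    sdOrigin (regular Ω (logFun c)) = 0 := by
  refine le_antisymm ?_ ?_
  · have h := scalingDegree_le_of_log (T := regular Ω (logFun c)) (d := 3) (scale := isoScale)
      (V := Set.univ) fun f => ⟨_, _, fun μ => regular_scale_log (locallyIntegrable_logFun hc)
        locallyIntegrable_two integral_mul_isoScale (logFun_smul hc) f μ⟩
    simpa [sdOrigin] using h
  · obtain ⟨f, -, h0⟩ := exists_test_integral_ne_zero (w := fun _ => 2) contDiffOn_const
      (fun _ _ => two_ne_zero)
    have h := le_scalingDegree_of_log (T := regular Ω (logFun c)) (d := 3) (scale := isoScale)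
      (V := Set.univ) (f := incl hΩ f) (Set.subset_univ _)
      (regular_scale_log (locallyIntegrable_logFun hc)
        locallyIntegrable_two integral_mul_isoScale (logFun_smul hc) (incl hΩ f)) h0
    simpa [sdOrigin] using h

theorem sdOrigin_logFunW {Ω : Opens R3} [Scalable Ω] (hΩ : offAxis ≤ Ω) {c : ℝ} (hc : 0 < c) :
    sdOrigin (regular Ω (logFunW c)) = 1 := by
  have h3 : ((3 : ℕ) : ℝ) - (((3 : ℕ) : ℝ) - 1) = 1 := by norm_num
  refine le_antisymm ?_ ?_
  · have h := scalingDegree_le_of_log (T := regular Ω (logFunW c)) (d := 3) (scale := isoScale)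
      (V := Set.univ) fun f => ⟨_, _, fun μ => regular_scale_log (locallyIntegrable_logFunW hc)
        locallyIntegrable_inv_norm integral_mul_isoScale (logFunW_smul hc) f μ⟩
    rw [h3] at h
    simpa [sdOrigin] using h
  · obtain ⟨f, -, h0⟩ := exists_test_integral_ne_zero
      ((contDiffOn_weight 1 1).mono offAxis_le) (fun k hk => by
        have : k ≠ 0 := offAxis_le hk
        simpa using this)
    have h := le_scalingDegree_of_log (T := regular Ω (logFunW c)) (d := 3) (scale := isoScale)
      (V := Set.univ) (f := incl hΩ f) (Set.subset_univ _)
      (regular_scale_log (locallyIntegrable_logFunW hc)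
        locallyIntegrable_inv_norm integral_mul_isoScale (logFunW_smul hc) (incl hΩ f)) h0
    rw [h3] at h
    simpa [sdOrigin] using h

theorem kernelDist_log (lam : ℝ) :
    kernelDist lam logKernel = regular offAxis (logFun (2 * lam ^ 4)) := by
  have h : (fun k : R3 => logKernel ((2 * lam ^ 4 * perpSq k : ℝ) : ℂ)) = logFun (2 * lam ^ 4) := by
    funext k
    rw [logFun, logKernel, Complex.ofReal_log]
    have := perpSq_nonneg k
    positivity
  rw [kernelDist, h]

theorem axisExtensions_log {lam : ℝ} (hlam : 0 < lam) :
    axisExtensions (kernelDist lam logKernel) =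
      {regular punctured3 (logFun (2 * lam ^ 4))} := by
  have hc : 0 < 2 * lam ^ 4 := by positivity
  have h0 : sdAxis (kernelDist lam logKernel) = ((0 : ℝ) : EReal) := by
    rw [kernelDist_log, sdAxis_logFun le_rfl hc]; rfl
  have hT : regular punctured3 (logFun (2 * lam ^ 4)) ∈
      axisExtensions (kernelDist lam logKernel) := by
    refine ⟨?_, ?_⟩
    · rw [restrict_regular offAxis_le (locallyIntegrable_logFun hc), kernelDist_log]
    · rw [h0]; exact sdAxis_logFun_le hc
  refine Set.eq_singleton_iff_unique_mem.2 ⟨hT, fun T hT' => ?_⟩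
  -- Degree `0` is below the codimension `2`, so the counterterms form an empty sum.
  obtain ⟨c, hc, -⟩ := existsUnique_counterterm h0 (m := 0) (by norm_num) hT hT'
  ext f
  rw [hc f, counterterm]
  simp

/-! ### Uniqueness of the extension to the origin -/

theorem properPull_cut3 : HasCompactSupport fun k : R3 => cutPow 0 (k 0) * cutPow 0 (k 1) *
    cutPow 0 (k 2) := by
  refine HasCompactSupport.of_support_subset_isCompact
    (isCompact_box (isCompact_closedBall (0 : ℝ) 2) 2) fun k hk => ?_
  rw [Function.mem_support] at hk
  refine ⟨?_, ?_, ?_⟩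
  · by_contra h
    rw [mem_closedBall_zero_iff, Real.norm_eq_abs, not_le] at h
    exact hk (by rw [cutPow_eq_zero h.le]; simp)
  · by_contra h
    exact hk (by rw [cutPow_eq_zero (not_le.1 h).le]; simp)
  · by_contra h
    exact hk (by rw [cutPow_eq_zero (not_le.1 h).le]; simp)

/-- The test function `χ(k₁) χ(k₂) χ(k₃)` on `ℝ³`. -/
def cut3 : 𝓓((⊤ : Opens R3), ℂ) where
  toFun := fun k => cutPow 0 (k 0) * cutPow 0 (k 1) * cutPow 0 (k 2)
  contDiff' := by
    refine ContDiff.mul (ContDiff.mul ?_ ?_) ?_ <;> exact (contDiff_cutPow 0).comp (by fun_prop)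
  hasCompactSupport' := properPull_cut3
  tsupport_subset' := fun _ _ => trivial

theorem cut3_apply (k : R3) : cut3 k = cutPow 0 (k 0) * cutPow 0 (k 1) * cutPow 0 (k 2) := rfl

theorem cut3_eq_one {k : R3} (hk : ‖k‖ < 1) : cut3 k = 1 := by
  have h : ∀ i, cutPow 0 (k i) = 1 := fun i => by
    rw [cutPow_of_le ((PiLp.norm_apply_le k i).trans hk.le), pow_zero]
  rw [cut3_apply, h, h, h]; simp

theorem coordProj_univ (k : R3) : coordProj Finset.univ k = k := by
  ext i; rw [coordProj_apply]; simp

theorem mono_smul (α : Fin 3 → ℕ) (t : ℝ) (k : R3) :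
    mono α (t • k) = (t : ℂ) ^ (∑ i, α i) * mono α k := by
  unfold mono
  rw [← Finset.prod_pow_eq_pow_sum, ← Finset.prod_mul_distrib]
  refine Finset.prod_congr rfl fun i _ => ?_
  simp [mul_pow]

theorem vanishesOff_origin {D : Dist (⊤ : Opens R3)} (h : restrict (Ω := punctured3) D = 0) :
    VanishesOff Finset.univ D := fun f ⟨U, hU, hZ, hf⟩ => by
  have h1 : tsupport f ⊆ punctured3 := (tsupport_subset_of_vanish hU hf).trans fun k hk h0 =>
    hk (hZ k (by rw [coordProj_univ]; exact h0))
  rw [← restrict_apply le_top D (recast punctured3 f h1) f fun x => rfl, h]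
  simp

/-- A distribution supported at the origin whose scaling degree is less than `3` is zero. -/
theorem eq_zero_of_mem_decaySet {D : Dist (⊤ : Opens R3)} (h : restrict (Ω := punctured3) D = 0)
    {a : ℝ} (ha : a ∈ decaySet 3 isoScale Set.univ D) (ha3 : a ≤ 3) : D = 0 := by
  have hD := vanishesOff_origin h
  ext f
  have hloc : ∀ F G : 𝓓((⊤ : Opens R3), ℂ), (∃ r > 0, ∀ k : R3, ‖k‖ < r → F k = G k) → D F = D G := by
    rintro F G ⟨r, hr, hFG⟩
    rw [← sub_eq_zero, ← map_sub]
    refine hD _ ⟨Metric.ball 0 r, Metric.isOpen_ball, fun k hk => ?_, fun k hk => ?_⟩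
    · rw [coordProj_univ] at hk
      subst hk; simpa using hr
    · rw [sub_apply, hFG k (by simpa using hk), sub_self]
  have e1 : D (mulCLM f.contDiff.contDiffOn cut3) = 0 := by
    refine hD.eq_zero _ (fun α _ g hg F hF => ?_) f f.contDiff
    by_contra hne
    -- Near the origin `F` is a constant times `k^α`, so a nonzero value scales as `μ^{-|α|}`; this
    -- would give `3 < a - |α|`, against `a ≤ 3`.
    have hp := lt_of_mem_decaySet (p := -((∑ i, α i : ℕ) : ℝ)) ha (Set.subset_univ (tsupport F)) hne
      (G := fun _ => D F) (fun μ => ?_) (Eventually.of_forall fun _ => le_rfl)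
    · have h2 : (0 : ℝ) ≤ ((∑ i, α i : ℕ) : ℝ) := Nat.cast_nonneg _
      push_cast at hp h2
      linarith
    · have hμ : 0 < (μ : ℝ) := μ.2
      rw [← smul_eq_mul, ← map_smul]
      refine hloc _ _ ⟨min 1 μ, lt_min one_pos hμ, fun k hk => ?_⟩
      rw [lt_min_iff] at hk
      have h1 : ‖(μ : ℝ)⁻¹ • k‖ < 1 := by
        rw [norm_smul, norm_inv, Real.norm_of_nonneg hμ.le, inv_mul_lt_iff₀ hμ]; linarith
      rw [isoScale_apply, smul_apply, hF, hF, cut3_eq_one h1, cut3_eq_one hk.1, coordProj_univ,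
        coordProj_univ, sub_self, sub_self, mono_smul, smul_eq_mul, Real.rpow_neg hμ.le,
        Real.rpow_natCast]
      push_cast
      rw [inv_pow]; ring
  rw [hloc f (mulCLM f.contDiff.contDiffOn cut3) ⟨1, one_pos, fun k hk => by
    rw [mulCLM_apply, cut3_eq_one hk, mul_one]⟩, e1]
  rfl

theorem originExtensions_unique {K : Dist punctured3} {s : ℝ} (hK : sdOrigin K = s) (hs : s < 3)
    {S S' : Dist (⊤ : Opens R3)} (hS : S ∈ originExtensions K) (hS' : S' ∈ originExtensions K) :
    S = S' := by
  obtain ⟨a, hsa, ha3⟩ := exists_between hs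
  have hlt : ∀ S ∈ originExtensions K, a ∈ decaySet 3 isoScale Set.univ S := fun S hS =>
    mem_decaySet_of_lt (lt_of_le_of_lt (hS.2.trans hK.le) (by exact_mod_cast hsa))
  have h := eq_zero_of_mem_decaySet (D := S + -S') (by
    ext f
    have h1 := congrArg (fun D => D f) (hS.1.trans hS'.1.symm)
    simp only [restrict_apply' (le_top : punctured3 ≤ ⊤)] at h1 ⊢
    simp [h1]) (mem_decaySet_add (hlt S hS) (mem_decaySet_neg (hlt S' hS'))) ha3.le
  rwa [← sub_eq_add_neg, sub_eq_zero] at h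

theorem existsUnique_originExtension_regular {g : R3 → ℂ} (hg : LocallyIntegrable g) {s : ℝ}
    (h1 : sdOrigin (regular punctured3 g) = s) (h2 : sdOrigin (regular (⊤ : Opens R3) g) = s)
    (hs : s < 3) : ∃! S, S ∈ originExtensions (regular punctured3 g) := by
  have h : regular (⊤ : Opens R3) g ∈ originExtensions (regular punctured3 g) :=
    ⟨restrict_regular le_top hg, by rw [h1, h2]⟩
  exact ⟨_, h, fun S hS => originExtensions_unique h1 hs hS h⟩

theorem isWeighted_log {c : ℝ} (hc : 0 < c) :
    IsWeighted (regular punctured3 (logFun c)) (regular punctured3 (logFunW c)) := fun f => by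
  refine ⟨mulCLM (contDiffOn_weight 1 (1 / 2)) f, fun k => ?_, ?_⟩
  · rw [mulCLM_apply]; push_cast; ring
  · rw [regular_apply ((locallyIntegrable_logFunW hc).locallyIntegrableOn _),
      regular_apply ((locallyIntegrable_logFun hc).locallyIntegrableOn _)]
    congr 1
    funext k
    rw [mulCLM_apply, logFunW]; ring

/-- The extensions for `K = ln`. -/
theorem log_extensions {lam : ℝ} (hlam : 0 < lam) :
    sdAxis (kernelDist lam logKernel) = 0 ∧
      ∃ T W : Dist punctured3, axisExtensions (kernelDist lam logKernel) = {T} ∧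
        IsWeighted T W ∧ sdOrigin T = 0 ∧ sdOrigin W = 1 ∧
        (∃! S, S ∈ originExtensions T) ∧ (∃! S, S ∈ originExtensions W) := by
  have hc : 0 < 2 * lam ^ 4 := by positivity
  refine ⟨by rw [kernelDist_log, sdAxis_logFun le_rfl hc], _, _, axisExtensions_log hlam,
    isWeighted_log hc, sdOrigin_logFun offAxis_le hc, sdOrigin_logFunW offAxis_le hc, ?_, ?_⟩
  · exact existsUnique_originExtension_regular (locallyIntegrable_logFun hc) (s := 0)
      (sdOrigin_logFun offAxis_le hc) (sdOrigin_logFun le_top hc) (by norm_num)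
  · exact existsUnique_originExtension_regular (locallyIntegrable_logFunW hc) (s := 1)
      (sdOrigin_logFunW offAxis_le hc) (sdOrigin_logFunW le_top hc) (by norm_num)

/-! ### Powers -/

/-- `ln²(|k_⊥|²)`. -/
def logSqFun (k : R3) : ℂ := ((Real.log (perpSq k) ^ 2 : ℝ) : ℂ)

theorem continuousOn_logSqFun : ContinuousOn logSqFun offAxis :=
  (contDiffOn_log_perpSq.continuousOn.pow 2).congr fun k _ => by simp [logSqFun]

theorem norm_logSqFun_le (k : R3) : ‖logSqFun k‖ ≤ logSq (perpSq k) := by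
  rw [logSqFun, Complex.norm_real, Real.norm_of_nonneg (sq_nonneg _)]
  exact sq_log_le_logSq _

theorem locallyIntegrable_logSq : LocallyIntegrable fun k : R3 => (logSq (perpSq k) : ℂ) := by
  refine locallyIntegrable_of_logSq ?_ zero_le_one one_mul_le fun k hk => ?_
  · have h : ContinuousOn (fun k : R3 => Real.log (perpSq k)) offAxis :=
      contDiff_perpSq.continuous.continuousOn.log fun k hk => hk
    exact Complex.continuous_ofReal.comp_continuousOn ((continuousOn_const.add h.abs).pow 2)
  · rw [Complex.norm_real, Real.norm_of_nonneg (zero_le_one.trans (one_le_logSq _))]; simp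

theorem locallyIntegrable_logSqFun : LocallyIntegrable logSqFun :=
  locallyIntegrable_of_logSq continuousOn_logSqFun zero_le_one one_mul_le fun k _ => by
    rw [mul_one, one_mul]; exact norm_logSqFun_le k

/-- The constants in `Δ_⊥ⁿ ln²(|k_⊥|²) = radialConst n |k_⊥|⁻²ⁿ`. -/
def radialConst : ℕ → ℝ
  | 0 => 1
  | 1 => 8
  | n + 2 => 4 * (n + 1) ^ 2 * radialConst (n + 1)

theorem radialConst_pos : ∀ n, 0 < radialConst n
  | 0 => one_pos
  | 1 => by norm_num [radialConst]
  | n + 2 => by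
    have := radialConst_pos (n + 1)
    rw [radialConst]; positivity

/-- With `t = |k_⊥|²` one has `4t(ln² t)'' + 4(ln² t)' = 8/t`. The square is needed because `ln t`
itself is harmonic in two dimensions. -/
theorem integral_logSqFun_perpLap (f : 𝓓(offAxis, ℂ)) :
    ∫ k, logSqFun k * perpLap f k = 8 * ∫ k, (((perpSq k)⁻¹ : ℝ) : ℂ) * f k := by
  have h := integral_mul_perpLap (h := fun t => Real.log t ^ 2) (h₁ := fun t => 2 * Real.log t * t⁻¹)
    (h₂ := fun t => 2 * (t⁻¹) ^ 2 - 2 * Real.log t * (t⁻¹) ^ 2) ?_ ?_ ?_ ?_ f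
  · refine h.trans ?_
    rw [← integral_const_mul]
    refine integral_congr_ae ?_
    filter_upwards [ae_coord_ne_zero (0 : Fin 3)] with k hk
    have := (perpSq_pos hk).ne'
    rw [← mul_assoc (8 : ℂ)]
    congr 1
    rw [← Complex.ofReal_ofNat, ← Complex.ofReal_mul]
    congr 1
    field_simp
    ring
  · exact (contDiffOn_id.log fun t ht => (ne_of_gt ht)).pow 2
  · exact (contDiffOn_const.mul (contDiffOn_id.log fun t ht => (ne_of_gt ht))).mul
      (contDiffOn_id.inv fun t ht => (ne_of_gt ht))
  · intro t ht
    refine ((Real.hasDerivAt_log ht.ne').pow 2).congr_deriv ?_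
    simp
  · intro t ht
    refine (((Real.hasDerivAt_log ht.ne').const_mul 2).mul (hasDerivAt_inv ht.ne')).congr_deriv ?_
    field_simp
    ring

/-- `4t · n(n+1) t^{-n-2} - 4n t^{-n-1} = 4n² t^{-n-1}`, which is the recursion of `radialConst`. -/
theorem integral_pow_perpLap (n : ℕ) (f : 𝓓(offAxis, ℂ)) :
    ∫ k, ((((perpSq k)⁻¹) ^ n : ℝ) : ℂ) * perpLap f k =
      ((4 * (n : ℝ) ^ 2 : ℝ) : ℂ) * ∫ k, ((((perpSq k)⁻¹) ^ (n + 1) : ℝ) : ℂ) * f k := by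
  have h := integral_mul_perpLap (h := fun t => (t⁻¹) ^ n)
    (h₁ := fun t => -(n : ℝ) * (t⁻¹) ^ (n + 1))
    (h₂ := fun t => (n : ℝ) * (n + 1) * (t⁻¹) ^ (n + 2)) ?_ ?_ ?_ ?_ f
  · refine h.trans ?_
    rw [← integral_const_mul]
    refine integral_congr_ae ?_
    filter_upwards [ae_coord_ne_zero (0 : Fin 3)] with k hk
    have := (perpSq_pos hk).ne'
    rw [← mul_assoc ((4 * (n : ℝ) ^ 2 : ℝ) : ℂ)]
    congr 1
    rw [← Complex.ofReal_mul]
    congr 1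
    have h2 : (perpSq k)⁻¹ ^ (n + 2) = (perpSq k)⁻¹ ^ (n + 1) * (perpSq k)⁻¹ := pow_succ _ _
    rw [h2]
    field_simp
    ring
  · exact (contDiffOn_id.inv fun t ht => (ne_of_gt ht)).pow n
  · exact contDiffOn_const.mul ((contDiffOn_id.inv fun t ht => (ne_of_gt ht)).pow (n + 1))
  · intro t ht
    refine ((hasDerivAt_inv ht.ne').pow n).congr_deriv ?_
    rcases n with _ | n
    · simp
    · simp only [Nat.add_sub_cancel, pow_succ, inv_pow]; field_simp
  · intro t ht
    refine (((hasDerivAt_inv ht.ne').pow (n + 1)).const_mul (-(n : ℝ))).congr_deriv ?_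
    simp only [Nat.add_sub_cancel, pow_succ, inv_pow]; push_cast; field_simp

theorem integral_logSqFun_perpLap_pow (n : ℕ) (f : 𝓓(offAxis, ℂ)) :
    ∫ k, logSqFun k * (perpLap ^ (n + 1)) f k =
      (radialConst (n + 1) : ℂ) * ∫ k, ((((perpSq k)⁻¹) ^ (n + 1) : ℝ) : ℂ) * f k := by
  induction n generalizing f with
  | zero => simpa [radialConst] using integral_logSqFun_perpLap f
  | succ n ih =>
    rw [pow_succ, mul_apply_eq_comp, ih, integral_pow_perpLap, ← mul_assoc, ← Complex.ofReal_mul,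
      radialConst]
    push_cast; ring

/-- The extension `const · Δ_⊥ⁿ ln²(|k_⊥|²)` of `(c |k_⊥|²)⁻ⁿ`. -/
def powExt (Ω : Opens R3) (c : ℝ) (n : ℕ) : Dist Ω :=
  (((c ^ n * radialConst n)⁻¹ : ℝ) : ℂ) • (regular Ω logSqFun ∘L perpLap ^ n)

theorem powExt_apply (Ω : Opens R3) (c : ℝ) (n : ℕ) (f : 𝓓(Ω, ℂ)) : powExt Ω c n f =
    (((c ^ n * radialConst n)⁻¹ : ℝ) : ℂ) * ∫ k, logSqFun k * (perpLap ^ n) f k := by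
  rw [powExt, smul_apply, smul_eq_mul, ContinuousLinearMap.comp_apply,
    regular_apply (locallyIntegrable_logSqFun.locallyIntegrableOn _)]

theorem restrict_powExt {Ω Ω' : Opens R3} (h : Ω ≤ Ω') (c : ℝ) (n : ℕ) :
    restrict (Ω := Ω) (powExt Ω' c n) = powExt Ω c n := by
  ext f
  rw [restrict_apply' h, powExt_apply, powExt_apply, perpLap_pow_incl]; rfl

theorem powExt_offAxis {lam : ℝ} (hlam : 0 < lam) {n : ℕ} (hn : 1 ≤ n) :
    powExt offAxis (2 * lam ^ 4) n = kernelDist lam (powKernel n) := by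
  obtain ⟨m, rfl⟩ : ∃ m, n = m + 1 := ⟨n - 1, by omega⟩
  ext f
  rw [powExt_apply, kernelDist_apply (isKernel_pow hn) hlam, integral_logSqFun_perpLap_pow,
    ← mul_assoc, ← Complex.ofReal_mul, ← integral_const_mul]
  congr 1
  funext k
  rw [← mul_assoc]
  congr 1
  have h0 := (radialConst_pos (m + 1)).ne'
  rw [powKernel, ← Complex.ofReal_mul, ← Complex.ofReal_pow, ← Complex.ofReal_inv]
  congr 1
  rw [mul_pow (2 * lam ^ 4), mul_inv, mul_inv, inv_pow]
  field_simp

theorem kernelDist_pow_perpScale {lam : ℝ} (hlam : 0 < lam) {n : ℕ} (hn : 1 ≤ n)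
    (f : 𝓓(offAxis, ℂ)) (μ : Set.Ioi (0 : ℝ)) :
    kernelDist lam (powKernel n) (perpScale μ f) =
      (((μ : ℝ) ^ (2 - 2 * n : ℝ) : ℝ) : ℂ) * kernelDist lam (powKernel n) f := by
  have hμ : 0 < (μ : ℝ) := μ.2
  rw [kernelDist_apply (isKernel_pow hn) hlam, kernelDist_apply (isKernel_pow hn) hlam,
    integral_mul_perpScale, ← integral_const_mul, ← integral_const_mul]
  congr 1
  funext k
  have h : (((μ : ℝ) ^ 2 : ℝ) : ℂ) * powKernel n ((2 * lam ^ 4 * perpSq (perpDil μ k) : ℝ) : ℂ) =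
      (((μ : ℝ) ^ (2 - 2 * n : ℝ) : ℝ) : ℂ) * powKernel n ((2 * lam ^ 4 * perpSq k : ℝ) : ℂ) := by
    have h1 : (μ : ℝ) ^ (2 * n : ℝ) = ((μ : ℝ) ^ 2) ^ n := by
      rw [← pow_mul, ← Real.rpow_natCast]; push_cast; rfl
    simp only [powKernel]
    rw [perpSq_perpDil, Real.rpow_sub hμ, ← Complex.ofReal_pow, ← Complex.ofReal_pow,
      ← Complex.ofReal_inv, ← Complex.ofReal_inv, ← Complex.ofReal_mul, ← Complex.ofReal_mul, h1,
      Real.rpow_ofNat, mul_left_comm, mul_pow ((μ : ℝ) ^ 2), mul_inv]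
    congr 1
    ring
  rw [← mul_assoc, h, mul_assoc]

theorem exists_kernelDist_pow_ne_zero {lam : ℝ} (hlam : 0 < lam) {n : ℕ} (hn : 1 ≤ n) :
    ∃ f : 𝓓(offAxis, ℂ), tsupport f ⊆ {k | k 1 ≠ 0} ∧ kernelDist lam (powKernel n) f ≠ 0 := by
  obtain ⟨f, hf, h0⟩ := exists_test_integral_ne_zero (kernel_contDiffOn (isKernel_pow hn) hlam)
    (fun k hk => by
      have := perpSq_pos_of_mem hk
      change (((2 * lam ^ 4 * perpSq k : ℝ) : ℂ) ^ n)⁻¹ ≠ 0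
      rw [← Complex.ofReal_pow]
      exact inv_ne_zero (Complex.ofReal_ne_zero.2 (by positivity)))
  exact ⟨f, hf, by rwa [kernelDist_apply (isKernel_pow hn) hlam]⟩

theorem sdAxis_kernelDist_pow {lam : ℝ} (hlam : 0 < lam) {n : ℕ} (hn : 1 ≤ n) :
    sdAxis (kernelDist lam (powKernel n)) = ((2 * n : ℝ) : EReal) := by
  have h2 : (((2 : ℕ) : ℝ) - (2 - 2 * n : ℝ)) = 2 * n := by push_cast; ring
  rw [← h2]
  refine le_antisymm ?_ ?_
  · refine scalingDegree_le_of_bound fun f _ => ⟨‖kernelDist lam (powKernel n) f‖, fun μ _ => ?_⟩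
    have hμ : 0 < (μ : ℝ) := μ.2
    rw [kernelDist_pow_perpScale hlam hn, norm_mul, Complex.norm_real,
      Real.norm_of_nonneg (by positivity)]
    gcongr
    exact le_mul_of_one_le_right (norm_nonneg _) (one_le_logSq _)
  · obtain ⟨f, hf, h0⟩ := exists_kernelDist_pow_ne_zero hlam hn
    exact le_scalingDegree_of_homogeneous hf (kernelDist_pow_perpScale hlam hn f) h0

theorem logSq_rescale {μ : ℝ} (hμ : 0 < μ) {y : ℝ} (hy : 0 < y) :
    logSq (μ ^ 2 * y) ≤ 4 * (1 + |Real.log μ|) ^ 2 * logSq y :=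
  (logSq_mul_le (by positivity) hy.ne').trans (mul_le_mul_of_nonneg_right (logSq_sq_le μ)
    (zero_le_one.trans (one_le_logSq y)))

/-- Bound of an integral against a function of logarithmic growth, under rescaling. -/
theorem norm_integral_logSqFun_le {Ω : Opens R3} {μ : ℝ} (hμ : 0 < μ) {δ : R3 → R3}
    (hδ : ∀ k, perpSq (δ k) = μ ^ 2 * perpSq k) (f : 𝓓(Ω, ℂ)) :
    ‖∫ k, logSqFun (δ k) * f k‖ ≤
      4 * (1 + |Real.log μ|) ^ 2 * ∫ k, ‖(logSq (perpSq k) : ℂ) * f k‖ := by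
  rw [← integral_const_mul]
  refine norm_integral_le_of_norm_le
    ((integrable_mul_test (locallyIntegrable_logSq.locallyIntegrableOn _) f).norm.const_mul _) ?_
  filter_upwards [ae_coord_ne_zero (0 : Fin 3)] with k hk
  rw [norm_mul, norm_mul, ← mul_assoc, Complex.norm_real,
    Real.norm_of_nonneg (zero_le_one.trans (one_le_logSq _))]
  refine mul_le_mul_of_nonneg_right ((norm_logSqFun_le _).trans ?_) (norm_nonneg _)
  rw [hδ]
  exact logSq_rescale hμ (perpSq_pos hk)

/-- The change of variables contributes `μ²` and each Laplacian `μ⁻²`; rescaling `ln²` costs only a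
factor `(1 + |log μ|)²`. This works on any admissible open set, in particular on ℝ³. -/
theorem sdAxis_powExt_le (Ω : Opens R3) [Scalable Ω] (c : ℝ) (n : ℕ) :
    sdAxis (powExt Ω c n) ≤ ((2 * n : ℝ) : EReal) := by
  have h2 : (((2 : ℕ) : ℝ) - (2 - 2 * n : ℝ)) = 2 * n := by push_cast; ring
  rw [← h2]
  refine scalingDegree_le_of_bound fun f _ => ⟨‖(c ^ n * radialConst n)⁻¹‖ *
    (4 * ∫ k, ‖(logSq (perpSq k) : ℂ) * (perpLap ^ n) f k‖), fun μ _ => ?_⟩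
  have hμ : 0 < (μ : ℝ) := μ.2
  rw [powExt_apply, perpLap_pow_perpScale]
  simp only [smul_apply, smul_eq_mul]
  simp only [mul_left_comm _ ((((μ : ℝ)⁻¹ ^ (2 * n) : ℝ)) : ℂ)]
  rw [integral_const_mul, integral_mul_perpScale, norm_mul, norm_mul, norm_mul, Complex.norm_real,
    Complex.norm_real, Complex.norm_real, Real.norm_of_nonneg (by positivity : 0 ≤ (μ : ℝ)⁻¹ ^ (2 * n)),
    Real.norm_of_nonneg (by positivity : 0 ≤ (μ : ℝ) ^ 2)]
  have h3 := norm_integral_logSqFun_le hμ (δ := perpDil μ) (fun k => perpSq_perpDil μ k)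
    ((perpLap ^ n) f)
  have h4 : (μ : ℝ) ^ (2 - 2 * n : ℝ) = (μ : ℝ)⁻¹ ^ (2 * n) * (μ : ℝ) ^ 2 := by
    rw [Real.rpow_sub hμ, Real.rpow_ofNat, inv_pow, ← Real.rpow_natCast _ (2 * n)]
    push_cast; ring
  rw [h4]
  calc _ ≤ ‖(c ^ n * radialConst n)⁻¹‖ * ((μ : ℝ)⁻¹ ^ (2 * n) * ((μ : ℝ) ^ 2 *
        (4 * (1 + |Real.log μ|) ^ 2 * ∫ k, ‖(logSq (perpSq k) : ℂ) * (perpLap ^ n) f k‖))) := by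
        gcongr
    _ = _ := by ring

theorem powExt_mem_axisExtensions {lam : ℝ} (hlam : 0 < lam) {n : ℕ} (hn : 1 ≤ n) :
    powExt punctured3 (2 * lam ^ 4) n ∈ axisExtensions (kernelDist lam (powKernel n)) := by
  refine ⟨?_, ?_⟩
  · rw [restrict_powExt offAxis_le, powExt_offAxis hlam hn]
  · rw [sdAxis_kernelDist_pow hlam hn]; exact sdAxis_powExt_le _ _ _

/-- The extensions for `K = x⁻ⁿ`. -/
theorem pow_extensions {lam : ℝ} (hlam : 0 < lam) {n : ℕ} (hn : 1 ≤ n) :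
    sdAxis (kernelDist lam (powKernel n)) = ((2 * n : ℝ) : EReal) ∧
      (∃ T₀ ∈ axisExtensions (kernelDist lam (powKernel n)),
        (∀ T ∈ axisExtensions (kernelDist lam (powKernel n)),
          ∃! c : PerpIndex (2 * n - 1) → Dist punctured1,
            ∀ f, T f = T₀ f + counterterm c f) ∧
        (∀ c : PerpIndex (2 * n - 1) → Dist punctured1,
          ∃ T ∈ axisExtensions (kernelDist lam (powKernel n)),
            ∀ f, T f = T₀ f + counterterm c f)) ∧
      (∀ T ∈ axisExtensions (kernelDist lam (powKernel n)),
        ∀ T' ∈ axisExtensions (kernelDist lam (powKernel n)), T ≠ T' →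
          ¬ ∃ g : R3 → ℂ, ContinuousOn g punctured3 ∧
            ∀ f, T f - T' f = ∫ k, g k * f k) := by
  have hs := sdAxis_kernelDist_pow hlam hn
  have h1 : (((2 * n - 1 : ℕ) : ℝ)) = 2 * n - 1 := by
    rw [Nat.cast_sub (by omega)]; push_cast; ring
  refine ⟨hs, ⟨_, powExt_mem_axisExtensions hlam hn, fun T hT => ?_, fun c => ?_⟩, ?_⟩
  -- The choice `m = 2n - 1` is sharp: `2n < m + 2` excludes orders from `2n - 1` on, while orders
  -- up to `2n - 2` satisfy `j + 2 ≤ 2n`.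
  · exact existsUnique_counterterm hs (by rw [h1]; linarith) (powExt_mem_axisExtensions hlam hn) hT
  · refine add_counterterm_mem hs (fun j hj => ?_) (powExt_mem_axisExtensions hlam hn) c
    have : ((j + 2 : ℕ) : ℝ) ≤ ((2 * n : ℕ) : ℝ) := by exact_mod_cast (by omega)
    push_cast at this; exact this
  · rintro T hT T' hT' hne ⟨g, hg, h⟩
    exact hne (eq_of_sub_eq_integral (hT.1.trans hT'.1.symm) hg h)

/-! ### Extensions to the origin for `K = 1/x` -/

theorem restrict_restrict {Ω Ω' Ω'' : Opens R3} (h : Ω ≤ Ω') (h' : Ω' ≤ Ω'') (T : Dist Ω'') :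
    restrict (Ω := Ω) (restrict (Ω := Ω') T) = restrict T := by
  ext f
  rw [restrict_apply' h, restrict_apply' h', restrict_apply' (h.trans h')]; rfl

theorem restrict_add {Ω Ω' : Opens R3} (h : Ω ≤ Ω') (T T' : Dist Ω') :
    restrict (Ω := Ω) (T + T') = restrict T + restrict T' := by
  ext f
  simp [restrict_apply' h]

/-- The kernel `1/(c|k_⊥|²)` scales isotropically with weight `-2`. -/
theorem integral_perpInv_smul (c : ℝ) {Ω : Opens R3} [Scalable Ω] (f : 𝓓(Ω, ℂ))
    (μ : Set.Ioi (0 : ℝ)) :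
    ∫ k, powKernel 1 ((c * perpSq k : ℝ) : ℂ) * isoScale μ f k =
      (((μ : ℝ) ^ (1 : ℝ) : ℝ) : ℂ) * ∫ k, powKernel 1 ((c * perpSq k : ℝ) : ℂ) * f k := by
  have hμ : 0 < (μ : ℝ) := μ.2
  rw [integral_mul_isoScale, ← integral_const_mul, ← integral_const_mul]
  congr 1
  funext k
  have h : (((μ : ℝ) ^ 3 : ℝ) : ℂ) * powKernel 1 ((c * perpSq ((μ : ℝ) • k) : ℝ) : ℂ) =
      (((μ : ℝ) ^ (1 : ℝ) : ℝ) : ℂ) * powKernel 1 ((c * perpSq k : ℝ) : ℂ) := by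
    simp only [powKernel, pow_one]
    rw [perpSq_smul, ← Complex.ofReal_inv, ← Complex.ofReal_inv, ← Complex.ofReal_mul,
      ← Complex.ofReal_mul, Real.rpow_one, mul_left_comm, mul_inv]
    congr 1
    field_simp
  rw [← mul_assoc, h, mul_assoc]

/-- Isotropically the change of variables gives `μ³` and the Laplacian `μ⁻²`, hence degree `3 - 1 =
2`. -/
theorem sdOrigin_powExt_one_le (Ω : Opens R3) [Scalable Ω] (c : ℝ) :
    sdOrigin (powExt Ω c 1) ≤ ((2 : ℝ) : EReal) := by
  have h2 : (((3 : ℕ) : ℝ) - (1 : ℝ)) = 2 := by norm_num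
  rw [← h2]
  refine scalingDegree_le_of_bound fun f _ => ⟨‖(c ^ 1 * radialConst 1)⁻¹‖ *
    (4 * ∫ k, ‖(logSq (perpSq k) : ℂ) * perpLap f k‖), fun μ _ => ?_⟩
  have hμ : 0 < (μ : ℝ) := μ.2
  rw [powExt_apply, pow_one perpLap, perpLap_isoScale]
  simp only [smul_apply, smul_eq_mul]
  simp only [mul_left_comm _ ((((μ : ℝ)⁻¹ ^ 2 : ℝ)) : ℂ)]
  rw [integral_const_mul, integral_mul_isoScale, norm_mul, norm_mul, norm_mul, Complex.norm_real,
    Complex.norm_real, Complex.norm_real, Real.norm_of_nonneg (by positivity : 0 ≤ (μ : ℝ)⁻¹ ^ 2),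
    Real.norm_of_nonneg (by positivity : 0 ≤ (μ : ℝ) ^ 3)]
  have h3 := norm_integral_logSqFun_le hμ (δ := fun k => (μ : ℝ) • k)
    (fun k => perpSq_smul μ k) (perpLap f)
  calc _ ≤ ‖(c ^ 1 * radialConst 1)⁻¹‖ * ((μ : ℝ)⁻¹ ^ 2 * ((μ : ℝ) ^ 3 *
        (4 * (1 + |Real.log μ|) ^ 2 * ∫ k, ‖(logSq (perpSq k) : ℂ) * perpLap f k‖))) := by
        gcongr
    _ = _ := by rw [Real.rpow_one]; field_simp

theorem properPull_axis_top :
    ProperPull (⊤ : Opens R3) (⊤ : Opens ℝ) (fun _ => (1 : ℂ)) axisPoint := fun K hK _ => by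
  have hce : IsClosedEmbedding axisPoint :=
    Function.LeftInverse.isClosedEmbedding (f := fun k : R3 => k 1)
      (fun s => by simp [axisPoint]) (by fun_prop) axisPoint_contDiff.continuous
  exact ⟨axisPoint ⁻¹' K, hce.isCompact_preimage hK, fun s hs => trivial, fun s hs => Or.inr hs⟩

/-- Integration over the axis. -/
def axisDelta : Dist (⊤ : Opens R3) :=
  regular (⊤ : Opens ℝ) (fun _ => 1) ∘L
    weightedPull contDiffOn_const axisPoint_contDiff.contDiffOn properPull_axis_top

theorem axisDelta_apply (f : 𝓓((⊤ : Opens R3), ℂ)) : axisDelta f = ∫ s : ℝ, f (axisPoint s) := by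
  rw [axisDelta, ContinuousLinearMap.comp_apply,
    regular_apply ((continuous_const.locallyIntegrable).locallyIntegrableOn _)]
  refine integral_congr_ae (Eventually.of_forall fun s => ?_)
  simp only [one_mul]
  rw [weightedPull_apply, one_mul]

theorem restrict_axisDelta : restrict (Ω := offAxis) axisDelta = 0 := by
  ext f
  rw [restrict_apply' le_top, axisDelta_apply]
  have : ∀ s, incl (le_top : offAxis ≤ ⊤) f (axisPoint s) = 0 := fun s => by
    rw [incl_apply]
    refine testFunction_eq_zero f fun h => ?_
    have h1 : perpSq (axisPoint s) ≠ 0 := f.tsupport_subset h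
    exact h1 (by simp [perpSq, axisPoint])
  simp [this]

theorem axisDelta_perpScale (μ : Set.Ioi (0 : ℝ)) (f : 𝓓((⊤ : Opens R3), ℂ)) :
    axisDelta (perpScale μ f) = axisDelta f := by
  rw [axisDelta_apply, axisDelta_apply]
  congr 1
  funext s
  rw [perpScale_apply]
  congr 1
  ext i; fin_cases i <;> simp [perpDil, axisPoint]

theorem axisDelta_isoScale (μ : Set.Ioi (0 : ℝ)) (f : 𝓓((⊤ : Opens R3), ℂ)) :
    axisDelta (isoScale μ f) = (((μ : ℝ) ^ (1 : ℝ) : ℝ) : ℂ) * axisDelta f := by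
  have hμ : 0 < (μ : ℝ) := μ.2
  rw [axisDelta_apply, axisDelta_apply, Real.rpow_one]
  have h := Measure.integral_comp_smul (volume : Measure ℝ) (fun s => f (axisPoint s)) (μ : ℝ)⁻¹
  have h2 : ∀ s : ℝ, isoScale μ f (axisPoint s) = f (axisPoint ((μ : ℝ)⁻¹ • s)) := fun s => by
    rw [isoScale_apply]
    congr 1
    ext i; fin_cases i <;> simp [axisPoint]
  simp only [h2]
  rw [h]
  simp [abs_of_pos hμ]

theorem sd_le_of_homogeneous {E : Type*} [NormedAddCommGroup E] [NormedSpace ℝ E] {Ω : Opens E}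
    {d : ℕ} {scale : Set.Ioi (0 : ℝ) → 𝓓(Ω, ℂ) → 𝓓(Ω, ℂ)} {V : Set E} {T : Dist Ω} {p : ℝ}
    (h : ∀ f (μ : Set.Ioi (0 : ℝ)), T (scale μ f) = (((μ : ℝ) ^ p : ℝ) : ℂ) * T f) :
    scalingDegree d scale V T ≤ ((d - p : ℝ) : EReal) :=
  scalingDegree_le_of_log fun f => ⟨0, T f, fun μ => by rw [h]; simp⟩

theorem scalingDegree_add_smul_le {E : Type*} [NormedAddCommGroup E] [NormedSpace ℝ E]
    {Ω : Opens E} {d : ℕ} {scale : Set.Ioi (0 : ℝ) → 𝓓(Ω, ℂ) → 𝓓(Ω, ℂ)} {V : Set E}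
    {T T' : Dist Ω} {x : EReal} (h : scalingDegree d scale V T ≤ x)
    (h' : scalingDegree d scale V T' ≤ x) (b : ℂ) : scalingDegree d scale V (T + b • T') ≤ x := by
  refine EReal.le_of_forall_lt_iff_le.1 fun a ha => ?_
  rw [scalingDegree_eq]
  refine sInf_le ⟨a, mem_decaySet_add (mem_decaySet_of_lt (h.trans_lt ha)) fun f hf => ?_, rfl⟩
  have := (mem_decaySet_of_lt (h'.trans_lt ha) f hf).const_mul b
  rw [mul_zero] at this
  refine this.congr fun μ => ?_
  rw [smul_apply, smul_eq_mul]; ring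

/-- The one-parameter family of extensions for `K = 1/x` concentrated on the axis. -/
theorem exists_axis_family {lam : ℝ} (hlam : 0 < lam) :
    ∃ S : Dist (⊤ : Opens R3), ∀ b : ℂ,
        ∃ T ∈ axisExtensions (kernelDist lam (powKernel 1)),
          ∃ S' ∈ originExtensions T,
            ∀ f, S' f = S f + b * ∫ s : ℝ, f (axisPoint s) := by
  set c := 2 * lam ^ 4 with hcdef
  -- Since `ln²|k_⊥|²` is locally integrable on all of ℝ³, `powExt` is an extension across the axis
  -- and to the origin at the same time.
  refine ⟨powExt ⊤ c 1, fun b => ?_⟩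
  have hr : restrict (Ω := offAxis) (restrict (Ω := punctured3)
      (powExt ⊤ c 1 + b • axisDelta)) = kernelDist lam (powKernel 1) := by
    rw [restrict_restrict offAxis_le le_top, restrict_add le_top, restrict_powExt le_top,
      powExt_offAxis hlam le_rfl]
    ext f
    have := congrArg (fun D => D f) restrict_axisDelta
    simp only [restrict_apply' (le_top : offAxis ≤ ⊤)] at this
    simp [restrict_apply' (le_top : offAxis ≤ ⊤), this]
  refine ⟨restrict (powExt ⊤ c 1 + b • axisDelta), ⟨hr, ?_⟩, powExt ⊤ c 1 + b • axisDelta,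
    ⟨rfl, ?_⟩, fun f => by rw [_root_.add_apply, smul_apply, axisDelta_apply, smul_eq_mul]⟩
  · rw [sdAxis_kernelDist_pow hlam le_rfl]
    -- Integration over the axis is unchanged by transversal scaling of the test function, so it has
    -- degree at most `2` at the axis, the degree of `1/x`.
    have h1 : sdAxis (powExt ⊤ c 1 + b • axisDelta) ≤ ((2 * (1 : ℕ) : ℝ) : EReal) := by
      refine scalingDegree_add_smul_le (sdAxis_powExt_le _ _ _) ?_ b
      have := sd_le_of_homogeneous (T := axisDelta) (d := 2) (scale := perpScale) (p := 0)
        (V := {k | k 1 ≠ 0}) fun f μ => by rw [axisDelta_perpScale]; simp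
      simpa using this
    refine le_trans ?_ h1
    rw [sdAxis, sdAxis, scalingDegree_eq, scalingDegree_eq]
    refine sInf_le_sInf (Set.image_mono fun a ha f hf => ?_)
    have h2 := ha (incl le_top f) hf
    refine h2.congr fun μ => ?_
    rw [restrict_apply' le_top]; rfl
  · have h1 : sdOrigin (powExt ⊤ c 1 + b • axisDelta) ≤ ((2 : ℝ) : EReal) := by
      refine scalingDegree_add_smul_le (sdOrigin_powExt_one_le _ _) ?_ b
      have := sd_le_of_homogeneous (d := 3) (V := Set.univ) (fun f μ => axisDelta_isoScale μ f)
      norm_num at this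
      exact this
    refine h1.trans ?_
    -- The extension must not raise the degree at the origin, so `2` is also needed as a lower bound
    -- for the restriction; test functions supported off the axis see the exact homogeneity of
    -- `1/|k_⊥|²`.
    obtain ⟨f, -, h0⟩ := exists_kernelDist_pow_ne_zero hlam (n := 1) le_rfl
    have hT : ∀ g : 𝓓(offAxis, ℂ), restrict (Ω := punctured3) (powExt ⊤ c 1 + b • axisDelta)
        (incl offAxis_le g) = kernelDist lam (powKernel 1) g := fun g => by
      rw [← hr, restrict_apply' offAxis_le]
    have h2 := le_scalingDegree_of_homogeneous (d := 3) (scale := isoScale) (V := Set.univ)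
      (p := 1) (T := restrict (Ω := punctured3) (powExt ⊤ c 1 + b • axisDelta))
      (f := incl offAxis_le f) (Set.subset_univ _) (fun μ => by
        have h3 := hT (isoScale μ f)
        rw [hT f, kernelDist_apply (isKernel_pow le_rfl) hlam, ← integral_perpInv_smul,
          ← kernelDist_apply (isKernel_pow le_rfl) hlam, ← h3]
        rfl) (by rwa [hT])
    norm_num at h2
    exact h2

/-! ### The delta distribution at the origin -/

/-- The delta distribution at the origin. -/
def originDelta : Dist (⊤ : Opens R3) :=
  BoundedContinuousFunction.evalCLM ℂ (0 : R3) ∘L TestFunction.toBoundedContinuousFunctionCLM ℂ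

theorem originDelta_apply (f : 𝓓((⊤ : Opens R3), ℂ)) : originDelta f = f 0 := rfl

theorem restrict_originDelta : restrict (Ω := punctured3) originDelta = 0 := by
  ext f
  rw [restrict_apply' le_top, originDelta_apply, incl_apply]
  exact testFunction_eq_zero f fun h => f.tsupport_subset h rfl

theorem originDelta_isoScale (μ : Set.Ioi (0 : ℝ)) (f : 𝓓((⊤ : Opens R3), ℂ)) :
    originDelta (isoScale μ f) = (((μ : ℝ) ^ (0 : ℝ) : ℝ) : ℂ) * originDelta f := by
  rw [originDelta_apply, originDelta_apply, isoScale_apply]; simp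

/-- `(c|k_⊥|²)⁻¹ / (2|k|)`. -/
def weightedInv (c : ℝ) (k : R3) : ℂ :=
  powKernel 1 ((c * perpSq k : ℝ) : ℂ) * ((1 / 2) * (((‖k‖ : ℝ) : ℂ) ^ 1)⁻¹)

theorem weighted_incl {lam : ℝ} (hlam : 0 < lam) {T W : Dist punctured3}
    (hT : restrict T = kernelDist lam (powKernel 1)) (hW : IsWeighted T W) (f : 𝓓(offAxis, ℂ)) :
    W (incl offAxis_le f) = ∫ k, weightedInv (2 * lam ^ 4) k * f k := by
  obtain ⟨g, hg, hWg⟩ := hW (incl offAxis_le f)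
  let G := mulCLM ((contDiffOn_weight 1 (1 / 2)).mono offAxis_le) f
  have hgG : g = incl offAxis_le G := by
    ext k
    rw [hg, incl_apply, incl_apply, mulCLM_apply]; push_cast; ring
  rw [hWg, hgG, ← restrict_apply' offAxis_le, hT, kernelDist_apply (isKernel_pow le_rfl) hlam]
  congr 1
  funext k
  rw [mulCLM_apply, weightedInv]; ring

theorem weightedInv_smul (c : ℝ) {μ : ℝ} (hμ : 0 < μ) (k : R3) :
    weightedInv c (μ • k) = ((μ ^ 3 : ℝ) : ℂ)⁻¹ * weightedInv c k := by
  simp only [weightedInv, powKernel, pow_one]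
  rw [perpSq_smul, norm_smul, Real.norm_of_nonneg hμ.le]
  push_cast
  simp only [mul_inv]
  ring

theorem integral_weightedInv_isoScale (c : ℝ) (f : 𝓓(offAxis, ℂ)) (μ : Set.Ioi (0 : ℝ)) :
    ∫ k, weightedInv c k * isoScale μ f k = ∫ k, weightedInv c k * f k := by
  have hμ : 0 < (μ : ℝ) := μ.2
  rw [integral_mul_isoScale, ← integral_const_mul]
  congr 1
  funext k
  have : (((μ : ℝ) ^ 3 : ℝ) : ℂ) ≠ 0 := by exact_mod_cast (by positivity : (μ : ℝ) ^ 3 ≠ 0)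
  rw [weightedInv_smul c hμ, ← mul_assoc, mul_inv_cancel_left₀ this]

theorem weightedInv_ne_zero {c : ℝ} (hc : 0 < c) (k : R3) (hk : k ∈ offAxis) :
    weightedInv c k ≠ 0 := by
  have h1 : k ≠ 0 := offAxis_le hk
  have h2 := (perpSq_pos_of_mem hk).ne'
  simp [weightedInv, powKernel, h1, h2, hc.ne']

theorem contDiffOn_weightedInv {lam : ℝ} (hlam : 0 < lam) :
    ContDiffOn ℝ ∞ (weightedInv (2 * lam ^ 4)) offAxis :=
  (kernel_contDiffOn (isKernel_pow le_rfl) hlam).mul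
    ((contDiffOn_weight 1 (1 / 2)).mono offAxis_le)

/-- Off the axis the weighted kernel is homogeneous of degree `-3`, so its pairing is invariant
under `isoScale`. This holds for every choice across the axis and is the reason why `δ₀`, of degree
at most `3`, is always an allowed ambiguity. -/
theorem three_le_sdOrigin_weighted {lam : ℝ} (hlam : 0 < lam) {T W : Dist punctured3}
    (hT : restrict T = kernelDist lam (powKernel 1)) (hW : IsWeighted T W) :
    ((3 : ℝ) : EReal) ≤ sdOrigin W := by
  obtain ⟨f, -, h0⟩ := exists_test_integral_ne_zero (contDiffOn_weightedInv hlam)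
    (weightedInv_ne_zero (by positivity))
  have h := le_scalingDegree_of_homogeneous (d := 3) (scale := isoScale) (V := Set.univ) (p := 0)
    (T := W) (f := incl offAxis_le f) (Set.subset_univ _) (fun μ => by
      have : isoScale μ (incl offAxis_le f) = incl offAxis_le (isoScale μ f) := rfl
      rw [this, weighted_incl hlam hT hW, weighted_incl hlam hT hW, integral_weightedInv_isoScale]
      simp) (by rwa [weighted_incl hlam hT hW])
  norm_num at h
  exact h

/-- Delta distributions at the origin can be added to the extensions for `K = 1/x`. -/
theorem exists_add_originDelta {lam : ℝ} (hlam : 0 < lam) {T W : Dist punctured3}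
    (hT : restrict T = kernelDist lam (powKernel 1)) (hW : IsWeighted T W)
    {S : Dist (⊤ : Opens R3)} (hS : S ∈ originExtensions W) (b : ℂ) :
    ∃ S' ∈ originExtensions W, ∀ f, S' f = S f + b * f 0 := by
  refine ⟨S + b • originDelta, ⟨?_, ?_⟩, fun f => by
    rw [_root_.add_apply, smul_apply, originDelta_apply, smul_eq_mul]⟩
  · rw [restrict_add le_top, hS.1]
    ext f
    have := congrArg (fun D => D f) restrict_originDelta
    simp only [restrict_apply' (le_top : punctured3 ≤ ⊤)] at this
    simp [restrict_apply' (le_top : punctured3 ≤ ⊤), this]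
  · refine scalingDegree_add_smul_le hS.2 (le_trans ?_ (three_le_sdOrigin_weighted hlam hT hW)) b
    have := sd_le_of_homogeneous (d := 3) (V := Set.univ) (fun f μ => originDelta_isoScale μ f)
    norm_num at this
    exact this

/-! ### A potential for `1/(|k_⊥|²|k|)` -/

/-- A vector field with divergence `2/(|k_⊥|²|k|)`. -/
def potential (j : Fin 3) (k : R3) : ℝ :=
  k j * ((if j = 1 then 0 else Real.log (perpSq k) / (perpSq k * ‖k‖)) +
    (Real.log (perpSq k) * Real.log ‖k‖ - Real.log ‖k‖ ^ 2) / ‖k‖ ^ 3)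

theorem contDiffOn_potential (j : Fin 3) :
    ContDiffOn ℝ ∞ (fun k => (potential j k : ℂ)) offAxis := by
  refine Complex.ofRealCLM.contDiff.comp_contDiffOn ?_
  have h1 : ContDiffOn ℝ ∞ (fun k : R3 => Real.log (perpSq k)) offAxis :=
    contDiff_perpSq.contDiffOn.log fun _ hk => hk
  have h2 : ContDiffOn ℝ ∞ (fun k : R3 => ‖k‖) offAxis := fun k hk =>
    (contDiffAt_norm ℝ (offAxis_le hk)).contDiffWithinAt
  have h0 : ∀ k ∈ offAxis, ‖k‖ ≠ 0 := fun k hk => norm_ne_zero_iff.2 (offAxis_le hk)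
  have h3 := h2.log h0
  have h4 : ContDiffOn ℝ ∞ (fun k : R3 => (Real.log (perpSq k) * Real.log ‖k‖ -
      Real.log ‖k‖ ^ 2) / ‖k‖ ^ 3) offAxis :=
    ((h1.mul h3).sub (h3.pow 2)).div (h2.pow 3) fun k hk => pow_ne_zero 3 (h0 k hk)
  have h5 : ContDiffOn ℝ ∞ (fun k : R3 => k j) offAxis := ContDiff.contDiffOn (by fun_prop)
  refine h5.mul (ContDiffOn.add ?_ h4)
  split_ifs
  · exact contDiffOn_const
  · exact h1.div (contDiff_perpSq.contDiffOn.mul h2) fun k hk => mul_ne_zero hk (h0 k hk)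

theorem hasDerivAt_norm {k : R3} (hk : k ≠ 0) (j : Fin 3) :
    HasDerivAt (fun t : ℝ => ‖k + t • dir j‖) (k j / ‖k‖) 0 := by
  have h1 : (fun t : ℝ => ‖k + t • dir j‖) = fun t => √(‖k‖ ^ 2 + 2 * k j * t + t ^ 2) := by
    funext t
    rw [← Real.sqrt_sq (norm_nonneg (k + t • dir j))]
    congr 1
    rw [norm_add_sq_real, inner_smul_right, norm_smul]
    simp [EuclideanSpace.inner_single_right]
    ring
  rw [h1]
  have h2 := (((hasDerivAt_id (0 : ℝ)).const_mul (2 * k j)).const_add (‖k‖ ^ 2)).add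
    (hasDerivAt_pow 2 (0 : ℝ))
  have h3 := h2.sqrt (by simpa using hk)
  refine h3.congr_deriv ?_
  have : ‖k‖ ≠ 0 := norm_ne_zero_iff.2 hk
  simp [Real.sqrt_sq (norm_nonneg k)]
  field_simp

/-- The derivative along a line, with `P`, `R`, `Q` in place of `|k_⊥|²`, `|k|` and the coordinate;
`ε` is `0` in the direction of the axis and `1` transversally. -/
theorem hasDerivAt_potential_aux {P R Q : ℝ → ℝ} {p r : ℝ} (hP : HasDerivAt P p 0)
    (hR : HasDerivAt R r 0) (hQ : HasDerivAt Q 1 0) (hP0 : P 0 ≠ 0) (hR0 : R 0 ≠ 0) (ε : ℝ) :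
    HasDerivAt (fun t => Q t * (ε * (Real.log (P t) / (P t * R t)) +
      (Real.log (P t) * Real.log (R t) - Real.log (R t) ^ 2) / R t ^ 3))
    (ε * (Real.log (P 0) / (P 0 * R 0)) +
      (Real.log (P 0) * Real.log (R 0) - Real.log (R 0) ^ 2) / R 0 ^ 3 +
      Q 0 * (ε * (p * (1 - Real.log (P 0)) / (P 0 ^ 2 * R 0) -
          r * Real.log (P 0) / (P 0 * R 0 ^ 2)) +
        ((p / P 0 * Real.log (R 0) + Real.log (P 0) * (r / R 0) -
          2 * Real.log (R 0) * (r / R 0)) / R 0 ^ 3 -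
        3 * r * (Real.log (P 0) * Real.log (R 0) - Real.log (R 0) ^ 2) / R 0 ^ 4))) 0 := by
  have hlP := hP.log hP0
  have hlR := hR.log hR0
  have h1 := (hlP.div (hP.mul hR) (mul_ne_zero hP0 hR0)).const_mul ε
  have h2 := ((hlP.mul hlR).sub (hlR.pow 2)).div (hR.pow 3) (pow_ne_zero 3 hR0)
  refine (hQ.mul (h1.add h2)).congr_deriv ?_
  simp only [Pi.add_apply, Pi.mul_apply, Pi.sub_apply, Pi.pow_apply, Pi.div_apply]
  field_simp
  ring

/-- The line derivative of `potential j` in direction `j`. -/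
def potentialDeriv (j : Fin 3) (k : R3) : ℝ :=
  (if j = 1 then 0 else 1) * (Real.log (perpSq k) / (perpSq k * ‖k‖)) +
      (Real.log (perpSq k) * Real.log ‖k‖ - Real.log ‖k‖ ^ 2) / ‖k‖ ^ 3 +
      k j * ((if j = 1 then 0 else 1) * ((if j = 1 then 0 else 2 * k j) *
          (1 - Real.log (perpSq k)) / (perpSq k ^ 2 * ‖k‖) -
          (k j / ‖k‖) * Real.log (perpSq k) / (perpSq k * ‖k‖ ^ 2)) +
        (((if j = 1 then 0 else 2 * k j) / perpSq k * Real.log ‖k‖ +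
          Real.log (perpSq k) * ((k j / ‖k‖) / ‖k‖) -
          2 * Real.log ‖k‖ * ((k j / ‖k‖) / ‖k‖)) / ‖k‖ ^ 3 -
        3 * (k j / ‖k‖) * (Real.log (perpSq k) * Real.log ‖k‖ - Real.log ‖k‖ ^ 2) / ‖k‖ ^ 4))

theorem hasLineDerivAt_potential (j : Fin 3) (k : R3) (hk : k ∈ offAxis) :
    HasLineDerivAt ℝ (fun k => (potential j k : ℂ)) (potentialDeriv j k : ℂ) k (dir j) := by
  have hk0 : k ≠ 0 := offAxis_le hk
  have hP : HasDerivAt (fun t : ℝ => perpSq (k + t • dir j)) (if j = 1 then 0 else 2 * k j) 0 := by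
    split_ifs with h
    · subst h
      have : (fun t : ℝ => perpSq (k + t • dir 1)) = fun _ => perpSq k := by
        funext t; simp [perpSq]
      rw [this]; exact hasDerivAt_const _ _
    · exact hasDerivAt_perpSq k h
  have h := hasDerivAt_potential_aux hP (hasDerivAt_norm hk0 j) (hasDerivAt_coord k j)
    (by simpa using show perpSq k ≠ 0 from hk) (by simpa using hk0) (if j = 1 then 0 else 1)
  simp only [zero_smul, add_zero] at h
  refine HasDerivAt.ofReal_comp (f := fun t : ℝ => potential j (k + t • dir j)) ?_
  refine h.congr_of_eventuallyEq (Eventually.of_forall fun t => ?_)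
  simp only [potential]
  split_ifs <;> simp

/-- Let `t = |k_⊥|²`, `r = |k|`, `l = ln t`, `m = ln r`. The field `k_⊥ l/(tr)` has divergence
`2/(tr) - l/r³`, because `k_⊥/t` is divergence free off the axis. As `k/r³` is divergence free, the
radial field `k(lm - m²)/r³` has divergence `(2m + l - 2m)/r³ = l/r³`, which cancels the unwanted
term. -/
theorem sum_potentialDeriv {k : R3} (hk : k ∈ offAxis) :
    ∑ j, potentialDeriv j k = 2 / (perpSq k * ‖k‖) := by
  have h1 : ‖k‖ ≠ 0 := norm_ne_zero_iff.2 (offAxis_le hk)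
  have h2 : perpSq k ≠ 0 := hk
  have h3 : k 1 ^ 2 = ‖k‖ ^ 2 - perpSq k := by rw [norm_sq_R3]; unfold perpSq; ring
  have h4 : k 2 ^ 2 = perpSq k - k 0 ^ 2 := by unfold perpSq; ring
  rw [Fin.sum_univ_three]
  simp only [potentialDeriv, Fin.reduceEq, if_true, if_false]
  generalize Real.log ‖k‖ = m
  generalize Real.log (perpSq k) = l
  generalize perpSq k = t at *
  generalize ‖k‖ = r at *
  field_simp
  ring_nf
  simp only [h3, h4]
  ring

/-- Bound for the potential. -/
def potBound (k : R3) : ℝ :=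
  (2 * logSq (perpSq k) + logSq (‖k‖ ^ 2)) * (√(perpSq k) * ‖k‖)⁻¹

theorem logSq_nonneg (y : ℝ) : 0 ≤ logSq y := sq_nonneg _

theorem potBound_nonneg (k : R3) : 0 ≤ potBound k := by
  have := logSq_nonneg (perpSq k)
  have := logSq_nonneg (‖k‖ ^ 2)
  unfold potBound; positivity

theorem abs_potential_le (j : Fin 3) {k : R3} (hk : k ∈ offAxis) :
    |potential j k| ≤ potBound k := by
  have hr : 0 < ‖k‖ := norm_pos_iff.2 (offAxis_le hk)
  have ht : 0 < perpSq k := perpSq_pos_of_mem hk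
  have hρ : 0 < √(perpSq k) := Real.sqrt_pos.2 ht
  have hρr := sqrt_perpSq_le_norm k
  have e1 : Real.log (‖k‖ ^ 2) = 2 * Real.log ‖k‖ := by rw [Real.log_pow]; norm_num
  have s1 := sq_log_le_logSq (perpSq k)
  have s2 := sq_log_le_logSq (‖k‖ ^ 2)
  have s3 := abs_log_le_logSq (perpSq k)
  rw [e1] at s2
  have hkj : |k j| ≤ ‖k‖ := PiLp.norm_apply_le k j
  have hsq : √(perpSq k) ^ 2 = perpSq k := Real.sq_sqrt ht.le
  have A : |k j * (if j = 1 then 0 else Real.log (perpSq k) / (perpSq k * ‖k‖))| ≤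
      logSq (perpSq k) * (√(perpSq k) * ‖k‖)⁻¹ := by
    split_ifs with h
    · rw [mul_zero, abs_zero]
      have := logSq_nonneg (perpSq k)
      positivity
    · have hkρ : |k j| ≤ √(perpSq k) := Real.le_sqrt_of_sq_le (by
        rw [sq_abs]; unfold perpSq
        fin_cases j
        · simpa using sq_nonneg (k 2)
        · exact absurd rfl h
        · simpa using sq_nonneg (k 0))
      rw [abs_mul, abs_div, abs_of_pos (by positivity : 0 < perpSq k * ‖k‖)]
      calc _ ≤ √(perpSq k) * (logSq (perpSq k) / (√(perpSq k) ^ 2 * ‖k‖)) := by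
            rw [hsq]; gcongr
        _ = _ := by field_simp
  have B : |k j * ((Real.log (perpSq k) * Real.log ‖k‖ - Real.log ‖k‖ ^ 2) / ‖k‖ ^ 3)| ≤
      (logSq (perpSq k) + logSq (‖k‖ ^ 2)) * (√(perpSq k) * ‖k‖)⁻¹ := by
    rw [abs_mul, abs_div, abs_of_pos (by positivity : 0 < ‖k‖ ^ 3)]
    have h1 : |Real.log (perpSq k) * Real.log ‖k‖ - Real.log ‖k‖ ^ 2| ≤
        logSq (perpSq k) + logSq (‖k‖ ^ 2) := by
      rw [abs_le]
      constructor <;> nlinarith [sq_nonneg (Real.log (perpSq k) + Real.log ‖k‖),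
        sq_nonneg (Real.log (perpSq k) - Real.log ‖k‖), sq_nonneg (Real.log ‖k‖),
        sq_nonneg (Real.log (perpSq k))]
    have h2 : 0 ≤ logSq (perpSq k) + logSq (‖k‖ ^ 2) :=
      add_nonneg (logSq_nonneg _) (logSq_nonneg _)
    calc _ ≤ ‖k‖ * ((logSq (perpSq k) + logSq (‖k‖ ^ 2)) / ‖k‖ ^ 3) := by gcongr
      _ = (logSq (perpSq k) + logSq (‖k‖ ^ 2)) * (‖k‖ * ‖k‖)⁻¹ := by field_simp
      _ ≤ _ := by gcongr
  rw [potential, mul_add, potBound]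
  refine (abs_add_le _ _).trans ((add_le_add A B).trans (le_of_eq ?_))
  ring

theorem potBound_le_majorant {k : R3} (h0 : k 0 ≠ 0) (h1 : k 1 ≠ 0) (h2 : k 2 ≠ 0) :
    potBound k ≤ 1536 * majorant k := by
  have e0 : k 0 ^ 2 ≤ perpSq k := by unfold perpSq; nlinarith [sq_nonneg (k 2)]
  have e1 := logSq_div_le_majorant h0 h1 h2 e0 (perpSq_le_norm_sq k)
  have e2 := logSq_div_le_majorant h0 h1 h2 (e0.trans (perpSq_le_norm_sq k)) le_rfl
  unfold potBound
  linarith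

theorem continuousOn_potBound : ContinuousOn (fun k => (potBound k : ℂ)) offAxis := by
  refine Complex.continuous_ofReal.comp_continuousOn ?_
  have h1 : ContinuousOn (fun k : R3 => logSq (perpSq k)) offAxis := by
    have h : ContinuousOn (fun k : R3 => Real.log (perpSq k)) offAxis :=
      contDiff_perpSq.continuous.continuousOn.log fun k hk => hk
    exact (continuousOn_const.add h.abs).pow 2
  have h2 : ContinuousOn (fun k : R3 => logSq (‖k‖ ^ 2)) offAxis := by
    have h : ContinuousOn (fun k : R3 => Real.log (‖k‖ ^ 2)) offAxis :=
      (continuous_norm.pow 2).continuousOn.log fun k hk =>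
        pow_ne_zero 2 (norm_ne_zero_iff.2 (offAxis_le hk))
    exact (continuousOn_const.add h.abs).pow 2
  refine ((continuousOn_const.mul h1).add h2).mul (ContinuousOn.inv₀ ?_ fun k hk => ?_)
  · exact (Real.continuous_sqrt.comp contDiff_perpSq.continuous).continuousOn.mul
      continuous_norm.continuousOn
  · exact mul_ne_zero (Real.sqrt_pos.2 (perpSq_pos_of_mem hk)).ne'
      (norm_ne_zero_iff.2 (offAxis_le hk))

theorem locallyIntegrable_potBound : LocallyIntegrable fun k => (potBound k : ℂ) :=
  locallyIntegrable_of_le_majorant (aestronglyMeasurable_of_continuousOn continuousOn_potBound)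
    fun k h0 h1 h2 => by
      rw [Complex.norm_real, Real.norm_of_nonneg (potBound_nonneg k)]
      exact potBound_le_majorant h0 h1 h2

theorem locallyIntegrable_potential (j : Fin 3) :
    LocallyIntegrable fun k => (potential j k : ℂ) :=
  locallyIntegrable_of_le_majorant
    (aestronglyMeasurable_of_continuousOn (contDiffOn_potential j).continuousOn)
    fun k h0 h1 h2 => by
      rw [Complex.norm_real]
      exact (abs_potential_le j (perpSq_pos h0).ne').trans (potBound_le_majorant h0 h1 h2)

/-- An extension of `1/(2c|k_⊥|²|k|)` to `ℝ³`. -/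
def invPot (c : ℝ) : Dist (⊤ : Opens R3) :=
  (-((4 * c)⁻¹ : ℝ) : ℂ) • ∑ j, regular ⊤ (fun k => (potential j k : ℂ)) ∘L derivCLM (dir j)

theorem invPot_apply (c : ℝ) (f : 𝓓((⊤ : Opens R3), ℂ)) : invPot c f =
    (-((4 * c)⁻¹ : ℝ) : ℂ) *
      ∑ j, ∫ k, (potential j k : ℂ) * (∂_{dir j} f : 𝓓((⊤ : Opens R3), ℂ)) k := by
  rw [invPot, smul_apply, smul_eq_mul, sum_apply]
  congr 1
  refine Finset.sum_congr rfl fun j _ => ?_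
  rw [ContinuousLinearMap.comp_apply, derivCLM_apply,
    regular_apply ((locallyIntegrable_potential j).locallyIntegrableOn _)]

theorem norm_invPot_le (c : ℝ) {f : 𝓓((⊤ : Opens R3), ℂ)} {M : Fin 3 → ℝ}
    (h : ∀ j, ‖∫ k, (potential j k : ℂ) * (∂_{dir j} f : 𝓓((⊤ : Opens R3), ℂ)) k‖ ≤ M j) :
    ‖invPot c f‖ ≤ |(4 * c)⁻¹| * ∑ j, M j := by
  rw [invPot_apply, norm_mul, norm_neg, Complex.norm_real, Real.norm_eq_abs]
  gcongr
  exact norm_sum_le_of_le _ fun j _ => h j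

theorem integrable_potentialDeriv_mul (j : Fin 3) (f : 𝓓(offAxis, ℂ)) :
    Integrable fun k => (potentialDeriv j k : ℂ) * f k := by
  have h : ContinuousOn (fun k => (potentialDeriv j k : ℂ)) offAxis := by
    refine ((contDiffOn_potential j).continuousOn_fderiv_of_isOpen offAxis.isOpen
      (by simp)).clm_apply (continuousOn_const (c := dir j)) |>.congr fun k hk => ?_
    have hd := ((contDiffOn_potential j).differentiableOn (by simp) k hk).differentiableAt
      (offAxis.isOpen.mem_nhds hk)
    exact (hasLineDerivAt_potential j k hk).unique (hd.hasFDerivAt.hasLineDerivAt _)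
  exact integrable_mul_test (h.locallyIntegrableOn offAxis.isOpen.measurableSet) f

/-- Integration by parts off the axis: the constant `(4c)⁻¹` times the divergence `2/(|k_⊥|²|k|)` is
the weighted kernel. -/
theorem invPot_incl (c : ℝ) (f : 𝓓(offAxis, ℂ)) :
    invPot c (incl le_top f) = ∫ k, weightedInv c k * f k := by
  rw [invPot_apply]
  have h1 : ∀ j, ∫ k, (potential j k : ℂ) *
      (∂_{dir j} (incl (le_top : offAxis ≤ ⊤) f) : 𝓓((⊤ : Opens R3), ℂ)) k =
      -∫ k, (potentialDeriv j k : ℂ) * f k := fun j => by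
    rw [lineDeriv_incl]
    exact integral_mul_lineDeriv (contDiffOn_potential j) (dir j)
      (hasLineDerivAt_potential j) f
  simp only [h1]
  rw [Finset.sum_neg_distrib, ← integral_finsetSum _ fun j _ => integrable_potentialDeriv_mul j f,
    neg_mul_neg, ← integral_const_mul]
  refine integral_congr_ae ?_
  filter_upwards [ae_coord_ne_zero (0 : Fin 3)] with k hk
  have hk' : k ∈ offAxis := (perpSq_pos hk).ne'
  rw [← Finset.sum_mul, ← Complex.ofReal_sum, sum_potentialDeriv hk', ← mul_assoc, weightedInv,
    powKernel]
  congr 1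
  push_cast
  simp only [pow_one, mul_inv, div_eq_mul_inv]
  ring

theorem logSq_between {a b c : ℝ} (ha : 0 < a) (hab : a ≤ b) (hbc : b ≤ c) :
    logSq b ≤ logSq a * logSq c := by
  have h1 := Real.log_le_log ha hab
  have h2 := Real.log_le_log (ha.trans_le hab) hbc
  unfold logSq
  rw [← mul_pow]
  have h3 : |Real.log b| ≤ |Real.log a| + |Real.log c| := by
    rw [abs_le]
    constructor
    · linarith [neg_abs_le (Real.log a), abs_nonneg (Real.log c)]
    · linarith [le_abs_self (Real.log c), abs_nonneg (Real.log a)]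
  gcongr
  nlinarith [abs_nonneg (Real.log a), abs_nonneg (Real.log c)]

theorem potBound_smul_le {μ : ℝ} (hμ : 0 < μ) {k : R3} (hk : k ∈ offAxis) :
    potBound (μ • k) ≤ (μ⁻¹ ^ 2 * (4 * (1 + |Real.log μ|) ^ 2)) * potBound k := by
  have hr : 0 < ‖k‖ := norm_pos_iff.2 (offAxis_le hk)
  have h1 := logSq_rescale hμ (perpSq_pos_of_mem hk)
  have h2 := logSq_rescale hμ (by positivity : 0 < ‖k‖ ^ 2)
  unfold potBound
  rw [perpSq_smul, norm_smul, Real.norm_of_nonneg hμ.le, mul_pow, Real.sqrt_mul (sq_nonneg μ),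
    Real.sqrt_sq hμ.le]
  calc _ ≤ (2 * (4 * (1 + |Real.log μ|) ^ 2 * logSq (perpSq k)) +
        4 * (1 + |Real.log μ|) ^ 2 * logSq (‖k‖ ^ 2)) *
          (μ * √(perpSq k) * (μ * ‖k‖))⁻¹ := by gcongr
    _ = _ := by simp only [mul_inv]; ring

/-- Up to logarithms the potential contributes `μ⁻²`, the derivative of the test function `μ⁻¹` and
the volume `μ³`. -/
theorem sdOrigin_invPot_le (c : ℝ) : sdOrigin (invPot c) ≤ ((3 : ℝ) : EReal) := by
  have h2 : (((3 : ℕ) : ℝ) - (0 : ℝ)) = 3 := by norm_num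
  rw [← h2]
  refine scalingDegree_le_of_bound fun f _ => ⟨|(4 * c)⁻¹| * ∑ j : Fin 3,
    4 * ∫ k, ‖(potBound k : ℂ) * (∂_{dir j} f : 𝓓((⊤ : Opens R3), ℂ)) k‖, fun μ _ => ?_⟩
  have hμ : 0 < (μ : ℝ) := μ.2
  refine (norm_invPot_le c (M := fun j => (4 * ∫ k, ‖(potBound k : ℂ) *
    (∂_{dir j} f : 𝓓((⊤ : Opens R3), ℂ)) k‖) * (1 + |Real.log μ|) ^ 2) fun j => ?_).trans ?_
  · rw [lineDeriv_isoScale]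
    simp only [smul_apply, smul_eq_mul]
    simp only [mul_left_comm _ ((((μ : ℝ)⁻¹ : ℝ)) : ℂ)]
    rw [integral_const_mul, integral_mul_isoScale, ← mul_assoc, ← Complex.ofReal_mul, norm_mul,
      Complex.norm_real, Real.norm_of_nonneg (by positivity)]
    have h3 : ‖∫ k, (potential j ((μ : ℝ) • k) : ℂ) * (∂_{dir j} f : 𝓓((⊤ : Opens R3), ℂ)) k‖ ≤
        ((μ : ℝ)⁻¹ ^ 2 * (4 * (1 + |Real.log μ|) ^ 2)) *
          ∫ k, ‖(potBound k : ℂ) * (∂_{dir j} f : 𝓓((⊤ : Opens R3), ℂ)) k‖ := by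
      rw [← integral_const_mul]
      refine norm_integral_le_of_norm_le ((integrable_mul_test
        (locallyIntegrable_potBound.locallyIntegrableOn _) _).norm.const_mul _) ?_
      filter_upwards [ae_coord_ne_zero (0 : Fin 3)] with k hk
      have hk' : k ∈ offAxis := (perpSq_pos hk).ne'
      have hk'' : (μ : ℝ) • k ∈ offAxis := by
        change perpSq _ ≠ 0
        rw [perpSq_smul]; exact mul_ne_zero (by positivity) hk'
      rw [norm_mul, norm_mul, ← mul_assoc, Complex.norm_real, Complex.norm_real,
        Real.norm_of_nonneg (potBound_nonneg k)]
      exact mul_le_mul_of_nonneg_right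
        ((abs_potential_le j hk'').trans (potBound_smul_le hμ hk')) (norm_nonneg _)
    calc _ ≤ (μ : ℝ)⁻¹ * (μ : ℝ) ^ 3 * (((μ : ℝ)⁻¹ ^ 2 * (4 * (1 + |Real.log μ|) ^ 2)) *
          ∫ k, ‖(potBound k : ℂ) * (∂_{dir j} f : 𝓓((⊤ : Opens R3), ℂ)) k‖) := by gcongr
      _ = _ := by field_simp
  · rw [Real.rpow_zero, one_mul, ← Finset.sum_mul, mul_assoc]

theorem contDiffOn_two_norm : ContDiffOn ℝ ∞ (fun k : R3 => ((2 * ‖k‖ : ℝ) : ℂ)) punctured3 :=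
  Complex.ofRealCLM.contDiff.comp_contDiffOn
    (contDiffOn_const.mul fun _ hk => (contDiffAt_norm ℝ hk).contDiffWithinAt)

/-- The extension `2|k| · invPot` of `1/(c|k_⊥|²)`. -/
def invPotAxis (c : ℝ) : Dist punctured3 :=
  restrict (Ω := punctured3) (invPot c) ∘L mulCLM contDiffOn_two_norm

theorem invPotAxis_apply (c : ℝ) (f : 𝓓(punctured3, ℂ)) :
    invPotAxis c f = invPot c (incl le_top (mulCLM contDiffOn_two_norm f)) := by
  rw [invPotAxis, ContinuousLinearMap.comp_apply, restrict_apply' le_top]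

theorem restrict_invPotAxis {lam : ℝ} (hlam : 0 < lam) :
    restrict (invPotAxis (2 * lam ^ 4)) = kernelDist lam (powKernel 1) := by
  ext f
  rw [restrict_apply' offAxis_le, invPotAxis_apply, kernelDist_apply (isKernel_pow le_rfl) hlam]
  let G : 𝓓(offAxis, ℂ) := mulCLM (contDiffOn_two_norm.mono offAxis_le) f
  have hG : incl (le_top : punctured3 ≤ ⊤) (mulCLM contDiffOn_two_norm (incl offAxis_le f)) =
      incl le_top G := by
    ext k
    rw [incl_apply, incl_apply, mulCLM_apply, mulCLM_apply, incl_apply]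
  rw [hG, invPot_incl]
  refine integral_congr_ae ?_
  filter_upwards [ae_coord_ne_zero (0 : Fin 3)] with k hk
  have h0 : k ≠ 0 := fun h => hk (by simp [h])
  have h1 : ((‖k‖ : ℝ) : ℂ) ≠ 0 := by exact_mod_cast norm_ne_zero_iff.2 h0
  rw [mulCLM_apply, weightedInv]
  push_cast
  rw [pow_one]
  field_simp

theorem isWeighted_invPotAxis (c : ℝ) :
    IsWeighted (invPotAxis c) (restrict (invPot c)) := fun f => by
  refine ⟨mulCLM (contDiffOn_weight 1 (1 / 2)) f, fun k => ?_, ?_⟩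
  · rw [mulCLM_apply]; push_cast; ring
  · rw [restrict_apply' le_top, invPotAxis_apply]
    congr 1
    ext k
    rw [incl_apply, incl_apply, mulCLM_apply, mulCLM_apply]
    rcases eq_or_ne k 0 with rfl | h
    · rw [testFunction_eq_zero f fun h => f.tsupport_subset h rfl]; simp
    · have h1 : ((‖k‖ : ℝ) : ℂ) ≠ 0 := by exact_mod_cast norm_ne_zero_iff.2 h
      push_cast
      rw [pow_one]
      field_simp

theorem norm_lineDeriv_perpScale_le {Ω : Opens R3} [Scalable Ω] {μ : Set.Ioi (0 : ℝ)}
    (hμ1 : (μ : ℝ) < 1) (f : 𝓓(Ω, ℂ)) (j : Fin 3) (k : R3) :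
    ‖(∂_{dir j} (perpScale μ f) : 𝓓(Ω, ℂ)) (perpDil μ k)‖ ≤
      (μ : ℝ)⁻¹ * ‖(∂_{dir j} f : 𝓓(Ω, ℂ)) k‖ := by
  have hμ : 0 < (μ : ℝ) := μ.2
  by_cases hj : j = 1
  · subst hj
    have h : (∂_{dir 1} (perpScale μ f) : 𝓓(Ω, ℂ)) (perpDil μ k) =
        (∂_{dir 1} f : 𝓓(Ω, ℂ)) k := by
      rw [lineDeriv_test', lineDeriv_test']
      congr 1
      funext t
      rw [perpScale_apply]
      congr 1
      ext i; fin_cases i <;> simp [perpDil, hμ.ne']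
    rw [h]
    exact le_mul_of_one_le_left (norm_nonneg _) ((one_le_inv₀ hμ).2 hμ1.le)
  · rw [lineDeriv_perpScale μ f hj, smul_apply, perpScale_apply, perpDil_perpDil,
      inv_mul_cancel₀ hμ.ne', perpDil_one, smul_eq_mul, norm_mul, Complex.norm_real,
      Real.norm_of_nonneg (by positivity)]

theorem norm_lineDeriv_mul_norm_le (f : 𝓓(punctured3, ℂ)) (j : Fin 3) {k : R3} (hk : k ≠ 0) :
    ‖(∂_{dir j} (mulCLM contDiffOn_two_norm f) : 𝓓(punctured3, ℂ)) k‖ ≤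
      2 * ‖f k‖ + 2 * ‖k‖ * ‖(∂_{dir j} f : 𝓓(punctured3, ℂ)) k‖ := by
  have h1 : HasDerivAt (fun t : ℝ => ((2 * ‖k + t • dir j‖ : ℝ) : ℂ)) ((2 * (k j / ‖k‖) : ℝ) : ℂ) 0 :=
    ((hasDerivAt_norm hk j).const_mul 2).ofReal_comp
  have h2 : HasDerivAt (fun t : ℝ => f (k + t • dir j)) ((∂_{dir j} f : 𝓓(punctured3, ℂ)) k) 0 := by
    rw [lineDeriv_test]
    exact ((f.contDiff.differentiable (by simp)) k).hasFDerivAt.hasLineDerivAt _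
  rw [lineDeriv_test']
  simp only [mulCLM_apply]
  have h3 := (h1.mul h2).deriv
  change deriv (fun t : ℝ => ((2 * ‖k + t • dir j‖ : ℝ) : ℂ) * f (k + t • dir j)) 0 = _ at h3
  rw [h3]
  simp only [zero_smul, add_zero]
  refine (norm_add_le _ _).trans ?_
  rw [norm_mul, norm_mul, Complex.norm_real, Complex.norm_real]
  have h4 : ‖(2 * (k j / ‖k‖) : ℝ)‖ ≤ 2 := by
    rw [norm_mul, norm_div, norm_norm]
    have : ‖k j‖ / ‖k‖ ≤ 1 := div_le_one_of_le₀ (PiLp.norm_apply_le k j) (norm_nonneg k)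
    rw [Real.norm_ofNat]
    linarith
  have h5 : ‖(2 * ‖k‖ : ℝ)‖ = 2 * ‖k‖ := Real.norm_of_nonneg (by positivity)
  rw [h5]
  gcongr

theorem locallyIntegrable_logSq_div :
    LocallyIntegrable fun k : R3 => ((logSq (perpSq k) * (√(perpSq k))⁻¹ : ℝ) : ℂ) := by
  refine locallyIntegrable_of_logSq (w := fun k => (√(perpSq k))⁻¹) ?_ zero_le_one (fun k => ?_)
    fun k hk => ?_
  · refine Complex.continuous_ofReal.comp_continuousOn (ContinuousOn.mul ?_ ?_)
    · have h : ContinuousOn (fun k : R3 => Real.log (perpSq k)) offAxis :=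
        contDiff_perpSq.continuous.continuousOn.log fun k hk => hk
      exact (continuousOn_const.add h.abs).pow 2
    · exact (Real.continuous_sqrt.comp contDiff_perpSq.continuous).continuousOn.inv₀
        fun k hk => (Real.sqrt_pos.2 (perpSq_pos_of_mem hk)).ne'
  · rcases eq_or_ne (√(perpSq k)) 0 with h | h
    · rw [h]; simp; positivity
    · rw [inv_mul_cancel_left₀ h]; nlinarith [sq_nonneg (‖k‖ - 1)]
  · rw [Complex.norm_real, Real.norm_of_nonneg, one_mul]
    exact mul_nonneg (logSq_nonneg _) (inv_nonneg.2 (Real.sqrt_nonneg _))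

theorem norm_perpDil_le {μ : ℝ} (hμ : 0 < μ) (hμ1 : μ < 1) (k : R3) : ‖perpDil μ k‖ ≤ ‖k‖ := by
  refine (sq_le_sq₀ (norm_nonneg _) (norm_nonneg _)).1 ?_
  rw [norm_sq_R3, norm_sq_R3]
  simp only [perpDil, Matrix.cons_val_zero, Matrix.cons_val_one, Matrix.cons_val, mul_pow]
  have h1 : μ ^ 2 ≤ 1 := pow_le_one₀ hμ.le hμ1.le
  nlinarith [sq_nonneg (k 0), sq_nonneg (k 2)]

/-- Bound of the potential at a transversally rescaled point. -/
theorem potBound_perpDil_le {μ : ℝ} (hμ : 0 < μ) (hμ1 : μ < 1) {k : R3} (h0 : k 0 ≠ 0) {R : ℝ}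
    (hR : ‖k‖ ≤ R) : potBound (perpDil μ k) * ‖perpDil μ k‖ ≤
      μ⁻¹ * (4 * (2 + logSq (R ^ 2))) * (1 + |Real.log μ|) ^ 2 *
        (logSq (perpSq k) * (√(perpSq k))⁻¹) := by
  have ht : 0 < perpSq k := perpSq_pos h0
  have h1 := logSq_rescale hμ ht
  have hk' : 0 < ‖perpDil μ k‖ := norm_pos_iff.2 fun h => by
    have : (perpDil μ k) 0 = 0 := by rw [h]; rfl
    simp [perpDil, hμ.ne', h0] at this
  have h2 : logSq (‖perpDil μ k‖ ^ 2) ≤ logSq (μ ^ 2 * perpSq k) * logSq (R ^ 2) := by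
    refine logSq_between (by positivity) ?_ ?_
    · rw [← perpSq_perpDil]; exact perpSq_le_norm_sq _
    · exact pow_le_pow_left₀ (norm_nonneg _) ((norm_perpDil_le hμ hμ1 k).trans hR) 2
  have h3 := logSq_nonneg (R ^ 2)
  have hs : √(perpSq (perpDil μ k)) = μ * √(perpSq k) := by
    rw [perpSq_perpDil, Real.sqrt_mul (sq_nonneg μ), Real.sqrt_sq hμ.le]
  unfold potBound
  rw [hs, perpSq_perpDil, mul_inv, mul_assoc, mul_assoc, inv_mul_cancel₀ hk'.ne', mul_one]
  have h4 : 2 * logSq (μ ^ 2 * perpSq k) + logSq (‖perpDil μ k‖ ^ 2) ≤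
      (4 * (1 + |Real.log μ|) ^ 2 * logSq (perpSq k)) * (2 + logSq (R ^ 2)) := by
    calc _ ≤ logSq (μ ^ 2 * perpSq k) * (2 + logSq (R ^ 2)) := by linarith
      _ ≤ _ := by gcongr
  calc _ ≤ (4 * (1 + |Real.log μ|) ^ 2 * logSq (perpSq k)) * (2 + logSq (R ^ 2)) *
        (μ * √(perpSq k))⁻¹ := by gcongr
    _ = _ := by rw [mul_inv]; ring

/-- Under transversal scaling the potential is at most of order `μ⁻¹`, by its factor `1/|k_⊥|`, and
the derivative of the scaled test function is of order `μ⁻¹`; the volume factor `μ²` compensates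
both. The number `δ` bounds `1/|k₂|` on the support and controls the derivative that falls on the
weight `2|k|`. -/
theorem norm_potential_lineDeriv_le (f : 𝓓(punctured3, ℂ)) {μ : Set.Ioi (0 : ℝ)}
    (hμ1 : (μ : ℝ) < 1) (j : Fin 3) {R δ : ℝ} (hR : ∀ k ∈ tsupport f, ‖k‖ ≤ R)
    (hδ : ∀ k ∈ tsupport f, k 1 ≠ 0 ∧ ‖(k 1)⁻¹‖ ≤ δ) {k : R3} (h0 : k 0 ≠ 0) :
    ‖(potential j (perpDil μ k) : ℂ) * (∂_{dir j} (mulCLM contDiffOn_two_norm (perpScale μ f)) :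
        𝓓(punctured3, ℂ)) (perpDil μ k)‖ ≤
      ((μ : ℝ)⁻¹ ^ 2 * (1 + |Real.log μ|) ^ 2 * (8 * (2 + logSq (R ^ 2)))) *
        (δ * ‖((logSq (perpSq k) * (√(perpSq k))⁻¹ : ℝ) : ℂ) * f k‖ +
          ‖((logSq (perpSq k) * (√(perpSq k))⁻¹ : ℝ) : ℂ) *
            (∂_{dir j} f : 𝓓(punctured3, ℂ)) k‖) := by
  have hμ : 0 < (μ : ℝ) := μ.2
  have hk0 : perpDil μ k ≠ 0 := fun h => by
    have : (perpDil μ k) 0 = 0 := by rw [h]; rfl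
    simp [perpDil, hμ.ne', h0] at this
  have hkn : 0 < ‖perpDil μ k‖ := norm_pos_iff.2 hk0
  have hkA : perpDil μ k ∈ offAxis := by
    change perpSq _ ≠ 0
    rw [perpSq_perpDil]; exact mul_ne_zero (by positivity) (perpSq_pos h0).ne'
  have e1 := norm_lineDeriv_mul_norm_le (perpScale μ f) j hk0
  rw [perpScale_apply, perpDil_perpDil, inv_mul_cancel₀ hμ.ne', perpDil_one] at e1
  have e2 := norm_lineDeriv_perpScale_le hμ1 f j k
  have e3 := abs_potential_le j hkA
  have hQ : 0 ≤ logSq (perpSq k) * (√(perpSq k))⁻¹ :=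
    mul_nonneg (logSq_nonneg _) (inv_nonneg.2 (Real.sqrt_nonneg _))
  rw [norm_mul, norm_mul, norm_mul, Complex.norm_real, Complex.norm_real, Real.norm_of_nonneg hQ,
    Real.norm_eq_abs]
  set Q := logSq (perpSq k) * (√(perpSq k))⁻¹
  set D := ‖(∂_{dir j} f : 𝓓(punctured3, ℂ)) k‖
  set L := (1 + |Real.log (μ : ℝ)|) ^ 2
  have hD : 0 ≤ D := norm_nonneg _
  have hL : 0 ≤ L := sq_nonneg _
  have hμi : 1 ≤ (μ : ℝ)⁻¹ := (one_le_inv₀ hμ).2 hμ1.le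
  have hA : 0 ≤ 2 + logSq (R ^ 2) := by have := logSq_nonneg (R ^ 2); linarith
  by_cases hk : k ∈ tsupport f
  · have e4 := potBound_perpDil_le hμ hμ1 h0 (hR k hk)
    obtain ⟨h1, hδk⟩ := hδ k hk
    have e5 : ‖perpDil μ k‖⁻¹ ≤ δ := by
      refine le_trans ?_ hδk
      rw [norm_inv]
      refine inv_anti₀ (norm_pos_iff.2 h1) ?_
      have := PiLp.norm_apply_le (perpDil (μ : ℝ) k) 1
      simpa [perpDil] using this
    have hδ0 : 0 ≤ δ := (inv_nonneg.2 hkn.le).trans e5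
    calc _ ≤ potBound (perpDil μ k) * (2 * ‖f k‖ + 2 * ‖perpDil μ k‖ * ((μ : ℝ)⁻¹ * D)) := by
          refine mul_le_mul e3 (e1.trans ?_) (norm_nonneg _) (potBound_nonneg _)
          gcongr
      _ = (potBound (perpDil μ k) * ‖perpDil μ k‖) *
          (2 * (‖perpDil μ k‖⁻¹ * ‖f k‖ + (μ : ℝ)⁻¹ * D)) := by field_simp
      _ ≤ ((μ : ℝ)⁻¹ * (4 * (2 + logSq (R ^ 2))) * L * Q) *
          (2 * ((μ : ℝ)⁻¹ * (δ * ‖f k‖) + (μ : ℝ)⁻¹ * D)) := by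
          have : ‖perpDil μ k‖⁻¹ * ‖f k‖ ≤ (μ : ℝ)⁻¹ * (δ * ‖f k‖) := by
            calc _ ≤ 1 * (δ * ‖f k‖) := by rw [one_mul]; gcongr
              _ ≤ _ := by gcongr
          gcongr
      _ = _ := by ring
  · have z1 : f k = 0 := testFunction_eq_zero f hk
    have z2 : D = 0 := by
      have : (f : R3 → ℂ) =ᶠ[𝓝 k] fun _ => 0 := by
        filter_upwards [(isClosed_tsupport f).isOpen_compl.mem_nhds hk] with x hx
        exact testFunction_eq_zero f hx
      simp only [D]
      rw [lineDeriv_test, this.fderiv_eq]; simp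
    rw [z2, mul_zero] at e2
    have z3 := le_antisymm e2 (norm_nonneg _)
    rw [z1, z3] at e1
    simp only [norm_zero, mul_zero, add_zero] at e1
    rw [le_antisymm e1 (norm_nonneg _), z1, z2]
    simp

theorem sdAxis_invPotAxis_le (c : ℝ) : sdAxis (invPotAxis c) ≤ ((2 : ℝ) : EReal) := by
  have h2 : (((2 : ℕ) : ℝ) - (0 : ℝ)) = 2 := by norm_num
  rw [← h2]
  refine scalingDegree_le_of_bound fun f hf => ?_
  obtain ⟨R, hR⟩ := f.hasCompactSupport.isCompact.isBounded.exists_norm_le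
  -- Testing at `k₂ ≠ 0` keeps `1/|k₂|` bounded on the compact support.
  obtain ⟨δ', hδ'⟩ := f.hasCompactSupport.isCompact.exists_bound_of_continuousOn
    (f := fun k : R3 => (k 1)⁻¹) (ContinuousOn.inv₀ (Continuous.continuousOn (by fun_prop))
      fun k hk => hf hk)
  set Q : R3 → ℝ := fun k => logSq (perpSq k) * (√(perpSq k))⁻¹ with hQ
  set A : ℝ := 8 * (2 + logSq (R ^ 2)) with hA
  refine ⟨|(4 * c)⁻¹| * ∑ j : Fin 3, A * ∫ k, (δ' * ‖(Q k : ℂ) * f k‖ +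
    ‖(Q k : ℂ) * (∂_{dir j} f : 𝓓(punctured3, ℂ)) k‖), fun μ hμ1 => ?_⟩
  have hμ : 0 < (μ : ℝ) := μ.2
  rw [invPotAxis_apply]
  refine (norm_invPot_le c (M := fun j => (A * ∫ k, (δ' * ‖(Q k : ℂ) * f k‖ +
    ‖(Q k : ℂ) * (∂_{dir j} f : 𝓓(punctured3, ℂ)) k‖)) * (1 + |Real.log μ|) ^ 2) fun j => ?_).trans ?_
  · rw [lineDeriv_incl]
    simp only [incl_apply]
    have hch := integral_perpDil (fun k => (potential j k : ℂ) * (∂_{dir j} (mulCLM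
      contDiffOn_two_norm (perpScale μ f)) : 𝓓(punctured3, ℂ)) k) hμ
    have hμ2 : (((μ : ℝ) ^ 2 : ℝ) : ℂ) ≠ 0 := by exact_mod_cast (by positivity : (μ : ℝ) ^ 2 ≠ 0)
    rw [eq_inv_mul_iff_mul_eq₀ hμ2] at hch
    rw [← hch, norm_mul, Complex.norm_real, Real.norm_of_nonneg (by positivity)]
    have hQi := locallyIntegrable_logSq_div.locallyIntegrableOn (punctured3 : Set R3)
    have key : ‖∫ k, (potential j (perpDil μ k) : ℂ) * (∂_{dir j} (mulCLM
        contDiffOn_two_norm (perpScale μ f)) : 𝓓(punctured3, ℂ)) (perpDil μ k)‖ ≤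
        ((μ : ℝ)⁻¹ ^ 2 * (1 + |Real.log μ|) ^ 2 * A) * ∫ k, (δ' * ‖(Q k : ℂ) * f k‖ +
          ‖(Q k : ℂ) * (∂_{dir j} f : 𝓓(punctured3, ℂ)) k‖) := by
      rw [← integral_const_mul]
      refine norm_integral_le_of_norm_le ((((integrable_mul_test hQi f).norm.const_mul δ').add
        (integrable_mul_test hQi _).norm).const_mul _) ?_
      filter_upwards [ae_coord_ne_zero (0 : Fin 3)] with k hk
      exact norm_potential_lineDeriv_le f hμ1 j hR (fun k hk => ⟨hf hk, hδ' k hk⟩) hk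
    calc _ ≤ (μ : ℝ) ^ 2 * (((μ : ℝ)⁻¹ ^ 2 * (1 + |Real.log μ|) ^ 2 * A) *
          ∫ k, (δ' * ‖(Q k : ℂ) * f k‖ +
          ‖(Q k : ℂ) * (∂_{dir j} f : 𝓓(punctured3, ℂ)) k‖)) := by gcongr
      _ = _ := by field_simp
  · rw [Real.rpow_zero, one_mul, ← Finset.sum_mul, mul_assoc]

theorem sd_restrict_le {Ω Ω' : Opens R3} (h : Ω ≤ Ω') {d : ℕ}
    {scale : Set.Ioi (0 : ℝ) → 𝓓(Ω, ℂ) → 𝓓(Ω, ℂ)} {scale' : Set.Ioi (0 : ℝ) → 𝓓(Ω', ℂ) → 𝓓(Ω', ℂ)}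
    (hs : ∀ μ f, incl h (scale μ f) = scale' μ (incl h f)) (V : Set R3) (T : Dist Ω') :
    scalingDegree d scale V (restrict (Ω := Ω) T) ≤ scalingDegree d scale' V T := by
  rw [scalingDegree_eq, scalingDegree_eq]
  refine sInf_le_sInf (Set.image_mono fun a ha f hf => ?_)
  refine (ha (incl h f) hf).congr fun μ => ?_
  rw [restrict_apply' h, hs]

/-- For `K = 1/x` there is an extension with an extension to the origin. -/
theorem exists_originExtension {lam : ℝ} (hlam : 0 < lam) :
    ∃ T ∈ axisExtensions (kernelDist lam (powKernel 1)),
        ∃ W : Dist punctured3, IsWeighted T W ∧ sdOrigin W = 3 ∧ (originExtensions W).Nonempty := by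
  have h1 : sdOrigin (restrict (Ω := punctured3) (invPot (2 * lam ^ 4))) ≤ ((3 : ℝ) : EReal) :=
    (sd_restrict_le le_top (scale := isoScale) (scale' := isoScale) (fun _ _ => rfl) Set.univ
      (invPot (2 * lam ^ 4))).trans (sdOrigin_invPot_le _)
  have h2 := three_le_sdOrigin_weighted hlam (restrict_invPotAxis hlam)
    (isWeighted_invPotAxis (2 * lam ^ 4))
  have h3 : sdOrigin (restrict (Ω := punctured3) (invPot (2 * lam ^ 4))) = 3 := le_antisymm h1 h2
  refine ⟨invPotAxis (2 * lam ^ 4), ⟨restrict_invPotAxis hlam, ?_⟩, restrict (invPot (2 * lam ^ 4)),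
    isWeighted_invPotAxis _, h3, invPot (2 * lam ^ 4), rfl, ?_⟩
  · rw [sdAxis_kernelDist_pow hlam le_rfl, Nat.cast_one, mul_one]
    exact sdAxis_invPotAxis_le (2 * lam ^ 4)
  · rw [h3]; exact sdOrigin_invPot_le _

/-! ### Boundary values -/

/-- The unit vector of `ℝ⁴` in direction `i`. -/
abbrev dir4 (i : Fin 4) : R4 := EuclideanSpace.single i 1

/-- The signs of the quadratic form `-(kΘ₀)²`. -/
def sgn4 (i : Fin 4) : ℝ := if i = 2 then -1 else 1

theorem negKThetaSq_add_smul (lam : ℝ) (k : R4) (i : Fin 4) (t : ℝ) :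
    negKThetaSq lam (k + t • dir4 i) =
      negKThetaSq lam k + 2 * lam ^ 4 * sgn4 i * k i * t + lam ^ 4 * sgn4 i * t ^ 2 := by
  rw [negKThetaSq_eq, negKThetaSq_eq]
  fin_cases i <;> simp [sgn4] <;> ring

theorem hasDerivAt_negKThetaSq (lam : ℝ) (k : R4) (i : Fin 4) :
    HasDerivAt (fun t : ℝ => negKThetaSq lam (k + t • dir4 i)) (2 * lam ^ 4 * sgn4 i * k i) 0 := by
  simp only [negKThetaSq_add_smul]
  have h := (((hasDerivAt_id (0 : ℝ)).const_mul (2 * lam ^ 4 * sgn4 i * k i)).const_add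
    (negKThetaSq lam k)).add ((hasDerivAt_pow 2 (0 : ℝ)).const_mul (lam ^ 4 * sgn4 i))
  exact h.congr_deriv (by simp)

/-- The components of `∇q / |∇q|²`, where `q = -(kΘ₀)²`. -/
def gradCoeff (lam : ℝ) (i : Fin 4) (k : R4) : ℂ :=
  ((sgn4 i * k i / (2 * lam ^ 4 * ‖k‖ ^ 2) : ℝ) : ℂ)

theorem contDiffOn_gradCoeff {lam : ℝ} (hlam : 0 < lam) (i : Fin 4) :
    ContDiffOn ℝ ∞ (gradCoeff lam i) punctured4 := by
  refine Complex.ofRealCLM.contDiff.comp_contDiffOn ?_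
  have h1 : ContDiff ℝ ∞ fun k : R4 => sgn4 i * k i := by fun_prop
  refine h1.contDiffOn.div (contDiff_const.mul (contDiff_norm_sq ℝ)).contDiffOn fun k hk => ?_
  have : ‖k‖ ≠ 0 := norm_ne_zero_iff.2 hk
  positivity

/-- The transpose of the operator `f ↦ |∇q|⁻² ∇q · ∇f`. -/
def gradOp {lam : ℝ} (hlam : 0 < lam) : 𝓓(punctured4, ℂ) →L[ℂ] 𝓓(punctured4, ℂ) :=
  -∑ i, derivCLM (dir4 i) ∘L mulCLM (contDiffOn_gradCoeff hlam i)

/-- The regularised variable `ε - iσq`, so that `q + iσε = iσ(ε - iσq)`. -/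
def regVar (lam σ ε : ℝ) (k : R4) : ℂ := (ε : ℂ) - (σ * negKThetaSq lam k : ℝ) * Complex.I

theorem regVar_re (lam σ ε : ℝ) (k : R4) : (regVar lam σ ε k).re = ε := by simp [regVar]

theorem contDiff_regVar (lam σ ε : ℝ) : ContDiff ℝ ∞ (regVar lam σ ε) := by
  unfold regVar
  refine contDiff_const.sub (ContDiff.mul ?_ contDiff_const)
  exact Complex.ofRealCLM.contDiff.comp (contDiff_const.mul (contDiff_negKThetaSq lam))

theorem isOpen_rightHalf : IsOpen {w : ℂ | 0 < w.re} := isOpen_lt continuous_const Complex.continuous_re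

/-- Along `∇q/|∇q|²` the function `q` has derivative one, so `Φ(ε - iσq)` has derivative `-iσΦ'`.
Integration by parts trades `Φ'` for `Φ`; the coefficients are smooth because `|∇q|² = 4λ⁸‖k‖²`
vanishes only at the origin. -/
theorem integral_regVar_gradOp {lam : ℝ} (hlam : 0 < lam) {σ : ℝ} (hσ : σ ^ 2 = 1) {ε : ℝ}
    (hε : 0 < ε) {Φ Φ' : ℂ → ℂ} (hΦ : ∀ w : ℂ, 0 < w.re → HasDerivAt Φ (Φ' w) w)
    (hc : ContinuousOn Φ' {w : ℂ | 0 < w.re}) (f : 𝓓(punctured4, ℂ)) :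
    ∫ k, Φ' (regVar lam σ ε k) * f k =
      (σ * Complex.I) * ∫ k, Φ (regVar lam σ ε k) * gradOp hlam f k := by
  have hsm : ContDiffOn ℝ ∞ (fun k => Φ (regVar lam σ ε k)) punctured4 := by
    -- A complex differentiable function on an open set is smooth, so one derivative suffices as
    -- hypothesis.
    have h1 : ContDiffOn ℂ ∞ Φ {w : ℂ | 0 < w.re} :=
      DifferentiableOn.contDiffOn (fun w hw => (hΦ w hw).differentiableAt.differentiableWithinAt)
        isOpen_rightHalf
    exact (h1.restrict_scalars ℝ).comp (contDiff_regVar lam σ ε).contDiffOn fun k _ => by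
      change 0 < (regVar lam σ ε k).re
      rw [regVar_re]; exact hε
  have hpos : ∀ k, 0 < (regVar lam σ ε k).re := fun k => by rw [regVar_re]; exact hε
  have hder : ∀ (i : Fin 4) (k : R4), HasLineDerivAt ℝ (fun k => Φ (regVar lam σ ε k))
      (Φ' (regVar lam σ ε k) * (-((σ * (2 * lam ^ 4 * sgn4 i * k i) : ℝ) : ℂ) * Complex.I)) k
      (dir4 i) := fun i k => by
    have h1 : HasDerivAt (fun t : ℝ => regVar lam σ ε (k + t • dir4 i))
        (-((σ * (2 * lam ^ 4 * sgn4 i * k i) : ℝ) : ℂ) * Complex.I) 0 := by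
      have := (((hasDerivAt_negKThetaSq lam k i).const_mul σ).ofReal_comp.mul_const
        Complex.I).const_sub (ε : ℂ)
      exact this.congr_deriv (by ring)
    exact (hΦ _ (hpos k)).comp_of_eq (0 : ℝ) h1 (by simp)
  have hint : ∀ (a : R4 → ℂ), ContinuousOn a punctured4 → ∀ g : 𝓓(punctured4, ℂ),
      Integrable fun k => a k * g k := fun a ha g =>
    integrable_mul_test (ha.locallyIntegrableOn punctured4.isOpen.measurableSet) g
  have h1 : ∀ k, Φ (regVar lam σ ε k) * gradOp hlam f k = -∑ i, Φ (regVar lam σ ε k) *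
      (∂_{dir4 i} (mulCLM (contDiffOn_gradCoeff hlam i) f) : 𝓓(punctured4, ℂ)) k := fun k => by
    rw [gradOp, _root_.neg_apply, sum_apply, _root_.neg_apply, mul_neg, sum_apply, Finset.mul_sum]
    rfl
  simp only [h1]
  rw [integral_neg, integral_finsetSum _ fun i _ => hint _ hsm.continuousOn _]
  simp only [fun i => integral_mul_lineDeriv hsm (dir4 i) (fun k _ => hder i k)
    (mulCLM (contDiffOn_gradCoeff hlam i) f)]
  have hc' : ContinuousOn (fun k => Φ' (regVar lam σ ε k)) punctured4 :=
    hc.comp (contDiff_regVar lam σ ε).continuous.continuousOn fun k _ => hpos k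
  rw [Finset.sum_neg_distrib, neg_neg, ← integral_finsetSum _ fun i _ => by
    refine hint _ (hc'.mul (Continuous.continuousOn ?_)) _
    refine Continuous.mul (Continuous.neg ?_) continuous_const
    exact Complex.continuous_ofReal.comp (by fun_prop), ← integral_const_mul]
  refine integral_congr_ae (Eventually.of_forall fun k => ?_)
  by_cases hk : k ∈ punctured4
  swap
  · simp [testFunction_eq_zero f fun h => hk (f.tsupport_subset h)]
  have hk0 : ‖k‖ ≠ 0 := norm_ne_zero_iff.2 hk
  have hkc : ((‖k‖ : ℝ) : ℂ) ≠ 0 := by exact_mod_cast hk0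
  have hlc : (lam : ℂ) ≠ 0 := by exact_mod_cast hlam.ne'
  have hn : ((‖k‖ : ℝ) : ℂ) ^ 2 = (k 0 : ℂ) ^ 2 + (k 1 : ℂ) ^ 2 + (k 2 : ℂ) ^ 2 + (k 3 : ℂ) ^ 2 := by
    have := norm_sq_R4 k
    exact_mod_cast this
  have hσc : (σ : ℂ) ^ 2 = 1 := by exact_mod_cast hσ
  simp only [Fin.sum_univ_four, mulCLM_apply, gradCoeff, sgn4]
  simp only [Fin.reduceEq, if_true, if_false]
  push_cast
  field_simp
  rw [Complex.I_sq, hσc, hn]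
  ring

/-- A sequence of functions, each the derivative of the preceding one: `w log w - w`, `log w`,
`w⁻¹`, `-w⁻²`, … -/
def logTower : ℕ → ℂ → ℂ
  | 0 => fun w => w * Complex.log w - w
  | 1 => Complex.log
  | j + 2 => fun w => ((-1) ^ j * (j.factorial : ℂ)) * (w ^ (j + 1))⁻¹

theorem hasDerivAt_logTower (j : ℕ) {w : ℂ} (hw : 0 < w.re) :
    HasDerivAt (logTower j) (logTower (j + 1) w) w := by
  have hs : w ∈ Complex.slitPlane := Or.inl hw
  have h0 : w ≠ 0 := Complex.slitPlane_ne_zero hs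
  match j with
  | 0 =>
    refine (((hasDerivAt_id w).mul (Complex.hasDerivAt_log hs)).sub (hasDerivAt_id w)).congr_deriv ?_
    simp [logTower, h0]
  | 1 =>
    refine (Complex.hasDerivAt_log hs).congr_deriv ?_
    simp [logTower]
  | j + 2 =>
    refine (((hasDerivAt_pow (j + 1) w).inv (pow_ne_zero _ h0)).const_mul _).congr_deriv ?_
    simp only [logTower, Nat.factorial_succ, pow_succ]
    push_cast
    field_simp

theorem continuousOn_logTower (j : ℕ) : ContinuousOn (logTower j) {w : ℂ | 0 < w.re} :=
  fun _ hw => (hasDerivAt_logTower j hw).continuousAt.continuousWithinAt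

theorem integral_logTower {lam : ℝ} (hlam : 0 < lam) {σ : ℝ} (hσ : σ ^ 2 = 1) {ε : ℝ}
    (hε : 0 < ε) (j : ℕ) (f : 𝓓(punctured4, ℂ)) :
    ∫ k, logTower j (regVar lam σ ε k) * f k =
      (σ * Complex.I) ^ j * ∫ k, logTower 0 (regVar lam σ ε k) * (gradOp hlam ^ j) f k := by
  induction j generalizing f with
  | zero => simp
  | succ j ih =>
    rw [integral_regVar_gradOp hlam hσ hε (fun w hw => hasDerivAt_logTower j hw)
      (continuousOn_logTower (j + 1)), ih, pow_succ, pow_succ, mul_apply_eq_comp]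
    ring

theorem norm_logTower_zero_le (w : ℂ) :
    ‖logTower 0 w‖ ≤ |‖w‖ * Real.log ‖w‖| + (Real.pi + 1) * ‖w‖ := by
  have h1 : ‖Complex.log w‖ ≤ |Real.log ‖w‖| + Real.pi := by
    refine (Complex.norm_le_abs_re_add_abs_im _).trans ?_
    rw [Complex.log_re, Complex.log_im]
    gcongr
    exact Complex.abs_arg_le_pi w
  calc ‖logTower 0 w‖ ≤ ‖w‖ * ‖Complex.log w‖ + ‖w‖ := by
        rw [← norm_mul]; exact norm_sub_le _ _
    _ ≤ ‖w‖ * (|Real.log ‖w‖| + Real.pi) + ‖w‖ := by gcongr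
    _ = _ := by rw [abs_mul, abs_norm]; ring

theorem norm_logTower_zero_le_sq (w : ℂ) : ‖logTower 0 w‖ ≤ 6 * (1 + ‖w‖) ^ 2 := by
  have h2 : |‖w‖ * Real.log ‖w‖| ≤ 1 + ‖w‖ ^ 2 := by
    rcases (norm_nonneg w).eq_or_lt with h | h
    · rw [← h]; simp
    rcases le_or_gt ‖w‖ 1 with h1 | h1
    · have := Real.abs_log_mul_self_lt ‖w‖ h h1
      rw [mul_comm]; nlinarith
    · rw [abs_of_nonneg (mul_nonneg h.le (Real.log_nonneg h1.le))]
      have := Real.log_le_self h.le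
      nlinarith
  have h3 := Real.pi_lt_d2
  have h4 := norm_nonneg w
  refine (norm_logTower_zero_le w).trans ?_
  nlinarith

/-- The factor `w` tames the logarithm at zero. At `ε = 0` the variable is imaginary, hence zero or
in the slit plane, so the limit `ε → 0` can be taken pointwise. -/
theorem continuousAt_logTower_zero {w : ℂ} (hw : w = 0 ∨ w ∈ Complex.slitPlane) :
    ContinuousAt (logTower 0) w := by
  rcases hw with rfl | hw
  · have h0 : logTower 0 0 = 0 := by simp [logTower]
    rw [ContinuousAt, h0]
    refine squeeze_zero_norm norm_logTower_zero_le ?_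
    have h : Continuous fun w : ℂ => |‖w‖ * Real.log ‖w‖| + (Real.pi + 1) * ‖w‖ := by
      have := Real.continuous_mul_log.comp (continuous_norm (E := ℂ))
      exact (continuous_abs.comp this).add (by fun_prop)
    simpa using h.tendsto 0
  · exact (continuousAt_id.mul (continuousAt_clog hw)).sub continuousAt_id

theorem norm_regVar_le {σ : ℝ} (hσ : |σ| = 1) (lam : ℝ) {ε : ℝ} (h0 : 0 ≤ ε) (h1 : ε ≤ 1) (k : R4) :
    ‖regVar lam σ ε k‖ ≤ 1 + |negKThetaSq lam k| := by
  refine (norm_sub_le _ _).trans ?_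
  rw [norm_mul, Complex.norm_I, Complex.norm_real, Complex.norm_real, mul_one, Real.norm_eq_abs,
    Real.norm_eq_abs, abs_mul, hσ, one_mul, abs_of_nonneg h0]
  gcongr

theorem measurable_logTower_zero : Measurable (logTower 0) :=
  (measurable_id.mul Complex.measurable_log).sub measurable_id

theorem regVar_zero_mem {σ : ℝ} (hσ : |σ| = 1) (lam : ℝ) (k : R4) :
    regVar lam σ 0 k = 0 ∨ regVar lam σ 0 k ∈ Complex.slitPlane := by
  by_cases h : negKThetaSq lam k = 0
  · left; simp [regVar, h]
  · right
    refine Or.inr ?_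
    have : σ ≠ 0 := by rintro rfl; simp at hσ
    simp [regVar, this, h]

theorem locallyIntegrable_logTower_zero {σ : ℝ} (hσ : |σ| = 1) (lam : ℝ) :
    LocallyIntegrable (fun k => logTower 0 (regVar lam σ 0 k)) (volume : Measure R4) := by
  have hb : Continuous fun k : R4 => 6 * (1 + (1 + |negKThetaSq lam k|)) ^ 2 := by
    have := (contDiff_negKThetaSq lam).continuous
    fun_prop
  refine hb.locallyIntegrable.mono
    (measurable_logTower_zero.comp (contDiff_regVar lam σ 0).continuous.measurable).aestronglyMeasurable
    (Eventually.of_forall fun k => ?_)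
  rw [Real.norm_of_nonneg (by positivity)]
  refine (norm_logTower_zero_le_sq _).trans ?_
  gcongr
  exact norm_regVar_le hσ lam le_rfl zero_le_one k

theorem tendsto_logTower_zero {σ : ℝ} (hσ : |σ| = 1) (lam : ℝ) (g : 𝓓(punctured4, ℂ)) :
    Tendsto (fun ε : ℝ => ∫ k, logTower 0 (regVar lam σ ε k) * g k) (𝓝[>] 0)
      (𝓝 (∫ k, logTower 0 (regVar lam σ 0 k) * g k)) := by
  have hb : Continuous fun k : R4 => 6 * (1 + (1 + |negKThetaSq lam k|)) ^ 2 := by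
    have := (contDiff_negKThetaSq lam).continuous
    fun_prop
  refine tendsto_integral_filter_of_dominated_convergence
    (fun k => 6 * (1 + (1 + |negKThetaSq lam k|)) ^ 2 * ‖g k‖) ?_ ?_ ?_ ?_
  · exact Eventually.of_forall fun ε =>
      ((measurable_logTower_zero.comp (contDiff_regVar lam σ ε).continuous.measurable).mul
        g.contDiff.continuous.measurable).aestronglyMeasurable
  · filter_upwards [Ioc_mem_nhdsGT (show (0 : ℝ) < 1 by norm_num)] with ε hε
    refine Eventually.of_forall fun k => ?_
    rw [norm_mul]
    gcongr
    refine (norm_logTower_zero_le_sq _).trans ?_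
    gcongr
    exact norm_regVar_le hσ lam hε.1.le hε.2 k
  · refine Continuous.integrable_of_hasCompactSupport (hb.mul g.contDiff.continuous.norm) ?_
    exact (g.hasCompactSupport.norm).mul_left
  · refine Eventually.of_forall fun k => ?_
    refine Tendsto.mul_const _ ?_
    refine (continuousAt_logTower_zero (regVar_zero_mem hσ lam k)).tendsto.comp ?_
    have : Continuous fun ε : ℝ => regVar lam σ ε k := by unfold regVar; fun_prop
    exact (this.tendsto 0).mono_left nhdsWithin_le_nhds

theorem regArg_eq (lam : ℝ) {σ : ℝ} (hσ : σ ^ 2 = 1) (ε : ℝ) (k : R4) :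
    (negKThetaSq lam k : ℂ) + ((σ * ε : ℝ) : ℂ) * Complex.I =
      (σ * Complex.I) * regVar lam σ ε k := by
  have hσc : (σ : ℂ) ^ 2 = 1 := by exact_mod_cast hσ
  unfold regVar
  push_cast
  linear_combination (-(negKThetaSq lam k : ℂ)) * hσc +
    (negKThetaSq lam k : ℂ) * (σ : ℂ) ^ 2 * Complex.I_sq

/-- The argument of `w` lies strictly between `-π/2` and `π/2`, so adding `±π/2` does not cross the
branch cut. -/
theorem log_sign_I_mul {σ : ℝ} (hσ : σ = 1 ∨ σ = -1) {w : ℂ} (hw : 0 < w.re) :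
    Complex.log (σ * Complex.I * w) = Complex.log w + σ * (Real.pi / 2) * Complex.I := by
  have h0 : w ≠ 0 := Complex.slitPlane_ne_zero (Or.inl hw)
  have harg := Complex.abs_arg_lt_pi_div_two_iff.2 (Or.inl hw)
  rw [abs_lt] at harg
  have hpi := Real.pi_pos
  have hlog : Complex.log (σ * Complex.I) = σ * (Real.pi / 2) * Complex.I := by
    rcases hσ with rfl | rfl
    · simp [Complex.log_I]
    · simp [Complex.log_neg_I]
  have harg' : Complex.arg (σ * Complex.I) = σ * (Real.pi / 2) := by
    rcases hσ with rfl | rfl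
    · simp
    · simp
  have hne : (σ * Complex.I : ℂ) ≠ 0 := by rcases hσ with rfl | rfl <;> simp
  rw [Complex.log_mul hne h0, hlog, add_comm]
  rw [harg']
  rcases hσ with rfl | rfl <;> constructor <;> linarith [harg.1, harg.2]

/-- The distribution that is the limit of `logTower j (ε - iσq)` as `ε → 0+`. -/
def towerDist {lam : ℝ} (hlam : 0 < lam) (σ : ℝ) (j : ℕ) : Dist punctured4 :=
  (σ * Complex.I) ^ j •
    (regular punctured4 (fun k => logTower 0 (regVar lam σ 0 k)) ∘L gradOp hlam ^ j)

theorem tendsto_logTower {lam : ℝ} (hlam : 0 < lam) {σ : ℝ} (hσ : σ = 1 ∨ σ = -1) (j : ℕ)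
    (f : 𝓓(punctured4, ℂ)) :
    Tendsto (fun ε : ℝ => ∫ k, logTower j (regVar lam σ ε k) * f k) (𝓝[>] 0)
      (𝓝 (towerDist hlam σ j f)) := by
  have hσa : |σ| = 1 := by rcases hσ with rfl | rfl <;> simp
  have hσ2 : σ ^ 2 = 1 := by rcases hσ with rfl | rfl <;> simp
  have h : towerDist hlam σ j f = (σ * Complex.I) ^ j *
      ∫ k, logTower 0 (regVar lam σ 0 k) * (gradOp hlam ^ j) f k := by
    rw [towerDist, _root_.smul_apply, smul_eq_mul, ContinuousLinearMap.comp_apply,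
      regular_apply ((locallyIntegrable_logTower_zero hσa lam).locallyIntegrableOn _)]
  rw [h]
  refine ((tendsto_logTower_zero hσa lam ((gradOp hlam ^ j) f)).const_mul _).congr' ?_
  filter_upwards [self_mem_nhdsWithin] with ε hε
  exact (integral_logTower hlam hσ2 hε j f).symm

/-- As `q + iσε = iσ(ε - iσq)`, the logarithm is the entry `1` of the tower plus a constant, and
`x⁻ⁿ` is a multiple of the entry `n + 1`. -/
theorem exists_isBoundaryValue {lam : ℝ} (hlam : 0 < lam) {K : ℂ → ℂ} (hK : IsKernel K) {σ : ℝ}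
    (hσ : σ = 1 ∨ σ = -1) : ∃ v, IsBoundaryValue lam K σ v := by
  have hσ2 : σ ^ 2 = 1 := by rcases hσ with rfl | rfl <;> simp
  have hσ0 : (σ : ℂ) ≠ 0 := by rcases hσ with rfl | rfl <;> simp
  rcases hK with rfl | ⟨n, hn, rfl⟩
  · have h1 : LocallyIntegrableOn (fun _ : R4 => (1 : ℂ)) punctured4 :=
      (continuous_const.locallyIntegrable).locallyIntegrableOn _
    refine ⟨towerDist hlam σ 1 + (σ * (Real.pi / 2) * Complex.I : ℂ) •
      regular punctured4 (fun _ => 1), fun f => ?_⟩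
    rw [_root_.add_apply, _root_.smul_apply, regular_apply h1, smul_eq_mul]
    refine ((tendsto_logTower hlam hσ 1 f).add_const _).congr' ?_
    filter_upwards [self_mem_nhdsWithin] with ε hε
    have hpos : ∀ k, 0 < (regVar lam σ ε k).re := fun k => by rw [regVar_re]; exact hε
    have hi : Integrable fun k => logTower 1 (regVar lam σ ε k) * f k := by
      refine integrable_mul_test (ContinuousOn.locallyIntegrableOn (Continuous.continuousOn ?_)
        punctured4.isOpen.measurableSet) f
      exact (contDiff_regVar lam σ ε).continuous.clog fun k => Or.inl (hpos k)
    rw [← integral_const_mul, ← integral_add hi ((integrable_mul_test h1 f).const_mul _)]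
    refine integral_congr_ae (Eventually.of_forall fun k => ?_)
    change _ = Complex.log _ * _
    rw [regArg_eq lam hσ2, log_sign_I_mul hσ (hpos k)]
    simp only [logTower]
    ring
  · obtain ⟨j, rfl⟩ : ∃ j, n = j + 1 := ⟨n - 1, by omega⟩
    have hc : ((-1) ^ j * (j.factorial : ℂ)) ≠ 0 :=
      mul_ne_zero (pow_ne_zero _ (by norm_num)) (by exact_mod_cast j.factorial_ne_zero)
    refine ⟨(((σ * Complex.I) ^ (j + 1))⁻¹ * ((-1) ^ j * (j.factorial : ℂ))⁻¹) •
      towerDist hlam σ (j + 2), fun f => ?_⟩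
    rw [_root_.smul_apply, smul_eq_mul]
    refine ((tendsto_logTower hlam hσ (j + 2) f).const_mul _).congr fun ε => ?_
    rw [← integral_const_mul]
    refine integral_congr_ae (Eventually.of_forall fun k => ?_)
    change _ = ((_ : ℂ) ^ _)⁻¹ * _
    rw [regArg_eq lam hσ2, mul_pow (σ * Complex.I : ℂ)]
    simp only [logTower]
    generalize regVar lam σ ε k ^ (j + 1) = w
    generalize (σ * Complex.I : ℂ) ^ (j + 1) = s
    generalize ((-1) ^ j * (j.factorial : ℂ)) = c at hc ⊢
    rw [mul_inv]
    linear_combination s⁻¹ * w⁻¹ * f k * inv_mul_cancel₀ hc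

/-- Where `q > 0` the argument stays in the right half plane down to `ε = 0`, so the kernel is
bounded on the compact set `[0, 1] × tsupport f` and dominated convergence applies. -/
theorem IsBoundaryValue.realizes {lam : ℝ} {K : ℂ → ℂ} (hK : IsKernel K) {σ : ℝ}
    {v : Dist punctured4} (hv : IsBoundaryValue lam K σ v) : Realizes lam K v := fun f hf => by
  refine tendsto_nhds_unique (hv f) ?_
  have harg : Continuous fun p : ℝ × R4 =>
      (negKThetaSq lam p.2 : ℂ) + ((σ * p.1 : ℝ) : ℂ) * Complex.I := by
    have := (contDiff_negKThetaSq lam).continuous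
    fun_prop
  have hslit : ∀ p : ℝ × R4, 0 < negKThetaSq lam p.2 →
      (negKThetaSq lam p.2 : ℂ) + ((σ * p.1 : ℝ) : ℂ) * Complex.I ∈ Complex.slitPlane :=
    fun p hp => Or.inl (by simpa using hp)
  have hcont : ∀ p : ℝ × R4, 0 < negKThetaSq lam p.2 → ContinuousAt (fun p : ℝ × R4 =>
      K ((negKThetaSq lam p.2 : ℂ) + ((σ * p.1 : ℝ) : ℂ) * Complex.I)) p := fun p hp =>
    ContinuousAt.comp (hK.contDiffAt (hslit p hp)).continuousAt harg.continuousAt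
  obtain ⟨C, hC⟩ := IsCompact.exists_bound_of_continuousOn
    ((isCompact_Icc (a := (0 : ℝ)) (b := 1)).prod f.hasCompactSupport)
    (fun p hp => (hcont p (hf hp.2)).continuousWithinAt)
  have hsupp : ∀ (ε : ℝ), Continuous fun k =>
      K ((negKThetaSq lam k : ℂ) + ((σ * ε : ℝ) : ℂ) * Complex.I) * f k := fun ε => by
    rw [continuous_iff_continuousAt]
    intro k
    by_cases hk : k ∈ tsupport f
    · exact (ContinuousAt.comp (f := fun k : R4 => (ε, k)) (hcont (ε, k) (hf hk))
        (by fun_prop)).mul f.contDiff.continuous.continuousAt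
    · refine (continuousAt_const (y := (0 : ℂ))).congr ?_
      filter_upwards [(isClosed_tsupport f).isOpen_compl.mem_nhds hk] with x hx
      rw [testFunction_eq_zero f hx, mul_zero]
  refine tendsto_integral_filter_of_dominated_convergence (fun k => C * ‖f k‖) ?_ ?_ ?_ ?_
  · exact Eventually.of_forall fun ε => (hsupp ε).aestronglyMeasurable
  · filter_upwards [Ioc_mem_nhdsGT (show (0 : ℝ) < 1 by norm_num)] with ε hε
    refine Eventually.of_forall fun k => ?_
    by_cases hk : k ∈ tsupport f
    · rw [norm_mul]
      gcongr
      exact hC (ε, k) ⟨⟨hε.1.le, hε.2⟩, hk⟩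
    · simp [testFunction_eq_zero f hk]
  · exact (Continuous.integrable_of_hasCompactSupport (continuous_const.mul
      f.contDiff.continuous.norm) f.hasCompactSupport.norm.mul_left)
  · refine Eventually.of_forall fun k => ?_
    by_cases hk : k ∈ tsupport f
    · refine Tendsto.mul_const _ ?_
      have h := (ContinuousAt.comp (f := fun ε : ℝ => (ε, k)) (x := (0 : ℝ))
        (hcont (0, k) (hf hk)) (by fun_prop)).tendsto
      simp only [Function.comp_def, mul_zero, Complex.ofReal_zero, zero_mul, add_zero] at h
      exact h.mono_left nhdsWithin_le_nhds
    · simp [testFunction_eq_zero f hk]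

/-! ### Fourier series of test functions -/

theorem summable_int_inv_sq : Summable fun m : ℤ => ((1 + |(m : ℝ)|) ^ 2)⁻¹ := by
  refine Summable.of_norm_bounded_eventually (g := fun m : ℤ => 1 / (m : ℝ) ^ 2)
    (Real.summable_one_div_int_pow.2 one_lt_two) ?_
  filter_upwards [(Set.finite_singleton (0 : ℤ)).compl_mem_cofinite] with m hm
  have hm' : (0 : ℝ) < |(m : ℝ)| := abs_pos.2 (by exact_mod_cast hm)
  rw [Real.norm_of_nonneg (by positivity), one_div, ← sq_abs (m : ℝ)]
  gcongr
  linarith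

theorem summable_pi_prod {f : ℤ → ℝ} (h0 : ∀ m, 0 ≤ f m) (hf : Summable f) (n : ℕ) :
    Summable fun m : Fin n → ℤ => ∏ i, f (m i) := by
  induction n with
  | zero => exact (hasSum_fintype _).summable
  | succ n ih =>
    rw [← (Fin.consEquiv fun _ : Fin (n + 1) => ℤ).summable_iff]
    refine (hf.mul_of_nonneg ih h0 fun m => Finset.prod_nonneg fun i _ => h0 _).congr fun p => ?_
    simp [Fin.prod_univ_succ, Fin.consEquiv]

theorem summable_lattice (n : ℕ) : Summable fun m : Fin n → ℤ => ((1 + ‖m‖) ^ (2 * n))⁻¹ := by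
  refine Summable.of_nonneg_of_le (fun m => by positivity) (fun m => ?_)
    (summable_pi_prod (fun m => by positivity) summable_int_inv_sq n)
  rw [Finset.prod_inv_distrib]
  refine inv_anti₀ (Finset.prod_pos fun i _ => by positivity) ?_
  rw [pow_mul]
  calc ∏ i, (1 + |((m i : ℤ) : ℝ)|) ^ 2 ≤ ∏ _i : Fin n, (1 + ‖m‖) ^ 2 := by
        refine Finset.prod_le_prod (fun i _ => by positivity) fun i _ => ?_
        gcongr
        exact norm_le_pi_norm m i
    _ = _ := by simp

/-- The lattice vector with integral coordinates `m`. -/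
def latticePt {n : ℕ} (m : Fin n → ℤ) : EuclideanSpace ℝ (Fin n) := WithLp.toLp 2 fun i => (m i : ℝ)

theorem norm_le_norm_latticePt {n : ℕ} (m : Fin n → ℤ) : ‖m‖ ≤ ‖latticePt m‖ := by
  refine (pi_norm_le_iff_of_nonneg (norm_nonneg _)).2 fun i => ?_
  exact PiLp.norm_apply_le (latticePt m) i

theorem norm_latticePt_le {n : ℕ} (m : Fin n → ℤ) : ‖latticePt m‖ ≤ n * ‖m‖ := by
  have h : latticePt m = ∑ i, EuclideanSpace.single i (m i : ℝ) := by
    ext j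
    simp [latticePt, Finset.sum_apply]
  rw [h]
  refine (norm_sum_le _ _).trans ?_
  refine (Finset.sum_le_card_nsmul _ _ ‖m‖ fun i _ => ?_).trans (by simp)
  rw [PiLp.norm_single]
  exact norm_le_pi_norm m i

/-- The function on the torus given by a function supported in the unit cube. -/
def torusFun {n : ℕ} (θ : EuclideanSpace ℝ (Fin n) → ℂ) (t : UnitAddTorus (Fin n)) : ℂ :=
  θ (WithLp.toLp 2 fun i => (AddCircle.equivIoc (1 : ℝ) (-1 / 2) (t i) : ℝ))

theorem torusFun_coe {n : ℕ} (θ : EuclideanSpace ℝ (Fin n) → ℂ) {x : Fin n → ℝ}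
    (hx : ∀ i, x i ∈ Set.Ioc (-1 / 2 : ℝ) (-1 / 2 + 1)) :
    torusFun θ (fun i => (x i : UnitAddCircle)) = θ (WithLp.toLp 2 x) := by
  unfold torusFun
  congr 2
  funext i
  exact AddCircle.equivIoc_coe_of_mem (p := 1) (a := -1 / 2) (hx i)

/-- The representative of a point of the torus jumps at `-1/2`, which is away from the support of
`θ`. -/
theorem continuous_torusFun {n : ℕ} {θ : EuclideanSpace ℝ (Fin n) → ℂ} (hθ : Continuous θ)
    (hs : ∀ x, θ x ≠ 0 → ∀ i, |x i| ≤ 1 / 4) : Continuous (torusFun θ) := by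
  let C : Set UnitAddCircle := (fun x : ℝ => (x : UnitAddCircle)) '' Set.Icc (-(1 / 4)) (1 / 4)
  have hC : IsClosed C := (isCompact_Icc.image (AddCircle.continuous_mk' 1)).isClosed
  have hmem : ∀ t : UnitAddTorus (Fin n), torusFun θ t ≠ 0 → ∀ i, t i ∈ C := fun t ht i =>
    ⟨_, abs_le.1 (hs _ ht i), AddCircle.coe_equivIoc⟩
  rw [continuous_iff_continuousAt]
  intro t
  by_cases h : ∀ i, t i ∈ C
  · have hne : ∀ i, t i ≠ ((-1 / 2 : ℝ) : UnitAddCircle) := fun i hi => by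
      obtain ⟨x, hx, hxt⟩ := h i
      have h1 : (AddCircle.equivIoc (1 : ℝ) (-1 / 2) (t i) : ℝ) = x := by
        rw [← hxt]
        exact AddCircle.equivIoc_coe_of_mem (p := 1) (a := -1 / 2) ⟨by linarith [hx.1], by linarith [hx.2]⟩
      have h2 : (AddCircle.equivIoc (1 : ℝ) (-1 / 2) (t i) : ℝ) = 1 / 2 := by
        have h3 : t i = ((1 / 2 : ℝ) : UnitAddCircle) := by
          rw [hi, show (1 / 2 : ℝ) = -1 / 2 + 1 by norm_num, AddCircle.coe_add_period]
        rw [h3]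
        exact AddCircle.equivIoc_coe_of_mem (p := 1) (a := -1 / 2) ⟨by norm_num, by norm_num⟩
      linarith [hx.2]
    refine hθ.continuousAt.comp ((PiLp.continuous_toLp 2 _).continuousAt.comp ?_)
    refine continuousAt_pi.2 fun i => ?_
    exact ContinuousAt.comp (f := fun s : UnitAddTorus (Fin n) => s i)
      (continuous_subtype_val.continuousAt.comp (AddCircle.continuousAt_equivIoc 1 (-1 / 2) (hne i)))
      (continuous_apply i).continuousAt
  · push Not at h
    obtain ⟨i, hi⟩ := h
    refine (continuousAt_const (y := (0 : ℂ))).congr ?_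
    filter_upwards [(continuous_apply i).continuousAt.preimage_mem_nhds
      (hC.isOpen_compl.mem_nhds hi)] with s hsC
    by_contra h0
    exact hsC (hmem s (fun h' => h0 h'.symm) i)

theorem mFourier_coe {n : ℕ} (m : Fin n → ℤ) (x : EuclideanSpace ℝ (Fin n)) :
    UnitAddTorus.mFourier m (fun i => ((x i : ℝ) : UnitAddCircle)) =
      Complex.exp (2 * Real.pi * Complex.I * (inner ℝ (latticePt m) x : ℝ)) := by
  change ∏ i, fourier (m i) ((x i : ℝ) : UnitAddCircle) = _
  simp only [fourier_coe_apply]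
  rw [← Complex.exp_sum]
  congr 1
  rw [PiLp.inner_apply]
  push_cast
  rw [Finset.mul_sum]
  refine Finset.sum_congr rfl fun i _ => ?_
  simp [latticePt]
  ring

theorem mFourierCoeff_torusFun {n : ℕ} {θ : EuclideanSpace ℝ (Fin n) → ℂ}
    (hs : ∀ x, θ x ≠ 0 → ∀ i, |x i| ≤ 1 / 4) (m : Fin n → ℤ) :
    UnitAddTorus.mFourierCoeff (torusFun θ) m = FourierTransform.fourier θ (latticePt m) := by
  rw [UnitAddTorus.mFourierCoeff_eq_integral _ _ (fun _ => -1 / 2), Real.fourier_eq']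
  have h1 : ∫ x : EuclideanSpace ℝ (Fin n),
      Complex.exp (↑(-2 * Real.pi * inner ℝ x (latticePt m)) * Complex.I) • θ x =
      ∫ x : Fin n → ℝ, Complex.exp (↑(-2 * Real.pi * inner ℝ (WithLp.toLp 2 x) (latticePt m)) *
        Complex.I) • θ (WithLp.toLp 2 x) :=
    ((EuclideanSpace.volume_preserving_symm_measurableEquiv_toLp (Fin n)).symm.integral_comp
      (MeasurableEquiv.measurableEmbedding _) _).symm
  have h2 := setIntegral_eq_integral_of_forall_compl_eq_zero (μ := (volume : Measure (Fin n → ℝ)))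
    (s := {x : Fin n → ℝ | ∀ i, x i ∈ Set.Ioc (-1 / 2 : ℝ) (-1 / 2 + 1)})
    (f := fun x => Complex.exp (↑(-2 * Real.pi * inner ℝ (WithLp.toLp 2 x) (latticePt m)) *
        Complex.I) • θ (WithLp.toLp 2 x)) fun x hx => by
    by_contra h0
    have h0' : θ (WithLp.toLp 2 x) ≠ 0 := fun h => h0 (by simp [h])
    refine hx fun i => ?_
    have h3 := abs_le.1 (hs _ h0' i)
    simp only at h3
    exact ⟨by linarith [h3.1], by linarith [h3.2]⟩
  rw [h1, ← h2]
  refine setIntegral_congr_fun ?_ fun x hx => ?_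
  · have : {x : Fin n → ℝ | ∀ i, x i ∈ Set.Ioc (-1 / 2 : ℝ) (-1 / 2 + 1)} =
        Set.univ.pi fun _ => Set.Ioc (-1 / 2 : ℝ) (-1 / 2 + 1) := by ext; simp
    rw [this]
    exact MeasurableSet.univ_pi fun _ => measurableSet_Ioc
  · simp only
    rw [torusFun_coe θ hx]
    congr 1
    have := mFourier_coe (-m) (WithLp.toLp 2 x)
    simp only at this
    rw [this]
    congr 1
    have h3 : latticePt (-m) = -latticePt m := by ext i; simp [latticePt]
    rw [h3, inner_neg_left, real_inner_comm]
    push_cast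
    ring

/-- Smooth functions supported in the unit cube have a rapidly convergent Fourier expansion. -/
theorem exists_fourier_series {n : ℕ} {θ : EuclideanSpace ℝ (Fin n) → ℂ} (hθ : ContDiff ℝ ∞ θ)
    (hs : ∀ x, θ x ≠ 0 → ∀ i, |x i| ≤ 1 / 4) : ∃ c : (Fin n → ℤ) → ℂ,
      (∀ M : ℕ, ∃ C : ℝ, 0 ≤ C ∧ ∀ m, ‖c m‖ ≤ C * ((1 + ‖m‖) ^ M)⁻¹) ∧
      ∀ x : EuclideanSpace ℝ (Fin n), (∀ i, |x i| < 1 / 2) →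
        HasSum (fun m => c m * Complex.exp (2 * Real.pi * Complex.I * (inner ℝ (latticePt m) x : ℝ)))
          (θ x) := by
  have hcs : HasCompactSupport θ := by
    refine HasCompactSupport.intro
      ((isCompact_univ_pi fun _ : Fin n => isCompact_Icc (a := (-1 / 4 : ℝ)) (b := 1 / 4)).image
        (PiLp.continuous_toLp 2 _)) fun x hx => ?_
    by_contra h
    refine hx ⟨fun i => x i, fun i _ => ?_, rfl⟩
    have := abs_le.1 (hs x h i)
    exact ⟨by linarith [this.1], this.2⟩
  let S := hcs.toSchwartzMap hθ
  have hdec : ∀ M : ℕ, ∃ C : ℝ, 0 ≤ C ∧ ∀ m : Fin n → ℤ,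
      ‖FourierTransform.fourier θ (latticePt m)‖ ≤ C * ((1 + ‖m‖) ^ M)⁻¹ := fun M => by
    have h := fun x => SchwartzMap.one_add_le_sup_seminorm_apply (𝕜 := ℝ) (m := (M, 0)) le_rfl le_rfl
      (FourierTransform.fourier S) x
    refine ⟨2 ^ M * (Finset.Iic (M, 0)).sup
      (fun m => SchwartzMap.seminorm ℝ m.1 m.2) (FourierTransform.fourier S),
      by positivity, fun m => ?_⟩
    rw [← div_eq_mul_inv, le_div_iff₀ (by positivity)]
    refine le_trans ?_ (h (latticePt m))
    rw [norm_iteratedFDeriv_zero, mul_comm, SchwartzMap.fourier_coe]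
    gcongr
    · exact norm_le_norm_latticePt m
    · exact le_rfl
  refine ⟨fun m => FourierTransform.fourier θ (latticePt m), hdec, fun x hx => ?_⟩
  let F : C(UnitAddTorus (Fin n), ℂ) := ⟨torusFun θ, continuous_torusFun hθ.continuous hs⟩
  have hco : ∀ m, UnitAddTorus.mFourierCoeff F m = FourierTransform.fourier θ (latticePt m) :=
    mFourierCoeff_torusFun hs
  have hsum : Summable (UnitAddTorus.mFourierCoeff F) := by
    obtain ⟨C, -, hC⟩ := hdec (2 * n)
    refine Summable.of_norm_bounded ((summable_lattice n).mul_left C) fun m => ?_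
    rw [hco]; exact hC m
  have h := UnitAddTorus.hasSum_mFourier_series_apply_of_summable hsum
    (fun i => ((x i : ℝ) : UnitAddCircle))
  have h2 : F (fun i => ((x i : ℝ) : UnitAddCircle)) = θ x :=
    torusFun_coe θ fun i => ⟨by linarith [(abs_lt.1 (hx i)).1], by linarith [(abs_lt.1 (hx i)).2]⟩
  rw [h2] at h
  simpa only [hco, mFourier_coe, smul_eq_mul] using h

section Exchange

variable {E : Type*} [NormedAddCommGroup E] [NormedSpace ℝ E]

/-- Distributions can be interchanged with sums that converge with all derivatives. -/
theorem hasSum_dist {Ω : Opens E} (u : Dist Ω) {α : Type*} {K : Set E} (hK : IsCompact K)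
    (hKΩ : K ⊆ Ω) {F : α → 𝓓(Ω, ℂ)} {f : 𝓓(Ω, ℂ)} (h0 : ∀ j, ∀ x, x ∉ K → F j x = 0)
    {a : ℕ → α → ℝ} (ha : ∀ i, Summable (a i)) (hb : ∀ i j x, ‖iteratedFDeriv ℝ i (F j) x‖ ≤ a i j)
    (hf : ∀ x, HasSum (fun j => F j x) (f x)) : HasSum (fun j => u (F j)) (u f) := by
  classical
  obtain ⟨N, C, hC, hu⟩ := exists_order_bound u K hK hKΩ
  let b : α → ℝ := fun j => ∑ i ∈ Finset.range (N + 1), a i j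
  have ha0 : ∀ i j, 0 ≤ a i j := fun i j => (norm_nonneg _).trans (hb i j 0)
  have hbs : Summable b := summable_sum fun i _ => ha i
  have hsum : (f : E → ℂ) = fun y => ∑' j, F j y := by
    funext y; exact (hf y).tsum_eq.symm
  have hder : ∀ (i : ℕ) (x : E), iteratedFDeriv ℝ i f x = ∑' j, iteratedFDeriv ℝ i (F j) x :=
    fun i x => by
      rw [hsum]
      exact iteratedFDeriv_tsum_apply (N := ⊤) (fun j => (F j).contDiff) (fun k _ => ha k)
        (fun k j x _ => hb k j x) le_top x
  have hds : ∀ i x, Summable fun j => iteratedFDeriv ℝ i (F j) x := fun i x =>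
    Summable.of_norm_bounded (ha i) fun j => hb i j x
  -- Every derivative of the remainder is the tail of a series dominated by `b`; through the order
  -- bound the error of `u` is a constant times the tail of a convergent sum.
  have hrem : ∀ s : Finset α, ‖(∑ j ∈ s, u (F j)) - u f‖ ≤ C * ∑' j : {j // j ∉ s}, b j := fun s => by
    rw [← map_sum, ← map_sub]
    refine hu _ (fun x hx => ?_) _ (tsum_nonneg fun j => Finset.sum_nonneg fun i _ => ha0 i _)
      fun i hi x _ => ?_
    · have : f x = 0 := by
        exact (hf x).unique (by simp only [h0 _ x hx]; exact hasSum_zero)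
      rw [sub_apply, sum_apply, this]
      simp [h0 _ x hx]
    · have h1 : iteratedFDeriv ℝ i (((∑ j ∈ s, F j) - f : 𝓓(Ω, ℂ)) : E → ℂ) x =
          -∑' j : {j // j ∉ s}, iteratedFDeriv ℝ i (F j) x := by
        have h2 : (((∑ j ∈ s, F j) - f : 𝓓(Ω, ℂ)) : E → ℂ) = (fun y => ∑ j ∈ s, F j y) - f := by
          funext y
          rw [sub_apply, sum_apply, Pi.sub_apply]
        have hcd : ∀ j, ContDiff ℝ i (F j) := fun j => (F j).contDiff.of_le (natCast_le_infty i)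
        have hcs : ContDiff ℝ i (fun y => ∑ j ∈ s, F j y) := ContDiff.sum fun j _ => hcd j
        rw [h2, iteratedFDeriv_sub_apply hcs.contDiffAt
          (f.contDiff.of_le (natCast_le_infty i)).contDiffAt, hder,
          ← (hds i x).sum_add_tsum_subtype_compl s, iteratedFDeriv_sum fun j _ => hcd j]
        rw [Finset.sum_apply]
        abel
      rw [h1, norm_neg]
      refine tsum_of_norm_bounded ((hbs.subtype _).hasSum) fun j => ?_
      refine (hb i j x).trans ?_
      exact Finset.single_le_sum (f := fun i => a i j) (fun i _ => ha0 i j)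
        (Finset.mem_range.2 (Nat.lt_succ_of_le hi))
  rw [HasSum, SummationFilter.unconditional_filter, tendsto_iff_norm_sub_tendsto_zero]
  refine squeeze_zero (fun _ => norm_nonneg _) hrem ?_
  simpa using (tendsto_tsum_compl_atTop_zero b).const_mul C

end Exchange

/-! ### Localised Fourier transforms and rapid decrease -/

theorem one_add_norm_le_mul {E : Type*} [SeminormedAddCommGroup E] (η ζ : E) : 1 + ‖η‖ ≤ (1 + ‖η - ζ‖) * (1 + ‖ζ‖) := by
  have h := norm_le_norm_sub_add η ζ
  nlinarith [mul_nonneg (norm_nonneg (η - ζ)) (norm_nonneg ζ)]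

theorem one_add_norm_sub_le_mul {E : Type*} [SeminormedAddCommGroup E] (η ζ : E) : 1 + ‖η - ζ‖ ≤ (1 + ‖η‖) * (1 + ‖ζ‖) := by
  have h := norm_sub_le η ζ
  nlinarith [mul_nonneg (norm_nonneg η) (norm_nonneg ζ)]

section Modulate

variable {E : Type*} [NormedAddCommGroup E] [InnerProductSpace ℝ E] {Ω : Opens E}

theorem modulate_apply (η : E) (φ : 𝓓(Ω, ℂ)) (x : E) :
    modulate η φ x = Complex.exp (-Complex.I * ((inner ℝ η x : ℝ) : ℂ)) * φ x := rfl

theorem iteratedDeriv_cexp_neg_I (n : ℕ) :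
    iteratedDeriv n (fun y : ℝ => Complex.exp (-Complex.I * (y : ℂ))) =
      fun y : ℝ => (-Complex.I) ^ n * Complex.exp (-Complex.I * (y : ℂ)) := by
  induction n with
  | zero => simp
  | succ n ih =>
    rw [iteratedDeriv_succ, ih]
    funext y
    have h : HasDerivAt (fun y : ℝ => Complex.exp (-Complex.I * (y : ℂ)))
        (Complex.exp (-Complex.I * (y : ℂ)) * (-Complex.I * 1)) y :=
      ((Complex.ofRealCLM.hasDerivAt (x := y)).const_mul (-Complex.I)).cexp
    rw [(h.const_mul _).deriv]
    ring

theorem norm_iteratedFDeriv_phase_le (η x : E) (i : ℕ) :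
    ‖iteratedFDeriv ℝ i (fun x : E => Complex.exp (-Complex.I * ((inner ℝ η x : ℝ) : ℂ))) x‖ ≤
      ‖η‖ ^ i := by
  let g : ℝ → ℂ := fun y => Complex.exp (-Complex.I * (y : ℂ))
  have hg : ContDiff ℝ i g := Complex.contDiff_exp.comp (contDiff_const.mul Complex.ofRealCLM.contDiff)
  have h := (innerSL ℝ η).iteratedFDeriv_comp_right (f := g) hg x (i := i) le_rfl
  have h2 : (g ∘ innerSL ℝ η) =
      fun x : E => Complex.exp (-Complex.I * ((inner ℝ η x : ℝ) : ℂ)) := rfl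
  rw [h2] at h
  rw [h]
  refine (ContinuousMultilinearMap.norm_compContinuousLinearMap_le _ _).trans ?_
  rw [norm_iteratedFDeriv_eq_norm_iteratedDeriv, iteratedDeriv_cexp_neg_I]
  have h3 : ‖Complex.exp (-Complex.I * ((innerSL ℝ η x : ℝ) : ℂ))‖ = 1 := by
    rw [Complex.norm_exp]; simp
  rw [norm_mul, h3]
  simp

theorem exists_bound_modulate (φ : 𝓓(Ω, ℂ)) (i : ℕ) : ∃ C : ℝ, 0 ≤ C ∧ ∀ η x : E,
    ‖iteratedFDeriv ℝ i (modulate η φ) x‖ ≤ C * (1 + ‖η‖) ^ i := by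
  have hb : ∀ j : ℕ, ∃ B : ℝ, ∀ x, ‖iteratedFDeriv ℝ j φ x‖ ≤ B := fun j =>
    ((φ.contDiff.of_le (natCast_le_infty j)).continuous_iteratedFDeriv
      le_rfl).bounded_above_of_compact_support (φ.hasCompactSupport.iteratedFDeriv j)
  choose B hB using hb
  have hB0 : ∀ j, 0 ≤ B j := fun j => (norm_nonneg _).trans (hB j 0)
  refine ⟨∑ j ∈ Finset.range (i + 1), (i.choose j : ℝ) * B (i - j),
    Finset.sum_nonneg fun j _ => mul_nonneg (by positivity) (hB0 _), fun η x => ?_⟩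
  have hp : ContDiff ℝ i fun x : E => Complex.exp (-Complex.I * ((inner ℝ η x : ℝ) : ℂ)) :=
    Complex.contDiff_exp.comp (contDiff_const.mul
      (Complex.ofRealCLM.contDiff.comp (contDiff_const.inner ℝ contDiff_id)))
  refine (norm_iteratedFDeriv_mul_le hp (φ.contDiff.of_le (natCast_le_infty i)) x le_rfl).trans ?_
  rw [Finset.sum_mul]
  refine Finset.sum_le_sum fun j hj => ?_
  rw [mul_assoc, mul_assoc, mul_comm (B _)]
  gcongr
  · refine (norm_iteratedFDeriv_phase_le η x j).trans ?_
    refine (pow_le_pow_left₀ (norm_nonneg _) (by linarith [norm_nonneg η]) j).trans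
      (pow_le_pow_right₀ (by linarith [norm_nonneg η]) (Nat.lt_succ_iff.1 (Finset.mem_range.1 hj)))
  · exact hB _ x

theorem modulate_eq_zero (η : E) (φ : 𝓓(Ω, ℂ)) {x : E} (hx : x ∉ tsupport φ) :
    modulate η φ x = 0 := by
  rw [modulate_apply, testFunction_eq_zero φ hx, mul_zero]

/-- The Fourier transform of a localised distribution is of polynomial growth. -/
theorem exists_bound_dist_modulate (u : Dist Ω) (φ : 𝓓(Ω, ℂ)) : ∃ (N : ℕ) (C : ℝ), 0 ≤ C ∧
    ∀ η : E, ‖u (modulate η φ)‖ ≤ C * (1 + ‖η‖) ^ N := by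
  obtain ⟨N, C, hC, hu⟩ := exists_order_bound u (tsupport φ) φ.hasCompactSupport φ.tsupport_subset
  choose B hB0 hB using exists_bound_modulate φ
  refine ⟨N, C * ∑ i ∈ Finset.range (N + 1), B i,
    mul_nonneg hC (Finset.sum_nonneg fun i _ => hB0 i), fun η => ?_⟩
  rw [mul_assoc]
  refine hu _ (fun x hx => modulate_eq_zero η φ hx) _
    (mul_nonneg (Finset.sum_nonneg fun i _ => hB0 i) (by positivity)) fun i hi x _ => ?_
  refine (hB i η x).trans ?_
  gcongr
  · exact Finset.sum_nonneg fun i _ => hB0 i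
  · exact Finset.single_le_sum (fun i _ => hB0 i) (Finset.mem_range.2 (Nat.lt_succ_of_le hi))
  · linarith [norm_nonneg η]

/-- The Fourier transform of `φ u` decreases rapidly in a conic neighbourhood of `ξ`. -/
def RapidNear (u : Dist Ω) (φ : 𝓓(Ω, ℂ)) (ξ : E) : Prop :=
  ∃ κ : ℝ, 0 < κ ∧ ∀ m : ℕ, ∃ C : ℝ, 0 ≤ C ∧ ∀ t : ℝ, 0 < t → ∀ η : E, ‖η - t • ξ‖ < κ * t →
    (1 + ‖η‖) ^ m * ‖u (modulate η φ)‖ ≤ C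

theorem exists_rapidNear {u : Dist Ω} {x ξ : E} (hx : x ∈ Ω) (hξ : ξ ≠ 0)
    (h : (x, ξ) ∉ waveFrontSet u) : ∃ φ : 𝓓(Ω, ℂ), φ x ≠ 0 ∧ RapidNear u φ ξ := by
  simp only [waveFrontSet, Set.mem_ofPred_eq, not_and, not_not] at h
  obtain ⟨φ, hφ, Γ, hΓ, hξΓ, hcone, hdec⟩ := h hx hξ
  obtain ⟨κ, hκ, hball⟩ := Metric.isOpen_iff.1 hΓ ξ hξΓ
  refine ⟨φ, hφ, κ, hκ, fun m => ?_⟩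
  obtain ⟨C, hC⟩ := hdec m
  refine ⟨max C 0, le_max_right _ _, fun t ht η hη => (hC η ?_).trans (le_max_left _ _)⟩
  have h1 : t⁻¹ • η ∈ Γ := hball <| by
    rw [Metric.mem_ball, dist_eq_norm]
    have : t⁻¹ • η - ξ = t⁻¹ • (η - t • ξ) := by
      rw [smul_sub, smul_smul, inv_mul_cancel₀ ht.ne', one_smul]
    rw [this, norm_smul, norm_inv, Real.norm_of_nonneg ht.le, inv_mul_lt_iff₀ ht]
    linarith
  have := hcone t ht _ h1
  rwa [smul_smul, mul_inv_cancel₀ ht.ne', one_smul] at this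

/-- A shift that is small compared with `t` keeps the frequency in the cone of rapid decrease. A
larger one satisfies `‖η‖ ≤ D‖ζ‖`, and polynomial growth is absorbed by a power of `1 + ‖ζ‖`. The
bound is polynomial in `ζ`, so it can be summed against Fourier coefficients. -/
theorem RapidNear.exists_shift_bound {u : Dist Ω} {φ : 𝓓(Ω, ℂ)} {ξ : E} (h : RapidNear u φ ξ) :
    ∃ κ : ℝ, 0 < κ ∧ ∀ m : ℕ, ∃ (C : ℝ) (p : ℕ), 0 ≤ C ∧ ∀ t : ℝ, 0 < t → ∀ η : E,
      ‖η - t • ξ‖ < κ * t → ∀ ζ : E,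
        (1 + ‖η‖) ^ m * ‖u (modulate (η - ζ) φ)‖ ≤ C * (1 + ‖ζ‖) ^ p := by
  obtain ⟨κ, hκ, hdec⟩ := h
  obtain ⟨N, B, hB, hpol⟩ := exists_bound_dist_modulate u φ
  refine ⟨κ / 2, by positivity, fun m => ?_⟩
  obtain ⟨C, hC, hm⟩ := hdec m
  let D := (‖ξ‖ + κ / 2) * (2 / κ)
  have hD : 0 ≤ D := by positivity
  refine ⟨C + B * (1 + D) ^ (m + N), m + N + N, by positivity, fun t ht η hη ζ => ?_⟩
  have hζ1 : (1 : ℝ) ≤ 1 + ‖ζ‖ := by linarith [norm_nonneg ζ]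
  rcases lt_or_ge ‖ζ‖ (κ / 2 * t) with hζ | hζ
  · have h1 := hm t ht (η - ζ) (by
      calc ‖η - ζ - t • ξ‖ = ‖(η - t • ξ) - ζ‖ := by congr 1; abel
        _ ≤ ‖η - t • ξ‖ + ‖ζ‖ := norm_sub_le _ _
        _ < κ * t := by linarith)
    calc (1 + ‖η‖) ^ m * ‖u (modulate (η - ζ) φ)‖
        ≤ ((1 + ‖η - ζ‖) * (1 + ‖ζ‖)) ^ m * ‖u (modulate (η - ζ) φ)‖ := by
          gcongr; exact one_add_norm_le_mul η ζ
      _ = (1 + ‖ζ‖) ^ m * ((1 + ‖η - ζ‖) ^ m * ‖u (modulate (η - ζ) φ)‖) := by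
          rw [mul_pow]; ring
      _ ≤ (1 + ‖ζ‖) ^ (m + N + N) * C := by
          gcongr
          omega
      _ ≤ _ := by
          rw [mul_comm]
          gcongr
          have : 0 ≤ B * (1 + D) ^ (m + N) := by positivity
          linarith
  · have h2 : ‖η‖ ≤ D * ‖ζ‖ := by
      have h3 : ‖η‖ ≤ ‖η - t • ξ‖ + ‖t • ξ‖ := norm_le_norm_sub_add _ _
      rw [norm_smul, Real.norm_of_nonneg ht.le] at h3
      have h4 : t ≤ 2 / κ * ‖ζ‖ := by
        rw [div_mul_eq_mul_div, le_div_iff₀ hκ]; linarith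
      calc ‖η‖ ≤ (‖ξ‖ + κ / 2) * t := by nlinarith
        _ ≤ (‖ξ‖ + κ / 2) * (2 / κ * ‖ζ‖) := by gcongr
        _ = D * ‖ζ‖ := by ring
    have h5 : 1 + ‖η‖ ≤ (1 + D) * (1 + ‖ζ‖) := by nlinarith [norm_nonneg ζ]
    calc (1 + ‖η‖) ^ m * ‖u (modulate (η - ζ) φ)‖
        ≤ (1 + ‖η‖) ^ m * (B * ((1 + ‖η‖) * (1 + ‖ζ‖)) ^ N) := by
          gcongr
          refine (hpol _).trans ?_
          gcongr
          exact one_add_norm_sub_le_mul η ζ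
      _ = B * (1 + ‖η‖) ^ (m + N) * (1 + ‖ζ‖) ^ N := by rw [mul_pow, pow_add]; ring
      _ ≤ B * ((1 + D) * (1 + ‖ζ‖)) ^ (m + N) * (1 + ‖ζ‖) ^ N := by gcongr
      _ = B * (1 + D) ^ (m + N) * (1 + ‖ζ‖) ^ (m + N + N) := by
          rw [mul_pow, pow_add _ (m + N) N]; ring
      _ ≤ _ := by
          gcongr
          linarith

end Modulate

/-- Rapid decrease near `ξ` is preserved under multiplication by smooth functions. -/
theorem RapidNear.mul {n : ℕ} {Ω : Opens (EuclideanSpace ℝ (Fin n))} {u : Dist Ω} {φ f : 𝓓(Ω, ℂ)}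
    {ξ : EuclideanSpace ℝ (Fin n)} (h : RapidNear u φ ξ) {θ : EuclideanSpace ℝ (Fin n) → ℂ}
    (hθ : ContDiff ℝ ∞ θ) (hc : HasCompactSupport θ) (hf : ∀ x, f x = θ x * φ x) :
    RapidNear u f ξ := by
  obtain ⟨R, hR, hsub⟩ : ∃ R : ℝ, 0 < R ∧ tsupport θ ∪ tsupport φ ⊆ Metric.closedBall 0 R := by
    obtain ⟨R, hR⟩ := (hc.union φ.hasCompactSupport).isBounded.subset_closedBall 0
    exact ⟨max R 1, by positivity, hR.trans (Metric.closedBall_subset_closedBall (le_max_left _ _))⟩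
  have hcoord : ∀ x, x ∈ tsupport θ ∪ tsupport φ → ∀ i, |x i| ≤ R := fun x hx i => by
    have := hsub hx
    rw [mem_closedBall_zero_iff] at this
    exact (PiLp.norm_apply_le x i).trans this
  -- Rescaling by `4R` puts both supports into the cube `|xᵢ| ≤ 1/4`, well inside the period.
  let L := 4 * R
  have hL : 0 < L := by positivity
  obtain ⟨c, hdec, hser⟩ := exists_fourier_series (θ := fun y => θ (L • y))
    (hθ.comp (contDiff_const_smul L)) fun y hy i => by
      have h1 := hcoord (L • y) (Or.inl (subset_tsupport _ hy)) i
      rw [PiLp.smul_apply, smul_eq_mul, abs_mul, abs_of_pos hL] at h1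
      have : 4 * R * |y i| ≤ R := h1
      nlinarith
  let ζ : (Fin n → ℤ) → EuclideanSpace ℝ (Fin n) := fun m => -((2 * Real.pi / L) • latticePt m)
  -- Multiplication by `θ` is a superposition of frequency shifts with rapidly decreasing
  -- coefficients; applied to `u` this gives the Fourier transform of the product as a sum of
  -- shifted ones.
  have hphase : ∀ η x, modulate η f x = ∑' m, c m * modulate (η + ζ m) φ x ∧
      HasSum (fun m => c m * modulate (η + ζ m) φ x) (modulate η f x) := fun η x => by
    have key : HasSum (fun m => c m * modulate (η + ζ m) φ x) (modulate η f x) := by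
      by_cases hx : x ∈ tsupport φ
      · have h1 := hser (L⁻¹ • x) fun i => by
          rw [PiLp.smul_apply, smul_eq_mul, abs_mul, abs_of_pos (inv_pos.2 hL),
            inv_mul_lt_iff₀ hL]
          have := hcoord x (Or.inr hx) i
          change _ < 4 * R * _
          linarith
        rw [smul_smul, mul_inv_cancel₀ hL.ne', one_smul] at h1
        have h2 := h1.mul_right (modulate η φ x)
        have h3 : θ x * modulate η φ x = modulate η f x := by
          rw [modulate_apply, modulate_apply, hf]; ring
        rw [h3] at h2
        refine h2.congr_fun fun m => ?_
        rw [modulate_apply, modulate_apply, mul_assoc, ← mul_assoc (Complex.exp _), ← Complex.exp_add]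
        congr 3
        simp only [ζ, inner_add_left, inner_neg_left, inner_smul_left, inner_smul_right]
        push_cast
        simp
        ring
      · have h1 : modulate η f x = 0 := by
          rw [modulate_apply, hf, testFunction_eq_zero φ hx]; simp
        rw [h1]
        simp [modulate_eq_zero _ φ hx]
    exact ⟨key.tsum_eq.symm, key⟩
  let B := 1 + 2 * Real.pi / L * n
  have hpi := Real.pi_pos
  have hB1 : 1 ≤ B := by
    have : 0 ≤ 2 * Real.pi / L * n := by positivity
    linarith
  have hζ : ∀ m, 1 + ‖ζ m‖ ≤ B * (1 + ‖m‖) := fun m => by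
    have h1 : ‖ζ m‖ ≤ 2 * Real.pi / L * (n * ‖m‖) := by
      rw [norm_neg, norm_smul, Real.norm_of_nonneg (by positivity)]
      gcongr
      exact norm_latticePt_le m
    have h2 : (2 * Real.pi / L * n) * ‖m‖ ≤ B * ‖m‖ := by
      gcongr
      linarith
    nlinarith
  have hsum : ∀ p : ℕ, Summable fun m => ‖c m‖ * (1 + ‖ζ m‖) ^ p := fun p => by
    obtain ⟨C, hC, hCm⟩ := hdec (2 * n + p)
    refine Summable.of_nonneg_of_le (fun m => by positivity) (fun m => ?_)
      ((summable_lattice n).mul_left (C * B ^ p))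
    calc ‖c m‖ * (1 + ‖ζ m‖) ^ p ≤ C * ((1 + ‖m‖) ^ (2 * n + p))⁻¹ * (B * (1 + ‖m‖)) ^ p := by
          gcongr
          · exact hCm m
          · exact hζ m
      _ = _ := by
          have : (1 + ‖m‖) ^ p ≠ 0 := by positivity
          rw [pow_add, mul_pow]
          field_simp
  have hdist : ∀ η, HasSum (fun m => c m * u (modulate (η + ζ m) φ)) (u (modulate η f)) := fun η => by
    choose A hA0 hA using exists_bound_modulate φ
    have h1 := hasSum_dist u φ.hasCompactSupport φ.tsupport_subset
      (F := fun m => c m • modulate (η + ζ m) φ) (f := modulate η f)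
      (a := fun i m => A i * (1 + ‖η‖) ^ i * (‖c m‖ * (1 + ‖ζ m‖) ^ i))
      (fun m x hx => by rw [smul_apply, modulate_eq_zero _ φ hx, smul_zero])
      (fun i => (hsum i).mul_left _) (fun i m x => ?_) (fun x => ?_)
    · simpa only [map_smul, smul_eq_mul] using h1
    · have h2 : ((c m • modulate (η + ζ m) φ : 𝓓(Ω, ℂ)) : EuclideanSpace ℝ (Fin n) → ℂ) =
          c m • (modulate (η + ζ m) φ : EuclideanSpace ℝ (Fin n) → ℂ) := rfl
      rw [h2, iteratedFDeriv_const_smul_apply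
        (((modulate (η + ζ m) φ).contDiff.of_le (natCast_le_infty i)).contDiffAt), norm_smul]
      calc ‖c m‖ * ‖iteratedFDeriv ℝ i (modulate (η + ζ m) φ) x‖
          ≤ ‖c m‖ * (A i * ((1 + ‖η‖) * (1 + ‖ζ m‖)) ^ i) := by
            gcongr
            refine (hA i _ x).trans ?_
            have := one_add_norm_sub_le_mul η (-ζ m)
            rw [sub_neg_eq_add, norm_neg] at this
            have hAi := hA0 i
            gcongr
        _ = _ := by rw [mul_pow]; ring
    · simpa only [smul_apply, smul_eq_mul] using (hphase η x).2
  obtain ⟨κ, hκ, hshift⟩ := h.exists_shift_bound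
  refine ⟨κ, hκ, fun m => ?_⟩
  obtain ⟨C, p, hC, hCb⟩ := hshift m
  refine ⟨∑' j, C * (‖c j‖ * (1 + ‖ζ j‖) ^ p), tsum_nonneg fun j => by positivity,
    fun t ht η hη => ?_⟩
  have h1 := (hdist η).mul_left (((1 + ‖η‖) ^ m : ℝ) : ℂ)
  have h2 : (1 + ‖η‖) ^ m * ‖u (modulate η f)‖ =
      ‖(((1 + ‖η‖) ^ m : ℝ) : ℂ) * u (modulate η f)‖ := by
    rw [norm_mul, Complex.norm_real, Real.norm_of_nonneg (by positivity)]
  rw [h2, ← h1.tsum_eq]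
  refine tsum_of_norm_bounded (((hsum p).mul_left C).hasSum) fun j => ?_
  rw [norm_mul, norm_mul, Complex.norm_real, Real.norm_of_nonneg (by positivity)]
  have h3 := hCb t ht η hη (-ζ j)
  rw [sub_neg_eq_add, norm_neg] at h3
  calc (1 + ‖η‖) ^ m * (‖c j‖ * ‖u (modulate (η + ζ j) φ)‖)
      = ‖c j‖ * ((1 + ‖η‖) ^ m * ‖u (modulate (η + ζ j) φ)‖) := by ring
    _ ≤ ‖c j‖ * (C * (1 + ‖ζ j‖) ^ p) := by gcongr
    _ = _ := by ring

/-! ### Oscillations along a line -/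

theorem hasCompactSupport_iteratedDeriv {h : ℝ → ℂ} (hc : HasCompactSupport h) (M : ℕ) :
    HasCompactSupport (iteratedDeriv M h) := by
  induction M with
  | zero => simpa using hc
  | succ M ih => rw [iteratedDeriv_succ]; exact ih.deriv

theorem contDiff_iteratedDeriv {h : ℝ → ℂ} (hh : ContDiff ℝ ∞ h) (M : ℕ) :
    ContDiff ℝ ∞ (iteratedDeriv M h) := by
  rw [iteratedDeriv_eq_iterate]
  exact hh.iterate_deriv M

theorem exists_fourier_decay {g : ℝ → ℂ} (hg : ContDiff ℝ ∞ g) (hc : HasCompactSupport g) (p : ℕ) :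
    ∃ C : ℝ, 0 ≤ C ∧ ∀ m : ℤ, ‖FourierTransform.fourier g (m : ℝ)‖ ≤ C * ((1 + |(m : ℝ)|) ^ p)⁻¹ := by
  let S := hc.toSchwartzMap hg
  have h := fun x => SchwartzMap.one_add_le_sup_seminorm_apply (𝕜 := ℝ) (m := (p, 0)) le_rfl le_rfl
    (FourierTransform.fourier S) x
  refine ⟨2 ^ p * (Finset.Iic (p, 0)).sup
    (fun m => SchwartzMap.seminorm ℝ m.1 m.2) (FourierTransform.fourier S),
    by positivity, fun m => ?_⟩
  rw [← div_eq_mul_inv, le_div_iff₀ (by positivity)]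
  refine le_trans (le_of_eq ?_) (h m)
  rw [norm_iteratedFDeriv_zero, mul_comm, SchwartzMap.fourier_coe]
  rfl

theorem hasSum_fourier_of_support {g : ℝ → ℂ} (hg : ContDiff ℝ ∞ g) (hc : HasCompactSupport g)
    (hs : ∀ y, g y ≠ 0 → |y| < 1 / 2) {y : ℝ} (hy : |y| < 1 / 2) :
    HasSum (fun m : ℤ => FourierTransform.fourier g (m : ℝ) *
      Complex.exp (2 * Real.pi * Complex.I * m * y)) (g y) := by
  have h := SchwartzMap.tsum_eq_tsum_fourier (hc.toSchwartzMap hg) y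
  have h1 : ∑' n : ℤ, (hc.toSchwartzMap hg) (y + n) = g y := by
    rw [tsum_eq_single 0]
    · simp
    · intro n hn
      by_contra h0
      have h2 := abs_lt.1 (hs _ h0)
      have h3 := abs_lt.1 hy
      have h4 : (-1 : ℝ) < n := by linarith [h2.1, h3.2]
      have h5 : (n : ℝ) < 1 := by linarith [h2.2, h3.1]
      have h6 : -1 < n := by exact_mod_cast h4
      have h7 : n < 1 := by exact_mod_cast h5
      omega
  rw [h1] at h
  obtain ⟨C, -, hC⟩ := exists_fourier_decay hg hc 2
  have hterm : ∀ m : ℤ, (FourierTransform.fourier (hc.toSchwartzMap hg) : ℝ → ℂ) m *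
      fourier m (y : UnitAddCircle) = FourierTransform.fourier g (m : ℝ) *
      Complex.exp (2 * Real.pi * Complex.I * m * y) := fun m => by
    rw [fourier_coe_apply, SchwartzMap.fourier_coe]
    simp
    rfl
  simp only [hterm] at h
  rw [h]
  refine Summable.hasSum (Summable.of_norm_bounded (summable_int_inv_sq.mul_left C) fun m => ?_)
  rw [norm_mul]
  have h3 : ‖Complex.exp (2 * Real.pi * Complex.I * m * y)‖ = 1 := by
    rw [Complex.norm_exp]; simp
  rw [h3, mul_one]
  exact hC m

/-- The function `h^{(M)}(sy)` is `s^{-M}` times the `M`-th derivative of `h(sy)`. On the Fourier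
side the derivative gives `(2πm)^M`, and the integral of `|h(sy)|` gives one more `s⁻¹`. With `s`
proportional to `1/δ` this is the gain `δ^{M+1}`. -/
theorem norm_fourier_scaled_le {h : ℝ → ℂ} (hh : ContDiff ℝ ∞ h) (hc : HasCompactSupport h) (M : ℕ)
    {s : ℝ} (hs : 0 < s) (m : ℤ) :
    ‖FourierTransform.fourier (fun y : ℝ => iteratedDeriv M h (s * y)) (m : ℝ)‖ ≤
      ((2 * Real.pi) ^ M * ∫ y, ‖h y‖) * (s⁻¹) ^ (M + 1) * |(m : ℝ)| ^ M := by
  let hs' : ℝ → ℂ := fun y => h (s * y)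
  have hsm : ContDiff ℝ ∞ hs' := hh.comp (contDiff_const.mul contDiff_id)
  have hcs : HasCompactSupport hs' :=
    hc.comp_homeomorph (Homeomorph.mulLeft₀ s hs.ne')
  have h1 : (fun y : ℝ => iteratedDeriv M h (s * y)) =
      (((s ^ M)⁻¹ : ℝ) : ℂ) • iteratedDeriv M hs' := by
    have h2 := iteratedDeriv_comp_const_smul (n := M) (hh.of_le (natCast_le_infty M)) s
    change iteratedDeriv M hs' = _ at h2
    rw [h2]
    funext y
    have : ((s : ℂ)) ^ M ≠ 0 := pow_ne_zero _ (by exact_mod_cast hs.ne')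
    simp only [Pi.smul_apply, smul_eq_mul, Complex.real_smul]
    push_cast
    rw [← mul_assoc, inv_mul_cancel₀ this, one_mul]
  have h3 : ∀ n : ℕ, (n : ℕ∞) ≤ ⊤ → Integrable (iteratedDeriv n hs') := fun n _ =>
    Continuous.integrable_of_hasCompactSupport
      (hsm.continuous_iteratedDeriv n (natCast_le_infty n)) (hasCompactSupport_iteratedDeriv hcs n)
  have h4 := Real.fourier_iteratedDeriv (N := ⊤) (n := M) hsm h3 le_top
  have h5 : FourierTransform.fourier ((((s ^ M)⁻¹ : ℝ) : ℂ) • iteratedDeriv M hs') (m : ℝ) =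
      (((s ^ M)⁻¹ : ℝ) : ℂ) * ((2 * Real.pi * Complex.I * (m : ℝ)) ^ M *
        FourierTransform.fourier hs' (m : ℝ)) := by
    have h6 := congrFun h4 (m : ℝ)
    rw [smul_eq_mul] at h6
    rw [← h6, Real.fourier_eq, Real.fourier_eq, ← integral_const_mul]
    refine integral_congr_ae (Eventually.of_forall fun y => ?_)
    simp only [Pi.smul_apply, smul_eq_mul]
    rw [Circle.smul_def, Circle.smul_def, smul_eq_mul, smul_eq_mul]
    ring
  have h6 : ‖FourierTransform.fourier hs' (m : ℝ)‖ ≤ s⁻¹ * ∫ y, ‖h y‖ := by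
    refine (VectorFourier.norm_fourierIntegral_le_integral_norm _ _ _ hs' (m : ℝ)).trans ?_
    have := Measure.integral_comp_mul_left (fun y => ‖h y‖) s
    rw [abs_of_pos (inv_pos.2 hs), smul_eq_mul] at this
    exact this.le
  rw [h1, h5, norm_mul, norm_mul, norm_pow, norm_mul, norm_mul, norm_mul, Complex.norm_I,
    Complex.norm_real, Complex.norm_real, Complex.norm_real, Real.norm_of_nonneg Real.pi_pos.le,
    Real.norm_of_nonneg (by positivity : (0 : ℝ) ≤ (s ^ M)⁻¹), Real.norm_eq_abs, mul_one]
  simp only [Complex.norm_ofNat]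
  calc (s ^ M)⁻¹ * ((2 * Real.pi * |(m : ℝ)|) ^ M * ‖FourierTransform.fourier hs' (m : ℝ)‖)
      ≤ (s ^ M)⁻¹ * ((2 * Real.pi * |(m : ℝ)|) ^ M * (s⁻¹ * ∫ y, ‖h y‖)) := by gcongr
    _ = _ := by rw [mul_pow _ |(m : ℝ)|, inv_pow, pow_succ]; field_simp

section Ray

variable {E : Type*} [NormedAddCommGroup E] [InnerProductSpace ℝ E] {Ω : Opens E}

theorem RapidNear.exists_ray_decay {u : Dist Ω} {θ : 𝓓(Ω, ℂ)} {ξ : E} (hξ : ξ ≠ 0)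
    (h : RapidNear u θ ξ) (p : ℕ) :
    ∃ C : ℝ, 0 ≤ C ∧ ∀ t : ℝ, 0 < t → (1 + t) ^ p * ‖u (modulate (t • ξ) θ)‖ ≤ C := by
  obtain ⟨κ, hκ, hd⟩ := h
  obtain ⟨C, hC, hb⟩ := hd p
  have hn : 0 < ‖ξ‖ := norm_pos_iff.2 hξ
  refine ⟨(1 + ‖ξ‖⁻¹) ^ p * C, by positivity, fun t ht => ?_⟩
  have h1 := hb t ht (t • ξ) (by rw [sub_self, norm_zero]; positivity)
  have h2 : 1 + t ≤ (1 + ‖ξ‖⁻¹) * (1 + ‖t • ξ‖) := by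
    rw [norm_smul, Real.norm_of_nonneg ht.le]
    have h3 : ‖ξ‖⁻¹ * (t * ‖ξ‖) = t := by field_simp
    have h4 : 0 ≤ t * ‖ξ‖ := by positivity
    have h5 : 0 ≤ ‖ξ‖⁻¹ := by positivity
    nlinarith
  calc (1 + t) ^ p * ‖u (modulate (t • ξ) θ)‖
      ≤ ((1 + ‖ξ‖⁻¹) * (1 + ‖t • ξ‖)) ^ p * ‖u (modulate (t • ξ) θ)‖ := by gcongr
    _ = (1 + ‖ξ‖⁻¹) ^ p * ((1 + ‖t • ξ‖) ^ p * ‖u (modulate (t • ξ) θ)‖) := by rw [mul_pow]; ring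
    _ ≤ _ := by gcongr

theorem exists_line_decay {u : Dist Ω} {θ : 𝓓(Ω, ℂ)} {ξ : E} (hξ : ξ ≠ 0)
    (h₁ : RapidNear u θ ξ) (h₂ : RapidNear u θ (-ξ)) (p : ℕ) :
    ∃ C : ℝ, 0 ≤ C ∧ ∀ t : ℝ, (1 + |t|) ^ p * ‖u (modulate (t • ξ) θ)‖ ≤ C := by
  obtain ⟨C₁, hC₁, hb₁⟩ := h₁.exists_ray_decay hξ p
  obtain ⟨C₂, hC₂, hb₂⟩ := h₂.exists_ray_decay (neg_ne_zero.2 hξ) p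
  refine ⟨C₁ + C₂ + ‖u (modulate ((0 : ℝ) • ξ) θ)‖, by positivity, fun t => ?_⟩
  rcases lt_trichotomy t 0 with ht | rfl | ht
  · have h := hb₂ (-t) (neg_pos.2 ht)
    rw [smul_neg, neg_smul, neg_neg] at h
    rw [abs_of_neg ht]
    linarith [norm_nonneg (u (modulate ((0 : ℝ) • ξ) θ))]
  · simp only [abs_zero, add_zero, one_pow, one_mul]
    linarith
  · have h := hb₁ t ht
    rw [abs_of_pos ht]
    linarith [norm_nonneg (u (modulate ((0 : ℝ) • ξ) θ))]

/-- If `θ u` has no singularity in the directions `± ξ`, then it is insensitive to oscillations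
along `ξ` on small scales. -/
theorem exists_ray_bound {u : Dist Ω} {θ : 𝓓(Ω, ℂ)} {ξ : E} (hξ : ξ ≠ 0)
    (h₁ : RapidNear u θ ξ) (h₂ : RapidNear u θ (-ξ)) {h : ℝ → ℂ} (hh : ContDiff ℝ ∞ h)
    (hc : HasCompactSupport h) (M : ℕ) : ∃ C δ₀ : ℝ, 0 < δ₀ ∧ ∀ δ : ℝ, 0 < δ → δ < δ₀ →
      ∀ f : 𝓓(Ω, ℂ), (∀ x, f x = iteratedDeriv M h (inner ℝ ξ x / δ) * θ x) →
        ‖u f‖ ≤ C * δ ^ (M + 1) := by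
  obtain ⟨R, hR, hRs⟩ : ∃ R : ℝ, 0 < R ∧ ∀ x ∈ tsupport θ, |inner ℝ ξ x| ≤ R := by
    obtain ⟨R, hR⟩ := θ.hasCompactSupport.exists_bound_of_continuousOn
      (f := fun x => inner ℝ ξ x) (by fun_prop)
    exact ⟨max R 1, by positivity, fun x hx => (hR x hx).trans (le_max_left _ _)⟩
  obtain ⟨S, hS, hSs⟩ : ∃ S : ℝ, 0 < S ∧ ∀ y, iteratedDeriv M h y ≠ 0 → |y| ≤ S := by
    obtain ⟨S, hS⟩ := (hasCompactSupport_iteratedDeriv hc M).isBounded.subset_closedBall 0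
    refine ⟨max S 1, by positivity, fun y hy => ?_⟩
    have := hS (subset_tsupport _ hy)
    rw [mem_closedBall_zero_iff] at this
    exact this.trans (le_max_left _ _)
  let L := 4 * R
  have hL : 0 < L := by positivity
  obtain ⟨D, hD, hdec⟩ := exists_line_decay hξ h₁ h₂ (M + 2)
  have hpi := Real.pi_pos
  let B := 1 + L / (2 * Real.pi)
  have hB : 0 < B := by positivity
  let A := (2 * Real.pi) ^ M * ∫ y, ‖h y‖
  have hA : 0 ≤ A := mul_nonneg (by positivity) (integral_nonneg fun _ => norm_nonneg _)
  let τ : ℤ → ℝ := fun m => -(2 * Real.pi * m / L)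
  have hτ : ∀ m : ℤ, 1 + |(m : ℝ)| ≤ B * (1 + |τ m|) := fun m => by
    have h1 : |τ m| = 2 * Real.pi / L * |(m : ℝ)| := by
      simp only [τ]
      rw [abs_neg, abs_div, abs_mul, abs_of_pos (by positivity : (0 : ℝ) < 2 * Real.pi),
        abs_of_pos hL]
      ring
    have h2 : L / (2 * Real.pi) * |τ m| = |(m : ℝ)| := by rw [h1]; field_simp
    have h3 : 0 ≤ L / (2 * Real.pi) := by positivity
    nlinarith [abs_nonneg (τ m)]
  -- The bound on `δ` makes the rescaled oscillation vanish for `|y| ≥ 1/2`, so its Fourier series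
  -- represents it on one period.
  refine ⟨∑' m : ℤ, A * (L⁻¹) ^ (M + 1) * (B ^ (M + 2) * D) * ((1 + |(m : ℝ)|) ^ 2)⁻¹,
    L / (2 * S + 1), by positivity, fun δ hδ hδ' f hf => ?_⟩
  let g : ℝ → ℂ := fun y => iteratedDeriv M h (L / δ * y)
  have hs : 0 < L / δ := by positivity
  have hgs : ContDiff ℝ ∞ g :=
    (contDiff_iteratedDeriv hh M).comp (contDiff_const.mul contDiff_id)
  have hgc : HasCompactSupport g :=
    (hasCompactSupport_iteratedDeriv hc M).comp_homeomorph (Homeomorph.mulLeft₀ (L / δ) hs.ne')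
  have hgsupp : ∀ y, g y ≠ 0 → |y| < 1 / 2 := fun y hy => by
    have h1 := hSs _ hy
    rw [abs_mul, abs_of_pos hs, div_mul_eq_mul_div, div_le_iff₀ hδ] at h1
    rw [lt_div_iff₀ (by positivity)] at hδ'
    by_contra h2
    push Not at h2
    nlinarith
  have hcoef : ∀ m : ℤ, ‖FourierTransform.fourier g (m : ℝ)‖ ≤ A * (δ / L) ^ (M + 1) * |(m : ℝ)| ^ M :=
    fun m => by
      have := norm_fourier_scaled_le hh hc M hs m
      rwa [inv_div] at this
  have hphase : ∀ x, HasSum (fun m : ℤ => FourierTransform.fourier g (m : ℝ) *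
      modulate (τ m • ξ) θ x) (f x) := fun x => by
    by_cases hx : x ∈ tsupport θ
    · have h1 := hasSum_fourier_of_support hgs hgc hgsupp (y := inner ℝ ξ x / L) (by
        rw [abs_div, abs_of_pos hL, div_lt_iff₀ hL]
        have := hRs x hx
        change _ < 1 / 2 * (4 * R)
        linarith)
      have h2 : g (inner ℝ ξ x / L) * θ x = f x := by
        rw [hf]
        simp only [g]
        congr 2
        field_simp
      have h3 := h1.mul_right (θ x)
      rw [h2] at h3
      refine h3.congr_fun fun m => ?_
      rw [modulate_apply, mul_assoc]
      congr 3
      rw [inner_smul_left]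
      simp only [τ]
      push_cast
      simp
      field_simp
    · have h1 : f x = 0 := by rw [hf, testFunction_eq_zero θ hx, mul_zero]
      rw [h1]
      simp [modulate_eq_zero _ θ hx]
  have hsum : HasSum (fun m : ℤ => FourierTransform.fourier g (m : ℝ) * u (modulate (τ m • ξ) θ))
      (u f) := by
    choose P hP0 hP using exists_bound_modulate θ
    choose Q hQ0 hQ using exists_fourier_decay hgs hgc
    let V := 1 + 2 * Real.pi / L * ‖ξ‖
    have hV : ∀ m : ℤ, 1 + ‖τ m • ξ‖ ≤ V * (1 + |(m : ℝ)|) := fun m => by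
      rw [norm_smul, Real.norm_eq_abs]
      have h1 : |τ m| = 2 * Real.pi / L * |(m : ℝ)| := by
        simp only [τ]
        rw [abs_neg, abs_div, abs_mul, abs_of_pos (by positivity : (0 : ℝ) < 2 * Real.pi),
          abs_of_pos hL]
        ring
      have h2 : 0 ≤ 2 * Real.pi / L * ‖ξ‖ := by positivity
      rw [h1]
      nlinarith [abs_nonneg (m : ℝ)]
    have h3 := hasSum_dist u θ.hasCompactSupport θ.tsupport_subset
      (F := fun m : ℤ => FourierTransform.fourier g (m : ℝ) • modulate (τ m • ξ) θ) (f := f)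
      (a := fun i m => Q (2 + i) * (P i * V ^ i) * ((1 + |(m : ℝ)|) ^ 2)⁻¹)
      (fun m x hx => by rw [smul_apply, modulate_eq_zero _ θ hx, smul_zero])
      (fun i => summable_int_inv_sq.mul_left _) (fun i m x => ?_) (fun x => ?_)
    · simpa only [map_smul, smul_eq_mul] using h3
    · have h2 : ((FourierTransform.fourier g (m : ℝ) • modulate (τ m • ξ) θ : 𝓓(Ω, ℂ)) : E → ℂ) =
          FourierTransform.fourier g (m : ℝ) • (modulate (τ m • ξ) θ : E → ℂ) := rfl
      rw [h2, iteratedFDeriv_const_smul_apply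
        (((modulate (τ m • ξ) θ).contDiff.of_le (natCast_le_infty i)).contDiffAt), norm_smul]
      calc ‖FourierTransform.fourier g (m : ℝ)‖ * ‖iteratedFDeriv ℝ i (modulate (τ m • ξ) θ) x‖
          ≤ (Q (2 + i) * ((1 + |(m : ℝ)|) ^ (2 + i))⁻¹) * (P i * (V * (1 + |(m : ℝ)|)) ^ i) := by
            have hQi := hQ0 (2 + i)
            have hPi := hP0 i
            gcongr
            · exact hQ _ m
            · refine (hP i _ x).trans ?_
              gcongr
              exact hV m
        _ = _ := by
            have : (1 + |(m : ℝ)|) ^ i ≠ 0 := by positivity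
            rw [pow_add, mul_pow]
            field_simp
    · simpa only [smul_apply, smul_eq_mul] using hphase x
  rw [← hsum.tsum_eq, ← tsum_mul_right]
  refine tsum_of_norm_bounded (((summable_int_inv_sq.mul_left _).mul_right _).hasSum) fun m => ?_
  rw [norm_mul]
  -- Decay of order `M + 2` along the line absorbs the factor `|m|^M` and leaves a summable inverse
  -- square.
  have h3 : |(m : ℝ)| ^ M * ‖u (modulate (τ m • ξ) θ)‖ ≤
      B ^ (M + 2) * D * ((1 + |(m : ℝ)|) ^ 2)⁻¹ := by
    rw [← div_eq_mul_inv, le_div_iff₀ (by positivity)]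
    calc |(m : ℝ)| ^ M * ‖u (modulate (τ m • ξ) θ)‖ * (1 + |(m : ℝ)|) ^ 2
        ≤ (1 + |(m : ℝ)|) ^ M * ‖u (modulate (τ m • ξ) θ)‖ * (1 + |(m : ℝ)|) ^ 2 := by
          gcongr
          linarith [abs_nonneg (m : ℝ)]
      _ = (1 + |(m : ℝ)|) ^ (M + 2) * ‖u (modulate (τ m • ξ) θ)‖ := by ring
      _ ≤ (B * (1 + |τ m|)) ^ (M + 2) * ‖u (modulate (τ m • ξ) θ)‖ := by gcongr; exact hτ m
      _ = B ^ (M + 2) * ((1 + |τ m|) ^ (M + 2) * ‖u (modulate (τ m • ξ) θ)‖) := by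
          rw [mul_pow]; ring
      _ ≤ _ := by gcongr; exact hdec _
  calc ‖FourierTransform.fourier g (m : ℝ)‖ * ‖u (modulate (τ m • ξ) θ)‖
      ≤ A * (δ / L) ^ (M + 1) * |(m : ℝ)| ^ M * ‖u (modulate (τ m • ξ) θ)‖ := by
        gcongr; exact hcoef m
    _ = A * (δ / L) ^ (M + 1) * (|(m : ℝ)| ^ M * ‖u (modulate (τ m • ξ) θ)‖) := by ring
    _ ≤ A * (δ / L) ^ (M + 1) * (B ^ (M + 2) * D * ((1 + |(m : ℝ)|) ^ 2)⁻¹) := by gcongr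
    _ = _ := by rw [div_eq_mul_inv, mul_pow]; ring

end Ray

/-! ### Wave front sets -/

section WaveFront

variable {n : ℕ} {Ω : Opens (EuclideanSpace ℝ (Fin n))}

/-- Away from the directions `± ξ` of its wave front set over `x`, a distribution is insensitive to
oscillations along `ξ` on small scales. -/
theorem exists_insensitive {u : Dist Ω} {x ξ : EuclideanSpace ℝ (Fin n)} (hξ : ξ ≠ 0)
    {φ₁ φ₂ : 𝓓(Ω, ℂ)} (hx₁ : φ₁ x ≠ 0) (hx₂ : φ₂ x ≠ 0) (h₁ : RapidNear u φ₁ ξ)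
    (h₂ : RapidNear u φ₂ (-ξ)) : ∃ U : Set (EuclideanSpace ℝ (Fin n)), IsOpen U ∧ x ∈ U ∧
      ∀ θ : 𝓓(Ω, ℂ), tsupport θ ⊆ U → ∀ h : ℝ → ℂ, ContDiff ℝ ∞ h → HasCompactSupport h →
        ∀ M : ℕ, ∃ C δ₀ : ℝ, 0 < δ₀ ∧ ∀ δ : ℝ, 0 < δ → δ < δ₀ → ∀ f : 𝓓(Ω, ℂ),
          (∀ x, f x = iteratedDeriv M h (inner ℝ ξ x / δ) * θ x) → ‖u f‖ ≤ C * δ ^ (M + 1) := by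
  refine ⟨{y | φ₁ y ≠ 0} ∩ {y | φ₂ y ≠ 0},
    (isOpen_ne_fun φ₁.contDiff.continuous continuous_const).inter
      (isOpen_ne_fun φ₂.contDiff.continuous continuous_const), ⟨hx₁, hx₂⟩, fun θ hθ h hh hc M => ?_⟩
  -- On a set where `φ` does not vanish `θ = (θ/φ) φ`, and multiplication by the smooth function
  -- `θ/φ` keeps rapid decrease.
  have key : ∀ (φ : 𝓓(Ω, ℂ)) (η : EuclideanSpace ℝ (Fin n)), tsupport θ ⊆ {y | φ y ≠ 0} →
      RapidNear u φ η → RapidNear u θ η := fun φ η hφ hr => by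
    have hne : ∀ y, φ y = 0 → θ y = 0 := fun y hy =>
      testFunction_eq_zero θ fun h => hφ h hy
    refine hr.mul (θ := fun y => θ y * (φ y)⁻¹) ?_ θ.hasCompactSupport.mul_right fun y => ?_
    · refine contDiff_of_vanish (isOpen_ne_fun φ.contDiff.continuous continuous_const)
        (isClosed_tsupport θ) hφ
        (θ.contDiff.contDiffOn.mul (φ.contDiff.contDiffOn.inv fun y hy => hy)) fun y hy => ?_
      rw [testFunction_eq_zero θ hy, zero_mul]
    · by_cases hy : φ y = 0
      · simp [hne y hy]
      · rw [mul_assoc, inv_mul_cancel₀ hy, mul_one]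
  exact exists_ray_bound hξ (key φ₁ ξ (fun y hy => (hθ hy).1) h₁)
    (key φ₂ (-ξ) (fun y hy => (hθ hy).2) h₂) hh hc M

/-- The complex conjugate of a test function. -/
def conjTest (f : 𝓓(Ω, ℂ)) : 𝓓(Ω, ℂ) :=
  mkTest (fun x => starRingEnd ℂ (f x)) (Complex.conjCLE.contDiff.comp f.contDiff) (tsupport f)
    f.hasCompactSupport f.tsupport_subset fun x hx => by rw [testFunction_eq_zero f hx, map_zero]

@[simp] theorem conjTest_apply (f : 𝓓(Ω, ℂ)) (x : EuclideanSpace ℝ (Fin n)) :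
    conjTest f x = starRingEnd ℂ (f x) := rfl

/-- Conjugation reverses frequencies. For a real distribution, regularity in one direction therefore
implies regularity in the opposite one. -/
theorem RapidNear.conj {u : Dist Ω} (hu : ∀ f, u (conjTest f) = starRingEnd ℂ (u f))
    {φ : 𝓓(Ω, ℂ)} {ξ : EuclideanSpace ℝ (Fin n)} (h : RapidNear u φ ξ) :
    RapidNear u (conjTest φ) (-ξ) := by
  obtain ⟨κ, hκ, hd⟩ := h
  refine ⟨κ, hκ, fun m => ?_⟩
  obtain ⟨C, hC, hb⟩ := hd m
  refine ⟨C, hC, fun t ht η hη => ?_⟩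
  have h1 := hb t ht (-η) (by
    have h3 : -η - t • ξ = -(η - t • -ξ) := by rw [smul_neg]; abel
    rw [h3, norm_neg]
    exact hη)
  have h2 : modulate η (conjTest φ) = conjTest (modulate (-η) φ) := by
    ext x
    rw [modulate_apply, conjTest_apply, conjTest_apply, modulate_apply, map_mul, ← Complex.exp_conj]
    congr 2
    simp
  rw [h2, hu, RCLike.norm_conj, ← norm_neg η]
  exact h1

theorem notMem_waveFrontSet_of_smooth {u : Dist Ω} {V : Set (EuclideanSpace ℝ (Fin n))}
    (hV : IsOpen V) (hVΩ : V ⊆ Ω) {g : EuclideanSpace ℝ (Fin n) → ℂ} (hg : ContDiffOn ℝ ∞ g V)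
    (hu : ∀ f : 𝓓(Ω, ℂ), tsupport f ⊆ V → u f = ∫ x, g x * f x)
    {x : EuclideanSpace ℝ (Fin n)} (hx : x ∈ V) (ξ : EuclideanSpace ℝ (Fin n)) :
    (x, ξ) ∉ waveFrontSet u := by
  rintro ⟨-, -, hnot⟩
  apply hnot
  obtain ⟨χ, hχ, hχc, hχV, -, W, -, hxW, hW1⟩ :=
    exists_cutoff (isCompact_singleton (x := x)) hV (Set.singleton_subset_iff.2 hx)
  have h0 : ∀ y, y ∉ tsupport χ → (χ y : ℂ) = 0 := fun y hy => by
    rw [image_eq_zero_of_notMem_tsupport hy]; simp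
  let φ : 𝓓(Ω, ℂ) := mkTest (fun y => (χ y : ℂ)) (Complex.ofRealCLM.contDiff.comp hχ) (tsupport χ)
    hχc (hχV.trans hVΩ) h0
  have hφV : ∀ η, tsupport (modulate η φ) ⊆ V := fun η =>
    (closure_minimal (fun y hy => by
      by_contra h
      exact hy (by
        change Complex.exp _ * (χ y : ℂ) = 0
        rw [h0 y h, mul_zero])) (isClosed_tsupport χ)).trans hχV
  have hψ : ContDiff ℝ ∞ fun y => g y * (χ y : ℂ) :=
    contDiff_of_vanish hV (isClosed_tsupport χ) hχV
      (hg.mul (Complex.ofRealCLM.contDiff.comp hχ).contDiffOn) fun y hy => by rw [h0 y hy, mul_zero]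
  have hψc : HasCompactSupport fun y => g y * (χ y : ℂ) :=
    HasCompactSupport.intro hχc fun y hy => by rw [h0 y hy, mul_zero]
  refine ⟨φ, ?_, Set.univ, isOpen_univ, trivial, fun _ _ _ _ => trivial, fun m => ?_⟩
  · change (χ x : ℂ) ≠ 0
    rw [hW1 x (hxW rfl)]; simp
  let S := hψc.toSchwartzMap hψ
  have hpi := Real.pi_pos
  have hdec := fun y => SchwartzMap.one_add_le_sup_seminorm_apply (𝕜 := ℝ) (m := (m, 0)) le_rfl
    le_rfl (FourierTransform.fourier S) y
  refine ⟨(2 * Real.pi) ^ m * (2 ^ m * (Finset.Iic (m, 0)).sup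
    (fun m => SchwartzMap.seminorm ℝ m.1 m.2) (FourierTransform.fourier S)), fun η _ => ?_⟩
  -- The wave front set is defined with `e^{-i⟨η,x⟩}`, the Fourier transform with `e^{-2πi⟨η,x⟩}`;
  -- hence the factor `(2π)⁻¹`.
  have h1 : u (modulate η φ) = FourierTransform.fourier S ((2 * Real.pi)⁻¹ • η) := by
    rw [hu _ (hφV η), SchwartzMap.fourier_coe, Real.fourier_eq']
    refine integral_congr_ae (Eventually.of_forall fun y => ?_)
    change g y * (Complex.exp _ * (χ y : ℂ)) = _ • (g y * (χ y : ℂ))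
    rw [smul_eq_mul, mul_left_comm]
    congr 2
    rw [inner_smul_right, real_inner_comm]
    push_cast
    have : (Real.pi : ℂ) ≠ 0 := by exact_mod_cast hpi.ne'
    field_simp
  have h2 := hdec ((2 * Real.pi)⁻¹ • η)
  rw [norm_iteratedFDeriv_zero, ← h1] at h2
  have h3 : 1 + ‖η‖ ≤ 2 * Real.pi * (1 + ‖(2 * Real.pi)⁻¹ • η‖) := by
    rw [norm_smul, Real.norm_of_nonneg (by positivity), mul_add, ← mul_assoc,
      mul_inv_cancel₀ (by positivity), one_mul, mul_one]
    linarith [Real.pi_gt_three]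
  calc (1 + ‖η‖) ^ m * ‖u (modulate η φ)‖
      ≤ (2 * Real.pi * (1 + ‖(2 * Real.pi)⁻¹ • η‖)) ^ m * ‖u (modulate η φ)‖ := by gcongr
    _ = (2 * Real.pi) ^ m * ((1 + ‖(2 * Real.pi)⁻¹ • η‖) ^ m * ‖u (modulate η φ)‖) := by
        rw [mul_pow]; ring
    _ ≤ _ := by gcongr

end WaveFront

/-! ### Location of the singularities of the two factors -/

theorem shellDelta_eq_zero {f : 𝓓(punctured4, ℂ)} (hf : ∀ k ∈ forwardCone, k ∉ tsupport f) :
    shellDelta f = 0 := by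
  rw [shellDelta_apply]
  refine integral_eq_zero_of_ae (Eventually.of_forall fun k => ?_)
  rw [onShell_eq]
  by_cases hk : k = 0
  · simp [hk, energy_zero]
  · simp [testFunction_eq_zero f (hf _ (shellPt_mem_forwardCone hk))]

theorem shellDeltaPrime_eq_zero {f : 𝓓(punctured4, ℂ)} (hf : ∀ k ∈ forwardCone, k ∉ tsupport f) :
    shellDeltaPrime f = 0 := by
  rw [shellDeltaPrime_apply]
  refine integral_eq_zero_of_ae (Eventually.of_forall fun k => ?_)
  by_cases hk : k = 0
  · simp [onShellDeriv, hk, energy_zero]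
  · have h1 := hf _ (shellPt_mem_forwardCone hk)
    have h2 : fderiv ℝ f (shellPt 0 k) = 0 := by
      have : shellPt 0 k ∉ tsupport (fderiv ℝ f) := fun h => h1 (tsupport_fderiv_subset ℝ h)
      exact image_eq_zero_of_notMem_tsupport this
    simp [onShellDeriv, testFunction_eq_zero f h1, h2]

theorem shellDelta_conj (f : 𝓓(punctured4, ℂ)) :
    shellDelta (conjTest f) = starRingEnd ℂ (shellDelta f) := by
  rw [shellDelta_apply, shellDelta_apply, ← integral_conj]
  refine integral_congr_ae (Eventually.of_forall fun k => ?_)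
  simp [onShell_eq, map_ofNat]

theorem shellDeltaPrime_conj (f : 𝓓(punctured4, ℂ)) :
    shellDeltaPrime (conjTest f) = starRingEnd ℂ (shellDeltaPrime f) := by
  rw [shellDeltaPrime_apply, shellDeltaPrime_apply, ← integral_conj]
  refine integral_congr_ae (Eventually.of_forall fun k => ?_)
  have hd : DifferentiableAt ℝ f (shellPt 0 k) := f.contDiff.differentiable (by simp) _
  have h1 : fderiv ℝ (conjTest f) (shellPt 0 k) timeDir =
      starRingEnd ℂ (fderiv ℝ f (shellPt 0 k) timeDir) := by
    have : HasFDerivAt (conjTest f : R4 → ℂ)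
        ((Complex.conjCLE : ℂ →L[ℝ] ℂ).comp (fderiv ℝ f (shellPt 0 k))) (shellPt 0 k) :=
      (Complex.conjCLE : ℂ →L[ℝ] ℂ).hasFDerivAt.comp _ hd.hasFDerivAt
    rw [this.fderiv]; rfl
  simp only [onShellDeriv, h1, conjTest_apply]
  simp [map_ofNat]

/-- The properties of `θ(k₀) δ(k²)` and `θ(k₀) δ'(k²)` that bound their wave front sets. -/
theorem mem_forwardCone_of_mem_waveFrontSet {D : Dist punctured4}
    (hD : D = shellDelta ∨ D = shellDeltaPrime) {k ξ : R4} (h : (k, ξ) ∈ waveFrontSet D) :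
    k ∈ forwardCone := by
  by_contra hk
  have h0 : k ≠ 0 := h.1
  have hc : Continuous fun k : R4 => minkowskiSq (fun i => k i) := by
    unfold minkowskiSq; fun_prop
  let V : Set R4 := punctured4 ∩ ({k | minkowskiSq (fun i => k i) ≠ 0} ∪ {k | k 0 < 0})
  have hV : IsOpen V := punctured4.isOpen.inter ((isOpen_ne_fun hc continuous_const).union
    (isOpen_lt (f := fun k : R4 => k 0) (by fun_prop) continuous_const))
  have hkV : k ∈ V := by
    refine ⟨h0, ?_⟩
    by_cases h1 : minkowskiSq (fun i => k i) = 0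
    · right
      rcases lt_trichotomy (k 0) 0 with h2 | h2 | h2
      · exact h2
      · exfalso
        apply h0
        simp only [minkowskiSq, h2] at h1
        ext i
        fin_cases i
        · exact h2
        · simp; nlinarith [sq_nonneg (k 1), sq_nonneg (k 2), sq_nonneg (k 3)]
        · simp; nlinarith [sq_nonneg (k 1), sq_nonneg (k 2), sq_nonneg (k 3)]
        · simp; nlinarith [sq_nonneg (k 1), sq_nonneg (k 2), sq_nonneg (k 3)]
      · exact absurd ⟨h1, h2⟩ hk
    · exact Or.inl h1
  refine notMem_waveFrontSet_of_smooth (u := D) hV Set.inter_subset_left (g := fun _ => 0)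
    contDiffOn_const (fun f hf => ?_) hkV ξ h
  have h1 : ∀ k ∈ forwardCone, k ∉ tsupport f := fun k hk hkf => by
    rcases (hf hkf).2 with h2 | h2
    · exact h2 hk.1
    · exact lt_asymm h2 hk.2
  rcases hD with rfl | rfl
  · simp [shellDelta_eq_zero h1]
  · simp [shellDeltaPrime_eq_zero h1]

theorem negKThetaSq_of_mem_forwardCone {lam : ℝ} {k : R4} (hk : k ∈ forwardCone) :
    negKThetaSq lam k = 2 * lam ^ 4 * (k 1 ^ 2 + k 3 ^ 2) := by
  have := hk.1
  rw [minkowskiSq] at this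
  rw [negKThetaSq_eq]
  linear_combination lam ^ 4 * this

/-- Over points off the cone `D` vanishes locally. On the cone `-(kΘ₀)² = 2λ⁴(k₁² + k₃²)`, which is
positive off `N`, and there `v` is a smooth function. -/
theorem waveFrontOverlap_subset {lam : ℝ} (hlam : 0 < lam) {K : ℂ → ℂ} (hK : IsKernel K)
    {v : Dist punctured4} (hv : Realizes lam K v) {D : Dist punctured4}
    (hD : D = shellDelta ∨ D = shellDeltaPrime) :
    waveFrontOverlap D v ⊆ planeN ∩ forwardCone := by
  rintro k ⟨ξ, h1, h2⟩
  have hc := mem_forwardCone_of_mem_waveFrontSet hD h1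
  refine ⟨?_, hc⟩
  by_contra hN
  have hpos : 0 < k 1 ^ 2 + k 3 ^ 2 := by
    by_contra h
    apply hN
    have h3 := sq_nonneg (k 1)
    have h4 := sq_nonneg (k 3)
    constructor
    · have : k 1 ^ 2 = 0 := by linarith
      simpa using this
    · have : k 3 ^ 2 = 0 := by linarith
      simpa using this
  have hq : 0 < negKThetaSq lam k := by
    rw [negKThetaSq_of_mem_forwardCone hc]; positivity
  have hqc := (contDiff_negKThetaSq lam).continuous
  let V : Set R4 := punctured4 ∩ {k | 0 < negKThetaSq lam k}
  refine notMem_waveFrontSet_of_smooth (u := v) (V := V)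
    (punctured4.isOpen.inter (isOpen_lt continuous_const hqc)) Set.inter_subset_left
    (g := fun k => K (negKThetaSq lam k : ℂ)) (fun x hx => ?_)
    (fun f hf => hv f fun x hx => (hf hx).2) ⟨h1.1, hq⟩ (-ξ) h2
  exact ((hK.contDiffAt_real hx.2).comp x (contDiff_negKThetaSq lam).contDiffAt).contDiffWithinAt

/-! ### Singularities of the mass shell distributions at `N` -/

/-- A family of nonnegative functions that is positive and continuous at a point has integrals that
are bounded below. -/
theorem exists_lower_bound {E : Type*} [NormedAddCommGroup E] [MeasurableSpace E] [BorelSpace E]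
    {ν : Measure E} [ν.IsOpenPosMeasure] [IsFiniteMeasureOnCompacts ν] [ProperSpace E] {Φ : ℝ → E → ℝ} {y₀ : E}
    (hc : ContinuousAt (fun p : ℝ × E => Φ p.1 p.2) (0, y₀)) (hpos : 0 < Φ 0 y₀)
    (hnn : ∀ μ, 0 < μ → ∀ y, 0 ≤ Φ μ y) (hint : ∀ μ, 0 < μ → Integrable (Φ μ) ν) :
    ∃ c μ₀ : ℝ, 0 < c ∧ 0 < μ₀ ∧ ∀ μ, 0 < μ → μ < μ₀ → c ≤ ∫ y, Φ μ y ∂ν := by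
  have h1 : ∀ᶠ p : ℝ × E in 𝓝 (0, y₀), Φ 0 y₀ / 2 < Φ p.1 p.2 :=
    hc.eventually_const_lt (show Φ 0 y₀ / 2 < Φ (0, y₀).1 (0, y₀).2 by simp; linarith)
  obtain ⟨r, hr, hb⟩ := Metric.eventually_nhds_iff_ball.1 h1
  have hvol : 0 < ν.real (Metric.ball y₀ r) :=
    ENNReal.toReal_pos (Metric.measure_ball_pos ν y₀ hr).ne' measure_ball_lt_top.ne
  refine ⟨Φ 0 y₀ / 2 * ν.real (Metric.ball y₀ r), r, by positivity, hr, fun μ hμ hμ' => ?_⟩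
  calc Φ 0 y₀ / 2 * ν.real (Metric.ball y₀ r) = ∫ _y in Metric.ball y₀ r, Φ 0 y₀ / 2 ∂ν := by
        rw [setIntegral_const, smul_eq_mul, mul_comm]
    _ ≤ ∫ y in Metric.ball y₀ r, Φ μ y ∂ν := by
        refine setIntegral_mono_on (integrableOn_const measure_ball_lt_top.ne)
          (hint μ hμ).integrableOn measurableSet_ball fun y hy => (hb (μ, y) ?_).le
        rw [← ball_prod_same]
        exact ⟨by rw [Metric.mem_ball, dist_zero_right, Real.norm_of_nonneg hμ.le]; exact hμ', hy⟩
    _ ≤ ∫ y, Φ μ y ∂ν := setIntegral_le_integral (hint μ hμ) (Eventually.of_forall (hnn μ hμ))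

/-- The device for all contradictions below. The small parameter is `δ = μ²` because `k_⊥` is scaled
by `μ` in the explicit integrals. -/
theorem not_forall_le_pow {c C μ₁ : ℝ} (hc : 0 < c) (hμ₁ : 0 < μ₁) {a : ℕ}
    (h : ∀ μ : ℝ, 0 < μ → μ < μ₁ → c * (μ ^ 2) ^ a ≤ C * (μ ^ 2) ^ (a + 1)) : False := by
  have h1 : Tendsto (fun μ : ℝ => C * μ ^ 2) (𝓝[>] 0) (𝓝 0) := by
    have : Continuous fun μ : ℝ => C * μ ^ 2 := by fun_prop
    simpa using (this.tendsto 0).mono_left nhdsWithin_le_nhds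
  refine absurd (ge_of_tendsto h1 ?_) (not_le.2 hc)
  filter_upwards [Ioo_mem_nhdsGT hμ₁] with μ hμ
  have h2 := h μ hμ.1 hμ.2
  have h3 : 0 < (μ ^ 2) ^ a := pow_pos (pow_pos hμ.1 2) a
  rw [pow_succ (μ ^ 2) a, mul_comm ((μ ^ 2) ^ a) (μ ^ 2), ← mul_assoc] at h2
  exact le_of_mul_le_mul_right h2 h3

/-- An even bump that decreases on the positive half-line. -/
def evenBump (y : ℝ) : ℝ := Real.smoothTransition (2 - y ^ 2)

theorem contDiff_evenBump : ContDiff ℝ ∞ evenBump :=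
  Real.smoothTransition.contDiff.comp (by fun_prop)

theorem evenBump_eq_zero {y : ℝ} (hy : 2 ≤ y ^ 2) : evenBump y = 0 :=
  Real.smoothTransition.zero_of_nonpos (by linarith)

theorem hasCompactSupport_evenBump : HasCompactSupport evenBump :=
  HasCompactSupport.intro (isCompact_Icc (a := -2) (b := 2)) fun y hy => evenBump_eq_zero (by
    by_contra h
    push Not at h
    exact hy ⟨by nlinarith, by nlinarith⟩)

theorem deriv_evenBump_nonpos {y : ℝ} (hy : 0 ≤ y) : deriv evenBump y ≤ 0 := by
  have h1 : HasDerivAt evenBump (deriv Real.smoothTransition (2 - y ^ 2) * (-(2 * y))) y := by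
    have hd : DifferentiableAt ℝ Real.smoothTransition (2 - y ^ 2) :=
      (Real.smoothTransition.contDiff (n := 1)).differentiable (by simp) _
    have h2 : HasDerivAt (fun y : ℝ => 2 - y ^ 2) (-(2 * y)) y := by
      simpa using (hasDerivAt_pow 2 y).const_sub 2
    exact hd.hasDerivAt.comp y h2
  rw [h1.deriv]
  have h3 : 0 ≤ deriv Real.smoothTransition (2 - y ^ 2) := Real.smoothTransition.monotone.deriv_nonneg
  nlinarith

theorem exists_deriv_evenBump_neg : ∃ y : ℝ, 0 < y ∧ deriv evenBump y < 0 := by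
  obtain ⟨y, hy, hd⟩ := exists_deriv_eq_slope evenBump (show (1 : ℝ) < 2 by norm_num)
    contDiff_evenBump.continuous.continuousOn
    (contDiff_evenBump.differentiable (by simp)).differentiableOn
  refine ⟨y, by linarith [hy.1], ?_⟩
  have h1 : evenBump 1 = 1 := Real.smoothTransition.one_of_one_le (by norm_num)
  rw [hd, h1, evenBump_eq_zero (by norm_num)]
  norm_num

theorem contDiff_ofReal_comp {E : Type*} [NormedAddCommGroup E] [NormedSpace ℝ E] {g : E → ℝ}
    (hg : ContDiff ℝ ∞ g) : ContDiff ℝ ∞ fun x => (g x : ℂ) := Complex.ofRealCLM.contDiff.comp hg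

theorem deriv_ofReal_comp {g : ℝ → ℝ} (hg : ContDiff ℝ ∞ g) :
    deriv (fun x => (g x : ℂ)) = fun x => ((deriv g x : ℝ) : ℂ) := by
  funext x
  exact ((hg.differentiable (by simp)) x).hasDerivAt.ofReal_comp.deriv

/-- The null covector `(1, 0, -σ, 0)`. -/
def nullDir (σ : ℝ) : R4 := !₂[1, 0, -σ, 0]

/-- The point `(e, 0, σe, 0)` of the forward cone. -/
def lightPt (σ e : ℝ) : R4 := !₂[e, 0, σ * e, 0]

theorem inner_nullDir (σ : ℝ) (k : R4) : inner ℝ (nullDir σ) k = k 0 - σ * k 2 := by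
  rw [PiLp.inner_apply, Fin.sum_univ_four]
  simp [nullDir]
  ring

theorem nullDir_ne_zero (σ : ℝ) : nullDir σ ≠ 0 := fun h => by
  have := congrArg (fun v : R4 => v 0) h
  simp [nullDir] at this

theorem axisPoint_one (s : ℝ) : axisPoint s 1 = s := by simp [axisPoint]

theorem norm_axisPoint (s : ℝ) : ‖axisPoint s‖ = |s| := by
  rw [axisPoint, PiLp.norm_single, Real.norm_eq_abs]

theorem norm_sub_mul_eq {σ : ℝ} (hσ : σ ^ 2 = 1) {k : R3} (hk : 0 < σ * k 1) :
    ‖k‖ - σ * k 1 = perpSq k / (‖k‖ + σ * k 1) := by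
  have h1 := norm_sq_R3 k
  have h2 : ‖k‖ + σ * k 1 ≠ 0 := by have := norm_nonneg k; positivity
  rw [eq_div_iff h2, perpSq]
  linear_combination h1 - k 1 ^ 2 * hσ

/-- On the support of `G` one has `‖k‖ - σk₂ = |k_⊥|²/(‖k‖ + σk₂)`. Substituting `k_⊥ = μy_⊥` gives
the Jacobian `μ²`, and the argument tends to a multiple of `|y_⊥|²`. The bump decreases on the
positive half-line, so the integrand has one sign and nothing cancels in the limit. -/
theorem exists_shell_lower_bound {σ e : ℝ} (hσ : σ ^ 2 = 1) (he : 0 < e) {G : R3 → ℝ}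
    (hG : Continuous G) (hGc : HasCompactSupport G) (hG0 : ∀ k, 0 ≤ G k)
    (hGs : ∀ k, G k ≠ 0 → 0 < σ * k 1) (hG1 : 0 < G (axisPoint (σ * e))) :
    (∀ δ, 0 < δ → ∀ k, 0 ≤ -deriv evenBump ((‖k‖ - σ * k 1) / δ) * G k) ∧
    (∀ δ, Integrable fun k => -deriv evenBump ((‖k‖ - σ * k 1) / δ) * G k) ∧
    ∃ c μ₀ : ℝ, 0 < c ∧ 0 < μ₀ ∧ ∀ μ, 0 < μ → μ < μ₀ →
      c * μ ^ 2 ≤ ∫ k, -deriv evenBump ((‖k‖ - σ * k 1) / μ ^ 2) * G k := by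
  have hdc : Continuous (deriv evenBump) := contDiff_evenBump.continuous_deriv (by simp)
  have hnn : ∀ δ, 0 < δ → ∀ k, 0 ≤ -deriv evenBump ((‖k‖ - σ * k 1) / δ) * G k := fun δ hδ k => by
    by_cases hk : G k = 0
    · simp [hk]
    · refine mul_nonneg (neg_nonneg.2 (deriv_evenBump_nonpos ?_)) (hG0 k)
      rw [norm_sub_mul_eq hσ (hGs k hk)]
      have := hGs k hk
      have := perpSq_nonneg k
      positivity
  have hint : ∀ δ, Integrable fun k => -deriv evenBump ((‖k‖ - σ * k 1) / δ) * G k := fun δ =>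
    Continuous.integrable_of_hasCompactSupport
      ((hdc.comp (by fun_prop)).neg.mul hG) hGc.mul_left
  refine ⟨hnn, hint, ?_⟩
  obtain ⟨y₁, hy₁, hneg⟩ := exists_deriv_evenBump_neg
  let Φ : ℝ → R3 → ℝ := fun μ y =>
    -deriv evenBump (perpSq y / (‖perpDil μ y‖ + σ * y 1)) * G (perpDil μ y)
  have hΦ : ∀ μ, 0 < μ → Φ μ = fun y =>
      (fun k => -deriv evenBump ((‖k‖ - σ * k 1) / μ ^ 2) * G k) (perpDil μ y) := fun μ hμ => by
    funext y
    simp only [Φ]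
    by_cases hk : G (perpDil μ y) = 0
    · simp [hk]
    · rw [norm_sub_mul_eq hσ (hGs _ hk)]
      congr 3
      have h1 : perpSq (perpDil μ y) = μ ^ 2 * perpSq y := by simp [perpSq, perpDil]; ring
      have h2 : perpDil μ y 1 = y 1 := by simp [perpDil]
      have h3 := hGs _ hk
      rw [h2] at h3
      have h4 : ‖perpDil μ y‖ + σ * y 1 ≠ 0 := by positivity
      rw [h1, h2]
      field_simp
  -- Chosen so that the limiting argument `|y_⊥|²/(2e)` equals `y₁`, where the bump strictly
  -- decreases.
  let y₀ : R3 := !₂[√(2 * e * y₁), σ * e, 0]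
  have hy00 : perpSq y₀ = 2 * e * y₁ := by
    simp [perpSq, y₀]
    exact Real.sq_sqrt (by positivity)
  have hp0 : perpDil 0 y₀ = axisPoint (σ * e) := by
    ext i; fin_cases i <;> simp [perpDil, y₀, axisPoint]
  have hσa : |σ| = 1 := by
    rw [← Real.sqrt_sq_eq_abs, hσ, Real.sqrt_one]
  have hden : ‖perpDil 0 y₀‖ + σ * y₀ 1 = 2 * e := by
    rw [hp0, norm_axisPoint, abs_mul, hσa, abs_of_pos he]
    have : y₀ 1 = σ * e := by simp [y₀]
    rw [this, ← mul_assoc, ← sq, hσ]; ring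
  have hperp : Continuous fun p : ℝ × R3 => perpDil p.1 p.2 := by
    unfold perpDil
    refine (PiLp.continuous_toLp 2 _).comp (continuous_pi fun i => ?_)
    fin_cases i <;> simp <;> fun_prop
  have hcont : ContinuousAt (fun p : ℝ × R3 => Φ p.1 p.2) (0, y₀) := by
    refine ContinuousAt.mul (ContinuousAt.neg (hdc.continuousAt.comp (ContinuousAt.div ?_ ?_ ?_)))
      (hG.comp hperp).continuousAt
    · exact (contDiff_perpSq.continuous.comp continuous_snd).continuousAt
    · exact (hperp.norm.add (by fun_prop)).continuousAt
    · simp only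
      rw [hden]; positivity
  have hpos : 0 < Φ 0 y₀ := by
    simp only [Φ]
    rw [hden, hy00, hp0]
    have : 2 * e * y₁ / (2 * e) = y₁ := by field_simp
    rw [this]
    exact mul_pos (neg_pos.2 hneg) hG1
  obtain ⟨c, μ₀, hc, hμ₀, hb⟩ := exists_lower_bound (ν := (volume : Measure R3)) hcont hpos
    (fun μ hμ y => by rw [hΦ μ hμ]; exact hnn _ (by positivity) _)
    (fun μ hμ => by
      rw [hΦ μ hμ]
      refine Continuous.integrable_of_hasCompactSupport (Continuous.mul
        ((hdc.comp ?_).neg) (hG.comp (perpDil_contDiff μ).continuous)) ?_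
      · have := (perpDil_contDiff μ).continuous
        fun_prop
      · exact (hGc.comp_isClosedEmbedding (perpDil_isClosedEmbedding hμ.ne')).mul_left)
  refine ⟨c, μ₀, hc, hμ₀, fun μ hμ hμ' => ?_⟩
  have h1 := hb μ hμ hμ'
  have h2 := integral_perpDil (fun k => ((-deriv evenBump ((‖k‖ - σ * k 1) / μ ^ 2) * G k : ℝ) : ℂ)) hμ
  rw [integral_complex_ofReal, integral_complex_ofReal, ← Complex.ofReal_inv, ← Complex.ofReal_mul,
    Complex.ofReal_inj] at h2
  rw [hΦ μ hμ, h2, inv_mul_eq_div, le_div_iff₀ (by positivity)] at h1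
  exact h1

/-- The conclusion of `exists_insensitive`. -/
def InsensitiveOn (u : Dist punctured4) (ξ : R4) (U : Set R4) : Prop :=
  ∀ θ : 𝓓(punctured4, ℂ), tsupport θ ⊆ U → ∀ h : ℝ → ℂ, ContDiff ℝ ∞ h → HasCompactSupport h →
    ∀ M : ℕ, ∃ C δ₀ : ℝ, 0 < δ₀ ∧ ∀ δ : ℝ, 0 < δ → δ < δ₀ → ∀ f : 𝓓(punctured4, ℂ),
      (∀ x, f x = iteratedDeriv M h (inner ℝ ξ x / δ) * θ x) → ‖u f‖ ≤ C * δ ^ (M + 1)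

/-- A test function near a point of `N` on the cone: on the mass shell it is `w G`, and it does not
depend on `k₀` near the mass shell. -/
theorem exists_shell_test {σ e : ℝ} (hσ : σ ^ 2 = 1) (he : 0 < e) {U : Set R4} (hU : IsOpen U)
    (hx : lightPt σ e ∈ U) {w : R3 → ℂ} (hw : ContDiffOn ℝ ∞ w punctured3) :
    ∃ G : R3 → ℝ, Continuous G ∧ HasCompactSupport G ∧ (∀ k, 0 ≤ G k) ∧
      (∀ k, G k ≠ 0 → 0 < σ * k 1) ∧ 0 < G (axisPoint (σ * e)) ∧
      ∃ θ : 𝓓(punctured4, ℂ), tsupport θ ⊆ U ∧ ∀ k, ∀ᶠ t in 𝓝 (0 : ℝ),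
        θ (shellPt 0 k + t • timeDir) = w k * G k := by
  obtain ⟨ρ, hρ, hball⟩ := Metric.nhds_basis_closedBall.mem_iff.1 (hU.mem_nhds hx)
  -- With `r ≤ ρ/3` the support has radius at most `√(4r² + r²) ≤ ρ`; with `r ≤ e/2` it stays at
  -- `σk₂ > 0`. The bump in `k₀` has inner radius `r`, so it is one near `‖k‖` wherever `g` is
  -- nonzero.
  let r := min (ρ / 3) (e / 2)
  have hr : 0 < r := by positivity
  have hrρ : r ≤ ρ / 3 := min_le_left _ _
  have hre : r ≤ e / 2 := min_le_right _ _
  have hσa : |σ| = 1 := by rw [← Real.sqrt_sq_eq_abs, hσ, Real.sqrt_one]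
  let b : ContDiffBump e := ⟨r, 2 * r, hr, by linarith⟩
  let g : ContDiffBump (axisPoint (σ * e)) := ⟨r / 2, r, by positivity, by linarith⟩
  have hgs : ∀ k, g k ≠ 0 → ‖k - axisPoint (σ * e)‖ < r := fun k hk => by
    have : k ∈ Function.support g := hk
    rw [g.support_eq, Metric.mem_ball, dist_eq_norm] at this
    exact this
  have hgσ : ∀ k, ‖k - axisPoint (σ * e)‖ ≤ r → 0 < σ * k 1 := fun k hk => by
    have h2 : |k 1 - σ * e| ≤ ‖k - axisPoint (σ * e)‖ := by
      have := PiLp.norm_apply_le (k - axisPoint (σ * e)) 1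
      rwa [PiLp.sub_apply, axisPoint_one, Real.norm_eq_abs] at this
    have h3 : |σ * k 1 - e| ≤ r := by
      have : σ * k 1 - e = σ * (k 1 - σ * e) := by linear_combination e * hσ
      rw [this, abs_mul, hσa, one_mul]; linarith
    have := (abs_le.1 h3).1
    linarith
  have hgb : ∀ k, ‖k - axisPoint (σ * e)‖ < r → |‖k‖ - e| < r := fun k hk => by
    have h1 := abs_norm_sub_norm_le k (axisPoint (σ * e))
    rw [norm_axisPoint, abs_mul, hσa, one_mul, abs_of_pos he] at h1
    linarith
  have hcl : ∀ k ∈ tsupport g, ‖k - axisPoint (σ * e)‖ ≤ r := fun k hk => by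
    rw [g.tsupport_eq, Metric.mem_closedBall, dist_eq_norm] at hk
    exact hk
  let gt : 𝓓(punctured3, ℂ) := mkTest (fun k => (g k : ℂ)) (contDiff_ofReal_comp g.contDiff)
    (tsupport g) g.hasCompactSupport (fun k hk => by
      rw [SetLike.mem_coe, mem_punctured3]
      rintro rfl
      have := hgσ 0 (hcl 0 hk)
      simp at this) fun k hk => by rw [image_eq_zero_of_notMem_tsupport hk]; simp
  have hgt : ∀ k, gt k = (g k : ℂ) := fun _ => rfl
  let θ := liftTest (fun t => (b t : ℂ)) (contDiff_ofReal_comp b.contDiff)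
    (b.hasCompactSupport.comp_left (g := fun x : ℝ => (x : ℂ)) (by simp)) (mulCLM hw gt)
  have hθ : ∀ k, θ k = (b (k 0) : ℂ) * (w !₂[k 1, k 2, k 3] * (g !₂[k 1, k 2, k 3] : ℂ)) := fun k => by
    simp only [θ, liftTest_apply, mulCLM_apply, hgt]
  refine ⟨g, g.continuous, g.hasCompactSupport, fun k => g.nonneg, fun k hk => hgσ k (hgs k hk).le, ?_,
    θ, ?_, fun k => ?_⟩
  · rw [g.one_of_mem_closedBall (Metric.mem_closedBall_self (by positivity))]; norm_num
  · refine (closure_minimal (fun k hk => ?_) Metric.isClosed_closedBall).trans hball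
    have hk' : θ k ≠ 0 := hk
    rw [hθ] at hk'
    have h1 : b (k 0) ≠ 0 := fun h => hk' (by simp [h])
    have h2 : g !₂[k 1, k 2, k 3] ≠ 0 := fun h => hk' (by simp [h])
    have h3 : |k 0 - e| < 2 * r := by
      have : k 0 ∈ Function.support b := h1
      rw [b.support_eq, Metric.mem_ball, Real.dist_eq] at this
      exact this
    have h4 := hgs _ h2
    have h5 := norm_sq_R3 (!₂[k 1, k 2, k 3] - axisPoint (σ * e))
    have h6 := norm_sq_R4 (k - lightPt σ e)
    simp [axisPoint, lightPt] at h5 h6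
    rw [mem_closedBall_iff_norm]
    refine abs_le_of_sq_le_sq' ?_ hρ.le |>.2
    rw [abs_lt] at h3
    have h7 := norm_nonneg (!₂[k 1, k 2, k 3] - axisPoint (σ * e))
    have h8 : ‖!₂[k 1, k 2, k 3] - axisPoint (σ * e)‖ ^ 2 ≤ r ^ 2 := by
      have := h4.le
      gcongr
    have h9 : (k 0 - e) ^ 2 ≤ (2 * r) ^ 2 := sq_le_sq' (by linarith) (by linarith)
    have h10 : r ^ 2 ≤ (ρ / 3) ^ 2 := by gcongr
    simp [axisPoint] at h8
    change ‖k - !₂[e, 0, σ * e, 0]‖ ^ 2 ≤ ρ ^ 2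
    rw [h6]
    nlinarith
  · have hpt : ∀ t : ℝ, θ (shellPt 0 k + t • timeDir) = (b (‖k‖ + t) : ℂ) * (w k * (g k : ℂ)) :=
      fun t => by
        have h1 : (!₂[(shellPt 0 k + t • timeDir) 1, (shellPt 0 k + t • timeDir) 2,
            (shellPt 0 k + t • timeDir) 3] : R3) = k := by
          ext i; fin_cases i <;> simp [shellPt, timeDir]
        rw [hθ, h1]
        simp [shellPt, timeDir, energy_zero]
    by_cases hk : g k = 0
    · exact Eventually.of_forall fun t => by rw [hpt, hk]; simp
    · have h1 := hgb k (hgs k hk)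
      have h2 : ∀ᶠ t in 𝓝 (0 : ℝ), |‖k‖ + t - e| < r := by
        have hc : Continuous fun t : ℝ => |‖k‖ + t - e| := by fun_prop
        exact hc.continuousAt.eventually_lt continuousAt_const (by simpa using h1)
      filter_upwards [h2] with t ht
      rw [hpt, b.one_of_mem_closedBall]
      · simp
      · rw [Metric.mem_closedBall, Real.dist_eq]; exact ht.le

theorem contDiff_oscillation {h : ℝ → ℂ} (hh : ContDiff ℝ ∞ h) (M : ℕ) (ξ : R4) (δ : ℝ) :
    ContDiff ℝ ∞ fun k : R4 => iteratedDeriv M h (inner ℝ ξ k / δ) :=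
  (contDiff_iteratedDeriv hh M).comp ((contDiff_const.inner ℝ contDiff_id).div_const δ)

theorem inner_nullDir_shellPt (σ : ℝ) (k : R3) (t : ℝ) :
    inner ℝ (nullDir σ) (shellPt 0 k + t • timeDir) = ‖k‖ - σ * k 1 + t := by
  rw [inner_nullDir]
  simp [shellPt, timeDir, energy_zero]
  ring

/-- With `M = 1` and the weight `2‖k‖` cancelling `1/(2‖k‖)`, the value is exactly the integral
bounded below by `cδ`, whereas insensitivity would give `O(δ²)`. -/
theorem not_insensitiveOn_shellDelta {σ e : ℝ} (hσ : σ ^ 2 = 1) (he : 0 < e) {U : Set R4}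
    (hU : IsOpen U) (hx : lightPt σ e ∈ U) : ¬ InsensitiveOn shellDelta (nullDir σ) U := fun hins => by
  have hw : ContDiffOn ℝ ∞ (fun k : R3 => ((2 * ‖k‖ : ℝ) : ℂ)) punctured3 := fun k hk =>
    (Complex.ofRealCLM.contDiff.contDiffAt.comp k
      (contDiffAt_const.mul (contDiffAt_norm ℝ hk))).contDiffWithinAt
  obtain ⟨G, hG, hGc, hG0, hGs, hG1, θ, hθU, hθ⟩ := exists_shell_test hσ he hU hx hw
  obtain ⟨hJ0, hJi, c, μ₀, hc, hμ₀, hJ⟩ := exists_shell_lower_bound hσ he hG hGc hG0 hGs hG1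
  let h : ℝ → ℂ := fun y => (evenBump y : ℂ)
  have hh : ContDiff ℝ ∞ h := contDiff_ofReal_comp contDiff_evenBump
  obtain ⟨C, δ₀, hδ₀, hb⟩ := hins θ hθU h hh
    (hasCompactSupport_evenBump.comp_left (g := fun x : ℝ => (x : ℂ)) (by simp)) 1
  refine not_forall_le_pow (a := 1) (C := C) (μ₁ := min μ₀ √δ₀) hc (by positivity) fun μ hμ hμ' => ?_
  have hμδ : μ ^ 2 < δ₀ := (Real.lt_sqrt hμ.le).1 (hμ'.trans_le (min_le_right _ _))
  have h1 := hb (μ ^ 2) (by positivity) hμδ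
    (mulCLM (contDiff_oscillation hh 1 (nullDir σ) (μ ^ 2)).contDiffOn θ) fun x => mulCLM_apply _ _ _
  refine le_trans ?_ h1
  have h2 : shellDelta (mulCLM (contDiff_oscillation hh 1 (nullDir σ) (μ ^ 2)).contDiffOn θ) =
      ((-∫ k, -deriv evenBump ((‖k‖ - σ * k 1) / μ ^ 2) * G k : ℝ) : ℂ) := by
    rw [shellDelta_apply, ← integral_neg, ← integral_complex_ofReal]
    refine integral_congr_ae (Eventually.of_forall fun k => ?_)
    have h3 := (hθ k).self_of_nhds
    have h4 := inner_nullDir_shellPt σ k 0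
    rw [zero_smul, add_zero] at h3 h4
    simp only
    rw [onShell_eq, mulCLM_apply, h3, h4, energy_zero, iteratedDeriv_one,
      deriv_ofReal_comp contDiff_evenBump, add_zero]
    by_cases hk : G k = 0
    · simp [hk]
    · have hk0 : (‖k‖ : ℂ) ≠ 0 := by
        have : k ≠ 0 := by rintro rfl; simpa using hGs 0 hk
        exact_mod_cast norm_ne_zero_iff.2 this
      push_cast
      field_simp
  rw [h2, Complex.norm_real, norm_neg, pow_one]
  exact (hJ μ hμ (hμ'.trans_le (min_le_left _ _))).trans (le_abs_self _)

/-- Here `M = 0` suffices: the energy derivative itself hits the oscillation and produces `δ⁻¹`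
times the previous integral, which stays bounded below. The other term has the same sign, so it can
be dropped. -/
theorem not_insensitiveOn_shellDeltaPrime {σ e : ℝ} (hσ : σ ^ 2 = 1) (he : 0 < e) {U : Set R4}
    (hU : IsOpen U) (hx : lightPt σ e ∈ U) :
    ¬ InsensitiveOn shellDeltaPrime (nullDir σ) U := fun hins => by
  have hw : ContDiffOn ℝ ∞ (fun k : R3 => ((4 * ‖k‖ ^ 2 : ℝ) : ℂ)) punctured3 :=
    (contDiff_ofReal_comp (contDiff_const.mul (contDiff_norm_sq ℝ))).contDiffOn
  obtain ⟨G, hG, hGc, hG0, hGs, hG1, θ, hθU, hθ⟩ := exists_shell_test hσ he hU hx hw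
  obtain ⟨hJ0, hJi, c, μ₀, hc, hμ₀, hJ⟩ := exists_shell_lower_bound hσ he hG hGc hG0 hGs hG1
  let h : ℝ → ℂ := fun y => (evenBump y : ℂ)
  have hh : ContDiff ℝ ∞ h := contDiff_ofReal_comp contDiff_evenBump
  obtain ⟨C, δ₀, hδ₀, hb⟩ := hins θ hθU h hh
    (hasCompactSupport_evenBump.comp_left (g := fun x : ℝ => (x : ℂ)) (by simp)) 0
  refine not_forall_le_pow (a := 0) (C := C) (μ₁ := min μ₀ √δ₀) hc (by positivity) fun μ hμ hμ' => ?_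
  have hμδ : μ ^ 2 < δ₀ := (Real.lt_sqrt hμ.le).1 (hμ'.trans_le (min_le_right _ _))
  have hμ2 : 0 < μ ^ 2 := by positivity
  let f := mulCLM (contDiff_oscillation hh 0 (nullDir σ) (μ ^ 2)).contDiffOn θ
  have h1 := hb (μ ^ 2) hμ2 hμδ f fun x => mulCLM_apply _ _ _
  refine le_trans ?_ h1
  let R : R3 → ℝ := fun k => -deriv evenBump ((‖k‖ - σ * k 1) / μ ^ 2) * G k * (μ ^ 2)⁻¹ +
    evenBump ((‖k‖ - σ * k 1) / μ ^ 2) * G k / ‖k‖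
  have hR : ∀ k, -onShellDeriv f 0 k = (R k : ℂ) := fun k => by
    have hval : ∀ᶠ t in 𝓝 (0 : ℝ), f (shellPt 0 k + t • timeDir) =
        (evenBump ((‖k‖ - σ * k 1 + t) / μ ^ 2) : ℂ) * (((4 * ‖k‖ ^ 2 : ℝ) : ℂ) * G k) := by
      filter_upwards [hθ k] with t ht
      rw [mulCLM_apply, ht, inner_nullDir_shellPt, iteratedDeriv_zero]
    have hd : DifferentiableAt ℝ f (shellPt 0 k) := f.contDiff.differentiable (by simp) _
    have h3 : HasDerivAt (fun t : ℝ => f (shellPt 0 k + t • timeDir))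
        (fderiv ℝ f (shellPt 0 k) timeDir) 0 := hd.hasFDerivAt.hasLineDerivAt timeDir
    have h4 : HasDerivAt (fun t : ℝ => (evenBump ((‖k‖ - σ * k 1 + t) / μ ^ 2) : ℂ) *
        (((4 * ‖k‖ ^ 2 : ℝ) : ℂ) * G k))
        (((deriv evenBump ((‖k‖ - σ * k 1) / μ ^ 2) * (1 / μ ^ 2) : ℝ) : ℂ) *
          (((4 * ‖k‖ ^ 2 : ℝ) : ℂ) * G k)) 0 := by
      refine HasDerivAt.mul_const (HasDerivAt.ofReal_comp ?_) _
      have h5 : HasDerivAt (fun t : ℝ => (‖k‖ - σ * k 1 + t) / μ ^ 2) (1 / μ ^ 2) 0 :=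
        ((hasDerivAt_id (0 : ℝ)).const_add _).div_const _
      have h6 : HasDerivAt evenBump (deriv evenBump ((‖k‖ - σ * k 1) / μ ^ 2))
          ((‖k‖ - σ * k 1) / μ ^ 2) := (contDiff_evenBump.differentiable (by simp) _).hasDerivAt
      exact h6.comp_of_eq 0 h5 (by simp)
    have h5 := h3.unique (h4.congr_of_eventuallyEq hval)
    have h6 := hval.self_of_nhds
    rw [zero_smul, add_zero, add_zero] at h6
    rw [onShellDeriv, h5, h6, energy_zero]
    by_cases hk : G k = 0
    · simp [hk, R]
    · have hk0 : (‖k‖ : ℂ) ≠ 0 := by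
        have : k ≠ 0 := by rintro rfl; simpa using hGs 0 hk
        exact_mod_cast norm_ne_zero_iff.2 this
      have hμc : (μ : ℂ) ≠ 0 := by exact_mod_cast hμ.ne'
      simp only [R]
      push_cast
      field_simp
      ring
  have hRi : Integrable R := by
    have h3 := integrable_mul_test (locallyIntegrableOn_one punctured3) (shell₁ shellPair_punctured f)
    simp only [one_mul, shell₁_apply, hR] at h3
    exact h3.re
  have h2 : shellDeltaPrime f = ((∫ k, R k : ℝ) : ℂ) := by
    rw [shellDeltaPrime_apply, ← integral_complex_ofReal]
    exact integral_congr_ae (Eventually.of_forall hR)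
  rw [h2, Complex.norm_real, pow_zero, mul_one]
  refine le_trans ?_ (le_abs_self _)
  have h3 := hJ μ hμ (hμ'.trans_le (min_le_left _ _))
  have h4 : ∫ k, -deriv evenBump ((‖k‖ - σ * k 1) / μ ^ 2) * G k * (μ ^ 2)⁻¹ ≤ ∫ k, R k := by
    refine integral_mono ((hJi _).mul_const _) hRi fun k => ?_
    have h5 : 0 ≤ evenBump ((‖k‖ - σ * k 1) / μ ^ 2) := Real.smoothTransition.nonneg _
    have h6 := hG0 k
    simp only [R]
    have : 0 ≤ evenBump ((‖k‖ - σ * k 1) / μ ^ 2) * G k / ‖k‖ := by positivity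
    linarith
  rw [integral_mul_const] at h4
  refine le_trans ?_ h4
  rw [← div_eq_mul_inv, le_div_iff₀ hμ2]
  exact h3

theorem lightPt_mem {σ e : ℝ} (he : 0 < e) : lightPt σ e ∈ punctured4 := by
  rw [mem_punctured4]
  intro h
  have := congrArg (fun v : R4 => v 0) h
  simp [lightPt] at this
  exact he.ne' this

/-- Over the points of `N` on the forward cone the wave front sets of `θ(k₀) δ(k²)` and
`θ(k₀) δ'(k²)` contain both normal directions of the cone. -/
theorem mem_waveFrontSet_shell {D : Dist punctured4} (hD : D = shellDelta ∨ D = shellDeltaPrime)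
    {σ e : ℝ} (hσ : σ ^ 2 = 1) (he : 0 < e) :
    (lightPt σ e, nullDir σ) ∈ waveFrontSet D ∧ (lightPt σ e, -nullDir σ) ∈ waveFrontSet D := by
  have hconj : ∀ f, D (conjTest f) = starRingEnd ℂ (D f) := by
    rcases hD with rfl | rfl
    · exact shellDelta_conj
    · exact shellDeltaPrime_conj
  -- Regularity in both directions is contradictory, and by reality of `D` regularity in one implies
  -- it in the other; hence both covectors are singular.
  have key : ∀ φ₁ φ₂ : 𝓓(punctured4, ℂ), φ₁ (lightPt σ e) ≠ 0 → φ₂ (lightPt σ e) ≠ 0 →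
      RapidNear D φ₁ (nullDir σ) → RapidNear D φ₂ (-nullDir σ) → False := fun φ₁ φ₂ h1 h2 h3 h4 => by
    obtain ⟨U, hU, hx, hins⟩ := exists_insensitive (nullDir_ne_zero σ) h1 h2 h3 h4
    rcases hD with rfl | rfl
    · exact not_insensitiveOn_shellDelta hσ he hU hx hins
    · exact not_insensitiveOn_shellDeltaPrime hσ he hU hx hins
  constructor
  · by_contra h
    obtain ⟨φ, hφ, hr⟩ := exists_rapidNear (lightPt_mem he) (nullDir_ne_zero σ) h
    exact key φ (conjTest φ) hφ (by simpa using hφ) hr (hr.conj hconj)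
  · by_contra h
    obtain ⟨φ, hφ, hr⟩ := exists_rapidNear (lightPt_mem he) (neg_ne_zero.2 (nullDir_ne_zero σ)) h
    have := hr.conj hconj
    rw [neg_neg] at this
    exact key (conjTest φ) φ (by simpa using hφ) hφ this hr

/-! ### Singularities of `K(-(kΘ₀)²)` at `N` -/

/-- After one differentiation the logarithm and the inverse powers have the same form, the logarithm
being the case `n = 0`, so they can be treated together. -/
theorem IsKernel.exists_hasDerivAt {K : ℂ → ℂ} (hK : IsKernel K) : ∃ (n : ℕ) (c : ℂ), c ≠ 0 ∧
    ∀ x : ℝ, 0 < x → HasDerivAt (fun x : ℝ => K x) (c * ((x : ℂ) ^ (n + 1))⁻¹) x := by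
  rcases hK with rfl | ⟨n, hn, rfl⟩
  · refine ⟨0, 1, one_ne_zero, fun x hx => ?_⟩
    have h := (Complex.hasDerivAt_log (Complex.ofReal_mem_slitPlane.2 hx)).comp_ofReal
    simpa [logKernel] using h
  · refine ⟨n, -n, neg_ne_zero.2 (Nat.cast_ne_zero.2 (by lia)), fun x hx => ?_⟩
    have hx' : (x : ℂ) ≠ 0 := by exact_mod_cast hx.ne'
    have h := ((hasDerivAt_pow n (x : ℂ)).inv (pow_ne_zero n hx')).comp_ofReal
    refine h.congr_deriv ?_
    obtain ⟨m, rfl⟩ : ∃ m, n = m + 1 := ⟨n - 1, by lia⟩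
    simp only [Nat.add_sub_cancel]
    field_simp
    ring

/-- The coordinate `k₀ + σk₂` along the cone. -/
def nullCoord (σ : ℝ) (k : R4) : ℝ := k 0 + σ * k 2

theorem contDiff_nullCoord (σ : ℝ) : ContDiff ℝ ∞ (nullCoord σ) := by
  unfold nullCoord; fun_prop

theorem negKThetaSq_eq_null {σ : ℝ} (hσ : σ ^ 2 = 1) (lam : ℝ) (k : R4) : negKThetaSq lam k =
    lam ^ 4 * ((k 0 - σ * k 2) * nullCoord σ k + k 1 ^ 2 + k 3 ^ 2) := by
  rw [negKThetaSq_eq, nullCoord]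
  linear_combination lam ^ 4 * k 2 ^ 2 * hσ

theorem norm_sub_lightPt {σ : ℝ} (hσ : σ ^ 2 = 1) (e : ℝ) (k : R4) : ‖k - lightPt σ e‖ ^ 2 =
    ((k 0 - σ * k 2) ^ 2 + (nullCoord σ k - 2 * e) ^ 2) / 2 + k 1 ^ 2 + k 3 ^ 2 := by
  rw [norm_sq_R4]
  simp [lightPt, nullCoord]
  linear_combination (e ^ 2 - k 2 ^ 2) * hσ

/-- A cutoff equal to one for `t ≤ r` and to zero for `t ≥ 2r`. -/
def stepCut (r t : ℝ) : ℝ := Real.smoothTransition (2 - t / r)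

theorem contDiff_stepCut (r : ℝ) : ContDiff ℝ ∞ (stepCut r) :=
  Real.smoothTransition.contDiff.comp (by fun_prop)

theorem stepCut_nonneg (r t : ℝ) : 0 ≤ stepCut r t := Real.smoothTransition.nonneg _

theorem stepCut_eq_one {r t : ℝ} (hr : 0 < r) (ht : t ≤ r) : stepCut r t = 1 :=
  Real.smoothTransition.one_of_one_le (by have := (div_le_one hr).2 ht; linarith)

theorem lt_of_stepCut_ne_zero {r t : ℝ} (hr : 0 < r) (h : stepCut r t ≠ 0) : t < 2 * r := by
  by_contra ht
  push Not at ht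
  refine h (Real.smoothTransition.zero_of_nonpos ?_)
  have := (le_div_iff₀ hr).2 ht
  linarith

/-- A cutoff to a neighbourhood of `lightPt σ e` that does not depend on `k₀ - σk₂`. -/
def tubeCut (σ e r : ℝ) (k : R4) : ℝ :=
  stepCut r ((nullCoord σ k - 2 * e) ^ 2 + k 1 ^ 2 + k 3 ^ 2)

theorem contDiff_tubeCut (σ e r : ℝ) : ContDiff ℝ ∞ (tubeCut σ e r) := by
  have := contDiff_nullCoord σ
  exact (contDiff_stepCut r).comp (by fun_prop)

/-- The closed neighbourhood `(k₀ - σk₂)² ≤ 2r`, `(k₀ + σk₂ - 2e)² + k₁² + k₃² ≤ 2r`. -/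
def tube (σ e r : ℝ) : Set R4 :=
  {k | (k 0 - σ * k 2) ^ 2 ≤ 2 * r ∧ (nullCoord σ k - 2 * e) ^ 2 + k 1 ^ 2 + k 3 ^ 2 ≤ 2 * r}

theorem isClosed_tube (σ e r : ℝ) : IsClosed (tube σ e r) := by
  have h := (contDiff_nullCoord σ).continuous
  have h1 : IsClosed {k : R4 | (k 0 - σ * k 2) ^ 2 ≤ 2 * r} :=
    isClosed_le (by fun_prop) continuous_const
  have h2 : IsClosed {k : R4 | (nullCoord σ k - 2 * e) ^ 2 + k 1 ^ 2 + k 3 ^ 2 ≤ 2 * r} :=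
    isClosed_le (by fun_prop) continuous_const
  exact h1.inter h2

theorem tube_subset {σ e r ρ : ℝ} (hσ : σ ^ 2 = 1) (hρ : 0 < ρ) (hr : 4 * r ≤ ρ ^ 2) :
    tube σ e r ⊆ Metric.closedBall (lightPt σ e) ρ := fun k hk => by
  rw [mem_closedBall_iff_norm]
  refine (abs_le_of_sq_le_sq' ?_ hρ.le).2
  rw [norm_sub_lightPt hσ]
  have h1 := hk.1
  have h2 := hk.2
  nlinarith [sq_nonneg (k 1), sq_nonneg (k 3), sq_nonneg (k 0 - σ * k 2),
    sq_nonneg (nullCoord σ k - 2 * e)]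

theorem isCompact_tube {σ : ℝ} (hσ : σ ^ 2 = 1) (e r : ℝ) : IsCompact (tube σ e r) :=
  (isCompact_closedBall (lightPt σ e) (|4 * r| + 1)).of_isClosed_subset (isClosed_tube σ e r)
    (tube_subset hσ (by positivity) (by nlinarith [abs_nonneg (4 * r), le_abs_self (4 * r)]))

theorem nullCoord_pos {σ e r : ℝ} (he : 0 < e) (hr : 4 * r ≤ e ^ 2) {k : R4}
    (hk : (nullCoord σ k - 2 * e) ^ 2 + k 1 ^ 2 + k 3 ^ 2 ≤ 2 * r) : 0 < nullCoord σ k := by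
  by_contra h
  push Not at h
  nlinarith [sq_nonneg (k 1), sq_nonneg (k 3)]

/-- A bump supported in `[1, 2]`. -/
def midBump : ContDiffBump (3 / 2 : ℝ) := ⟨1 / 4, 1 / 2, by norm_num, by norm_num⟩

theorem contDiff_midBump : ContDiff ℝ ∞ fun y => (midBump y : ℂ) :=
  contDiff_ofReal_comp midBump.contDiff

theorem hasCompactSupport_midBump : HasCompactSupport fun y => (midBump y : ℂ) :=
  midBump.hasCompactSupport.comp_left (g := fun x : ℝ => (x : ℂ)) (by simp)

theorem midBump_support (j : ℕ) {y : ℝ} (hy : iteratedDeriv j (fun y => (midBump y : ℂ)) y ≠ 0) :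
    1 ≤ y ∧ y ≤ 2 := by
  have h1 : ∀ j, Function.support (iteratedDeriv j fun y => (midBump y : ℂ)) ⊆ Set.Icc 1 2 := by
    intro j
    induction j with
    | zero =>
      intro y hy
      have h2 : y ∈ Function.support midBump := fun h => hy (by simp [h])
      rw [midBump.support_eq, Metric.mem_ball, Real.dist_eq, abs_lt] at h2
      simp only [midBump] at h2
      constructor <;> linarith [h2.1, h2.2]
    | succ j ih =>
      rw [iteratedDeriv_succ]
      exact (support_deriv_subset).trans (closure_minimal ih isClosed_Icc)
  exact h1 j hy

/-- The half of momentum space on which `-(kΘ₀)²` is positive. -/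
def posSet (lam : ℝ) : Opens R4 :=
  ⟨{k | 0 < negKThetaSq lam k}, isOpen_lt (f := fun _ => (0 : ℝ)) (g := negKThetaSq lam)
    continuous_const (contDiff_negKThetaSq lam).continuous⟩

theorem negKThetaSq_pos {lam σ e r δ : ℝ} (hlam : 0 < lam) (hσ : σ ^ 2 = 1) (he : 0 < e)
    (hr : 4 * r ≤ e ^ 2) (hδ : 0 < δ) {k : R4} (hk : k ∈ tube σ e r) (hu : δ ≤ k 0 - σ * k 2) :
    0 < negKThetaSq lam k := by
  rw [negKThetaSq_eq_null hσ]
  have h1 := nullCoord_pos he hr hk.2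
  have h2 : 0 < k 0 - σ * k 2 := hδ.trans_le hu
  positivity

theorem oscillating_support {σ e r δ : ℝ} (hr : 0 < r) (hδ : 0 < δ) (hδr : 4 * δ ^ 2 ≤ r) (j : ℕ)
    {k : R4} (hk : iteratedDeriv j (fun y => (midBump y : ℂ)) ((k 0 - σ * k 2) / δ) *
      (tubeCut σ e r k : ℂ) ≠ 0) : k ∈ tube σ e r ∧ δ ≤ k 0 - σ * k 2 ∧ (k 0 - σ * k 2) ^ 2 ≤ r := by
  obtain ⟨h1, h2⟩ := midBump_support j (left_ne_zero_of_mul hk)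
  have h3 := lt_of_stepCut_ne_zero hr (Complex.ofReal_ne_zero.1 (right_ne_zero_of_mul hk))
  rw [le_div_iff₀ hδ, one_mul] at h1
  rw [div_le_iff₀ hδ] at h2
  have h4 : (k 0 - σ * k 2) ^ 2 ≤ r := by nlinarith
  exact ⟨⟨by linarith, h3.le⟩, h1, h4⟩

/-- Derivatives of the bump in `(k₀ - σk₂) / δ`, cut off near `lightPt σ e`. -/
def oscillating {lam σ e r δ : ℝ} (hlam : 0 < lam) (hσ : σ ^ 2 = 1) (he : 0 < e) (hr0 : 0 < r)
    (hr : 4 * r ≤ e ^ 2) (hδ : 0 < δ) (hδr : 4 * δ ^ 2 ≤ r) (j : ℕ) : 𝓓(posSet lam, ℂ) :=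
  mkTest (fun k => iteratedDeriv j (fun y => (midBump y : ℂ)) ((k 0 - σ * k 2) / δ) *
      (tubeCut σ e r k : ℂ))
    (ContDiff.mul ((contDiff_iteratedDeriv contDiff_midBump j).comp (by fun_prop))
      (contDiff_ofReal_comp (contDiff_tubeCut σ e r)))
    (tube σ e r ∩ {k | δ ≤ k 0 - σ * k 2})
    ((isCompact_tube hσ e r).inter_right (isClosed_le continuous_const (by fun_prop)))
    (fun _ hk => negKThetaSq_pos hlam hσ he hr hδ hk.1 hk.2)
    fun k hk => by
      by_contra h
      have := oscillating_support hr0 hδ hδr j h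
      exact hk ⟨this.1, this.2.1⟩

section

variable {lam σ e r δ : ℝ} (hlam : 0 < lam) (hσ : σ ^ 2 = 1) (he : 0 < e) (hr0 : 0 < r)
    (hr : 4 * r ≤ e ^ 2) (hδ : 0 < δ) (hδr : 4 * δ ^ 2 ≤ r)

theorem oscillating_apply (j : ℕ) (k : R4) : oscillating hlam hσ he hr0 hr hδ hδr j k =
    iteratedDeriv j (fun y => (midBump y : ℂ)) ((k 0 - σ * k 2) / δ) * (tubeCut σ e r k : ℂ) := rfl

/-- The direction along which `k₀ - σk₂` increases and `k₀ + σk₂` is constant. -/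
def riseDir (σ : ℝ) : R4 := !₂[1 / 2, 0, -σ / 2, 0]

theorem nullCoord_add_riseDir {σ : ℝ} (hσ : σ ^ 2 = 1) (k : R4) (t : ℝ) :
    nullCoord σ (k + t • riseDir σ) = nullCoord σ k := by
  simp [nullCoord, riseDir]
  linear_combination -(t / 2) * hσ

theorem sub_add_riseDir {σ : ℝ} (hσ : σ ^ 2 = 1) (k : R4) (t : ℝ) :
    (k + t • riseDir σ) 0 - σ * (k + t • riseDir σ) 2 = k 0 - σ * k 2 + t := by
  simp [riseDir]
  linear_combination (t / 2) * hσ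

/-- The direction `riseDir` changes `k₀ - σk₂` at unit speed and leaves the arguments of `tubeCut`
fixed, so only the oscillation is differentiated. -/
theorem lineDeriv_oscillating (j : ℕ) (k : R4) :
    (∂_{riseDir σ} (oscillating hlam hσ he hr0 hr hδ hδr j) : 𝓓(posSet lam, ℂ)) k =
      (δ : ℂ)⁻¹ * oscillating hlam hσ he hr0 hr hδ hδr (j + 1) k := by
  have h1 : HasDerivAt (fun t : ℝ => oscillating hlam hσ he hr0 hr hδ hδr j (k + t • riseDir σ))
      (fderiv ℝ (oscillating hlam hσ he hr0 hr hδ hδr j) k (riseDir σ)) 0 :=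
    ((oscillating hlam hσ he hr0 hr hδ hδr j).contDiff.differentiable
      (by simp) k).hasFDerivAt.hasLineDerivAt _
  have h2 : HasDerivAt (fun t : ℝ => iteratedDeriv j (fun y => (midBump y : ℂ))
      ((k 0 - σ * k 2 + t) / δ) * (tubeCut σ e r k : ℂ))
      (((1 / δ : ℝ) • deriv (iteratedDeriv j (fun y => (midBump y : ℂ))) ((k 0 - σ * k 2) / δ)) *
        (tubeCut σ e r k : ℂ)) 0 := by
    refine HasDerivAt.mul_const ?_ _
    have h3 : HasDerivAt (fun t : ℝ => (k 0 - σ * k 2 + t) / δ) (1 / δ) 0 :=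
      ((hasDerivAt_id (0 : ℝ)).const_add _).div_const _
    exact HasDerivAt.scomp_of_eq 0 ((contDiff_iteratedDeriv contDiff_midBump j).differentiable
      (by simp) _).hasDerivAt h3 (by simp)
  have h3 : (fun t : ℝ => oscillating hlam hσ he hr0 hr hδ hδr j (k + t • riseDir σ)) =
      fun t : ℝ => iteratedDeriv j (fun y => (midBump y : ℂ))
        ((k 0 - σ * k 2 + t) / δ) * (tubeCut σ e r k : ℂ) := by
    funext t
    have h4 : tubeCut σ e r (k + t • riseDir σ) = tubeCut σ e r k := by
      rw [tubeCut, nullCoord_add_riseDir hσ]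
      simp [riseDir, tubeCut]
    rw [oscillating_apply, sub_add_riseDir hσ, h4]
  rw [h3] at h1
  rw [lineDeriv_test, h1.unique h2, oscillating_apply, iteratedDeriv_succ, Complex.real_smul]
  push_cast
  ring

theorem hasDerivAt_negKThetaSq_riseDir {σ : ℝ} (hσ : σ ^ 2 = 1) (lam : ℝ) (k : R4) :
    HasDerivAt (fun t : ℝ => negKThetaSq lam (k + t • riseDir σ)) (lam ^ 4 * nullCoord σ k) 0 := by
  have h1 : (fun t : ℝ => negKThetaSq lam (k + t • riseDir σ)) = fun t =>
      negKThetaSq lam k + t * (lam ^ 4 * nullCoord σ k) := by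
    funext t
    rw [negKThetaSq_eq_null hσ, negKThetaSq_eq_null hσ, nullCoord_add_riseDir hσ, sub_add_riseDir hσ]
    simp [riseDir]
    ring
  rw [h1]
  simpa using ((hasDerivAt_id (0 : ℝ)).mul_const (lam ^ 4 * nullCoord σ k)).const_add
    (negKThetaSq lam k)

/-- Along `riseDir` the function `-(kΘ₀)²` is affine with slope `λ⁴` times `nullCoord`, which is
constant there. Two integrations by parts move both derivatives to the kernel and leave an integrand
of constant sign. One would not be enough for the logarithm: it yields order `δ²`, the same as the
bound to be contradicted. -/
theorem integral_kernel_oscillating {K : ℂ → ℂ} (hK : IsKernel K) {n : ℕ} {c : ℂ}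
    (hc : ∀ x : ℝ, 0 < x → HasDerivAt (fun x : ℝ => K x) (c * ((x : ℂ) ^ (n + 1))⁻¹) x) :
    ∫ k, K (negKThetaSq lam k : ℂ) * oscillating hlam hσ he hr0 hr hδ hδr 2 k =
      (δ : ℂ) ^ 2 * (-(n + 1) * c * (lam : ℂ) ^ 8) *
        ∫ k, ((nullCoord σ k ^ 2 * (negKThetaSq lam k ^ (n + 2))⁻¹ : ℝ) : ℂ) *
          oscillating hlam hσ he hr0 hr hδ hδr 0 k := by
  have hδc : (δ : ℂ) ≠ 0 := by exact_mod_cast hδ.ne'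
  have step : ∀ (g g' : R4 → ℂ), ContDiffOn ℝ ∞ g (posSet lam) →
      (∀ k ∈ posSet lam, HasLineDerivAt ℝ g (g' k) k (riseDir σ)) → ∀ j,
      ∫ k, g k * oscillating hlam hσ he hr0 hr hδ hδr (j + 1) k =
        -(δ : ℂ) * ∫ k, g' k * oscillating hlam hσ he hr0 hr hδ hδr j k := by
    intro g g' hg hg' j
    have h := integral_mul_lineDeriv hg (riseDir σ) hg' (oscillating hlam hσ he hr0 hr hδ hδr j)
    simp only [lineDeriv_oscillating, mul_left_comm _ (δ : ℂ)⁻¹] at h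
    rw [integral_const_mul, inv_mul_eq_iff_eq_mul₀ hδc] at h
    rw [h]; ring
  have hw : ContDiff ℝ ∞ fun k : R4 => (nullCoord σ k : ℂ) :=
    contDiff_ofReal_comp (contDiff_nullCoord σ)
  have hq : ContDiff ℝ ∞ fun k : R4 => (negKThetaSq lam k : ℂ) :=
    contDiff_ofReal_comp (contDiff_negKThetaSq lam)
  have hq0 : ∀ k ∈ posSet lam, (negKThetaSq lam k : ℂ) ≠ 0 := fun k hk => by
    exact_mod_cast (show 0 < negKThetaSq lam k from hk).ne'
  have h1 := step (fun k => K (negKThetaSq lam k : ℂ))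
    (fun k => c * ((negKThetaSq lam k : ℂ) ^ (n + 1))⁻¹ * (lam ^ 4 * nullCoord σ k : ℝ))
    (fun k hk => ((hK.contDiffAt_real hk).comp k
      (contDiff_negKThetaSq lam).contDiffAt).contDiffWithinAt)
    (fun k hk => by
      have h2 := (hc _ hk).scomp_of_eq (0 : ℝ) (hasDerivAt_negKThetaSq_riseDir hσ lam k) (by simp)
      refine HasDerivAt.congr_deriv h2 ?_
      rw [Complex.real_smul, mul_comm]) 1
  have h2 := step
    (fun k => c * ((negKThetaSq lam k : ℂ) ^ (n + 1))⁻¹ * (lam ^ 4 * nullCoord σ k : ℝ))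
    (fun k => -(n + 1) * c * (lam : ℂ) ^ 8 *
      ((nullCoord σ k ^ 2 * (negKThetaSq lam k ^ (n + 2))⁻¹ : ℝ) : ℂ))
    (ContDiffOn.mul (contDiffOn_const.mul ((hq.contDiffOn.pow _).inv fun k hk =>
        pow_ne_zero _ (hq0 k hk)))
      (contDiff_ofReal_comp (contDiff_const.mul (contDiff_nullCoord σ))).contDiffOn)
    (fun k hk => by
      have h3 : HasDerivAt (fun t : ℝ => (negKThetaSq lam (k + t • riseDir σ) : ℂ))
        ((lam ^ 4 * nullCoord σ k : ℝ) : ℂ) 0 := (hasDerivAt_negKThetaSq_riseDir hσ lam k).ofReal_comp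
      have h4 := ((((h3.pow (n + 1)).inv (by simpa using pow_ne_zero (n + 1) (hq0 k hk))).const_mul
        c).mul_const ((lam ^ 4 * nullCoord σ k : ℝ) : ℂ))
      have h5 : (fun t : ℝ => c * ((negKThetaSq lam (k + t • riseDir σ) : ℂ) ^ (n + 1))⁻¹ *
          ((lam ^ 4 * nullCoord σ (k + t • riseDir σ) : ℝ) : ℂ)) = fun t : ℝ =>
          c * ((negKThetaSq lam (k + t • riseDir σ) : ℂ) ^ (n + 1))⁻¹ *
          ((lam ^ 4 * nullCoord σ k : ℝ) : ℂ) := by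
        funext t; rw [nullCoord_add_riseDir hσ]
      change HasDerivAt (fun t : ℝ => c * ((negKThetaSq lam (k + t • riseDir σ) : ℂ) ^ (n + 1))⁻¹ *
          ((lam ^ 4 * nullCoord σ (k + t • riseDir σ) : ℝ) : ℂ)) _ 0
      rw [h5]
      refine HasDerivAt.congr_deriv h4 ?_
      have := hq0 k hk
      simp only [zero_smul, add_zero, Pi.pow_apply]
      push_cast
      field_simp
      simp
      ring) 0
  rw [h1, h2]
  simp only [mul_assoc (-((n : ℂ) + 1) * c * (lam : ℂ) ^ 8)]
  rw [integral_const_mul]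
  ring

end

/-- Coordinates adapted to the singularity at `lightPt σ e`. -/
def shear (σ μ : ℝ) (y : R4) : R4 := !₂[σ * y 2 + μ ^ 2 * y 0, μ * y 1, y 2, μ * y 3]

theorem continuous_shear (σ : ℝ) : Continuous fun p : ℝ × R4 => shear σ p.1 p.2 := by
  unfold shear
  refine (PiLp.continuous_toLp 2 _).comp (continuous_pi fun i => ?_)
  fin_cases i <;> simp <;> fun_prop

theorem map_shear (σ : ℝ) {μ : ℝ} (hμ : 0 < μ) : MeasurableEmbedding (shear σ μ) ∧
    Measure.map (shear σ μ) (volume : Measure R4) = ENNReal.ofReal (μ ^ 4)⁻¹ • volume := by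
  let A : R4 →ₗ[ℝ] R4 := Matrix.toLpLin 2 2
    !![μ ^ 2, 0, σ, 0; 0, μ, 0, 0; 0, 0, 1, 0; 0, 0, 0, μ]
  have hA : (⇑A : R4 → R4) = shear σ μ := by
    funext y; ext i; fin_cases i <;> simp [A, shear, Matrix.mulVec, dotProduct, Fin.sum_univ_four]; ring
  have hdet : LinearMap.det A = μ ^ 4 := by
    simp only [A]
    rw [Matrix.toLpLin_eq_toLin, LinearMap.det_toLin]
    simp [Matrix.det_succ_row_zero, Fin.sum_univ_succ, Fin.succAbove]
    ring
  have hne : LinearMap.det A ≠ 0 := by rw [hdet]; positivity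
  have hm := Measure.map_linearMap_addHaar_eq_smul_addHaar (volume : Measure R4) (f := A) hne
  rw [hdet, hA, abs_of_pos (by positivity)] at hm
  have he := (LinearEquiv.ofIsUnitDet (f := A) (v := PiLp.basisFun 2 ℝ (Fin 4))
    (v' := PiLp.basisFun 2 ℝ (Fin 4))
    (by rw [LinearMap.det_toMatrix]; exact hne.isUnit)).toContinuousLinearEquiv.toHomeomorph.measurableEmbedding
  refine ⟨?_, hm⟩
  rw [← hA]
  exact he

/-- In the sheared coordinates `k₀ - σk₂ = μ²y₀` and `k_⊥ = μy_⊥`, so `-(kΘ₀)²` acquires the factor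
`μ²` and the Jacobian is `μ⁴`. The integral is `μ^{-2n}` times one with positive limit, hence
bounded below for `μ ≤ 1`. -/
theorem exists_kernel_lower_bound {lam σ e r : ℝ} (hlam : 0 < lam) (hσ : σ ^ 2 = 1) (he : 0 < e)
    (hr0 : 0 < r) (hr : 4 * r ≤ e ^ 2) (n : ℕ) : ∃ c μ₀ : ℝ, 0 < c ∧ 0 < μ₀ ∧
      ∀ (μ : ℝ) (hμ : 0 < μ ^ 2) (hμr : 4 * (μ ^ 2) ^ 2 ≤ r), 0 < μ → μ < μ₀ →
        c ≤ ‖∫ k, ((nullCoord σ k ^ 2 * (negKThetaSq lam k ^ (n + 2))⁻¹ : ℝ) : ℂ) *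
          oscillating hlam hσ he hr0 hr hμ hμr 0 k‖ := by
  let I : ℝ → R4 → ℝ := fun δ k => nullCoord σ k ^ 2 * (negKThetaSq lam k ^ (n + 2))⁻¹ *
    (midBump ((k 0 - σ * k 2) / δ) * tubeCut σ e r k)
  -- The rescaled integrand with the powers of `μ` already cancelled, so that it is defined and
  -- continuous at `μ = 0` as well.
  let Φ : ℝ → R4 → ℝ := fun μ y => nullCoord σ (shear σ μ y) ^ 2 *
    ((lam ^ 4 * (y 0 * nullCoord σ (shear σ μ y) + y 1 ^ 2 + y 3 ^ 2)) ^ (n + 2))⁻¹ *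
    (midBump (y 0) * tubeCut σ e r (shear σ μ y))
  have hIosc : ∀ δ (hδ : 0 < δ) (hδr : 4 * δ ^ 2 ≤ r) k,
      ((nullCoord σ k ^ 2 * (negKThetaSq lam k ^ (n + 2))⁻¹ : ℝ) : ℂ) *
        oscillating hlam hσ he hr0 hr hδ hδr 0 k = (I δ k : ℂ) := fun δ hδ hδr k => by
    simp only [I]
    rw [oscillating_apply, iteratedDeriv_zero]
    push_cast
    ring
  have hInn : ∀ δ, 0 < δ → 4 * δ ^ 2 ≤ r → ∀ k, 0 ≤ I δ k := fun δ hδ hδr k => by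
    by_cases h : midBump ((k 0 - σ * k 2) / δ) * tubeCut σ e r k = 0
    · simp only [I, h, mul_zero, le_refl]
    · have h1 := oscillating_support (k := k) (σ := σ) (e := e) hr0 hδ hδr 0 (by
        rw [iteratedDeriv_zero]; exact_mod_cast h)
      have h2 := negKThetaSq_pos hlam hσ he hr hδ h1.1 h1.2.1
      have h3 : 0 ≤ midBump ((k 0 - σ * k 2) / δ) := midBump.nonneg
      have h4 : 0 ≤ tubeCut σ e r k := stepCut_nonneg _ _
      simp only [I]
      positivity
  have hIint : ∀ δ, 0 < δ → 4 * δ ^ 2 ≤ r → Integrable (I δ) := fun δ hδ hδr => by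
    have hc : ContinuousOn (fun k => ((nullCoord σ k ^ 2 * (negKThetaSq lam k ^ (n + 2))⁻¹ : ℝ) : ℂ))
        (posSet lam) :=
      Complex.continuous_ofReal.comp_continuousOn
        (((contDiff_nullCoord σ).continuous.pow 2).continuousOn.mul
          (((contDiff_negKThetaSq lam).continuous.pow (n + 2)).continuousOn.inv₀ fun k hk =>
            pow_ne_zero _ (show 0 < negKThetaSq lam k from hk).ne'))
    have h := integrable_mul_test (hc.locallyIntegrableOn (posSet lam).isOpen.measurableSet)
      (oscillating hlam hσ he hr0 hr hδ hδr 0)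
    simp only [hIosc] at h
    exact h.re
  have hΦ : ∀ μ, 0 < μ → ∀ y, Φ μ y = (μ ^ 2) ^ (n + 2) * I (μ ^ 2) (shear σ μ y) := fun μ hμ y => by
    have h1 : shear σ μ y 0 - σ * shear σ μ y 2 = μ ^ 2 * y 0 := by simp [shear]
    have h2 : negKThetaSq lam (shear σ μ y) =
        μ ^ 2 * (lam ^ 4 * (y 0 * nullCoord σ (shear σ μ y) + y 1 ^ 2 + y 3 ^ 2)) := by
      rw [negKThetaSq_eq_null hσ, h1]
      simp [shear]
      ring
    simp only [Φ, I]
    rw [h1, h2, mul_div_cancel_left₀ _ (by positivity : μ ^ 2 ≠ 0), mul_pow (μ ^ 2), mul_inv]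
    have h3 : (μ ^ 2) ^ (n + 2) * ((μ ^ 2) ^ (n + 2))⁻¹ = 1 := mul_inv_cancel₀ (by positivity)
    linear_combination (exp := 1) -(nullCoord σ (shear σ μ y) ^ 2 *
      ((lam ^ 4 * (y 0 * nullCoord σ (shear σ μ y) + y 1 ^ 2 + y 3 ^ 2)) ^ (n + 2))⁻¹ *
      (midBump (y 0) * tubeCut σ e r (shear σ μ y))) * h3
  let y₀ : R4 := !₂[3 / 2, 0, σ * e, 0]
  have hs0 : shear σ 0 y₀ = lightPt σ e := by
    ext i; fin_cases i <;> simp [shear, y₀, lightPt]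
    linear_combination e * hσ
  have hn0 : nullCoord σ (lightPt σ e) = 2 * e := by
    simp [nullCoord, lightPt]
    linear_combination e * hσ
  have hA0 : y₀ 0 * nullCoord σ (shear σ 0 y₀) + y₀ 1 ^ 2 + y₀ 3 ^ 2 = 3 * e := by
    rw [hs0, hn0]
    simp [y₀]
    ring
  have hm0 : midBump (y₀ 0) = 1 := by
    simp [y₀]
    exact midBump.one_of_mem_closedBall (Metric.mem_closedBall_self (by norm_num [midBump]))
  have ht0 : tubeCut σ e r (lightPt σ e) = 1 := by
    refine stepCut_eq_one hr0 ?_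
    rw [hn0]
    simp [lightPt, hr0.le]
  have hsh := continuous_shear σ
  have hnc := (contDiff_nullCoord σ).continuous.comp hsh
  have hcont : ContinuousAt (fun p : ℝ × R4 => Φ p.1 p.2) (0, y₀) := by
    refine ContinuousAt.mul (ContinuousAt.mul (hnc.pow 2).continuousAt (ContinuousAt.inv₀ ?_ ?_))
      (Continuous.continuousAt ?_)
    · refine Continuous.continuousAt (Continuous.pow (continuous_const.mul ?_) _)
      have h : Continuous fun p : ℝ × R4 => nullCoord σ (shear σ p.1 p.2) := hnc
      fun_prop
    · simp only
      rw [hA0]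
      positivity
    · exact (midBump.continuous.comp (by fun_prop)).mul ((contDiff_tubeCut σ e r).continuous.comp hsh)
  have hpos : 0 < Φ 0 y₀ := by
    simp only [Φ]
    rw [hA0, hs0, hn0, hm0, ht0]
    positivity
  obtain ⟨ρ, hρ, hρr⟩ : ∃ ρ : ℝ, 0 < ρ ∧ ∀ μ, 0 < μ → μ ≤ ρ → 4 * (μ ^ 2) ^ 2 ≤ r := by
    have h : Tendsto (fun μ : ℝ => 4 * (μ ^ 2) ^ 2) (𝓝[>] 0) (𝓝 0) := by
      have : Continuous fun μ : ℝ => 4 * (μ ^ 2) ^ 2 := by fun_prop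
      simpa using (this.tendsto 0).mono_left nhdsWithin_le_nhds
    obtain ⟨ρ, hρ, h1⟩ := mem_nhdsGT_iff_exists_Ioc_subset.1 (h.eventually_le_const hr0)
    exact ⟨ρ, hρ, fun μ h2 h3 => h1 ⟨h2, h3⟩⟩
  -- Positivity and integrability are available only for small `μ`, while `exists_lower_bound` asks
  -- for all; freezing the family beyond `ρ` does not affect its behaviour near `0`.
  have hΦext : ∀ μ, 0 < μ → Φ (min μ ρ) = fun y =>
      ((min μ ρ) ^ 2) ^ (n + 2) * I ((min μ ρ) ^ 2) (shear σ (min μ ρ) y) := fun μ hμ =>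
    funext (hΦ _ (lt_min hμ hρ))
  have hcont' : ContinuousAt (fun p : ℝ × R4 => Φ (min p.1 ρ) p.2) (0, y₀) := by
    refine ContinuousAt.comp_of_eq hcont (f := fun p : ℝ × R4 => (min p.1 ρ, p.2)) (by fun_prop) ?_
    simp [hρ.le]
  obtain ⟨c, μ₀, hc, hμ₀, hb⟩ := exists_lower_bound (ν := (volume : Measure R4))
    (Φ := fun μ => Φ (min μ ρ)) hcont' (by simpa [hρ.le] using hpos)
    (fun μ hμ y => by
      have h := lt_min hμ hρ
      simp only [hΦ _ h]
      exact mul_nonneg (by positivity) (hInn _ (by positivity) (hρr _ h (min_le_right _ _)) _))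
    (fun μ hμ => by
      have h := lt_min hμ hρ
      rw [hΦext μ hμ]
      refine Integrable.const_mul ?_ _
      obtain ⟨h1, h2⟩ := map_shear σ h
      refine (h1.integrable_map_iff (g := I (min μ ρ ^ 2))).1 ?_
      rw [h2]
      exact (hIint _ (by positivity) (hρr _ h (min_le_right _ _))).smul_measure ENNReal.ofReal_ne_top)
  refine ⟨c, min (min μ₀ ρ) 1, hc, by positivity, fun μ hμ2 hμr hμ hμ' => ?_⟩
  have hμρ : min μ ρ = μ := min_eq_left (hμ'.le.trans ((min_le_left _ _).trans (min_le_right _ _)))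
  have hμ1 : μ ≤ 1 := hμ'.le.trans (min_le_right _ _)
  have h1 := hb μ hμ (hμ'.trans_le ((min_le_left _ _).trans (min_le_left _ _)))
  rw [hΦext μ hμ, hμρ, integral_const_mul] at h1
  obtain ⟨h2, h3⟩ := map_shear σ hμ
  rw [← h2.integral_map (g := I (μ ^ 2)), h3, integral_smul_measure,
    ENNReal.toReal_ofReal (by positivity), smul_eq_mul, ← mul_assoc] at h1
  simp only [hIosc]
  rw [integral_complex_ofReal, Complex.norm_real]
  have h4 : 0 ≤ ∫ k, I (μ ^ 2) k := integral_nonneg (hInn _ hμ2 hμr)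
  rw [Real.norm_of_nonneg h4]
  refine h1.trans (mul_le_of_le_one_left h4 ?_)
  have h5 : (μ ^ 2) ^ (n + 2) * (μ ^ 4)⁻¹ = (μ ^ 2) ^ n := by field_simp; ring
  rw [h5]
  exact pow_le_one₀ hμ2.le (pow_le_one₀ hμ.le hμ1)

/-- The test functions live where `δ ≤ k₀ - σk₂`, and there `-(kΘ₀)² > 0`. Only the prescribed
values of `v` enter, so the argument is independent of how `v` is defined elsewhere. The value is at
least a constant times `δ²`, against the bound `Cδ³`. -/
theorem not_insensitiveOn_kernel {lam : ℝ} (hlam : 0 < lam) {K : ℂ → ℂ} (hK : IsKernel K)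
    {v : Dist punctured4} (hv : Realizes lam K v) {σ e : ℝ} (hσ : σ ^ 2 = 1) (he : 0 < e)
    {U : Set R4} (hU : IsOpen U) (hx : lightPt σ e ∈ U) : ¬ InsensitiveOn v (nullDir σ) U :=
    fun hins => by
  obtain ⟨ρ, hρ, hball⟩ := Metric.nhds_basis_closedBall.mem_iff.1 (hU.mem_nhds hx)
  let r := min (ρ ^ 2 / 4) (e ^ 2 / 4)
  have hr0 : 0 < r := by positivity
  have hrρ : 4 * r ≤ ρ ^ 2 := by linarith [min_le_left (ρ ^ 2 / 4) (e ^ 2 / 4)]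
  have hre : 4 * r ≤ e ^ 2 := by linarith [min_le_right (ρ ^ 2 / 4) (e ^ 2 / 4)]
  obtain ⟨n, c₁, hc₁, hder⟩ := hK.exists_hasDerivAt
  obtain ⟨c, μ₀, hc, hμ₀, hlow⟩ := exists_kernel_lower_bound hlam hσ he hr0 hre n
  let θ : 𝓓(punctured4, ℂ) := mkTest
    (fun k => ((stepCut r ((k 0 - σ * k 2) ^ 2) * tubeCut σ e r k : ℝ) : ℂ))
    (contDiff_ofReal_comp (((contDiff_stepCut r).comp (by fun_prop)).mul (contDiff_tubeCut σ e r)))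
    (tube σ e r) (isCompact_tube hσ e r) (fun k hk => by
      rw [SetLike.mem_coe, mem_punctured4]
      rintro rfl
      have := nullCoord_pos he hre hk.2
      simp [nullCoord] at this) fun k hk => by
    by_contra h
    have h1 := Complex.ofReal_ne_zero.1 h
    exact hk ⟨(lt_of_stepCut_ne_zero hr0 (left_ne_zero_of_mul h1)).le,
      (lt_of_stepCut_ne_zero hr0 (right_ne_zero_of_mul h1)).le⟩
  have hθU : tsupport θ ⊆ U := (closure_minimal (fun k hk => by
    have h1 := Complex.ofReal_ne_zero.1 hk
    exact ⟨(lt_of_stepCut_ne_zero hr0 (left_ne_zero_of_mul h1)).le,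
      (lt_of_stepCut_ne_zero hr0 (right_ne_zero_of_mul h1)).le⟩) (isClosed_tube σ e r)).trans
    ((tube_subset hσ hρ hrρ).trans hball)
  obtain ⟨C, δ₀, hδ₀, hb⟩ := hins θ hθU _ contDiff_midBump hasCompactSupport_midBump 2
  have hκ : 0 < ‖-((n : ℂ) + 1) * c₁ * (lam : ℂ) ^ 8‖ := by
    have h1 : (n : ℂ) + 1 ≠ 0 := by exact_mod_cast n.succ_ne_zero
    have h2 : (lam : ℂ) ≠ 0 := by exact_mod_cast hlam.ne'
    exact norm_pos_iff.2 (mul_ne_zero (mul_ne_zero (neg_ne_zero.2 h1) hc₁) (pow_ne_zero _ h2))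
  -- The conditions `μ < 1` and `μ < r/4` give `4μ⁴ ≤ 4μ ≤ r`, as `oscillating` requires.
  let μ₁ := min (min μ₀ √δ₀) (min (r / 4) 1)
  refine not_forall_le_pow (a := 2) (C := C) (μ₁ := μ₁) (mul_pos hκ hc) (by positivity)
    fun μ hμ hμ' => ?_
  have hμδ : μ ^ 2 < δ₀ := (Real.lt_sqrt hμ.le).1
    (hμ'.trans_le ((min_le_left _ _).trans (min_le_right _ _)))
  have hμ2 : 0 < μ ^ 2 := by positivity
  have hμ4 : μ < r / 4 := hμ'.trans_le ((min_le_right _ _).trans (min_le_left _ _))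
  have hμ1 : μ < 1 := hμ'.trans_le ((min_le_right _ _).trans (min_le_right _ _))
  have hμr : 4 * (μ ^ 2) ^ 2 ≤ r := by
    have : (μ ^ 2) ^ 2 ≤ μ := by
      rw [← pow_mul]; exact pow_le_of_le_one hμ.le hμ1.le (by norm_num)
    linarith
  let f := oscillating hlam hσ he hr0 hre hμ2 hμr 2
  have hne : posSet lam ≤ punctured4 := fun k hk => by
    rw [mem_punctured4]
    rintro rfl
    have h : 0 < negKThetaSq lam 0 := hk
    simp [negKThetaSq_eq] at h
  have h1 : v (incl hne f) = ∫ k, K (negKThetaSq lam k : ℂ) * f k := hv _ f.tsupport_subset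
  rw [integral_kernel_oscillating hlam hσ he hr0 hre hμ2 hμr hK hder] at h1
  have h2 := hb (μ ^ 2) hμ2 hμδ (incl hne f) fun k => by
    rw [incl_apply, inner_nullDir, oscillating_apply]
    by_cases h : iteratedDeriv 2 (fun y => (midBump y : ℂ)) ((k 0 - σ * k 2) / μ ^ 2) *
      (tubeCut σ e r k : ℂ) = 0
    · rw [h]
      change _ = _ * ((stepCut r ((k 0 - σ * k 2) ^ 2) * tubeCut σ e r k : ℝ) : ℂ)
      push_cast
      rw [mul_left_comm, h, mul_zero]
    · change _ = _ * ((stepCut r ((k 0 - σ * k 2) ^ 2) * tubeCut σ e r k : ℝ) : ℂ)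
      rw [stepCut_eq_one hr0 (oscillating_support hr0 hμ2 hμr 2 h).2.2, one_mul]
  rw [h1, norm_mul, norm_mul, norm_pow, Complex.norm_real, Real.norm_of_nonneg hμ2.le] at h2
  refine le_trans ?_ h2
  have h3 := hlow μ hμ2 hμr hμ (hμ'.trans_le ((min_le_left _ _).trans (min_le_left _ _)))
  rw [mul_comm, ← mul_assoc]
  gcongr

/-- As `v` need not be real, only one of the two signs is obtained; this is enough because the mass
shell distributions have both. -/
theorem mem_waveFrontSet_kernel {lam : ℝ} (hlam : 0 < lam) {K : ℂ → ℂ} (hK : IsKernel K)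
    {v : Dist punctured4} (hv : Realizes lam K v) {σ e : ℝ} (hσ : σ ^ 2 = 1) (he : 0 < e) :
    (lightPt σ e, nullDir σ) ∈ waveFrontSet v ∨ (lightPt σ e, -nullDir σ) ∈ waveFrontSet v := by
  by_contra! h
  obtain ⟨φ₁, h1, h2⟩ := exists_rapidNear (lightPt_mem he) (nullDir_ne_zero σ) h.1
  obtain ⟨φ₂, h3, h4⟩ := exists_rapidNear (lightPt_mem he) (neg_ne_zero.2 (nullDir_ne_zero σ)) h.2
  obtain ⟨U, hU, hx, hins⟩ := exists_insensitive (nullDir_ne_zero σ) h1 h3 h2 h4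
  exact not_insensitiveOn_kernel hlam hK hv hσ he hU hx hins

theorem lightPt_mem_waveFrontOverlap {lam : ℝ} (hlam : 0 < lam) {K : ℂ → ℂ} (hK : IsKernel K)
    {v : Dist punctured4} (hv : Realizes lam K v) {D : Dist punctured4}
    (hD : D = shellDelta ∨ D = shellDeltaPrime) {σ e : ℝ} (hσ : σ ^ 2 = 1) (he : 0 < e) :
    lightPt σ e ∈ waveFrontOverlap D v := by
  obtain ⟨h1, h2⟩ := mem_waveFrontSet_shell hD hσ he
  rcases mem_waveFrontSet_kernel hlam hK hv hσ he with h | h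
  · exact ⟨-nullDir σ, h2, by rwa [neg_neg]⟩
  · exact ⟨nullDir σ, h1, h⟩

theorem waveFrontOverlap_eq {lam : ℝ} (hlam : 0 < lam) {K : ℂ → ℂ} (hK : IsKernel K)
    {v : Dist punctured4} (hv : Realizes lam K v) {D : Dist punctured4}
    (hD : D = shellDelta ∨ D = shellDeltaPrime) :
    waveFrontOverlap D v = planeN ∩ forwardCone := by
  refine (waveFrontOverlap_subset hlam hK hv hD).antisymm ?_
  rintro k ⟨⟨h1, h3⟩, hc, h0⟩
  simp only [minkowskiSq, h1, h3] at hc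
  have h02 : k 0 ≠ 0 := h0.ne'
  -- On `N` the cone condition reads `k₀² = k₂²`, so every such point is a `lightPt` with `σ = k₂/k₀
  -- = ±1`.
  have hk : k = lightPt (k 2 / k 0) (k 0) := by
    ext i; fin_cases i <;> simp [lightPt, h1, h3]
    field_simp
  rw [hk]
  refine lightPt_mem_waveFrontOverlap hlam hK hv hD ?_ h0
  field_simp
  linarith

theorem not_hormanderMultipliable {lam : ℝ} (hlam : 0 < lam) {K : ℂ → ℂ} (hK : IsKernel K)
    {v : Dist punctured4} (hv : Realizes lam K v) {D : Dist punctured4}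
    (hD : D = shellDelta ∨ D = shellDeltaPrime) : ¬ HormanderMultipliable D v := fun h => by
  have := lightPt_mem_waveFrontOverlap hlam hK hv hD (one_pow 2) one_pos
  rw [h] at this
  exact this

end
end NCQED

/-! ### Assembly of the theorem -/

theorem mainTheorem2 (lam : ℝ) (hlam : 0 < lam) :
    -- the reduced distributions are given by locally integrable functions
    (∀ K : ℂ → ℂ, NCQED.IsKernel K →
      LocallyIntegrableOn (fun k : NCQED.R3 => K ((2 * lam ^ 4 * NCQED.perpSq k : ℝ) : ℂ))
        NCQED.offAxis ∧
      ∀ f : 𝓓(NCQED.offAxis, ℂ), NCQED.kernelDist lam K f =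
        ∫ k, K ((2 * lam ^ 4 * NCQED.perpSq k : ℝ) : ℂ) * f k) ∧
    -- products on Minkowski momentum space
    (∃ D₀ D₁ : NCQED.Dist NCQED.punctured4,
      NCQED.IsShellDelta D₀ ∧ NCQED.IsShellDeltaPrime D₁ ∧
      -- the product is not defined in the sense of Hörmander, whatever the prescription
      (∀ K : ℂ → ℂ, NCQED.IsKernel K →
        (∀ σ : ℝ, σ = 1 ∨ σ = -1 → ∃ v : NCQED.Dist NCQED.punctured4,
          NCQED.IsBoundaryValue lam K σ v ∧ NCQED.Realizes lam K v) ∧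
        ∀ v : NCQED.Dist NCQED.punctured4, NCQED.Realizes lam K v →
          ∀ D : NCQED.Dist NCQED.punctured4, D = D₀ ∨ D = D₁ →
            NCQED.waveFrontOverlap D v = NCQED.planeN ∩ NCQED.forwardCone ∧
            ¬ NCQED.HormanderMultipliable D v) ∧
      -- `θ(k₀) δ(k²) K(-(kΘ)²)`: product off `N`, reduction, extensions
      (∀ K : ℂ → ℂ, NCQED.IsKernel K → ∃ P : NCQED.Dist NCQED.offN,
        NCQED.IsProductOffN lam D₀ K P ∧ NCQED.ReducesTo P (NCQED.kernelDist lam K) ∧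
        (∀ T : NCQED.Dist NCQED.punctured3, NCQED.restrict T = NCQED.kernelDist lam K →
          ∃ P' : NCQED.Dist NCQED.punctured4, NCQED.restrict P' = P ∧ NCQED.ReducesTo P' T) ∧
        (∀ (T T' : NCQED.Dist NCQED.punctured3) (P' : NCQED.Dist NCQED.punctured4),
          NCQED.ReducesTo P' T → NCQED.ReducesTo P' T' → T = T')) ∧
      -- `θ(k₀) δ'(k²) (-(kΘ)²)⁻²`: product off `N`, reduction, extensions
      (∃ P : NCQED.Dist NCQED.offN,
        NCQED.IsProductOffN lam D₁ (NCQED.powKernel 2) P ∧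
        NCQED.ReducesTo₂ P ((2 * lam ^ 4 : ℂ) • NCQED.kernelDist lam (NCQED.powKernel 3))
          (NCQED.kernelDist lam (NCQED.powKernel 2)) ∧
        (∀ A B : NCQED.Dist NCQED.punctured3,
          NCQED.restrict A = NCQED.kernelDist lam (NCQED.powKernel 3) →
          NCQED.restrict B = NCQED.kernelDist lam (NCQED.powKernel 2) →
          ∃ P' : NCQED.Dist NCQED.punctured4, NCQED.restrict P' = P ∧
            NCQED.ReducesTo₂ P' ((2 * lam ^ 4 : ℂ) • A) B) ∧
        (∀ (A B A' B' : NCQED.Dist NCQED.punctured3) (P' : NCQED.Dist NCQED.punctured4),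
          NCQED.ReducesTo₂ P' ((2 * lam ^ 4 : ℂ) • A) B →
          NCQED.ReducesTo₂ P' ((2 * lam ^ 4 : ℂ) • A') B' → A = A' ∧ B = B'))) ∧
    -- `K = ln`: unique extension across `Ṅ` and to the origin
    (NCQED.sdAxis (NCQED.kernelDist lam NCQED.logKernel) = 0 ∧
      ∃ T W : NCQED.Dist NCQED.punctured3,
        NCQED.axisExtensions (NCQED.kernelDist lam NCQED.logKernel) = {T} ∧
        NCQED.IsWeighted T W ∧
        NCQED.sdOrigin T = 0 ∧ NCQED.sdOrigin W = 1 ∧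
        (∃! S, S ∈ NCQED.originExtensions T) ∧ (∃! S, S ∈ NCQED.originExtensions W)) ∧
    -- `K = x⁻ⁿ`: the extensions across `Ṅ` and their nonlocal ambiguities
    (∀ n : ℕ, 1 ≤ n →
      NCQED.sdAxis (NCQED.kernelDist lam (NCQED.powKernel n)) = ((2 * n : ℝ) : EReal) ∧
      (∃ T₀ ∈ NCQED.axisExtensions (NCQED.kernelDist lam (NCQED.powKernel n)),
        (∀ T ∈ NCQED.axisExtensions (NCQED.kernelDist lam (NCQED.powKernel n)),
          ∃! c : NCQED.PerpIndex (2 * n - 1) → NCQED.Dist NCQED.punctured1,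
            ∀ f, T f = T₀ f + NCQED.counterterm c f) ∧
        (∀ c : NCQED.PerpIndex (2 * n - 1) → NCQED.Dist NCQED.punctured1,
          ∃ T ∈ NCQED.axisExtensions (NCQED.kernelDist lam (NCQED.powKernel n)),
            ∀ f, T f = T₀ f + NCQED.counterterm c f)) ∧
      (∀ T ∈ NCQED.axisExtensions (NCQED.kernelDist lam (NCQED.powKernel n)),
        ∀ T' ∈ NCQED.axisExtensions (NCQED.kernelDist lam (NCQED.powKernel n)), T ≠ T' →
          ¬ ∃ g : NCQED.R3 → ℂ, ContinuousOn g NCQED.punctured3 ∧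
            ∀ f, T f - T' f = ∫ k, g k * f k)) ∧
    -- `K = x⁻¹`: the extensions to the origin
    ((∃ T ∈ NCQED.axisExtensions (NCQED.kernelDist lam (NCQED.powKernel 1)),
        ∃ W : NCQED.Dist NCQED.punctured3, NCQED.IsWeighted T W ∧ NCQED.sdOrigin W = 3 ∧
          (NCQED.originExtensions W).Nonempty) ∧
      (∀ T ∈ NCQED.axisExtensions (NCQED.kernelDist lam (NCQED.powKernel 1)),
        ∀ W : NCQED.Dist NCQED.punctured3, NCQED.IsWeighted T W →
          ∀ S ∈ NCQED.originExtensions W, ∀ b : ℂ, ∃ S' ∈ NCQED.originExtensions W,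
            ∀ f, S' f = S f + b * f 0) ∧
      (∃ S : NCQED.Dist (⊤ : Opens NCQED.R3), ∀ b : ℂ,
        ∃ T ∈ NCQED.axisExtensions (NCQED.kernelDist lam (NCQED.powKernel 1)),
          ∃ S' ∈ NCQED.originExtensions T,
            ∀ f, S' f = S f + b * ∫ s : ℝ, f (NCQED.axisPoint s))) := by
  -- Needed to recover `A` from `2λ⁴A` in the uniqueness of the pair.
  have hκ : (2 * lam ^ 4 : ℂ) ≠ 0 := by
    have : (lam : ℂ) ≠ 0 := by exact_mod_cast hlam.ne'
    exact mul_ne_zero two_ne_zero (pow_ne_zero _ this)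
  refine ⟨fun K hK => ⟨NCQED.kernel_locallyIntegrableOn hK hlam, NCQED.kernelDist_apply hK hlam⟩,
    ⟨NCQED.shellDelta, NCQED.shellDeltaPrime, NCQED.isShellDelta_shellDelta,
      NCQED.isShellDeltaPrime_shellDeltaPrime, fun K hK => ⟨fun σ hσ => ?_, fun v hv D hD =>
        ⟨NCQED.waveFrontOverlap_eq hlam hK hv hD, NCQED.not_hormanderMultipliable hlam hK hv hD⟩⟩,
      fun K hK => ⟨_, NCQED.isProductOffN_shellDelta hK hlam, NCQED.reducesTo_comp _ _,
        fun T hT => NCQED.exists_extension_product T hT, fun _ _ _ h h' => h.unique h'⟩,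
      _, NCQED.isProductOffN_shellDeltaPrime hlam, NCQED.reducesTo₂_comp _ _ _,
        fun A B hA hB => NCQED.exists_extension_product₂ ?_ hB, fun A B A' B' P' h h' => ?_⟩,
    NCQED.log_extensions hlam, fun n hn => NCQED.pow_extensions hlam hn,
    NCQED.exists_originExtension hlam,
    fun T hT W hW S hS b => NCQED.exists_add_originDelta hlam hT.1 hW hS b,
    NCQED.exists_axis_family hlam⟩
  · obtain ⟨v, hv⟩ := NCQED.exists_isBoundaryValue hlam hK hσ
    exact ⟨v, hv, hv.realizes hK⟩
  · rw [← hA]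
    rfl
  · obtain ⟨h1, h2⟩ := h.unique h'
    exact ⟨smul_right_injective _ hκ h1, h2⟩
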